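/- Fix $\tau\in\mathbb C$ with $\operatorname{Im}\tau>0$. Let $\theta_1,\theta_2,\theta_3,\theta_4$ ($\theta_0:=\theta_4$) be the Jacobi theta functions for the lattice $\mathbb Z+\mathbb Z\tau$, normalised by $\theta_3(z)=\sum_{n\in\mathbb Z}e^{2\pi i nz+\pi i n^2\tau}$, $\theta_4(z)=\theta_3(z+\frac12)$, $\theta_2(z)=e^{\pi i\tau/4+\pi i z}\theta_3(z+\frac\tau2)$, $\theta_1(z)=-ie^{\pi i\tau/4+\pi i z}\theta_3(z+\frac12+\frac\tau2)$. Put $\varepsilon_2=-1$, $\sqrt{\varepsilon_2}=i$, and $\varepsilon_\alpha=\sqrt{\varepsilon_\alpha}=1$ for $\alpha\in\{0,1,3\}$. For $\eta\in\mathbb C\setminus(\mathbb Q+\mathbb Q\tau)$ let $\mathcal A$ be the Sklyanin algebra: the unital associative $\mathbb C$-algebra generated by $S_0,S_1,S_2,S_3$ with relations $$[S_0,S_a]=iJ_{bc}(S_bS_c+S_cS_b),\qquad [S_b,S_c]=i(S_0S_a+S_aS_0),\qquad J_{bc}=\varepsilon_a\frac{\theta_1(\eta)^2\theta_{a+1}(\eta)^2}{\theta_{b+1}(\eta)^2\theta_{c+1}(\eta)^2},$$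 $(a,b,c)$ running over the cyclic permutations of $(1,2,3)$; let $\mathcal A_n$ be the span of the products of $n$ generators. Let $\iota^1,\iota^3$ be the automorphisms of $\mathcal A$ given by $$\iota^1:\ S_0\mapsto-\tfrac{\theta_1(\eta)}{\theta_2(\eta)}S_1,\quad S_1\mapsto\tfrac{\theta_2(\eta)}{\theta_1(\eta)}S_0,\quad S_2\mapsto i\tfrac{\theta_3(\eta)}{\theta_0(\eta)}S_3,\quad S_3\mapsto-i\tfrac{\theta_0(\eta)}{\theta_3(\eta)}S_2,$$ $$\iota^3:\ S_0\mapsto\tfrac{\theta_1(\eta)}{\theta_0(\eta)}S_3,\quad S_1\mapsto\tfrac{\theta_2(\eta)}{\theta_3(\eta)}S_2,\quad S_2\mapsto-\tfrac{\theta_3(\eta)}{\theta_2(\eta)}S_1,\quad S_3\mapsto\tfrac{\theta_0(\eta)}{\theta_1(\eta)}S_0.$$ For $k\ge0$ let $\mathcal V^{(k)}$ be the space of entire functions $f$ with $f(u+1)=f(u)=f(-u)$ and $f(u+\tau)=e^{-2\pi ik(2u+\tau)}f(u)$, and let $\pi^{(k)}:\mathcal A\to\operatorname{End}(\mathcal V^{(k)})$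 be the representation $$(\pi^{(k)}(S_\alpha)f)(u)=\frac{\sqrt{\varepsilon_\alpha}\,\theta_{\alpha+1}(\eta)}{\theta_1(2\eta)\theta_1(2u)}\bigl(\theta_{\alpha+1}(2u-k\eta)f(u+\eta)-\theta_{\alpha+1}(-2u-k\eta)f(u-\eta)\bigr).$$ Then there is a countable set $B\subset\mathbb C$, depending only on $\tau$, such that for all $\eta\notin B$ with $\eta\notin\mathbb Q+\mathbb Q\tau$ (that is, for generic $\eta$) the following holds. (0) For each homogeneous $A\in\mathcal A$ there is a unique entire function $\lambda\mapsto\mathrm{Tr}_\lambda A$ such that $\mathrm{Tr}_{k+1}A=\operatorname{tr}_{\mathcal V^{(k)}}\pi^{(k)}(A)$ for all integers $k\ge0$ and such that, if $A\in\mathcal A_n$, then $$\mathrm{Tr}_{t/\eta}A=\theta_1(t)^n\times\begin{cases}g_{A,0}(t)&(n\text{ odd}),\\ g_{A,1}(t)-\frac t\eta g_{A,2}(t)&(n\text{ even}),\end{cases}$$ where $g_{A,1}$ is meromorphic on $\mathbb C$ with $g_{A,1}(t+1)=g_{A,1}(t)$, and where $g_{A,0}$, $g_{A,2}$ and $g_{A,3}(t):=g_{A,1}(t+\tau)-g_{A,1}(t)$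 are elliptic functions with periods $1,\tau$. (1) Let $n$ be even, $A\in\mathcal A_n$, and let $g_{A,1},g_{A,2},g_{A,3}$ be as in (0). Then, as identities of meromorphic functions of $t$, $$\theta_1(t)^{-n}\,\mathrm{Tr}_{\frac t\eta+\frac1{2\eta}}\iota^1(A)=g_{A,1}(t)-\Bigl(\frac t\eta+\frac1{2\eta}\Bigr)g_{A,2}(t),$$ $$\theta_1(t)^{-n}\,\mathrm{Tr}_{\frac t\eta+\frac\tau{2\eta}}\iota^3(A)=\Bigl(g_{A,1}(t)+\frac12g_{A,3}(t)-\Bigl(\frac t\eta+\frac\tau{2\eta}\Bigr)g_{A,2}(t)\Bigr)\bigl(-e^{-\pi i(\tau/2+2t)}\bigr)^{n/2}.$$ -/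

import Mathlib

open Complex Filter

noncomputable section

namespace Sklyanin

/-! ### Jacobi theta functions -/

/-- `th τ α z = θ_{α+1}(z | τ)` for `α = 0, 1, 2, 3`: the four Jacobi theta functions, with
`θ₃(z | τ) = ∑ₙ exp (2 π i n z + π i n² τ)` and the usual shifts by half periods;
`th τ 3 = θ₄ = θ₀`. -/
def th (τ : ℂ) (α : Fin 4) (z : ℂ) : ℂ :=
  ![-I * exp (Real.pi * I * τ / 4 + Real.pi * I * z) * jacobiTheta₂ (z + 1 / 2 + τ / 2) τ,
    exp (Real.pi * I * τ / 4 + Real.pi * I * z) * jacobiTheta₂ (z + τ / 2) τ,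
    jacobiTheta₂ z τ,
    jacobiTheta₂ (z + 1 / 2) τ] α

/-! ### The Sklyanin algebra -/

/-- `ε₂ = -1` and `ε_α = 1` for `α ≠ 2`. -/
def eps (α : Fin 4) : ℂ := if α = 2 then -1 else 1

/-- `√ε₂ = i` and `√ε_α = 1` for `α ≠ 2`. -/
def sqrtEps (α : Fin 4) : ℂ := if α = 2 then I else 1

/-- `(a, b, c)` is a cyclic permutation of `(1, 2, 3)`. -/
def IsCyc (a b c : Fin 4) : Prop :=
  (a, b, c) = (1, 2, 3) ∨ (a, b, c) = (2, 3, 1) ∨ (a, b, c) = (3, 1, 2)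

/-- The structure constant
`J_{bc} = ε_a θ₁(η)² θ_{a+1}(η)² / (θ_{b+1}(η)² θ_{c+1}(η)²)`, `(a, b, c)` cyclic. -/
def Jconst (η τ : ℂ) (a b c : Fin 4) : ℂ :=
  eps a * (th τ 0 η ^ 2 * th τ a η ^ 2) / (th τ b η ^ 2 * th τ c η ^ 2)

/-- The quadratic relations `[S₀, S_a] = i J_{bc} (S_b S_c + S_c S_b)` and
`[S_b, S_c] = i (S₀ S_a + S_a S₀)` on the free algebra with generators `S₀, …, S₃`. -/
inductive Rel (η τ : ℂ) : FreeAlgebra ℂ (Fin 4) → FreeAlgebra ℂ (Fin 4) → Prop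
  | quad1 (a b c : Fin 4) (h : IsCyc a b c) : Rel η τ
      (FreeAlgebra.ι ℂ 0 * FreeAlgebra.ι ℂ a - FreeAlgebra.ι ℂ a * FreeAlgebra.ι ℂ 0)
      ((I * Jconst η τ a b c) •
        (FreeAlgebra.ι ℂ b * FreeAlgebra.ι ℂ c + FreeAlgebra.ι ℂ c * FreeAlgebra.ι ℂ b))
  | quad2 (a b c : Fin 4) (h : IsCyc a b c) : Rel η τ
      (FreeAlgebra.ι ℂ b * FreeAlgebra.ι ℂ c - FreeAlgebra.ι ℂ c * FreeAlgebra.ι ℂ b)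
      (I • (FreeAlgebra.ι ℂ 0 * FreeAlgebra.ι ℂ a + FreeAlgebra.ι ℂ a * FreeAlgebra.ι ℂ 0))

/-- The Sklyanin algebra `𝒜` with parameters `η, τ`. -/
abbrev Alg (η τ : ℂ) : Type := RingQuot (Rel η τ)

/-- The generators `S_α` of the Sklyanin algebra. -/
def S (η τ : ℂ) (α : Fin 4) : Alg η τ :=
  RingQuot.mkAlgHom ℂ (Rel η τ) (FreeAlgebra.ι ℂ α)

/-- The homogeneous component `𝒜ₙ`: the span of the products of `n` generators. -/
def degreePart (η τ : ℂ) (n : ℕ) : Submodule ℂ (Alg η τ) :=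
  Submodule.span ℂ (Set.range (S η τ)) ^ n

theorem S_quad1 (η τ : ℂ) {a b c : Fin 4} (h : IsCyc a b c) :
    S η τ 0 * S η τ a - S η τ a * S η τ 0 =
      (I * Jconst η τ a b c) • (S η τ b * S η τ c + S η τ c * S η τ b) := by
  simpa [S] using RingQuot.mkAlgHom_rel ℂ (Rel.quad1 (η := η) (τ := τ) a b c h)

theorem S_quad2 (η τ : ℂ) {a b c : Fin 4} (h : IsCyc a b c) :
    S η τ b * S η τ c - S η τ c * S η τ b =
      I • (S η τ 0 * S η τ a + S η τ a * S η τ 0) := by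
  simpa [S] using RingQuot.mkAlgHom_rel ℂ (Rel.quad2 (η := η) (τ := τ) a b c h)

/-! ### The automorphisms `ι¹` and `ι³` -/

/-- The images of `S₀, S₁, S₂, S₃` under `ι¹`. -/
def iota1Gen (η τ : ℂ) : Fin 4 → Alg η τ :=
  ![(-(th τ 0 η / th τ 1 η)) • S η τ 1,
    (th τ 1 η / th τ 0 η) • S η τ 0,
    (I * (th τ 2 η / th τ 3 η)) • S η τ 3,
    (-I * (th τ 3 η / th τ 2 η)) • S η τ 2]

/-- The images of `S₀, S₁, S₂, S₃` under `ι³`. -/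
def iota3Gen (η τ : ℂ) : Fin 4 → Alg η τ :=
  ![(th τ 0 η / th τ 3 η) • S η τ 3,
    (th τ 1 η / th τ 2 η) • S η τ 2,
    (-(th τ 2 η / th τ 1 η)) • S η τ 1,
    (th τ 3 η / th τ 0 η) • S η τ 0]

set_option linter.unusedSimpArgs false in
theorem iota1Gen_rel {η τ : ℂ} (hθ : ∀ α, th τ α η ≠ 0) ⦃x y : FreeAlgebra ℂ (Fin 4)⦄
    (h : Rel η τ x y) :
    FreeAlgebra.lift ℂ (iota1Gen η τ) x = FreeAlgebra.lift ℂ (iota1Gen η τ) y := by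
  have h0 := hθ 0
  have h1 := hθ 1
  have h2 := hθ 2
  have h3 := hθ 3
  rcases h with ⟨a, b, c, h⟩ | ⟨a, b, c, h⟩ <;> rcases id h with e | e | e <;>
    obtain ⟨rfl, rfl, rfl⟩ : _ ∧ _ ∧ _ := by simpa only [Prod.mk.injEq] using e
  · have key := S_quad1 η τ h
    simp only [map_sub, map_add, map_mul, map_smul, FreeAlgebra.lift_ι_apply, iota1Gen, Jconst, eps,
      Matrix.cons_val] at key ⊢
    simp only [smul_mul_assoc, mul_smul_comm, smul_smul, if_true, Fin.reduceEq, if_false] at key ⊢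
    linear_combination (norm := skip) (-(-(th τ 0 η / th τ 1 η) * (th τ 1 η / th τ 0 η))) • key
    match_scalars <;> field_simp <;> simp [I_sq]
  · have key := S_quad2 η τ h
    simp only [map_sub, map_add, map_mul, map_smul, FreeAlgebra.lift_ι_apply, iota1Gen, Jconst, eps,
      Matrix.cons_val] at key ⊢
    simp only [smul_mul_assoc, mul_smul_comm, smul_smul, if_true, Fin.reduceEq, if_false] at key ⊢
    linear_combination (norm := skip) (-(-(th τ 0 η / th τ 1 η) * (I * (th τ 2 η / th τ 3 η)))) • key
    match_scalars <;> field_simp <;> simp [I_sq]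
  · have key := S_quad2 η τ h
    simp only [map_sub, map_add, map_mul, map_smul, FreeAlgebra.lift_ι_apply, iota1Gen, Jconst, eps,
      Matrix.cons_val] at key ⊢
    simp only [smul_mul_assoc, mul_smul_comm, smul_smul, if_true, Fin.reduceEq, if_false] at key ⊢
    linear_combination (norm := skip) ((-(th τ 0 η / th τ 1 η) * (-I * (th τ 3 η / th τ 2 η)))) • key
    match_scalars <;> field_simp <;> simp [I_sq]
  · have key := S_quad2 η τ h
    simp only [map_sub, map_add, map_mul, map_smul, FreeAlgebra.lift_ι_apply, iota1Gen, Jconst, eps,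
      Matrix.cons_val] at key ⊢
    simp only [smul_mul_assoc, mul_smul_comm, smul_smul, if_true, Fin.reduceEq, if_false] at key ⊢
    linear_combination (norm := skip) (-((I * (th τ 2 η / th τ 3 η)) * (-I * (th τ 3 η / th τ 2 η)))) • key
    match_scalars <;> field_simp <;> simp [I_sq]
  · have key := S_quad1 η τ h
    simp only [map_sub, map_add, map_mul, map_smul, FreeAlgebra.lift_ι_apply, iota1Gen, Jconst, eps,
      Matrix.cons_val] at key ⊢
    simp only [smul_mul_assoc, mul_smul_comm, smul_smul, if_true, Fin.reduceEq, if_false] at key ⊢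
    linear_combination (norm := skip) (-((-I * (th τ 3 η / th τ 2 η)) * (th τ 1 η / th τ 0 η))) • key
    match_scalars <;> field_simp <;> simp [I_sq]
  · have key := S_quad1 η τ h
    simp only [map_sub, map_add, map_mul, map_smul, FreeAlgebra.lift_ι_apply, iota1Gen, Jconst, eps,
      Matrix.cons_val] at key ⊢
    simp only [smul_mul_assoc, mul_smul_comm, smul_smul, if_true, Fin.reduceEq, if_false] at key ⊢
    linear_combination (norm := skip) (((th τ 1 η / th τ 0 η) * (I * (th τ 2 η / th τ 3 η)))) • key
    match_scalars <;> field_simp <;> simp [I_sq]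

set_option linter.unusedSimpArgs false in
theorem iota3Gen_rel {η τ : ℂ} (hθ : ∀ α, th τ α η ≠ 0) ⦃x y : FreeAlgebra ℂ (Fin 4)⦄
    (h : Rel η τ x y) :
    FreeAlgebra.lift ℂ (iota3Gen η τ) x = FreeAlgebra.lift ℂ (iota3Gen η τ) y := by
  have h0 := hθ 0
  have h1 := hθ 1
  have h2 := hθ 2
  have h3 := hθ 3
  rcases h with ⟨a, b, c, h⟩ | ⟨a, b, c, h⟩ <;> rcases id h with e | e | e <;>
    obtain ⟨rfl, rfl, rfl⟩ : _ ∧ _ ∧ _ := by simpa only [Prod.mk.injEq] using e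
  · have key := S_quad2 η τ h
    simp only [map_sub, map_add, map_mul, map_smul, FreeAlgebra.lift_ι_apply, iota3Gen, Jconst, eps,
      Matrix.cons_val] at key ⊢
    simp only [smul_mul_assoc, mul_smul_comm, smul_smul, if_true, Fin.reduceEq, if_false] at key ⊢
    linear_combination (norm := skip) (-((th τ 0 η / th τ 3 η) * (th τ 1 η / th τ 2 η))) • key
    match_scalars <;> field_simp <;> simp [I_sq]
  · have key := S_quad2 η τ h
    simp only [map_sub, map_add, map_mul, map_smul, FreeAlgebra.lift_ι_apply, iota3Gen, Jconst, eps,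
      Matrix.cons_val] at key ⊢
    simp only [smul_mul_assoc, mul_smul_comm, smul_smul, if_true, Fin.reduceEq, if_false] at key ⊢
    linear_combination (norm := skip) (((th τ 0 η / th τ 3 η) * (-(th τ 2 η / th τ 1 η)))) • key
    match_scalars <;> field_simp <;> simp [I_sq]
  · have key := S_quad1 η τ h
    simp only [map_sub, map_add, map_mul, map_smul, FreeAlgebra.lift_ι_apply, iota3Gen, Jconst, eps,
      Matrix.cons_val] at key ⊢
    simp only [smul_mul_assoc, mul_smul_comm, smul_smul, if_true, Fin.reduceEq, if_false] at key ⊢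
    linear_combination (norm := skip) (-((th τ 0 η / th τ 3 η) * (th τ 3 η / th τ 0 η))) • key
    match_scalars <;> field_simp <;> simp [I_sq]
  · have key := S_quad1 η τ h
    simp only [map_sub, map_add, map_mul, map_smul, FreeAlgebra.lift_ι_apply, iota3Gen, Jconst, eps,
      Matrix.cons_val] at key ⊢
    simp only [smul_mul_assoc, mul_smul_comm, smul_smul, if_true, Fin.reduceEq, if_false] at key ⊢
    linear_combination (norm := skip) (-((-(th τ 2 η / th τ 1 η)) * (th τ 3 η / th τ 0 η))) • key
    match_scalars <;> field_simp <;> simp [I_sq]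
  · have key := S_quad1 η τ h
    simp only [map_sub, map_add, map_mul, map_smul, FreeAlgebra.lift_ι_apply, iota3Gen, Jconst, eps,
      Matrix.cons_val] at key ⊢
    simp only [smul_mul_assoc, mul_smul_comm, smul_smul, if_true, Fin.reduceEq, if_false] at key ⊢
    linear_combination (norm := skip) (((th τ 3 η / th τ 0 η) * (th τ 1 η / th τ 2 η))) • key
    match_scalars <;> field_simp <;> simp [I_sq]
  · have key := S_quad2 η τ h
    simp only [map_sub, map_add, map_mul, map_smul, FreeAlgebra.lift_ι_apply, iota3Gen, Jconst, eps,
      Matrix.cons_val] at key ⊢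
    simp only [smul_mul_assoc, mul_smul_comm, smul_smul, if_true, Fin.reduceEq, if_false] at key ⊢
    linear_combination (norm := skip) (-((th τ 1 η / th τ 2 η) * (-(th τ 2 η / th τ 1 η)))) • key
    match_scalars <;> field_simp <;> simp [I_sq]

open Classical in
/-- The automorphism `ι¹` of the Sklyanin algebra. The formulas on generators make sense when no
`θ_α(η)` vanishes, as is the case for `η ∉ ℚ + ℚ τ`; the other branch is never used. -/
def iota1 (η τ : ℂ) : Alg η τ →ₐ[ℂ] Alg η τ :=
  if hθ : ∀ α, th τ α η ≠ 0 then
    RingQuot.liftAlgHom ℂ ⟨FreeAlgebra.lift ℂ (iota1Gen η τ), iota1Gen_rel hθ⟩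
  else AlgHom.id ℂ _

open Classical in
/-- The automorphism `ι³` of the Sklyanin algebra, with the same convention as for `ι¹`. -/
def iota3 (η τ : ℂ) : Alg η τ →ₐ[ℂ] Alg η τ :=
  if hθ : ∀ α, th τ α η ≠ 0 then
    RingQuot.liftAlgHom ℂ ⟨FreeAlgebra.lift ℂ (iota3Gen η τ), iota3Gen_rel hθ⟩
  else AlgHom.id ℂ _

/-! ### The finite-dimensional representations -/

/-- The space `𝒱⁽ᵏ⁾` of entire functions with `f(u+1) = f(u) = f(-u)` and
`f(u+τ) = exp(-2πik(2u+τ)) f(u)`. -/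
def V (τ : ℂ) (k : ℕ) : Submodule ℂ (ℂ → ℂ) where
  carrier := {f | Differentiable ℂ f ∧ (∀ u, f (u + 1) = f u) ∧ (∀ u, f (-u) = f u) ∧
    ∀ u, f (u + τ) = exp (-2 * Real.pi * I * k * (2 * u + τ)) * f u}
  add_mem' := by
    rintro f g ⟨h1, h2, h3, h4⟩ ⟨h1', h2', h3', h4'⟩
    exact ⟨h1.add h1', fun u => by simp [h2, h2'], fun u => by simp [h3, h3'],
      fun u => by simp [h4, h4', mul_add]⟩
  zero_mem' := ⟨differentiable_const 0, by simp, by simp, by simp⟩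
  smul_mem' := by
    rintro c f ⟨h1, h2, h3, h4⟩
    exact ⟨h1.const_smul c, fun u => by simp [h2], fun u => by simp [h3],
      fun u => by simp [h4, mul_left_comm]⟩

/-- `ρ` is the representation `π⁽ᵏ⁾` of the Sklyanin algebra on `𝒱⁽ᵏ⁾`:
`(ρ(S_α) f)(u) = √ε_α θ_{α+1}(η) / (θ₁(2η) θ₁(2u)) *
  (θ_{α+1}(2u-kη) f(u+η) - θ_{α+1}(-2u-kη) f(u-η))`.
The denominator is cleared, since the quotient has only removable singularities in `u`; the
functions `ρ(S_α) f` being entire, the identity determines them, and so it determines `ρ`. -/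
def IsSeriesA (η τ : ℂ) (k : ℕ) (ρ : Alg η τ →ₐ[ℂ] Module.End ℂ (V τ k)) : Prop :=
  ∀ (α : Fin 4) (f : V τ k) (u : ℂ),
    th τ 0 (2 * η) * th τ 0 (2 * u) * (ρ (S η τ α) f : ℂ → ℂ) u =
      sqrtEps α * th τ α η *
        (th τ α (2 * u - k * η) * (f : ℂ → ℂ) (u + η) -
          th τ α (-2 * u - k * η) * (f : ℂ → ℂ) (u - η))

/-! ### The functional `Tr_λ` -/

/-- `g` is an elliptic function with periods `1, τ`. Meromorphic functions are regarded up to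
their values on discrete closed sets (their values at poles carry no meaning). -/
def IsElliptic (τ : ℂ) (g : ℂ → ℂ) : Prop :=
  Meromorphic g ∧ (fun t => g (t + 1)) =ᶠ[codiscrete ℂ] g ∧
    (fun t => g (t + τ)) =ᶠ[codiscrete ℂ] g

/-- For odd `n`: `F(t/η) = θ₁(t)ⁿ g₀(t)` with `g₀` elliptic. -/
def IsOddForm (η τ : ℂ) (n : ℕ) (F g₀ : ℂ → ℂ) : Prop :=
  IsElliptic τ g₀ ∧
    (fun t => F (t / η)) =ᶠ[codiscrete ℂ] fun t => th τ 0 t ^ n * g₀ t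

/-- For even `n`: `F(t/η) = θ₁(t)ⁿ (g₁(t) - (t/η) g₂(t))` with `g₁` meromorphic of period `1`,
and with `g₂(t)` and `g₃(t) = g₁(t+τ) - g₁(t)` elliptic. -/
def IsEvenForm (η τ : ℂ) (n : ℕ) (F g₁ g₂ : ℂ → ℂ) : Prop :=
  Meromorphic g₁ ∧ (fun t => g₁ (t + 1)) =ᶠ[codiscrete ℂ] g₁ ∧
    IsElliptic τ g₂ ∧ IsElliptic τ (fun t => g₁ (t + τ) - g₁ t) ∧
    (fun t => F (t / η)) =ᶠ[codiscrete ℂ] fun t => th τ 0 t ^ n * (g₁ t - t / η * g₂ t)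

/-- The properties which characterise the entire function `F(λ) = Tr_λ A` of `λ` for homogeneous
`A`: it interpolates the traces of `A` on the spaces `𝒱⁽ᵏ⁾` at `λ = k + 1`, and it has the
prescribed functional form if `A ∈ 𝒜ₙ`. -/
def IsTr (η τ : ℂ) (A : Alg η τ) (F : ℂ → ℂ) : Prop :=
  Differentiable ℂ F ∧
    (∀ k : ℕ, ∃ ρ : Alg η τ →ₐ[ℂ] Module.End ℂ (V τ k),
      IsSeriesA η τ k ρ ∧ F (k + 1) = LinearMap.trace ℂ (V τ k) (ρ A)) ∧
    ∀ n : ℕ, A ∈ degreePart η τ n →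
      (Odd n → ∃ g₀, IsOddForm η τ n F g₀) ∧ (Even n → ∃ g₁ g₂, IsEvenForm η τ n F g₁ g₂)

/-- `Tr η τ A l = Tr_l A` for homogeneous `A`: the function with the properties `IsTr`. -/
def Tr (η τ : ℂ) (A : Alg η τ) : ℂ → ℂ := Classical.epsilon (IsTr η τ A)

end Sklyanin

end

/-! On `V τ k` a word of length n in the generators acts as a difference operator, f ↦ ∑ coef(m, u)
f(u + mη) with |m| ≤ n, and its coefficients depend on k only through t = (k + 1)η. The trace is
made into an explicit expression in t, which then has a meaning for every t.

A function in `V τ k` is determined by its values at k + 1 generic points. With the string v, v + η,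
…, v + kη as nodes, Lagrange interpolation (`trace_eq_sum_lagr`) expresses the trace through the
values of the Lagrange functions at shifted nodes. A shifted node which is again a node contributes
nothing, so `trace_word` leaves a bulk sum ∑ coef(0, v + jη) and two boundary sums `bdSum`, one for
each end of the string, whose number of terms depends on n only.

The bulk is summed by partial fractions. For words on which the half-period characters are trivial
(`IsTriv`), u ↦ coef(0, u) is even, has the periods 1/2 and τ/2, and has at most simple poles, at
the points ±jη modulo these periods. By `exists_pfd` it is a combination of the functions `psi j`
with coefficients `dec j`, and `psi j` is the difference under u ↦ u + η of the explicit function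
`hfn j`, so the sum telescopes. The result `strF` is meromorphic in t. It does not depend on v, and
v can be moved away from any given singularity, so it defines an entire function
(`exists_entire_strF`). Words with a nontrivial character have trace zero, because a half-period
shift of `V τ k` conjugates them into a multiple c ≠ 1 of themselves.

Uniqueness, and with it the independence of v, rests on `eq_zero_of_tendsto_zero`: if g₁ - (t/η) g₂
is of the prescribed form and tends to zero at all kη with k ≥ 1, then g₁ and g₂ vanish. The proof
uses that the multiples of η return arbitrarily close to the lattice.

For even n the string at v = η/2 is distinguished (`strF_half_eta`): its lower boundary sum and all
`hfn j` at its starting point vanish, and the trace function becomes `perPart` plus (t/η) times `dec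
0`, which displays g₁ and g₂. For j ≠ 0 the function `hfn j` has period 1/2 and gains 4πij under the
shift by τ/2; so g₃ is assembled from 8πij times `dec j`, and half of it appears when t moves by
τ/2. Moving t by 1/2 or τ/2 permutes the four theta functions in the same way as ι¹ and ι³ permute
the generators, up to exponential factors that cancel between coefficients and boundary products
(`perPart_perm1`, `perPart_perm3`). Every η outside ℚ + ℚτ is admissible, so B is empty. -/

noncomputable section

namespace Sklyanin

open Topology

/-! ### Product formulas for theta functions -/

/-- The splitting of `ℤ × ℤ` into the pairs with even and with odd sum. -/
def paritySplit : (ℤ × ℤ) ⊕ (ℤ × ℤ) ≃ ℤ × ℤ :=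
  Equiv.ofBijective
    (Sum.elim (fun p => (p.1 + p.2, p.1 - p.2)) (fun p => (p.1 + p.2 + 1, p.1 - p.2))) (by
    constructor
    · rintro (⟨a, b⟩ | ⟨a, b⟩) (⟨c, d⟩ | ⟨c, d⟩) h <;>
        simp only [Sum.elim_inl, Sum.elim_inr, Prod.mk.injEq, Sum.inl.injEq, Sum.inr.injEq,
          reduceCtorEq] at h ⊢ <;> omega
    · rintro ⟨m, n⟩
      rcases Int.even_or_odd' (m + n) with ⟨k, hk | hk⟩
      · exact ⟨Sum.inl (k, m - k), by ext <;> simp <;> omega⟩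
      · exact ⟨Sum.inr (k, m - k - 1), by ext <;> simp <;> omega⟩)

theorem paritySplit_inl (p : ℤ × ℤ) : paritySplit (Sum.inl p) = (p.1 + p.2, p.1 - p.2) := rfl

theorem paritySplit_inr (p : ℤ × ℤ) : paritySplit (Sum.inr p) = (p.1 + p.2 + 1, p.1 - p.2) := rfl

/-- The even part of the product formula. -/
def thP (τ x : ℂ) : ℂ := jacobiTheta₂ (2 * x) (2 * τ)

/-- The odd part of the product formula. -/
def thR (τ x : ℂ) : ℂ :=
  exp (Real.pi * I * τ / 2 + 2 * Real.pi * I * x) * jacobiTheta₂ (2 * x + τ) (2 * τ)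

theorem two_mul_im_pos {τ : ℂ} (hτ : 0 < τ.im) : 0 < (2 * τ).im := by simpa using hτ

/-- The substitution m = a + b, n = a - b (or m = a + b + 1, n = a - b for odd sums) diagonalises
the form m² + n² and separates x from y, at the price of replacing τ by 2τ. Absolute convergence
permits the regrouping by parity. -/
theorem jacobiTheta₂_mul {τ : ℂ} (hτ : 0 < τ.im) (x y : ℂ) :
    jacobiTheta₂ (x + y) τ * jacobiTheta₂ (x - y) τ = thP τ x * thP τ y + thR τ x * thR τ y := by
  have hs : ∀ (z : ℂ) {σ : ℂ}, 0 < σ.im → Summable (fun n => ‖jacobiTheta₂_term n z σ‖) :=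
    fun z σ hσ => ((summable_jacobiTheta₂_term_iff z σ).2 hσ).norm
  have h2 := two_mul_im_pos hτ
  have e1 := (summable_mul_of_summable_norm (hs (2 * x) h2) (hs (2 * y) h2))
  have e2 := (summable_mul_of_summable_norm (hs (2 * x + τ) h2) (hs (2 * y + τ) h2))
  have e2' := e2.mul_left (exp (Real.pi * I * τ / 2 + 2 * Real.pi * I * x) *
    exp (Real.pi * I * τ / 2 + 2 * Real.pi * I * y))
  have hR : thR τ x * thR τ y = (exp (Real.pi * I * τ / 2 + 2 * Real.pi * I * x) *
    exp (Real.pi * I * τ / 2 + 2 * Real.pi * I * y)) *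
      (jacobiTheta₂ (2 * x + τ) (2 * τ) * jacobiTheta₂ (2 * y + τ) (2 * τ)) := by
    unfold thR; ring
  rw [hR]
  unfold thP jacobiTheta₂
  rw [tsum_mul_tsum_of_summable_norm (hs _ hτ) (hs _ hτ),
    tsum_mul_tsum_of_summable_norm (hs _ h2) (hs _ h2),
    tsum_mul_tsum_of_summable_norm (hs _ h2) (hs _ h2), ← tsum_mul_left, ← paritySplit.tsum_eq]
  have k1 : ((fun c => jacobiTheta₂_term (paritySplit c).1 (x + y) τ *
      jacobiTheta₂_term (paritySplit c).2 (x - y) τ) ∘ Sum.inl) =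
      fun z : ℤ × ℤ => jacobiTheta₂_term z.1 (2 * x) (2 * τ) *
        jacobiTheta₂_term z.2 (2 * y) (2 * τ) := by
    ext ⟨a, b⟩
    simp only [Function.comp, paritySplit_inl,
      jacobiTheta₂_term, ← Complex.exp_add]
    push_cast; congr 1; ring
  have k2 : ((fun c => jacobiTheta₂_term (paritySplit c).1 (x + y) τ *
      jacobiTheta₂_term (paritySplit c).2 (x - y) τ) ∘ Sum.inr) =
      fun z : ℤ × ℤ => (exp (Real.pi * I * τ / 2 + 2 * Real.pi * I * x) *
    exp (Real.pi * I * τ / 2 + 2 * Real.pi * I * y)) *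
        (jacobiTheta₂_term z.1 (2 * x + τ) (2 * τ) *
        jacobiTheta₂_term z.2 (2 * y + τ) (2 * τ)) := by
    ext ⟨a, b⟩
    simp only [Function.comp, paritySplit_inr,
      jacobiTheta₂_term, ← Complex.exp_add]
    push_cast; congr 1; ring
  rw [Summable.tsum_sum (by rw [k1]; exact e1) (by rw [k2]; exact e2')]
  congr 1
  · exact tsum_congr fun z => congrFun k1 z
  · exact tsum_congr fun z => congrFun k2 z

theorem exp_eq_of_sub {a b : ℂ} (n : ℤ) (h : a = b + n * (2 * Real.pi * I)) : exp a = exp b := by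
  rw [h, Complex.exp_add, exp_int_mul_two_pi_mul_I, mul_one]

theorem exp_eq_neg_of_sub {a b : ℂ} (n : ℤ) (h : a = b + Real.pi * I + n * (2 * Real.pi * I)) :
    exp a = -exp b := by
  rw [exp_eq_of_sub n h, Complex.exp_add, exp_pi_mul_I, mul_neg_one]

theorem exp_eq_I_mul_of_sub {a b : ℂ} (n : ℤ)
    (h : a = b + Real.pi / 2 * I + n * (2 * Real.pi * I)) :
    exp a = I * exp b := by
  rw [exp_eq_of_sub n h, Complex.exp_add, exp_pi_div_two_mul_I, mul_comm]

theorem thP_add_half (τ x : ℂ) : thP τ (x + 1 / 2) = thP τ x := by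
  unfold thP
  rw [show 2 * (x + 1 / 2) = 2 * x + 1 by ring, jacobiTheta₂_add_left]

theorem thR_add_half (τ x : ℂ) : thR τ (x + 1 / 2) = -thR τ x := by
  unfold thR
  rw [show 2 * (x + 1 / 2) + τ = 2 * x + τ + 1 by ring, jacobiTheta₂_add_left,
    exp_eq_neg_of_sub 0 (b := Real.pi * I * τ / 2 + 2 * Real.pi * I * x) (by push_cast; ring)]
  ring

/-- The shift by τ/2 exchanges `thP` and `thR`, while the shift by 1/2 changes the sign of `thR`
alone; together they turn a sum of products into a determinant. -/
theorem thP_add_half_tau (τ x : ℂ) :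
    thP τ (x + τ / 2) = exp (-(Real.pi * I * τ / 2 + 2 * Real.pi * I * x)) * thR τ x := by
  unfold thP thR
  rw [← mul_assoc, ← Complex.exp_add, neg_add_cancel, Complex.exp_zero, one_mul]
  ring_nf

theorem thR_add_half_tau (τ x : ℂ) :
    thR τ (x + τ / 2) = exp (-(Real.pi * I * τ / 2 + 2 * Real.pi * I * x)) * thP τ x := by
  unfold thP thR
  rw [show 2 * (x + τ / 2) + τ = 2 * x + 2 * τ by ring, jacobiTheta₂_add_left', ← mul_assoc,
    ← Complex.exp_add]
  congr 2; ring

/-! ### Half-period shifts -/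

theorem th_zero_eq (τ z : ℂ) : th τ 0 z =
    -I * exp (Real.pi * I * τ / 4 + Real.pi * I * z) * jacobiTheta₂ (z + 1 / 2 + τ / 2) τ := rfl

theorem th_one_eq (τ z : ℂ) : th τ 1 z =
    exp (Real.pi * I * τ / 4 + Real.pi * I * z) * jacobiTheta₂ (z + τ / 2) τ := rfl

theorem th_two_eq (τ z : ℂ) : th τ 2 z = jacobiTheta₂ z τ := rfl

theorem th_three_eq (τ z : ℂ) : th τ 3 z = jacobiTheta₂ (z + 1 / 2) τ := rfl

/-- Shifting x by 1/2 + τ/2 in `jacobiTheta₂_mul` exchanges the two functions of x and flips one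
sign, so that a 2 × 2 determinant in (`thP`, `thR`) appears. -/
theorem th_mul_zero {τ : ℂ} (hτ : 0 < τ.im) (x y : ℂ) :
    th τ 0 (x + y) * th τ 0 (x - y) = thP τ x * thR τ y - thR τ x * thP τ y := by
  have h := jacobiTheta₂_mul hτ (x + 1 / 2 + τ / 2) y
  rw [thP_add_half_tau, thR_add_half_tau, thP_add_half, thR_add_half,
    exp_eq_neg_of_sub (-1) (b := -(Real.pi * I * τ / 2 + 2 * Real.pi * I * x))
      (by push_cast; ring)] at h
  rw [th_zero_eq, th_zero_eq, show x + y + 1 / 2 + τ / 2 = x + 1 / 2 + τ / 2 + y by ring,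
    show x - y + 1 / 2 + τ / 2 = x + 1 / 2 + τ / 2 - y by ring]
  have e : exp (Real.pi * I * τ / 4 + Real.pi * I * (x + y)) *
      exp (Real.pi * I * τ / 4 + Real.pi * I * (x - y)) *
      exp (-(Real.pi * I * τ / 2 + 2 * Real.pi * I * x)) = 1 := by
    rw [← Complex.exp_add, ← Complex.exp_add, ← Complex.exp_zero]; congr 1; ring
  have hI := I_sq
  linear_combination (norm := skip) (-exp (Real.pi * I * τ / 4 + Real.pi * I * (x + y)) *
      exp (Real.pi * I * τ / 4 + Real.pi * I * (x - y))) * h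
      + (thP τ x * thR τ y - thR τ x * thP τ y) * e
      + (exp (Real.pi * I * τ / 4 + Real.pi * I * (x + y)) *
      exp (Real.pi * I * τ / 4 + Real.pi * I * (x - y)) *
      jacobiTheta₂ (x + 1 / 2 + τ / 2 + y) τ * jacobiTheta₂ (x + 1 / 2 + τ / 2 - y) τ) * hI
  ring

/-- The three-term relation of Weierstrass. -/
theorem th_three_term {τ : ℂ} (hτ : 0 < τ.im) (x y z w : ℂ) :
    th τ 0 (x + y) * th τ 0 (x - y) * (th τ 0 (z + w) * th τ 0 (z - w)) -
      th τ 0 (x + z) * th τ 0 (x - z) * (th τ 0 (y + w) * th τ 0 (y - w)) +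
      th τ 0 (x + w) * th τ 0 (x - w) * (th τ 0 (y + z) * th τ 0 (y - z)) = 0 := by
  -- Every product is a determinant of two vectors (`thP`, `thR`), so this is the Plücker relation
  -- for four vectors in the plane.
  simp only [th_mul_zero hτ]; ring

theorem th_zero_neg (τ z : ℂ) : th τ 0 (-z) = -th τ 0 z := by
  rw [th_zero_eq, th_zero_eq, ← jacobiTheta₂_neg_left (-z + 1 / 2 + τ / 2),
    show -(-z + 1 / 2 + τ / 2) = z - 1 / 2 - τ / 2 by ring,
    show z + 1 / 2 + τ / 2 = (z - 1 / 2 - τ / 2 + τ) + 1 by ring, jacobiTheta₂_add_left,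
    jacobiTheta₂_add_left', mul_assoc (-I), mul_assoc (-I), ← mul_assoc (exp _) (exp _),
    ← Complex.exp_add, exp_eq_neg_of_sub (-1)
      (b := Real.pi * I * τ / 4 + Real.pi * I * z + -Real.pi * I * (τ + 2 * (z - 1 / 2 - τ / 2)))
      (by push_cast; ring)]
  ring

theorem th_one_neg (τ z : ℂ) : th τ 1 (-z) = th τ 1 z := by
  rw [th_one_eq, th_one_eq, ← jacobiTheta₂_neg_left (-z + τ / 2),
    show -(-z + τ / 2) = z - τ / 2 by ring,
    show z + τ / 2 = (z - τ / 2 + τ) by ring,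
    jacobiTheta₂_add_left', ← mul_assoc (exp _) (exp _), ← Complex.exp_add]
  congr 2; ring

theorem th_two_neg (τ z : ℂ) : th τ 2 (-z) = th τ 2 z := by
  rw [th_two_eq, th_two_eq, jacobiTheta₂_neg_left]

theorem th_three_neg (τ z : ℂ) : th τ 3 (-z) = th τ 3 z := by
  rw [th_three_eq, th_three_eq, ← jacobiTheta₂_neg_left (-z + 1 / 2),
    show z + 1 / 2 = -(-z + 1 / 2) + 1 by ring, jacobiTheta₂_add_left]

theorem th_zero_zero (τ : ℂ) : th τ 0 0 = 0 := by
  have := th_zero_neg τ 0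
  rw [neg_zero] at this
  exact self_eq_neg.1 this

/-- Shift by `1 / 2`. -/
theorem th_zero_add_half (τ z : ℂ) : th τ 0 (z + 1 / 2) = th τ 1 z := by
  rw [th_zero_eq, th_one_eq, show z + 1 / 2 + 1 / 2 + τ / 2 = z + τ / 2 + 1 by ring,
    jacobiTheta₂_add_left, exp_eq_I_mul_of_sub 0
      (b := Real.pi * I * τ / 4 + Real.pi * I * z) (by push_cast; ring)]
  linear_combination (-exp (Real.pi * I * τ / 4 + Real.pi * I * z) *
    jacobiTheta₂ (z + τ / 2) τ) * I_sq

theorem th_one_add_half (τ z : ℂ) : th τ 1 (z + 1 / 2) = -th τ 0 z := by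
  rw [th_zero_eq, th_one_eq, show z + 1 / 2 + τ / 2 = z + 1 / 2 + τ / 2 by ring,
    exp_eq_I_mul_of_sub 0
      (b := Real.pi * I * τ / 4 + Real.pi * I * z) (by push_cast; ring)]
  ring

theorem th_two_add_half (τ z : ℂ) : th τ 2 (z + 1 / 2) = th τ 3 z := rfl

theorem th_three_add_half (τ z : ℂ) : th τ 3 (z + 1 / 2) = th τ 2 z := by
  rw [th_three_eq, th_two_eq, show z + 1 / 2 + 1 / 2 = z + 1 by ring, jacobiTheta₂_add_left]

/-- The multiplier of theta functions under the shift by `τ / 2`. -/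
def halfMul (τ z : ℂ) : ℂ := exp (-(Real.pi * I * τ / 4 + Real.pi * I * z))

theorem halfMul_ne_zero (τ z : ℂ) : halfMul τ z ≠ 0 := Complex.exp_ne_zero _

theorem th_two_add_half_tau (τ z : ℂ) : th τ 2 (z + τ / 2) = halfMul τ z * th τ 1 z := by
  rw [th_two_eq, th_one_eq, halfMul, ← mul_assoc, ← Complex.exp_add, neg_add_cancel,
    Complex.exp_zero, one_mul]

theorem th_three_add_half_tau (τ z : ℂ) : th τ 3 (z + τ / 2) = I * halfMul τ z * th τ 0 z := by
  rw [← th_two_add_half, show z + τ / 2 + 1 / 2 = z + 1 / 2 + τ / 2 by ring, th_two_add_half_tau,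
    th_one_add_half, halfMul, halfMul, exp_eq_I_mul_of_sub (-1)
      (b := -(Real.pi * I * τ / 4 + Real.pi * I * z) + Real.pi * I) (by push_cast; ring),
    Complex.exp_add, exp_pi_mul_I]
  ring

theorem th_one_add_half_tau (τ z : ℂ) : th τ 1 (z + τ / 2) = halfMul τ z * th τ 2 z := by
  rw [th_two_eq, th_one_eq, show z + τ / 2 + τ / 2 = z + τ by ring, jacobiTheta₂_add_left',
    ← mul_assoc, ← Complex.exp_add, halfMul]
  congr 2; ring

theorem th_zero_add_half_tau (τ z : ℂ) : th τ 0 (z + τ / 2) = I * halfMul τ z * th τ 3 z := by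
  have h := th_one_add_half_tau τ (z + 1 / 2)
  rw [show z + 1 / 2 + τ / 2 = z + τ / 2 + 1 / 2 by ring, th_one_add_half, th_two_add_half] at h
  have e : halfMul τ (z + 1 / 2) = -(I * halfMul τ z) := by
    rw [halfMul, halfMul, exp_eq_I_mul_of_sub (-1)
      (b := -(Real.pi * I * τ / 4 + Real.pi * I * z) + Real.pi * I) (by push_cast; ring),
      Complex.exp_add, exp_pi_mul_I]
    ring
  rw [e] at h
  linear_combination -h

/-- The sign of `θ_{α+1}` under the shift by `1`. -/
def sgn1 (α : Fin 4) : ℂ := ![-1, -1, 1, 1] α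

/-- The sign of `θ_{α+1}` under the shift by `τ`. -/
def sgnTau (α : Fin 4) : ℂ := ![-1, 1, 1, -1] α

theorem th_add_one (τ : ℂ) (α : Fin 4) (z : ℂ) : th τ α (z + 1) = sgn1 α * th τ α z := by
  rw [show z + 1 = z + 1 / 2 + 1 / 2 by ring]
  fin_cases α <;> simp only [sgn1, Fin.zero_eta, Fin.mk_one, Fin.reduceFinMk, Matrix.cons_val,
    th_zero_add_half, th_one_add_half, th_three_add_half, th_two_add_half, neg_mul, one_mul]

theorem halfMul_mul (τ z : ℂ) :
    halfMul τ (z + τ / 2) * halfMul τ z = exp (-(Real.pi * I * (τ + 2 * z))) := by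
  rw [halfMul, halfMul, ← Complex.exp_add]; congr 1; ring

theorem th_add_tau (τ : ℂ) (α : Fin 4) (z : ℂ) :
    th τ α (z + τ) = sgnTau α * exp (-(Real.pi * I * (τ + 2 * z))) * th τ α z := by
  rw [show z + τ = z + τ / 2 + τ / 2 by ring, ← halfMul_mul]
  have hI := I_sq
  fin_cases α
  · simp only [sgnTau, Fin.zero_eta, Matrix.cons_val, th_zero_add_half_tau, th_three_add_half_tau]
    linear_combination (halfMul τ (z + τ / 2) * halfMul τ z * th τ 0 z) * hI
  · simp only [sgnTau, Fin.mk_one, Matrix.cons_val, th_one_add_half_tau, th_two_add_half_tau]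
    ring
  · simp only [sgnTau, Fin.reduceFinMk, Matrix.cons_val, th_one_add_half_tau, th_two_add_half_tau]
    ring
  · simp only [sgnTau, Fin.reduceFinMk, Matrix.cons_val, th_zero_add_half_tau,
      th_three_add_half_tau]
    linear_combination (halfMul τ (z + τ / 2) * halfMul τ z * th τ 3 z) * hI

theorem differentiable_th {τ : ℂ} (hτ : 0 < τ.im) (α : Fin 4) : Differentiable ℂ (th τ α) := by
  have h : Differentiable ℂ (fun z => jacobiTheta₂ z τ) :=
    fun z => differentiableAt_jacobiTheta₂_fst z hτ
  have h' : ∀ a : ℂ, Differentiable ℂ (fun z => jacobiTheta₂ (z + a) τ) :=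
    fun a => h.comp (differentiable_id.add_const a)
  have e : ∀ a b : ℂ, Differentiable ℂ (fun z => exp (a + b * z)) := fun a b => by fun_prop
  fin_cases α
  · have := ((e (Real.pi * I * τ / 4) (Real.pi * I)).const_mul (-I)).mul (h' (1 / 2 + τ / 2))
    show Differentiable ℂ (fun z =>
      -I * exp (Real.pi * I * τ / 4 + Real.pi * I * z) * jacobiTheta₂ (z + 1 / 2 + τ / 2) τ)
    simp only [add_assoc]
    exact this
  · exact (e _ _).mul (h' (τ / 2))
  · exact h
  · exact h' (1 / 2)

/-! ### Zeros of `θ₁` -/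

/-- The lattice `ℤ + ℤ τ`. -/
def lat (τ : ℂ) : AddSubgroup ℂ where
  carrier := {z | ∃ m l : ℤ, z = m + l * τ}
  zero_mem' := ⟨0, 0, by simp⟩
  add_mem' := by
    rintro _ _ ⟨m, l, rfl⟩ ⟨m', l', rfl⟩
    exact ⟨m + m', l + l', by push_cast; ring⟩
  neg_mem' := by
    rintro _ ⟨m, l, rfl⟩
    exact ⟨-m, -l, by push_cast; ring⟩

theorem one_mem_lat (τ : ℂ) : (1 : ℂ) ∈ lat τ := ⟨1, 0, by simp⟩

theorem tau_mem_lat (τ : ℂ) : τ ∈ lat τ := ⟨0, 1, by simp⟩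

/-- A property invariant under the shifts by `1` and `τ` is invariant under the lattice. -/
theorem lat_induction {τ : ℂ} {p : ℂ → Prop} (h1 : ∀ z, p (z + 1) ↔ p z)
    (h2 : ∀ z, p (z + τ) ↔ p z) {w : ℂ} (hw : w ∈ lat τ) (z : ℂ) : p (z + w) ↔ p z := by
  have H : ∀ a : ℂ, (∀ z, p (z + a) ↔ p z) → ∀ (m : ℤ) (z : ℂ), p (z + m * a) ↔ p z := by
    intro a ha m
    induction m using Int.induction_on with
    | zero => intro z; simp
    | succ i ih =>
      intro z
      rw [← ih z, ← ha (z + _)]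
      push_cast
      rw [show z + ((i : ℂ) + 1) * a = z + i * a + a by ring, ha, ha]
    | pred i ih =>
      intro z
      rw [← ih z, ← ha (z + _)]
      push_cast
      rw [show z + (-(i : ℂ) - 1) * a + a = z + -i * a by ring]
  obtain ⟨m, l, rfl⟩ := hw
  rw [← add_assoc, H τ h2, ← mul_one (m : ℂ), H 1 h1]

/-- Integration over a period keeps only the zeroth Fourier coefficient. It serves to show that the
theta function is not identically zero. -/
theorem integral_jacobiTheta₂ {τ : ℂ} (hτ : 0 < τ.im) :
    ∫ x in (0 : ℝ)..1, jacobiTheta₂ x τ = 1 := by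
  have hn : ∀ (n : ℤ) (x : ℝ), ‖jacobiTheta₂_term n x τ‖ = ‖jacobiTheta₂_term n 0 τ‖ := by
    intro n x; simp [norm_jacobiTheta₂_term]
  have hc : ∀ n : ℤ, Continuous fun x : ℝ => jacobiTheta₂_term n x τ := by
    intro n; unfold jacobiTheta₂_term; fun_prop
  have hs : Summable fun n : ℤ => ‖jacobiTheta₂_term n 0 τ‖ :=
    ((summable_jacobiTheta₂_term_iff 0 τ).2 hτ).norm
  have h := intervalIntegral.hasSum_integral_of_dominated_convergence (a := 0) (b := 1)
    (μ := MeasureTheory.volume)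
    (F := fun (n : ℤ) (x : ℝ) => jacobiTheta₂_term n x τ) (f := fun x : ℝ => jacobiTheta₂ x τ)
    (bound := fun n _ => ‖jacobiTheta₂_term n 0 τ‖)
    (fun n => (hc n).aestronglyMeasurable) (fun n => .of_forall fun x _ => (hn n x).le)
    (.of_forall fun _ _ => hs) (by simp)
    (.of_forall fun x _ => hasSum_jacobiTheta₂_term x hτ)
  refine h.unique ?_
  have h0 : ∀ n : ℤ, ∫ x in (0 : ℝ)..1, jacobiTheta₂_term n x τ = if n = 0 then 1 else 0 := by
    intro n
    split_ifs with hn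
    · subst hn; simp [jacobiTheta₂_term]
    · have hne : (2 * Real.pi * I * n : ℂ) ≠ 0 := by simp [hn, Real.pi_ne_zero, I_ne_zero]
      simp only [jacobiTheta₂_term, Complex.exp_add]
      rw [intervalIntegral.integral_mul_const, integral_exp_mul_complex hne]
      have : exp (2 * Real.pi * I * n) = 1 := by
        rw [mul_comm, exp_int_mul_two_pi_mul_I]
      simp [this]
  simp only [h0]
  exact hasSum_ite_eq 0 1

theorem exists_th_zero_ne {τ : ℂ} (hτ : 0 < τ.im) : ∃ z, th τ 0 z ≠ 0 := by
  by_contra! h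
  have : ∀ z, jacobiTheta₂ z τ = 0 := by
    intro z
    have := h (z - 1 / 2 - τ / 2)
    rw [th_zero_eq, show z - 1 / 2 - τ / 2 + 1 / 2 + τ / 2 = z by ring] at this
    simpa using this
  have h2 := integral_jacobiTheta₂ hτ
  simp [this] at h2

/-- A vanishing Wronskian makes h/k constant near a point where k ≠ 0, and the identity theorem
extends the proportionality. -/
theorem eq_const_mul_of_wronskian {h k : ℂ → ℂ} (hh : Differentiable ℂ h)
    (hk : Differentiable ℂ k) (hw : ∀ s, deriv h s * k s = h s * deriv k s) {s₀ : ℂ}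
    (hs : k s₀ ≠ 0) : ∃ c, ∀ s, h s = c * k s := by
  refine ⟨h s₀ / k s₀, ?_⟩
  obtain ⟨ε, hε, hb⟩ := Metric.eventually_nhds_iff_ball.1
    (hk.continuous.continuousAt.eventually_ne hs)
  have hd : ∀ x ∈ Metric.ball s₀ ε, HasDerivAt (fun s => h s / k s) 0 x := by
    intro x hx
    have := (hh x).hasDerivAt.div (hk x).hasDerivAt (hb x hx)
    rwa [hw, sub_self, zero_div] at this
  have hc : ∀ x ∈ Metric.ball s₀ ε, h x / k x = h s₀ / k s₀ := by
    intro x hx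
    exact Metric.isOpen_ball.is_const_of_deriv_eq_zero
      (convex_ball s₀ ε).isPreconnected (f := fun s => h s / k s)
      (fun x hx => (hd x hx).differentiableAt.differentiableWithinAt)
      (fun x hx => (hd x hx).deriv) hx (Metric.mem_ball_self hε)
  have := AnalyticOnNhd.eq_of_eventuallyEq (f := h) (g := fun s => h s₀ / k s₀ * k s)
    (fun x _ => hh.analyticAt x) (fun x _ => (hk.const_mul _).analyticAt x) (z₀ := s₀) (by
      filter_upwards [Metric.ball_mem_nhds s₀ hε] with x hx
      rw [← hc x hx, div_mul_cancel₀ _ (hb x hx)])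
  exact fun s => congrFun this s

/-- If the derivative vanished at 0, differentiating `th_mul_zero` in y at y = x would show that
`thP` and `thR` have zero Wronskian; they would be proportional, and the determinant at y = 0, which
is the square of θ₁, would vanish identically. -/
theorem deriv_th_zero_ne {τ : ℂ} (hτ : 0 < τ.im) : deriv (th τ 0) 0 ≠ 0 := by
  intro h0
  have hd := differentiable_th hτ 0
  have hj : Differentiable ℂ (fun z => jacobiTheta₂ z (2 * τ)) :=
    fun z => differentiableAt_jacobiTheta₂_fst z (two_mul_im_pos hτ)
  have hP : Differentiable ℂ (thP τ) := hj.comp (differentiable_id.const_mul 2)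
  have hR : Differentiable ℂ (thR τ) := by
    have e : Differentiable ℂ (fun x : ℂ => exp (Real.pi * I * τ / 2 + 2 * Real.pi * I * x)) := by
      fun_prop
    exact e.mul (hj.comp ((differentiable_id.const_mul 2).add_const τ))
  have key : ∀ x, deriv (thP τ) x * thR τ x = thP τ x * deriv (thR τ) x := by
    intro x
    have e1 : HasDerivAt (fun y => th τ 0 (x + y) * th τ 0 (x - y))
        (deriv (th τ 0) (x + x) * th τ 0 (x - x) + th τ 0 (x + x) * -deriv (th τ 0) (x - x)) x :=
      ((hd (x + x)).hasDerivAt.comp_const_add x x).mul ((hd (x - x)).hasDerivAt.comp_const_sub x x)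
    have e2 : HasDerivAt (fun y => thP τ x * thR τ y - thR τ x * thP τ y)
        (thP τ x * deriv (thR τ) x - thR τ x * deriv (thP τ) x) x :=
      ((hR x).hasDerivAt.const_mul _).sub ((hP x).hasDerivAt.const_mul _)
    have e3 : (fun y => th τ 0 (x + y) * th τ 0 (x - y)) =
      fun y => thP τ x * thR τ y - thR τ x * thP τ y := funext fun y => th_mul_zero hτ x y
    rw [e3] at e1
    have := e1.unique e2
    rw [sub_self, th_zero_zero, h0] at this
    linear_combination this
  obtain ⟨z, hz⟩ := exists_th_zero_ne hτ
  by_cases hR0 : ∃ s, thR τ s ≠ 0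
  · obtain ⟨s, hs⟩ := hR0
    obtain ⟨c, hc⟩ := eq_const_mul_of_wronskian hP hR key hs
    have := th_mul_zero hτ z 0
    rw [hc z, hc 0] at this
    simp only [add_zero, sub_zero] at this
    have h2 : th τ 0 z * th τ 0 z = 0 := by rw [this]; ring
    exact hz (mul_self_eq_zero.1 h2)
  · push Not at hR0
    have := th_mul_zero hτ z 0
    rw [hR0 z, hR0 0] at this
    simp only [add_zero, sub_zero, mul_zero, zero_mul] at this
    exact hz (mul_self_eq_zero.1 this)

theorem th_zero_add_lat_eq_zero_iff {τ w : ℂ} (hw : w ∈ lat τ) (z : ℂ) :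
    th τ 0 (z + w) = 0 ↔ th τ 0 z = 0 := by
  refine lat_induction (p := fun z => th τ 0 z = 0) (fun z => ?_) (fun z => ?_) hw z
  · simp [th_add_one, sgn1]
  · simp [th_add_tau, sgnTau, Complex.exp_ne_zero]

theorem th_zero_eq_zero_of_mem {τ z : ℂ} (hz : z ∈ lat τ) : th τ 0 z = 0 := by
  have := th_zero_add_lat_eq_zero_iff hz 0
  rw [zero_add] at this
  exact this.2 (th_zero_zero τ)

/-- The zeros of `θ₁` are the lattice points. -/
theorem th_zero_eq_zero_iff {τ : ℂ} (hτ : 0 < τ.im) {a : ℂ} : th τ 0 a = 0 ↔ a ∈ lat τ := by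
  refine ⟨fun ha => ?_, th_zero_eq_zero_of_mem⟩
  have hd := differentiable_th hτ 0
  -- When θ₁(a) = 0, one term of the three-term relation drops out. What remains says that θ₁(s + δ)
  -- θ₁(s - a) / (θ₁(s) θ₁(s + δ - a)) does not depend on s.
  have W : ∀ s s' δ, th τ 0 (s + δ) * th τ 0 (s - a) * (th τ 0 s' * th τ 0 (s' + δ - a)) =
      th τ 0 s * th τ 0 (s + δ - a) * (th τ 0 (s' + δ) * th τ 0 (s' - a)) := by
    intro s s' δ
    have := th_three_term hτ (s + (δ - a) / 2) (s' + (δ - a) / 2) ((δ + a) / 2) ((a - δ) / 2)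
    rw [show (δ + a) / 2 + (a - δ) / 2 = a by ring, ha,
      show s + (δ - a) / 2 + (δ + a) / 2 = s + δ by ring,
      show s + (δ - a) / 2 - (δ + a) / 2 = s - a by ring,
      show s' + (δ - a) / 2 + (δ + a) / 2 = s' + δ by ring,
      show s' + (δ - a) / 2 - (δ + a) / 2 = s' - a by ring,
      show s + (δ - a) / 2 + (a - δ) / 2 = s by ring,
      show s + (δ - a) / 2 - (a - δ) / 2 = s + δ - a by ring,
      show s' + (δ - a) / 2 + (a - δ) / 2 = s' by ring,
      show s' + (δ - a) / 2 - (a - δ) / 2 = s' + δ - a by ring] at this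
    linear_combination -this
  obtain ⟨z, hz⟩ := exists_th_zero_ne hτ
  have hnear : ∀ᶠ s in 𝓝[≠] z, th τ 0 s ≠ 0 := by
    exact ((hd.continuous.continuousAt (x := z)).eventually_ne hz).filter_mono nhdsWithin_le_nhds
  have hnear2 : ∀ᶠ s in 𝓝[≠] z, th τ 0 (s - a) ≠ 0 := by
    have han : AnalyticOnNhd ℂ (fun s => th τ 0 (s - a)) Set.univ :=
      fun x _ => (hd.comp (differentiable_id.sub_const a)).analyticAt x
    rcases (han z trivial).eventually_eq_zero_or_eventually_ne_zero with h | h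
    · exfalso
      have h' := han.eqOn_zero_of_preconnected_of_eventuallyEq_zero isPreconnected_univ
        (Set.mem_univ z) h
      exact hz (by simpa using h' (Set.mem_univ (z + a)))
    · exact h
  obtain ⟨s₀, hs₀, hs₀'⟩ := (hnear.and hnear2).exists
  set lam : ℂ := (deriv (th τ 0) s₀ * th τ 0 (s₀ - a) - th τ 0 s₀ * deriv (th τ 0) (s₀ - a)) /
    (th τ 0 s₀ * th τ 0 (s₀ - a)) with hlam
  -- The derivative of W at δ = 0: the logarithmic derivatives of θ₁(s) and θ₁(s - a) differ by the
  -- constant `lam`, whence θ₁(s) = c exp(lam s) θ₁(s - a).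
  have key : ∀ s, deriv (th τ 0) s * th τ 0 (s - a) - th τ 0 s * deriv (th τ 0) (s - a) =
      lam * (th τ 0 s * th τ 0 (s - a)) := by
    intro s
    have d : ∀ b c : ℂ, HasDerivAt (fun δ => th τ 0 (b + δ + c)) (deriv (th τ 0) (b + c)) 0 := by
      intro b c
      have : HasDerivAt (th τ 0) (deriv (th τ 0) (b + c)) (b + 0 + c) := by
        rw [add_zero]; exact (hd _).hasDerivAt
      exact (this.comp_add_const (b + 0) c).comp_const_add b 0
    have e1 := ((d s 0).mul_const (th τ 0 (s - a))).mul
      ((d s₀ (-a)).const_mul (th τ 0 s₀))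
    have e2 := ((d s (-a)).const_mul (th τ 0 s)).mul
      ((d s₀ 0).mul_const (th τ 0 (s₀ - a)))
    have e3 : ((fun δ => th τ 0 (s + δ + 0) * th τ 0 (s - a)) *
        (fun δ => th τ 0 s₀ * th τ 0 (s₀ + δ + -a))) =
        ((fun δ => th τ 0 s * th τ 0 (s + δ + -a)) *
        (fun δ => th τ 0 (s₀ + δ + 0) * th τ 0 (s₀ - a))) := by
      ext δ
      simpa [sub_eq_add_neg] using W s s₀ δ
    rw [e3] at e1
    have := e1.unique e2
    simp only [add_zero, ← sub_eq_add_neg] at this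
    rw [hlam]
    field_simp
    linear_combination this
  obtain ⟨c, hc⟩ := eq_const_mul_of_wronskian (h := th τ 0)
    (k := fun s => exp (lam * s) * th τ 0 (s - a)) (s₀ := s₀) hd (by
      exact (by fun_prop : Differentiable ℂ fun s : ℂ => exp (lam * s)).mul
        (hd.comp (differentiable_id.sub_const a))) (by
      intro s
      have : HasDerivAt (fun s => exp (lam * s) * th τ 0 (s - a))
          (exp (lam * s) * (lam * 1) * th τ 0 (s - a) + exp (lam * s) * deriv (th τ 0) (s - a)) s :=
        (((hasDerivAt_id s).const_mul lam).cexp).mul ((hd (s - a)).hasDerivAt.comp_sub_const s a)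
      rw [this.deriv]
      linear_combination exp (lam * s) * key s) (mul_ne_zero (Complex.exp_ne_zero _) hs₀')
  have hc0 : c ≠ 0 := by
    rintro rfl
    exact hs₀ (by rw [hc, zero_mul])
  -- Comparing multipliers under s ↦ s + 1 and s ↦ s + τ gives lam = 2πin and lam τ + 2πia = 2πim,
  -- so a = m - nτ.
  have h1 : exp lam = 1 := by
    have := hc (s₀ + 1)
    rw [th_add_one, show s₀ + 1 - a = s₀ - a + 1 by ring, th_add_one, hc s₀, mul_add,
      Complex.exp_add, mul_one] at this
    have hne : c * exp (lam * s₀) * th τ 0 (s₀ - a) ≠ 0 :=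
      mul_ne_zero (mul_ne_zero hc0 (Complex.exp_ne_zero _)) hs₀'
    simp only [sgn1, Matrix.cons_val] at this
    apply mul_left_cancel₀ hne
    linear_combination this
  have h2 : exp (lam * τ + 2 * Real.pi * I * a) = 1 := by
    have := hc (s₀ + τ)
    rw [th_add_tau, show s₀ + τ - a = s₀ - a + τ by ring, th_add_tau, hc s₀, mul_add lam,
      Complex.exp_add, show -(Real.pi * I * (τ + 2 * (s₀ - a))) =
        -(Real.pi * I * (τ + 2 * s₀)) + 2 * Real.pi * I * a by ring, Complex.exp_add] at this
    have hne : exp (-(Real.pi * I * (τ + 2 * s₀))) * (c * exp (lam * s₀) * th τ 0 (s₀ - a)) ≠ 0 :=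
      mul_ne_zero (Complex.exp_ne_zero _)
        (mul_ne_zero (mul_ne_zero hc0 (Complex.exp_ne_zero _)) hs₀')
    simp only [sgnTau, Matrix.cons_val] at this
    rw [Complex.exp_add]
    apply mul_left_cancel₀ hne
    linear_combination this
  obtain ⟨n, hn⟩ := Complex.exp_eq_one_iff.1 h1
  obtain ⟨m, hm⟩ := Complex.exp_eq_one_iff.1 h2
  refine ⟨m, -n, ?_⟩
  rw [hn] at hm
  have : (2 * Real.pi * I : ℂ) ≠ 0 := two_pi_I_ne_zero
  apply mul_left_cancel₀ this
  push_cast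
  linear_combination hm

/-- The zeros of `θ₁` are simple. -/
theorem deriv_th_zero_ne_of_mem {τ : ℂ} (hτ : 0 < τ.im) {a : ℂ} (ha : a ∈ lat τ) :
    deriv (th τ 0) a ≠ 0 := by
  have hd := differentiable_th hτ 0
  -- The derivative alone is not quasi-periodic, but the simultaneous vanishing of θ₁ and its
  -- derivative is a lattice-invariant property.
  have h : (th τ 0 (0 + a) = 0 ∧ deriv (th τ 0) (0 + a) = 0) ↔
      (th τ 0 0 = 0 ∧ deriv (th τ 0) 0 = 0) := by
    refine lat_induction (p := fun z => th τ 0 z = 0 ∧ deriv (th τ 0) z = 0)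
      (fun z => ?_) (fun z => ?_) ha 0
    · have e : deriv (th τ 0) (z + 1) = -deriv (th τ 0) z := by
        rw [← deriv_comp_add_const, ← deriv.fun_neg]
        congr 1; ext w; simp [th_add_one, sgn1]
      simp [th_add_one, sgn1, e]
    · have e : deriv (th τ 0) (z + τ) = -(exp (-(Real.pi * I * (τ + 2 * z))) *
          (-(Real.pi * I * (2 * 1)))) * th τ 0 z +
          -exp (-(Real.pi * I * (τ + 2 * z))) * deriv (th τ 0) z := by
        rw [← deriv_comp_add_const]
        have e1 : (fun w => th τ 0 (w + τ)) =
            fun w => -exp (-(Real.pi * I * (τ + 2 * w))) * th τ 0 w := by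
          ext w; simp [th_add_tau, sgnTau]
        rw [e1]
        exact ((((((hasDerivAt_id z).const_mul 2).const_add τ).const_mul (Real.pi * I)).fun_neg.cexp.fun_neg).mul
          (hd z).hasDerivAt).deriv
      constructor
      · rintro ⟨h1, h2⟩
        have h1' : th τ 0 z = 0 := by simpa [th_add_tau, sgnTau, Complex.exp_ne_zero] using h1
        rw [e, h1'] at h2
        exact ⟨h1', by simpa [Complex.exp_ne_zero] using h2⟩
      · rintro ⟨h1, h2⟩
        rw [e, h1, h2, th_add_tau, h1]
        simp
  rw [zero_add] at h
  intro h0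
  exact deriv_th_zero_ne hτ (h.1 ⟨th_zero_eq_zero_of_mem ha, h0⟩).2

/-! ### Removable singularities -/

/-- `f` has at most a removable singularity at `x`. -/
def IsRem (f : ℂ → ℂ) (x : ℂ) : Prop := ∃ g, AnalyticAt ℂ g x ∧ f =ᶠ[𝓝[≠] x] g

theorem _root_.AnalyticAt.isRem {f : ℂ → ℂ} {x : ℂ} (h : AnalyticAt ℂ f x) : IsRem f x :=
  ⟨f, h, EventuallyEq.rfl⟩

namespace IsRem

variable {f g : ℂ → ℂ} {x : ℂ}

theorem congr (hf : IsRem f x) (h : g =ᶠ[𝓝[≠] x] f) : IsRem g x := by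
  obtain ⟨F, hF, e⟩ := hf
  exact ⟨F, hF, h.trans e⟩

theorem add (hf : IsRem f x) (hg : IsRem g x) : IsRem (fun z => f z + g z) x := by
  obtain ⟨F, hF, e⟩ := hf
  obtain ⟨G, hG, e'⟩ := hg
  exact ⟨F + G, hF.add hG, e.add e'⟩

theorem mul (hf : IsRem f x) (hg : IsRem g x) : IsRem (fun z => f z * g z) x := by
  obtain ⟨F, hF, e⟩ := hf
  obtain ⟨G, hG, e'⟩ := hg
  exact ⟨F * G, hF.mul hG, e.mul e'⟩

theorem const (c x : ℂ) : IsRem (fun _ => c) x := analyticAt_const.isRem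

theorem const_mul (c : ℂ) (hf : IsRem f x) : IsRem (fun z => c * f z) x := (const c x).mul hf

theorem neg (hf : IsRem f x) : IsRem (fun z => -f z) x := by
  simpa using hf.const_mul (-1)

theorem sub (hf : IsRem f x) (hg : IsRem g x) : IsRem (fun z => f z - g z) x := by
  simpa [sub_eq_add_neg] using hf.add hg.neg

theorem comp_add_const {c : ℂ} (hf : IsRem f (x + c)) : IsRem (fun z => f (z + c)) x := by
  obtain ⟨F, hF, e⟩ := hf
  refine ⟨fun z => F (z + c), hF.comp_of_eq (by fun_prop) rfl, ?_⟩
  have : Tendsto (fun z => z + c) (𝓝[≠] x) (𝓝[≠] (x + c)) := by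
    refine tendsto_nhdsWithin_iff.2 ⟨?_, ?_⟩
    · exact ((continuous_add_const c).tendsto x).mono_left nhdsWithin_le_nhds
    · filter_upwards [self_mem_nhdsWithin] with z hz
      simpa using hz
  exact this.eventually e

theorem comp_neg (hf : IsRem f (-x)) : IsRem (fun z => f (-z)) x := by
  obtain ⟨F, hF, e⟩ := hf
  refine ⟨fun z => F (-z), hF.comp_of_eq (by fun_prop) rfl, ?_⟩
  have : Tendsto (fun z => -z) (𝓝[≠] x) (𝓝[≠] (-x)) := by
    refine tendsto_nhdsWithin_iff.2 ⟨?_, ?_⟩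
    · exact (continuous_neg.tendsto x).mono_left nhdsWithin_le_nhds
    · filter_upwards [self_mem_nhdsWithin] with z hz
      simpa using hz
  exact this.eventually e

theorem exists_tendsto (hf : IsRem f x) : ∃ c, Tendsto f (𝓝[≠] x) (𝓝 c) := by
  obtain ⟨F, hF, e⟩ := hf
  exact ⟨F x, (hF.continuousAt.tendsto.mono_left nhdsWithin_le_nhds).congr' e.symm⟩

end IsRem

/-- An analytic function divided by an analytic function with a simple zero. -/
theorem isRem_div {f g : ℂ → ℂ} {x : ℂ} (hf : Differentiable ℂ f) (hg : Differentiable ℂ g)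
    (hfx : g x = 0 → f x = 0) (hgx : g x = 0 → deriv g x ≠ 0) : IsRem (fun z => f z / g z) x := by
  by_cases h0 : g x = 0
  · have hF : Differentiable ℂ (dslope f x) := fun y =>
      ((differentiableOn_dslope (s := Set.univ) Filter.univ_mem).2
        hf.differentiableOn).differentiableAt Filter.univ_mem
    have hG : Differentiable ℂ (dslope g x) := fun y =>
      ((differentiableOn_dslope (s := Set.univ) Filter.univ_mem).2
        hg.differentiableOn).differentiableAt Filter.univ_mem
    refine ⟨fun z => dslope f x z / dslope g x z,
      (hF.analyticAt x).div (hG.analyticAt x) (by rw [dslope_same]; exact hgx h0), ?_⟩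
    filter_upwards [self_mem_nhdsWithin] with z hz
    have hz' : z - x ≠ 0 := sub_ne_zero.2 hz
    rw [dslope_of_ne _ hz, dslope_of_ne _ hz, slope_def_field, slope_def_field, h0, hfx h0,
      sub_zero, sub_zero, div_div_div_cancel_right₀ hz']
  · exact ((hf.analyticAt x).div (hg.analyticAt x) h0).isRem

/-- A function with only removable singularities extends to an entire function. -/
theorem exists_entire_of_isRem {f : ℂ → ℂ} (hf : ∀ x, IsRem f x) :
    ∃ F : ℂ → ℂ, Differentiable ℂ F ∧ (∀ x, f =ᶠ[𝓝[≠] x] F) ∧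
      ∀ x, ContinuousAt f x → F x = f x := by
  -- The candidate takes the punctured limit at every point. Near x it agrees with any analytic
  -- representative at x, because the same representative also describes f in a punctured
  -- neighbourhood of each nearby point.
  choose c hc using fun x => (hf x).exists_tendsto
  have key : ∀ x g, AnalyticAt ℂ g x → f =ᶠ[𝓝[≠] x] g → c =ᶠ[𝓝 x] g := by
    intro x g hg e
    have h1 : ∀ᶠ y in 𝓝 x, f =ᶠ[𝓝[≠] y] g := by
      have := (eventually_nhdsWithin_iff.1 e)
      have := this.eventually_nhds
      filter_upwards [this] with y hy
      by_cases hyx : y = x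
      · subst hyx; exact e
      · have hne : ∀ᶠ z in 𝓝 y, z ≠ x := isOpen_ne.mem_nhds hyx
        exact ((hy.and hne).mono fun z hz => hz.1 hz.2).filter_mono nhdsWithin_le_nhds
    filter_upwards [h1, hg.eventually_analyticAt] with y hy hgy
    exact tendsto_nhds_unique (hc y)
      ((hgy.continuousAt.tendsto.mono_left nhdsWithin_le_nhds).congr' hy.symm)
  refine ⟨c, fun x => ?_, fun x => ?_, fun x hx => ?_⟩
  · obtain ⟨g, hg, e⟩ := hf x
    exact (hg.congr (key x g hg e).symm).differentiableAt
  · obtain ⟨g, hg, e⟩ := hf x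
    exact e.trans ((key x g hg e).symm.filter_mono nhdsWithin_le_nhds)
  · exact tendsto_nhds_unique (hc x) (hx.tendsto.mono_left nhdsWithin_le_nhds)

theorem eq_of_eventuallyEq_nhdsNE {f g : ℂ → ℂ} {x : ℂ} (hf : ContinuousAt f x)
    (hg : ContinuousAt g x) (h : f =ᶠ[𝓝[≠] x] g) : f x = g x :=
  tendsto_nhds_unique (hf.tendsto.mono_left nhdsWithin_le_nhds)
    ((hg.tendsto.mono_left nhdsWithin_le_nhds).congr' h.symm)

/-- Division of entire functions by an entire function with simple zeros. -/
theorem exists_entire_mul {f g : ℂ → ℂ} (hf : Differentiable ℂ f) (hg : Differentiable ℂ g)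
    (hfx : ∀ x, g x = 0 → f x = 0) (hgx : ∀ x, g x = 0 → deriv g x ≠ 0) :
    ∃ h : ℂ → ℂ, Differentiable ℂ h ∧ ∀ x, f x = g x * h x := by
  obtain ⟨h, hd, e, -⟩ := exists_entire_of_isRem (fun x => isRem_div hf hg (hfx x) (hgx x))
  refine ⟨h, hd, fun x => ?_⟩
  refine eq_of_eventuallyEq_nhdsNE (g := fun x => g x * h x) hf.continuous.continuousAt
    (hg.mul hd).continuous.continuousAt ?_
  have hne : ∀ᶠ z in 𝓝[≠] x, g z ≠ 0 := by
    rcases (hg.analyticAt x).eventually_eq_zero_or_eventually_ne_zero with h0 | h0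
    · exfalso
      have : g =ᶠ[𝓝 x] fun _ => 0 := h0
      exact hgx x this.eq_of_nhds (by rw [this.deriv_eq, deriv_const])
    · exact h0
  filter_upwards [e x, hne] with z hz hgz
  rw [← hz, mul_div_cancel₀ _ hgz]

/-! ### Entire quasi-periodic functions -/

theorem exists_lat_add_mem {τ : ℂ} (hτ : 0 < τ.im) (z : ℂ) :
    ∃ w ∈ lat τ, z + w ∈ (fun p : ℝ × ℝ => (p.1 : ℂ) + p.2 * τ) ''
      (Set.Icc (0 : ℝ) 1 ×ˢ Set.Icc (0 : ℝ) 1) := by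
  set b : ℝ := z.im / τ.im with hb
  set a : ℝ := z.re - b * τ.re with ha
  have hz : z = a + b * τ := by
    apply Complex.ext
    · simp [ha]
    · simp [hb, hτ.ne']
  refine ⟨((-⌊a⌋ : ℤ) : ℂ) + ((-⌊b⌋ : ℤ) : ℂ) * τ, ⟨_, _, rfl⟩, ⟨Int.fract a, Int.fract b⟩,
    ⟨⟨Int.fract_nonneg a, (Int.fract_lt_one a).le⟩, Int.fract_nonneg b, (Int.fract_lt_one b).le⟩, ?_⟩
  conv_rhs => rw [hz]
  simp only [Int.fract]
  push_cast
  ring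

/-- Liouville's theorem: the norm of F is controlled by a compact parallelogram. Only the norm has
to be periodic, which leaves room for unimodular multipliers. -/
theorem eq_const_of_norm_periodic {τ : ℂ} (hτ : 0 < τ.im) {F : ℂ → ℂ} (hF : Differentiable ℂ F)
    (h1 : ∀ z, ‖F (z + 1)‖ = ‖F z‖) (h2 : ∀ z, ‖F (z + τ)‖ = ‖F z‖) : ∃ c, ∀ z, F z = c := by
  refine hF.exists_const_forall_eq_of_bounded ?_
  have hK : IsCompact ((fun p : ℝ × ℝ => (p.1 : ℂ) + p.2 * τ) ''
      (Set.Icc (0 : ℝ) 1 ×ˢ Set.Icc (0 : ℝ) 1)) :=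
    (isCompact_Icc.prod isCompact_Icc).image (by fun_prop)
  obtain ⟨C, hC⟩ := (hK.image hF.continuous).isBounded.exists_norm_le
  refine isBounded_iff_forall_norm_le.2 ⟨C, ?_⟩
  rintro _ ⟨z, rfl⟩
  obtain ⟨w, hw, hm⟩ := exists_lat_add_mem hτ z
  have := lat_induction (p := fun x => ‖F x‖ ≤ C) (fun z => by rw [h1]) (fun z => by rw [h2]) hw z
  exact this.1 (hC _ ⟨_, hm, rfl⟩)

/-- `f` is entire and quasi-periodic of degree `N`. -/
def IsQP (τ : ℂ) (N : ℤ) (f : ℂ → ℂ) : Prop :=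
  Differentiable ℂ f ∧ ∃ c₁ c₂ : ℂ, ‖c₁‖ = 1 ∧ c₂ ≠ 0 ∧ (∀ z, f (z + 1) = c₁ * f z) ∧
    ∀ z, f (z + τ) = c₂ * exp (-(2 * Real.pi * I * N * z)) * f z

theorem th_zero_sub_ne {τ : ℂ} (hτ : 0 < τ.im) (a x : ℂ) :
    ∀ᶠ z in 𝓝[≠] x, th τ 0 (z - a) ≠ 0 := by
  have hd : Differentiable ℂ fun z => th τ 0 (z - a) :=
    (differentiable_th hτ 0).comp (differentiable_id.sub_const a)
  rcases (hd.analyticAt x).eventually_eq_zero_or_eventually_ne_zero with h | h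
  · exfalso
    obtain ⟨z, hz⟩ := exists_th_zero_ne hτ
    have han : AnalyticOnNhd ℂ (fun z => th τ 0 (z - a)) Set.univ := fun x _ => hd.analyticAt x
    have h' := han.eqOn_zero_of_preconnected_of_eventuallyEq_zero isPreconnected_univ
      (Set.mem_univ x) h
    exact hz (by simpa using h' (Set.mem_univ (z + a)))
  · exact h

/-- Moving the zero of θ₁(z - a) multiplies its τ-multiplier by exp(2πia); this freedom makes a
given multiplier unimodular. -/
theorem exists_norm_exp_mul_eq_one {c : ℂ} (hc : c ≠ 0) :
    ∃ a : ℂ, ‖c * exp (2 * Real.pi * I * a)‖ = 1 := by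
  refine ⟨I * (Real.log ‖c‖ / (2 * Real.pi) : ℝ), ?_⟩
  have hp : (Real.pi : ℂ) ≠ 0 := by exact_mod_cast Real.pi_ne_zero
  have : 2 * Real.pi * I * (I * (Real.log ‖c‖ / (2 * Real.pi) : ℝ)) = ((-Real.log ‖c‖ : ℝ) : ℂ) := by
    push_cast
    field_simp
    linear_combination (Real.log ‖c‖ : ℂ) * I_sq
  rw [this, norm_mul, ← Complex.ofReal_exp, Complex.norm_real, Real.exp_neg,
    Real.exp_log (norm_pos_iff.2 hc), norm_inv, norm_norm, mul_inv_cancel₀ (norm_ne_zero_iff.2 hc)]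

/-- Multiplication by θ₁(z - a) raises the degree to 0. For a suitable a the multipliers become
unimodular, so the product is constant, and it vanishes at z = a. -/
theorem IsQP.eq_zero_of_neg_one {τ : ℂ} (hτ : 0 < τ.im) {f : ℂ → ℂ} (h : IsQP τ (-1) f) :
    ∀ z, f z = 0 := by
  obtain ⟨hf, c₁, c₂, hc₁, hc₂, h1, h2⟩ := h
  obtain ⟨a, ha⟩ := exists_norm_exp_mul_eq_one
    (c := -c₂ * exp (-(Real.pi * I * τ))) (mul_ne_zero (neg_ne_zero.2 hc₂) (Complex.exp_ne_zero _))
  have hd : Differentiable ℂ fun z => th τ 0 (z - a) :=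
    (differentiable_th hτ 0).comp (differentiable_id.sub_const a)
  obtain ⟨c, hc⟩ := eq_const_of_norm_periodic hτ (F := fun z => f z * th τ 0 (z - a))
    (hf.mul hd) (fun z => by
      rw [h1, show z + 1 - a = z - a + 1 by ring, th_add_one]
      simp [sgn1, hc₁]) (fun z => by
      rw [h2, show z + τ - a = z - a + τ by ring, th_add_tau]
      have : c₂ * exp (-(2 * Real.pi * I * (-1 : ℤ) * z)) * f z *
          (sgnTau 0 * exp (-(Real.pi * I * (τ + 2 * (z - a)))) * th τ 0 (z - a)) =
          (-c₂ * exp (-(Real.pi * I * τ)) * exp (2 * Real.pi * I * a)) * (f z * th τ 0 (z - a)) := by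
        have e : exp (-(2 * Real.pi * I * (-1 : ℤ) * z)) *
            exp (-(Real.pi * I * (τ + 2 * (z - a)))) =
            exp (-(Real.pi * I * τ)) * exp (2 * Real.pi * I * a) := by
          rw [← Complex.exp_add, ← Complex.exp_add]; congr 1; push_cast; ring
        simp only [sgnTau, Matrix.cons_val]
        linear_combination (-c₂ * f z * th τ 0 (z - a)) * e
      rw [this, norm_mul, ha, one_mul])
  have hc0 : c = 0 := by rw [← hc a, sub_self, th_zero_zero, mul_zero]
  intro z
  refine eq_of_eventuallyEq_nhdsNE (g := fun _ => 0) hf.continuous.continuousAt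
    continuousAt_const ?_
  filter_upwards [th_zero_sub_ne hτ a z] with w hw
  exact (mul_eq_zero.1 ((hc w).trans hc0)).resolve_right hw

theorem IsQP.vanish_add_lat {τ : ℂ} {N : ℤ} {f : ℂ → ℂ} (h : IsQP τ N f) {a w : ℂ}
    (hw : w ∈ lat τ) (ha : f a = 0) : f (a + w) = 0 := by
  obtain ⟨-, c₁, c₂, hc₁, hc₂, h1, h2⟩ := h
  have hc₁' : c₁ ≠ 0 := by rintro rfl; simp at hc₁
  exact (lat_induction (p := fun z => f z = 0) (fun z => by simp [h1, hc₁'])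
    (fun z => by simp [h2, hc₂, Complex.exp_ne_zero]) hw a).2 ha

/-- Quasi-periodicity spreads the zero a over its whole lattice coset, which is exactly the set of
the simple zeros of θ₁(z - a); so the quotient is entire. Its multipliers are computed where θ₁(z -
a) ≠ 0 and extend by continuity. -/
theorem IsQP.exists_div {τ : ℂ} (hτ : 0 < τ.im) {N : ℤ} {f : ℂ → ℂ} (h : IsQP τ (N + 1) f) {a : ℂ}
    (ha : f a = 0) : ∃ g, IsQP τ N g ∧ ∀ z, f z = th τ 0 (z - a) * g z := by
  have hd : Differentiable ℂ fun z => th τ 0 (z - a) :=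
    (differentiable_th hτ 0).comp (differentiable_id.sub_const a)
  obtain ⟨g, hg, e⟩ := exists_entire_mul h.1 hd (fun x hx => by
      have := h.vanish_add_lat ((th_zero_eq_zero_iff hτ).1 hx) ha
      rwa [add_sub_cancel] at this) (fun x hx => by
      rw [deriv_comp_sub_const]
      exact deriv_th_zero_ne_of_mem hτ ((th_zero_eq_zero_iff hτ).1 hx))
  refine ⟨g, ⟨hg, ?_⟩, e⟩
  obtain ⟨-, c₁, c₂, hc₁, hc₂, h1, h2⟩ := h
  refine ⟨-c₁, -c₂ * exp (Real.pi * I * (τ - 2 * a)), by simpa using hc₁,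
    mul_ne_zero (neg_ne_zero.2 hc₂) (Complex.exp_ne_zero _), fun z => ?_, fun z => ?_⟩
  · refine eq_of_eventuallyEq_nhdsNE (f := fun z => g (z + 1)) (g := fun z => -c₁ * g z)
      (hg.continuous.comp (by fun_prop)).continuousAt
      (hg.continuous.const_mul _ |>.continuousAt) ?_
    filter_upwards [th_zero_sub_ne hτ a z] with w hw
    have := e (w + 1)
    rw [h1, e, show w + 1 - a = w - a + 1 by ring, th_add_one] at this
    simp only [sgn1, Matrix.cons_val] at this
    apply mul_left_cancel₀ hw
    linear_combination this
  · refine eq_of_eventuallyEq_nhdsNE (f := fun z => g (z + τ))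
      (g := fun z => -c₂ * exp (Real.pi * I * (τ - 2 * a)) *
        exp (-(2 * Real.pi * I * N * z)) * g z)
      (hg.continuous.comp (by fun_prop)).continuousAt ?_ ?_
    · exact ((Continuous.mul (by fun_prop) hg.continuous)).continuousAt
    filter_upwards [th_zero_sub_ne hτ a z] with w hw
    have := e (w + τ)
    rw [h2, e, show w + τ - a = w - a + τ by ring, th_add_tau] at this
    simp only [sgnTau, Matrix.cons_val] at this
    have e1 : exp (-(2 * Real.pi * I * ((N + 1 : ℤ) : ℂ) * w)) =
        exp (-(Real.pi * I * (τ + 2 * (w - a)))) * (exp (Real.pi * I * (τ - 2 * a)) *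
        exp (-(2 * Real.pi * I * N * w))) := by
      rw [← Complex.exp_add, ← Complex.exp_add]; congr 1; push_cast; ring
    rw [e1] at this
    apply mul_left_cancel₀ (mul_ne_zero (Complex.exp_ne_zero
      (-(Real.pi * I * (τ + 2 * (w - a))))) hw)
    linear_combination this

/-- A quasi-periodic entire function of degree `N` with more than `N` zeros is zero. -/
theorem IsQP.eq_zero {τ : ℂ} (hτ : 0 < τ.im) (s : Finset ℂ)
    (hs : ∀ a ∈ s, ∀ b ∈ s, a ≠ b → a - b ∉ lat τ) {f : ℂ → ℂ} (h : IsQP τ (s.card - 1) f)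
    (hz : ∀ a ∈ s, f a = 0) : ∀ z, f z = 0 := by
  classical
  -- Each zero is divided out and lowers the degree by one, until degree -1 is reached.
  induction s using Finset.induction_on generalizing f with
  | empty => exact IsQP.eq_zero_of_neg_one hτ (by simpa using h)
  | insert a s has ih =>
    rw [Finset.card_insert_of_notMem has,
      show (((s.card + 1 : ℕ) : ℤ) - 1) = ((s.card : ℤ) - 1) + 1 by push_cast; ring] at h
    obtain ⟨g, hg, e⟩ := h.exists_div hτ (hz a (Finset.mem_insert_self a s))
    have hg0 := ih (fun b hb c hc => hs b (Finset.mem_insert_of_mem hb) c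
      (Finset.mem_insert_of_mem hc)) hg (fun b hb => by
        have hb' := hz b (Finset.mem_insert_of_mem hb)
        rw [e] at hb'
        refine (mul_eq_zero.1 hb').resolve_left fun h0 => ?_
        exact hs b (Finset.mem_insert_of_mem hb) a (Finset.mem_insert_self a s)
          (by rintro rfl; exact has hb) ((th_zero_eq_zero_iff hτ).1 h0))
    intro z
    rw [e, hg0, mul_zero]

/-! ### Addition formulas -/

theorem halfMul_mul_neg (τ z : ℂ) : halfMul τ z * halfMul τ (-z) = halfMul τ 0 ^ 2 := by
  rw [halfMul, halfMul, halfMul, sq, ← Complex.exp_add, ← Complex.exp_add]; congr 1; ring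

theorem halfMul_add_mul_sub (τ x y : ℂ) :
    halfMul τ (x + y) * halfMul τ (x - y) = halfMul τ x ^ 2 := by
  rw [halfMul, halfMul, halfMul, sq, ← Complex.exp_add, ← Complex.exp_add]; congr 1; ring

theorem th_zero_sub_half (τ z : ℂ) : th τ 0 (z - 1 / 2) = -th τ 1 z := by
  rw [← neg_neg (z - 1 / 2), th_zero_neg, show -(z - 1 / 2) = -z + 1 / 2 by ring,
    th_zero_add_half, th_one_neg]

theorem th_zero_sub_half_tau (τ z : ℂ) :
    th τ 0 (z - τ / 2) = -I * halfMul τ (-z) * th τ 3 z := by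
  rw [← neg_neg (z - τ / 2), th_zero_neg, show -(z - τ / 2) = -z + τ / 2 by ring,
    th_zero_add_half_tau, th_three_neg]
  ring

theorem th_zero_add_half_add (τ z : ℂ) :
    th τ 0 (z + 1 / 2 + τ / 2) = halfMul τ z * th τ 2 z := by
  rw [show z + 1 / 2 + τ / 2 = z + τ / 2 + 1 / 2 by ring, th_zero_add_half, th_one_add_half_tau]

theorem th_zero_sub_half_sub (τ z : ℂ) :
    th τ 0 (z - 1 / 2 - τ / 2) = -halfMul τ (-z) * th τ 2 z := by
  rw [← neg_neg (z - 1 / 2 - τ / 2), th_zero_neg,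
    show -(z - 1 / 2 - τ / 2) = -z + 1 / 2 + τ / 2 by ring, th_zero_add_half_add, th_two_neg]
  ring

theorem th_one_add_half_add (τ z : ℂ) :
    th τ 1 (z + 1 / 2 + τ / 2) = -I * halfMul τ z * th τ 3 z := by
  rw [show z + 1 / 2 + τ / 2 = z + τ / 2 + 1 / 2 by ring, th_one_add_half, th_zero_add_half_tau]
  ring

theorem th_two_add_half_add (τ z : ℂ) :
    th τ 2 (z + 1 / 2 + τ / 2) = I * halfMul τ z * th τ 0 z := by
  rw [show z + 1 / 2 + τ / 2 = z + τ / 2 + 1 / 2 by ring, th_two_add_half, th_three_add_half_tau]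

theorem th_three_add_half_add (τ z : ℂ) :
    th τ 3 (z + 1 / 2 + τ / 2) = halfMul τ z * th τ 1 z := by
  rw [show z + 1 / 2 + τ / 2 = z + τ / 2 + 1 / 2 by ring, th_three_add_half, th_two_add_half_tau]

theorem IsCyc.cases {a b c : Fin 4} (h : IsCyc a b c) :
    (a = 1 ∧ b = 2 ∧ c = 3) ∨ (a = 2 ∧ b = 3 ∧ c = 1) ∨ (a = 3 ∧ b = 1 ∧ c = 2) := by
  simpa only [IsCyc, Prod.mk.injEq] using h

/-- The three-term relation at points displaced by quarter periods, chosen so that all sums and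
differences are X, Y or X ± Y up to half periods; these half periods turn θ₁ into the other theta
functions. -/
theorem th_zero_mul_th {τ : ℂ} (hτ : 0 < τ.im) {a b c : Fin 4} (h : IsCyc a b c) (X Y : ℂ) :
    th τ b 0 * th τ c 0 * (th τ 0 (X + Y) * th τ a (X - Y)) =
      th τ 0 X * th τ a X * (th τ b Y * th τ c Y) + th τ b X * th τ c X * (th τ 0 Y * th τ a Y) := by
  have hI := I_sq
  have hX := halfMul_mul_neg τ X
  have hY := halfMul_mul_neg τ Y
  have h0 := halfMul_ne_zero τ 0
  have z3 : th τ 0 (τ / 2) = I * halfMul τ 0 * th τ 3 0 := by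
    rw [← th_zero_add_half_tau, zero_add]
  have z1 : th τ 0 (1 / 2) = th τ 1 0 := by rw [← th_zero_add_half, zero_add]
  have z2 : th τ 0 (1 / 2 + τ / 2) = halfMul τ 0 * th τ 2 0 := by
    rw [← th_zero_add_half_add, zero_add]
  rcases h.cases with ⟨rfl, rfl, rfl⟩ | ⟨rfl, rfl, rfl⟩ | ⟨rfl, rfl, rfl⟩
  · have W := th_three_term hτ (X + 1 / 4) (Y - 1 / 4) (1 / 4 + τ / 2) (1 / 4)
    rw [show X + 1 / 4 + (Y - 1 / 4) = X + Y by ring,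
      show X + 1 / 4 - (Y - 1 / 4) = X - Y + 1 / 2 by ring,
      show (1 / 4 + τ / 2 + 1 / 4 : ℂ) = 1 / 2 + τ / 2 by ring,
      show (1 / 4 + τ / 2 - 1 / 4 : ℂ) = τ / 2 by ring,
      show X + 1 / 4 + (1 / 4 + τ / 2) = X + 1 / 2 + τ / 2 by ring,
      show X + 1 / 4 - (1 / 4 + τ / 2) = X - τ / 2 by ring,
      show Y - 1 / 4 + 1 / 4 = Y by ring, show Y - 1 / 4 - 1 / 4 = Y - 1 / 2 by ring,
      show X + 1 / 4 + 1 / 4 = X + 1 / 2 by ring, show X + 1 / 4 - 1 / 4 = X by ring,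
      show Y - 1 / 4 + (1 / 4 + τ / 2) = Y + τ / 2 by ring,
      show Y - 1 / 4 - (1 / 4 + τ / 2) = Y - 1 / 2 - τ / 2 by ring,
      th_zero_add_half, z2, z3, th_zero_add_half_add, th_zero_sub_half_tau, th_zero_sub_half,
      th_zero_add_half, th_zero_add_half_tau, th_zero_sub_half_sub] at W
    apply mul_left_cancel₀ (mul_ne_zero I_ne_zero (pow_ne_zero 2 h0))
    linear_combination W + (I * (th τ 2 X * th τ 3 X * (th τ 0 Y * th τ 1 Y))) * hX
      + (I * (th τ 0 X * th τ 1 X * (th τ 2 Y * th τ 3 Y))) * hY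
  · have W := th_three_term hτ (X + 1 / 4 + τ / 4) (Y - 1 / 4 - τ / 4) (1 / 4 - τ / 4)
      (1 / 4 + τ / 4)
    rw [show X + 1 / 4 + τ / 4 + (Y - 1 / 4 - τ / 4) = X + Y by ring,
      show X + 1 / 4 + τ / 4 - (Y - 1 / 4 - τ / 4) = X - Y + 1 / 2 + τ / 2 by ring,
      show (1 / 4 - τ / 4 + (1 / 4 + τ / 4) : ℂ) = 1 / 2 by ring,
      show (1 / 4 - τ / 4 - (1 / 4 + τ / 4) : ℂ) = -(τ / 2) by ring,
      show X + 1 / 4 + τ / 4 + (1 / 4 - τ / 4) = X + 1 / 2 by ring,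
      show X + 1 / 4 + τ / 4 - (1 / 4 - τ / 4) = X + τ / 2 by ring,
      show Y - 1 / 4 - τ / 4 + (1 / 4 + τ / 4) = Y by ring,
      show Y - 1 / 4 - τ / 4 - (1 / 4 + τ / 4) = Y - 1 / 2 - τ / 2 by ring,
      show X + 1 / 4 + τ / 4 + (1 / 4 + τ / 4) = X + 1 / 2 + τ / 2 by ring,
      show X + 1 / 4 + τ / 4 - (1 / 4 + τ / 4) = X by ring,
      show Y - 1 / 4 - τ / 4 + (1 / 4 - τ / 4) = Y - τ / 2 by ring,
      show Y - 1 / 4 - τ / 4 - (1 / 4 - τ / 4) = Y - 1 / 2 by ring,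
      th_zero_add_half_add, z1, th_zero_neg, z3, th_zero_add_half, th_zero_add_half_tau,
      th_zero_sub_half_sub, th_zero_add_half_add, th_zero_sub_half_tau, th_zero_sub_half] at W
    have hXY := halfMul_add_mul_sub τ X Y
    have k1 : halfMul τ (X - Y) * halfMul τ 0 = halfMul τ X * halfMul τ (-Y) := by
      rw [halfMul, halfMul, halfMul, halfMul, ← Complex.exp_add, ← Complex.exp_add]
      congr 1; ring
    apply mul_left_cancel₀ (mul_ne_zero I_ne_zero
      (mul_ne_zero (halfMul_ne_zero τ X) (halfMul_ne_zero τ (-Y))))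
    linear_combination -W - (I * th τ 0 (X + Y) * th τ 2 (X - Y) * th τ 1 0 * th τ 3 0) * k1
  · have W := th_three_term hτ (X + τ / 4) (Y - τ / 4) (1 / 2 + τ / 4) (τ / 4)
    rw [show X + τ / 4 + (Y - τ / 4) = X + Y by ring,
      show X + τ / 4 - (Y - τ / 4) = X - Y + τ / 2 by ring,
      show (1 / 2 + τ / 4 + τ / 4 : ℂ) = 1 / 2 + τ / 2 by ring,
      show (1 / 2 + τ / 4 - τ / 4 : ℂ) = 1 / 2 by ring,
      show X + τ / 4 + (1 / 2 + τ / 4) = X + 1 / 2 + τ / 2 by ring,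
      show X + τ / 4 - (1 / 2 + τ / 4) = X - 1 / 2 by ring,
      show Y - τ / 4 + τ / 4 = Y by ring, show Y - τ / 4 - τ / 4 = Y - τ / 2 by ring,
      show X + τ / 4 + τ / 4 = X + τ / 2 by ring, show X + τ / 4 - τ / 4 = X by ring,
      show Y - τ / 4 + (1 / 2 + τ / 4) = Y + 1 / 2 by ring,
      show Y - τ / 4 - (1 / 2 + τ / 4) = Y - 1 / 2 - τ / 2 by ring,
      th_zero_add_half_tau, z2, z1, th_zero_add_half_add, th_zero_sub_half, th_zero_sub_half_tau,
      th_zero_add_half_tau, th_zero_add_half, th_zero_sub_half_sub] at W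
    have k1 : halfMul τ (X - Y) * halfMul τ 0 = halfMul τ X * halfMul τ (-Y) := by
      rw [halfMul, halfMul, halfMul, halfMul, ← Complex.exp_add, ← Complex.exp_add]
      congr 1; ring
    apply mul_left_cancel₀ (mul_ne_zero I_ne_zero
      (mul_ne_zero (halfMul_ne_zero τ X) (halfMul_ne_zero τ (-Y))))
    linear_combination W - (I * th τ 0 (X + Y) * th τ 3 (X - Y) * th τ 1 0 * th τ 2 0) * k1

/-- The sign in the second family of addition formulas. -/
def addSgn (a : Fin 4) : ℂ := if a = 2 then 1 else -1

/-- Follows from `th_zero_mul_th` by adding to X the half period that carries the index 0 to b, and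
then also a to c. -/
theorem th_mul_th {τ : ℂ} (hτ : 0 < τ.im) {a b c : Fin 4} (h : IsCyc a b c) (X Y : ℂ) :
    th τ b 0 * th τ c 0 * (th τ b (X + Y) * th τ c (X - Y)) =
      th τ b X * th τ c X * (th τ b Y * th τ c Y) +
        addSgn a * (th τ 0 X * th τ a X * (th τ 0 Y * th τ a Y)) := by
  have hI := I_sq
  rcases id h.cases with ⟨rfl, rfl, rfl⟩ | ⟨rfl, rfl, rfl⟩ | ⟨rfl, rfl, rfl⟩
  · have F := th_zero_mul_th hτ h (X + 1 / 2 + τ / 2) Y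
    have hXY := halfMul_add_mul_sub τ X Y
    rw [show X + 1 / 2 + τ / 2 + Y = X + Y + 1 / 2 + τ / 2 by ring,
      show X + 1 / 2 + τ / 2 - Y = X - Y + 1 / 2 + τ / 2 by ring, th_zero_add_half_add,
      th_one_add_half_add, th_zero_add_half_add, th_one_add_half_add, th_two_add_half_add,
      th_three_add_half_add] at F
    apply mul_left_cancel₀ (mul_ne_zero I_ne_zero (pow_ne_zero 2 (halfMul_ne_zero τ X)))
    simp only [addSgn, Fin.reduceEq, if_false]
    linear_combination -F - (I * (th τ 2 0 * th τ 3 0 * (th τ 2 (X + Y) * th τ 3 (X - Y)))) * hXY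
  · have F := th_zero_mul_th hτ h (X + τ / 2) Y
    have hXY := halfMul_add_mul_sub τ X Y
    rw [show X + τ / 2 + Y = X + Y + τ / 2 by ring,
      show X + τ / 2 - Y = X - Y + τ / 2 by ring, th_zero_add_half_tau,
      th_two_add_half_tau, th_zero_add_half_tau, th_two_add_half_tau, th_three_add_half_tau,
      th_one_add_half_tau] at F
    apply mul_left_cancel₀ (mul_ne_zero I_ne_zero (pow_ne_zero 2 (halfMul_ne_zero τ X)))
    simp only [addSgn, if_true]
    linear_combination F - (I * (th τ 3 0 * th τ 1 0 * (th τ 3 (X + Y) * th τ 1 (X - Y)))) * hXY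
  · have F := th_zero_mul_th hτ h (X + 1 / 2) Y
    rw [show X + 1 / 2 + Y = X + Y + 1 / 2 by ring,
      show X + 1 / 2 - Y = X - Y + 1 / 2 by ring, th_zero_add_half,
      th_three_add_half, th_zero_add_half, th_three_add_half, th_one_add_half,
      th_two_add_half] at F
    simp only [addSgn, Fin.reduceEq, if_false]
    linear_combination F

/-! ### Non-vanishing -/

theorem two_mul_mem_lat_of_th_eq_zero {τ : ℂ} (hτ : 0 < τ.im) {α : Fin 4} {z : ℂ}
    (h : th τ α z = 0) : 2 * z ∈ lat τ := by
  have dbl : ∀ w ∈ lat τ, 2 * w ∈ lat τ := fun w hw => by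
    rw [two_mul]; exact add_mem hw hw
  have h1 := one_mem_lat τ
  have h2 := tau_mem_lat τ
  fin_cases α
  · exact dbl _ ((th_zero_eq_zero_iff hτ).1 h)
  · have := dbl _ ((th_zero_eq_zero_iff hτ).1 ((th_zero_add_half τ z).trans h))
    rw [show 2 * (z + 1 / 2) = 2 * z + 1 by ring] at this
    simpa using sub_mem this h1
  · have := dbl _ ((th_zero_eq_zero_iff hτ).1
      ((th_zero_add_half_add τ z).trans (by simp at h; simp [h])))
    rw [show 2 * (z + 1 / 2 + τ / 2) = 2 * z + (1 + τ) by ring] at this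
    simpa using sub_mem this (add_mem h1 h2)
  · have := dbl _ ((th_zero_eq_zero_iff hτ).1
      ((th_zero_add_half_tau τ z).trans (by simp at h; simp [h])))
    rw [show 2 * (z + τ / 2) = 2 * z + τ by ring] at this
    simpa using sub_mem this h2

/-- `η` has infinite order modulo the lattice. -/
def IsGen (η τ : ℂ) : Prop := ∀ n : ℤ, n ≠ 0 → (n : ℂ) * η ∉ lat τ

theorem isGen_of_notMem {η τ : ℂ} (hη : ¬ ∃ p q : ℚ, η = p + q * τ) : IsGen η τ := by
  rintro n hn ⟨m, l, h⟩
  refine hη ⟨m / n, l / n, ?_⟩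
  have : (n : ℂ) ≠ 0 := by exact_mod_cast hn
  push_cast
  field_simp
  linear_combination h

section
variable {η τ : ℂ}

theorem IsGen.th_zero_int_ne (hη : IsGen η τ) (hτ : 0 < τ.im) {n : ℤ} (hn : n ≠ 0) :
    th τ 0 (n * η) ≠ 0 :=
  fun h => hη n hn ((th_zero_eq_zero_iff hτ).1 h)

theorem IsGen.th_ne (hη : IsGen η τ) (hτ : 0 < τ.im) (α : Fin 4) : th τ α η ≠ 0 := fun h => by
  have := two_mul_mem_lat_of_th_eq_zero hτ h
  exact hη 2 (by norm_num) (by exact_mod_cast this)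

theorem IsGen.th_zero_two_ne (hη : IsGen η τ) (hτ : 0 < τ.im) : th τ 0 (2 * η) ≠ 0 := by
  exact_mod_cast hη.th_zero_int_ne hτ (n := 2) (by norm_num)

end

theorem half_notMem_lat {τ : ℂ} (hτ : 0 < τ.im) {a b : ℤ} (h : ¬ (Even a ∧ Even b)) :
    (a / 2 + b / 2 * τ : ℂ) ∉ lat τ := by
  rintro ⟨m, l, e⟩
  have him := congrArg Complex.im e
  have e1 : (a / 2 + b / 2 * τ : ℂ) = ((a / 2 : ℝ) : ℂ) + ((b / 2 : ℝ) : ℂ) * τ := by push_cast; ring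
  have e2 : (m + l * τ : ℂ) = ((m : ℝ) : ℂ) + ((l : ℝ) : ℂ) * τ := by push_cast; ring
  rw [e1, e2] at him e
  simp only [Complex.add_im, Complex.ofReal_im, Complex.im_ofReal_mul, zero_add] at him
  have hb := mul_right_cancel₀ hτ.ne' him
  rw [hb] at e
  have ha := add_right_cancel e
  have ha' : (a / 2 : ℝ) = m := by exact_mod_cast ha
  refine h ⟨⟨m, ?_⟩, ⟨l, ?_⟩⟩
  · have : (a : ℝ) = m + m := by linarith
    exact_mod_cast this
  · have : (b : ℝ) = l + l := by linarith
    exact_mod_cast this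

theorem th_at_zero_ne {τ : ℂ} (hτ : 0 < τ.im) {α : Fin 4} (hα : α ≠ 0) : th τ α 0 ≠ 0 := by
  intro h
  fin_cases α
  · exact hα rfl
  · have := (th_zero_eq_zero_iff hτ).1 ((th_zero_add_half τ 0).trans h)
    refine half_notMem_lat hτ (a := 1) (b := 0) (by decide) ?_
    simpa using this
  · have := (th_zero_eq_zero_iff hτ).1
      ((th_zero_add_half_add τ 0).trans (by simp at h; simp [h]))
    refine half_notMem_lat hτ (a := 1) (b := 1) (by decide) ?_
    convert this using 1
    push_cast; ring
  · have := (th_zero_eq_zero_iff hτ).1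
      ((th_zero_add_half_tau τ 0).trans (by simp at h; simp [h]))
    refine half_notMem_lat hτ (a := 0) (b := 1) (by decide) ?_
    convert this using 1
    push_cast; ring

/-! ### The quadratic relations in terms of theta functions -/

/-- The commutator keeps the part of the addition formula that is odd in Y, the anticommutator the
even part, and both depend on X through the same product θ_{b+1}(X) θ_{c+1}(X). The remaining
function of Y is recognised by `th_zero_mul_th` at (Y, η). The factorisation is needed because its
right-hand side vanishes at Y = -η. -/
theorem quad1_factor {η τ : ℂ} (hτ : 0 < τ.im) (hη : IsGen η τ) {a b c : Fin 4}
    (h : IsCyc a b c) (X : ℂ) : ∃ ψ : ℂ, ∀ Y,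
      sqrtEps 0 * th τ 0 η * (sqrtEps a * th τ a η) *
        (th τ 0 (X + Y) * th τ a (X - Y) - th τ a (X + Y) * th τ 0 (X - Y)) -
      I * Jconst η τ a b c * (sqrtEps b * th τ b η * (sqrtEps c * th τ c η)) *
        (th τ b (X + Y) * th τ c (X - Y) + th τ c (X + Y) * th τ b (X - Y)) =
      ψ * (th τ 0 (Y + η) * th τ a (Y - η)) := by
  have hN : th τ b 0 * th τ c 0 ≠ 0 := by
    rcases h.cases with ⟨rfl, rfl, rfl⟩ | ⟨rfl, rfl, rfl⟩ | ⟨rfl, rfl, rfl⟩ <;>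
      exact mul_ne_zero (th_at_zero_ne hτ (by decide)) (th_at_zero_ne hτ (by decide))
  have hb := hη.th_ne hτ b
  have hc := hη.th_ne hτ c
  refine ⟨2 * (sqrtEps a * (th τ b X * th τ c X * (th τ 0 η * th τ a η)) /
    (th τ b η * th τ c η)), fun Y => ?_⟩
  have f1 := th_zero_mul_th hτ h X Y
  have f2 := th_zero_mul_th hτ h X (-Y)
  have g1 := th_mul_th hτ h X Y
  have g2 := th_mul_th hτ h X (-Y)
  have e := th_zero_mul_th hτ h Y η
  have hp : th τ a (-Y) = th τ a Y ∧ th τ b (-Y) = th τ b Y ∧ th τ c (-Y) = th τ c Y := by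
    rcases h.cases with ⟨rfl, rfl, rfl⟩ | ⟨rfl, rfl, rfl⟩ | ⟨rfl, rfl, rfl⟩ <;>
      simp only [th_one_neg, th_two_neg, th_three_neg, and_self]
  have hs : I * eps a * sqrtEps b * sqrtEps c = -sqrtEps a ∧ sqrtEps 0 = 1 := by
    rcases h.cases with ⟨rfl, rfl, rfl⟩ | ⟨rfl, rfl, rfl⟩ | ⟨rfl, rfl, rfl⟩ <;>
      simp [eps, sqrtEps]
  obtain ⟨ha', hb', hc'⟩ := hp
  rw [ha', hb', hc', th_zero_neg, sub_neg_eq_add, ← sub_eq_add_neg] at f2 g2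
  obtain ⟨hs, hs0⟩ := hs
  apply mul_left_cancel₀ hN
  rw [hs0, Jconst]
  field_simp
  linear_combination (th τ 0 η * th τ a η * th τ b η * th τ c η * sqrtEps a) * f1 -
    (th τ 0 η * th τ a η * th τ b η * th τ c η * sqrtEps a) * f2
    - (I * eps a * sqrtEps b * sqrtEps c * th τ 0 η ^ 2 * th τ a η ^ 2) * (g1 + g2)
    - (2 * th τ 0 η ^ 2 * th τ a η ^ 2 * th τ b X * th τ c X * (th τ b Y * th τ c Y)) * hs
    - (2 * (sqrtEps a * (th τ b X * th τ c X * (th τ 0 η * th τ a η)))) * e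

/-- As in `quad1_factor`, but now the common factor is θ₁(X) θ_{a+1}(X): here the anticommutator is
even in Y and the commutator odd, with the roles of the two addition formulas exchanged. -/
theorem quad2_factor {η τ : ℂ} (hτ : 0 < τ.im) {a b c : Fin 4}
    (h : IsCyc a b c) (X : ℂ) : ∃ ψ : ℂ, ∀ Y,
      sqrtEps b * th τ b η * (sqrtEps c * th τ c η) *
        (th τ b (X + Y) * th τ c (X - Y) - th τ c (X + Y) * th τ b (X - Y)) -
      I * (sqrtEps 0 * th τ 0 η * (sqrtEps a * th τ a η)) *
        (th τ 0 (X + Y) * th τ a (X - Y) + th τ a (X + Y) * th τ 0 (X - Y)) =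
      ψ * (th τ 0 (Y + η) * th τ a (Y - η)) := by
  have hN : th τ b 0 * th τ c 0 ≠ 0 := by
    rcases h.cases with ⟨rfl, rfl, rfl⟩ | ⟨rfl, rfl, rfl⟩ | ⟨rfl, rfl, rfl⟩ <;>
      exact mul_ne_zero (th_at_zero_ne hτ (by decide)) (th_at_zero_ne hτ (by decide))
  refine ⟨-2 * I * (sqrtEps a * (th τ 0 X * th τ a X)), fun Y => ?_⟩
  have f1 := th_zero_mul_th hτ h X Y
  have f2 := th_zero_mul_th hτ h X (-Y)
  have g1 := th_mul_th hτ h X Y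
  have g2 := th_mul_th hτ h X (-Y)
  have e := th_zero_mul_th hτ h Y η
  have hp : th τ a (-Y) = th τ a Y ∧ th τ b (-Y) = th τ b Y ∧ th τ c (-Y) = th τ c Y := by
    rcases h.cases with ⟨rfl, rfl, rfl⟩ | ⟨rfl, rfl, rfl⟩ | ⟨rfl, rfl, rfl⟩ <;>
      simp only [th_one_neg, th_two_neg, th_three_neg, and_self]
  have hs : addSgn a * sqrtEps b * sqrtEps c = -I * sqrtEps a ∧ sqrtEps 0 = 1 := by
    rcases h.cases with ⟨rfl, rfl, rfl⟩ | ⟨rfl, rfl, rfl⟩ | ⟨rfl, rfl, rfl⟩ <;>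
      simp [addSgn, sqrtEps]
  obtain ⟨ha', hb', hc'⟩ := hp
  rw [ha', hb', hc', th_zero_neg, sub_neg_eq_add, ← sub_eq_add_neg] at f2 g2
  obtain ⟨hs, hs0⟩ := hs
  apply mul_left_cancel₀ hN
  rw [hs0]
  linear_combination (sqrtEps b * th τ b η * (sqrtEps c * th τ c η)) * (g1 - g2)
    - (I * (th τ 0 η * (sqrtEps a * th τ a η))) * (f1 + f2)
    + (2 * th τ b η * th τ c η * th τ 0 X * th τ a X * (th τ 0 Y * th τ a Y)) * hs
    + (2 * I * (sqrtEps a * (th τ 0 X * th τ a X))) * e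

theorem eventually_ne_of_differentiable {f : ℂ → ℂ} (hf : Differentiable ℂ f) (h : ∃ z, f z ≠ 0)
    (x : ℂ) : ∀ᶠ z in 𝓝[≠] x, f z ≠ 0 := by
  rcases (hf.analyticAt x).eventually_eq_zero_or_eventually_ne_zero with h0 | h0
  · exfalso
    obtain ⟨z, hz⟩ := h
    have han : AnalyticOnNhd ℂ f Set.univ := fun x _ => hf.analyticAt x
    exact hz (han.eqOn_zero_of_preconnected_of_eventuallyEq_zero isPreconnected_univ
      (Set.mem_univ x) h0 (Set.mem_univ z))
  · exact h0

theorem differentiable_th_affine {τ : ℂ} (hτ : 0 < τ.im) (α : Fin 4) (c d : ℂ) :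
    Differentiable ℂ fun z => th τ α (c * z + d) :=
  (differentiable_th hτ α).comp ((differentiable_id.const_mul c).add_const d)

theorem th_zero_affine_ne {τ : ℂ} (hτ : 0 < τ.im) {c : ℂ} (hc : c ≠ 0) (d x : ℂ) :
    ∀ᶠ z in 𝓝[≠] x, th τ 0 (c * z + d) ≠ 0 := by
  refine eventually_ne_of_differentiable (differentiable_th_affine hτ 0 c d) ?_ x
  obtain ⟨z, hz⟩ := exists_th_zero_ne hτ
  exact ⟨(z - d) / c, by rwa [mul_div_cancel₀ _ hc, sub_add_cancel]⟩

theorem th_zero_two_mul_ne {τ : ℂ} (hτ : 0 < τ.im) (x : ℂ) :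
    ∀ᶠ z in 𝓝[≠] x, th τ 0 (2 * z) ≠ 0 := by
  simpa using th_zero_affine_ne hτ (two_ne_zero) 0 x

theorem sgn1_mul_self (α : Fin 4) : sgn1 α * sgn1 α = 1 := by fin_cases α <;> simp [sgn1]

theorem sgnTau_mul_self (α : Fin 4) : sgnTau α * sgnTau α = 1 := by fin_cases α <;> simp [sgnTau]

theorem th_add_two (τ : ℂ) (α : Fin 4) (z : ℂ) : th τ α (z + 2) = th τ α z := by
  rw [show z + 2 = z + 1 + 1 by ring, th_add_one, th_add_one, ← mul_assoc, sgn1_mul_self, one_mul]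

theorem th_add_two_tau (τ : ℂ) (α : Fin 4) (z : ℂ) :
    th τ α (z + 2 * τ) = exp (-(4 * Real.pi * I * (τ + z))) * th τ α z := by
  rw [show z + 2 * τ = z + τ + τ by ring, th_add_tau, th_add_tau]
  have : exp (-(4 * Real.pi * I * (τ + z))) = exp (-(Real.pi * I * (τ + 2 * (z + τ)))) *
      exp (-(Real.pi * I * (τ + 2 * z))) := by
    rw [← Complex.exp_add]; congr 1; ring
  rw [this]
  linear_combination (exp (-(Real.pi * I * (τ + 2 * (z + τ)))) *
      exp (-(Real.pi * I * (τ + 2 * z))) * th τ α z) * sgnTau_mul_self α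

theorem th_zero_add_two_mul_tau_sub (τ : ℂ) (α : Fin 4) (z : ℂ) :
    th τ α (z - 2 * τ) = exp (4 * Real.pi * I * (z - τ)) * th τ α z := by
  have := th_add_two_tau τ α (z - 2 * τ)
  rw [sub_add_cancel] at this
  rw [this, ← mul_assoc, ← Complex.exp_add]
  rw [show 4 * Real.pi * I * (z - τ) + -(4 * Real.pi * I * (τ + (z - 2 * τ))) = 0 by ring,
    Complex.exp_zero, one_mul]

theorem ne_zero_of_im_pos {τ : ℂ} (hτ : 0 < τ.im) : τ ≠ 0 := by
  rintro rfl; simp at hτ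

/-- Odd quasi-periodic functions vanish at the half periods. -/
theorem odd_vanish {τ : ℂ} (hτ : 0 < τ.im) {k : ℕ} {f : ℂ → ℂ} (hodd : ∀ u, f (-u) = -f u)
    (h1 : ∀ u, f (u + 1) = f u)
    (h2 : ∀ u, f (u + τ) = exp (-2 * Real.pi * I * k * (2 * u + τ)) * f u) {u : ℂ}
    (hu : 2 * u ∈ lat τ) : f u = 0 := by
  have hτ0 := ne_zero_of_im_pos hτ
  obtain ⟨m, l, hml⟩ := hu
  set G : ℂ → ℂ := fun u => exp (2 * Real.pi * I * k * (u ^ 2 / τ)) * f u with hG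
  have hper : Function.Periodic G τ := by
    intro u
    simp only [hG]
    rw [h2, ← mul_assoc, ← Complex.exp_add]
    congr 2
    field_simp
    ring
  have hper1 : Function.Periodic f 1 := h1
  -- Since 2u = m + lτ, the point u - lτ is -u + m; oddness and 1-periodicity give -f(u) there,
  -- whereas the τ-periodicity of G gives f(u).
  have e1 : f (u - l * τ) = -f u := by
    rw [← hodd, ← hper1.int_mul m (-u)]
    congr 1
    linear_combination hml
  have e2 := hper.sub_int_mul_eq l (x := u)
  simp only [hG] at e2
  rw [e1] at e2
  have e3 : exp (2 * Real.pi * I * k * ((u - l * τ) ^ 2 / τ)) =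
      exp (2 * Real.pi * I * k * (u ^ 2 / τ)) := by
    refine exp_eq_of_sub (-(k * m * l)) ?_
    push_cast
    field_simp
    linear_combination (-(k * l * τ) : ℂ) * hml
  rw [e3] at e2
  have := mul_left_cancel₀ (Complex.exp_ne_zero _) (e2.trans rfl)
  exact self_eq_neg.1 this.symm

/-! ### The operators of the series -/

/-- The numerator is odd, 1-periodic and has the multiplier belonging to k + 2, so `odd_vanish`
gives zeros at all zeros of θ₁(2u), which are simple. Division by θ₁(2u) brings the multiplier back
to k. -/
theorem exists_seriesOp {η τ : ℂ} (hτ : 0 < τ.im) (hη : IsGen η τ) (k : ℕ) (α : Fin 4)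
    (f : V τ k) : ∃ g : V τ k, ∀ u : ℂ, th τ 0 (2 * η) * th τ 0 (2 * u) * (g : ℂ → ℂ) u =
      sqrtEps α * th τ α η *
        (th τ α (2 * u - k * η) * (f : ℂ → ℂ) (u + η) -
          th τ α (-2 * u - k * η) * (f : ℂ → ℂ) (u - η)) := by
  obtain ⟨f, hf, hf1, hfe, hf2⟩ := f
  have h2η := hη.th_zero_two_ne hτ
  set N : ℂ → ℂ := fun u => th τ α (2 * u - k * η) * f (u + η) -
    th τ α (-2 * u - k * η) * f (u - η) with hN
  have hNd : Differentiable ℂ N := by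
    have a1 := differentiable_th_affine hτ α 2 (-(k * η))
    have a2 := differentiable_th_affine hτ α (-2) (-(k * η))
    simp only [← sub_eq_add_neg] at a1 a2
    exact (a1.mul (hf.comp (differentiable_id.add_const η))).sub
      (a2.mul (hf.comp (differentiable_id.sub_const η)))
  have hNodd : ∀ u, N (-u) = -N u := by
    intro u
    simp only [hN]
    rw [show -u + η = -(u - η) by ring, show -u - η = -(u + η) by ring, hfe, hfe]
    ring_nf
  have hN1 : ∀ u, N (u + 1) = N u := by
    intro u
    simp only [hN]
    rw [show u + 1 + η = u + η + 1 by ring, show u + 1 - η = u - η + 1 by ring, hf1, hf1,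
      show 2 * (u + 1) - k * η = 2 * u - k * η + 2 by ring, th_add_two,
      show -2 * u - k * η = -2 * (u + 1) - k * η + 2 by ring, th_add_two]
  have hN2 : ∀ u, N (u + τ) = exp (-2 * Real.pi * I * (k + 2 : ℕ) * (2 * u + τ)) * N u := by
    intro u
    simp only [hN]
    rw [show u + τ + η = u + η + τ by ring, show u + τ - η = u - η + τ by ring, hf2, hf2,
      show 2 * (u + τ) - k * η = 2 * u - k * η + 2 * τ by ring, th_add_two_tau,
      show -2 * (u + τ) - k * η = -2 * u - k * η - 2 * τ by ring, th_zero_add_two_mul_tau_sub]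
    have e1 : exp (-2 * Real.pi * I * (k + 2 : ℕ) * (2 * u + τ)) =
        exp (-(4 * Real.pi * I * (τ + (2 * u - k * η)))) *
          exp (-2 * Real.pi * I * k * (2 * (u + η) + τ)) := by
      rw [← Complex.exp_add]; congr 1; push_cast; ring
    have e2 : exp (-2 * Real.pi * I * (k + 2 : ℕ) * (2 * u + τ)) =
        exp (4 * Real.pi * I * (-2 * u - k * η - τ)) *
          exp (-2 * Real.pi * I * k * (2 * (u - η) + τ)) := by
      rw [← Complex.exp_add]; congr 1; push_cast; ring
    linear_combination (-th τ α (2 * u - k * η) * f (u + η)) * e1 +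
      (th τ α (-2 * u - k * η) * f (u - η)) * e2
  have hθd : Differentiable ℂ fun u => th τ 0 (2 * u) := by
    simpa using differentiable_th_affine hτ 0 2 0
  obtain ⟨g, hg, e⟩ := exists_entire_mul hNd hθd
    (fun x hx => odd_vanish hτ hNodd hN1 hN2 ((th_zero_eq_zero_iff hτ).1 hx))
    (fun x hx => by
      have : HasDerivAt (fun u => th τ 0 (2 * u)) (deriv (th τ 0) (2 * x) * (2 * 1)) x :=
        (differentiable_th hτ 0 (2 * x)).hasDerivAt.comp x ((hasDerivAt_id x).const_mul 2)
      rw [this.deriv]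
      simpa using deriv_th_zero_ne_of_mem hτ ((th_zero_eq_zero_iff hτ).1 hx))
  set c : ℂ := sqrtEps α * th τ α η / th τ 0 (2 * η) with hc
  have hgm : g ∈ V τ k := by
    refine ⟨hg, fun u => ?_, fun u => ?_, fun u => ?_⟩
    · refine eq_of_eventuallyEq_nhdsNE (f := fun u => g (u + 1))
        (hg.continuous.comp (by fun_prop)).continuousAt hg.continuous.continuousAt ?_
      filter_upwards [th_zero_two_mul_ne hτ u] with w hw
      have := e (w + 1)
      rw [hN1, e, show 2 * (w + 1) = 2 * w + 2 by ring, th_add_two] at this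
      exact (mul_left_cancel₀ hw this).symm
    · refine eq_of_eventuallyEq_nhdsNE (f := fun u => g (-u))
        (hg.continuous.comp (by fun_prop)).continuousAt hg.continuous.continuousAt ?_
      filter_upwards [th_zero_two_mul_ne hτ u] with w hw
      have := e (-w)
      rw [hNodd, e, show 2 * -w = -(2 * w) by ring, th_zero_neg] at this
      apply mul_left_cancel₀ hw
      linear_combination this
    · refine eq_of_eventuallyEq_nhdsNE (f := fun u => g (u + τ))
        (g := fun u => exp (-2 * Real.pi * I * k * (2 * u + τ)) * g u)
        (hg.continuous.comp (by fun_prop)).continuousAt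
        (Continuous.mul (by fun_prop) hg.continuous).continuousAt ?_
      filter_upwards [th_zero_two_mul_ne hτ u] with w hw
      have := e (w + τ)
      rw [hN2, e, show 2 * (w + τ) = 2 * w + 2 * τ by ring, th_add_two_tau,
        show exp (-2 * Real.pi * I * (k + 2 : ℕ) * (2 * w + τ)) =
          exp (-(4 * Real.pi * I * (τ + 2 * w))) * exp (-2 * Real.pi * I * k * (2 * w + τ)) by
        rw [← Complex.exp_add]; congr 1; push_cast; ring] at this
      apply mul_left_cancel₀ (mul_ne_zero (Complex.exp_ne_zero
        (-(4 * Real.pi * I * (τ + 2 * w)))) hw)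
      linear_combination -this
  refine ⟨c • ⟨g, hgm⟩, fun u => ?_⟩
  have eu := e u
  simp only [hN] at eu
  show th τ 0 (2 * η) * th τ 0 (2 * u) * (c * g u) = _
  rw [eu, hc]
  field_simp

/-- The coefficient of the shift operator in the action of the generator `S_α`; the spectral
parameter is `t = (k + 1) η`. -/
def wt (η τ t : ℂ) (α : Fin 4) (u : ℂ) : ℂ :=
  sqrtEps α * th τ α η * th τ α (2 * u - t + η) / (th τ 0 (2 * η) * th τ 0 (2 * u))

theorem V_ext {τ : ℂ} {k : ℕ} {f g : V τ k}
    (h : ∀ x, ∀ᶠ u in 𝓝[≠] x, (f : ℂ → ℂ) u = (g : ℂ → ℂ) u) : f = g := by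
  ext u
  exact eq_of_eventuallyEq_nhdsNE f.2.1.continuous.continuousAt
    g.2.1.continuous.continuousAt (h u)

section
variable {η τ : ℂ} (hτ : 0 < τ.im) (hη : IsGen η τ) (k : ℕ)

/-- The action of a generator. -/
def seriesOp (α : Fin 4) : Module.End ℂ (V τ k) where
  toFun f := Classical.choose (exists_seriesOp hτ hη k α f)
  map_add' f g := by
    refine V_ext fun x => ?_
    filter_upwards [th_zero_two_mul_ne hτ x] with u hu
    have e1 := Classical.choose_spec (exists_seriesOp hτ hη k α f) u
    have e2 := Classical.choose_spec (exists_seriesOp hτ hη k α g) u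
    have e3 := Classical.choose_spec (exists_seriesOp hτ hη k α (f + g)) u
    apply mul_left_cancel₀ (mul_ne_zero (hη.th_zero_two_ne hτ) hu)
    rw [e3]
    simp only [Submodule.coe_add, Pi.add_apply]
    linear_combination -e1 - e2
  map_smul' c f := by
    refine V_ext fun x => ?_
    filter_upwards [th_zero_two_mul_ne hτ x] with u hu
    have e1 := Classical.choose_spec (exists_seriesOp hτ hη k α f) u
    have e3 := Classical.choose_spec (exists_seriesOp hτ hη k α (c • f)) u
    apply mul_left_cancel₀ (mul_ne_zero (hη.th_zero_two_ne hτ) hu)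
    rw [e3]
    simp only [Submodule.coe_smul, Pi.smul_apply, smul_eq_mul, RingHom.id_apply]
    linear_combination -c * e1

theorem seriesOp_spec (α : Fin 4) (f : V τ k) (u : ℂ) :
    th τ 0 (2 * η) * th τ 0 (2 * u) * (seriesOp hτ hη k α f : ℂ → ℂ) u =
      sqrtEps α * th τ α η *
        (th τ α (2 * u - k * η) * (f : ℂ → ℂ) (u + η) -
          th τ α (-2 * u - k * η) * (f : ℂ → ℂ) (u - η)) :=
  Classical.choose_spec (exists_seriesOp hτ hη k α f) u

theorem seriesOp_apply (α : Fin 4) (f : V τ k) {u : ℂ} (hu : th τ 0 (2 * u) ≠ 0) :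
    (seriesOp hτ hη k α f : ℂ → ℂ) u =
      wt η τ ((k + 1) * η) α u * (f : ℂ → ℂ) (u + η) +
        wt η τ ((k + 1) * η) α (-u) * (f : ℂ → ℂ) (u - η) := by
  have h := seriesOp_spec hτ hη k α f u
  have h2 := hη.th_zero_two_ne hτ
  rw [wt, wt, show 2 * -u = -(2 * u) by ring, th_zero_neg,
    show 2 * u - (k + 1) * η + η = 2 * u - k * η by ring,
    show -(2 * u) - (k + 1) * η + η = -2 * u - k * η by ring]
  apply mul_left_cancel₀ (mul_ne_zero h2 hu)
  rw [h]
  field_simp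
  ring

theorem seriesOp_seriesOp_apply (p q : Fin 4) (f : V τ k) (u : ℂ) :
    th τ 0 (2 * η) ^ 2 * th τ 0 (2 * u) * th τ 0 (2 * u + 2 * η) * th τ 0 (2 * u - 2 * η) *
      (seriesOp hτ hη k p (seriesOp hτ hη k q f) : ℂ → ℂ) u =
    sqrtEps p * th τ p η * (sqrtEps q * th τ q η) * (th τ 0 (2 * u - 2 * η) *
      (th τ p (2 * u - k * η) * th τ q (2 * u + 2 * η - k * η) * (f : ℂ → ℂ) (u + η + η) -
       th τ p (2 * u - k * η) * th τ q (-2 * u - 2 * η - k * η) * (f : ℂ → ℂ) u) -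
      th τ 0 (2 * u + 2 * η) *
      (th τ p (-2 * u - k * η) * th τ q (2 * u - 2 * η - k * η) * (f : ℂ → ℂ) u -
       th τ p (-2 * u - k * η) * th τ q (-2 * u + 2 * η - k * η) * (f : ℂ → ℂ) (u - η - η))) := by
  have h := seriesOp_spec hτ hη k p (seriesOp hτ hη k q f) u
  have h1 := seriesOp_spec hτ hη k q f (u + η)
  have h2 := seriesOp_spec hτ hη k q f (u - η)
  rw [add_sub_cancel_right, show 2 * (u + η) = 2 * u + 2 * η by ring,
    show -2 * (u + η) - k * η = -2 * u - 2 * η - k * η by ring] at h1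
  rw [sub_add_cancel, show 2 * (u - η) = 2 * u - 2 * η by ring,
    show -2 * (u - η) - k * η = -2 * u + 2 * η - k * η by ring] at h2
  linear_combination (th τ 0 (2 * η) * th τ 0 (2 * u + 2 * η) * th τ 0 (2 * u - 2 * η)) * h
    + (sqrtEps p * th τ p η * th τ p (2 * u - k * η) * th τ 0 (2 * u - 2 * η)) * h1
    - (sqrtEps p * th τ p η * th τ p (-2 * u - k * η) * th τ 0 (2 * u + 2 * η)) * h2

/-- The representations `π⁽ᵏ⁾` are well defined. -/
theorem seriesOp_rel ⦃x y : FreeAlgebra ℂ (Fin 4)⦄ (h : Rel η τ x y) :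
    FreeAlgebra.lift ℂ (seriesOp hτ hη k) x = FreeAlgebra.lift ℂ (seriesOp hτ hη k) y := by
  have h2η := hη.th_zero_two_ne hτ
  have gen : ∀ x : ℂ, ∀ᶠ u in 𝓝[≠] x, th τ 0 (2 * u) ≠ 0 ∧ th τ 0 (2 * u + 2 * η) ≠ 0 ∧
      th τ 0 (2 * u - 2 * η) ≠ 0 := by
    intro x
    filter_upwards [th_zero_two_mul_ne hτ x, th_zero_affine_ne hτ two_ne_zero (2 * η) x,
      th_zero_affine_ne hτ two_ne_zero (-(2 * η)) x] with u h1 h2 h3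
    exact ⟨h1, h2, by rwa [sub_eq_add_neg]⟩
  have heven : ∀ {a b c}, IsCyc a b c → ∀ z, th τ a (-z) = th τ a z := by
    intro a b c h z
    rcases h.cases with ⟨rfl, rfl, rfl⟩ | ⟨rfl, rfl, rfl⟩ | ⟨rfl, rfl, rfl⟩ <;>
      simp only [th_one_neg, th_two_neg, th_three_neg]
  rcases h with ⟨a, b, c, h⟩ | ⟨a, b, c, h⟩
  · simp only [map_sub, map_add, map_mul, map_smul, FreeAlgebra.lift_ι_apply]
    refine LinearMap.ext fun f => V_ext fun x => ?_
    filter_upwards [gen x] with u ⟨hu, hu1, hu2⟩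
    simp only [LinearMap.sub_apply, LinearMap.add_apply, LinearMap.smul_apply,
      Module.End.mul_apply, Submodule.coe_add, Submodule.coe_smul, Submodule.coe_sub,
      Pi.add_apply, Pi.sub_apply, Pi.smul_apply, smul_eq_mul]
    have E := fun p q => seriesOp_seriesOp_apply hτ hη k p q f u
    apply mul_left_cancel₀ (mul_ne_zero (mul_ne_zero (mul_ne_zero (pow_ne_zero 2 h2η) hu) hu1) hu2)
    -- The coefficients of f(u ± 2η) are defects at Y = -η, where θ₁(Y + η) = 0. The two
    -- contributions to the coefficient of f(u) share X = -η - kη, hence the same factor ψ₃, and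
    -- cancel because θ₁ is odd and θ_{a+1} is even.
    obtain ⟨ψ₁, F1⟩ := quad1_factor hτ hη h (2 * u - k * η + η)
    obtain ⟨ψ₂, F2⟩ := quad1_factor hτ hη h (-2 * u - k * η + η)
    obtain ⟨ψ₃, F3⟩ := quad1_factor hτ hη h (-η - k * η)
    have F1 := F1 (-η)
    have F2 := F2 (-η)
    have F4 := F3 (-2 * u + η)
    have F3 := F3 (2 * u + η)
    rw [neg_add_cancel, th_zero_zero] at F1 F2
    rw [show 2 * u + η + η = 2 * u + 2 * η by ring, add_sub_cancel_right,
      show -η - k * η + (2 * u + η) = 2 * u - k * η by ring,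
      show -η - k * η - (2 * u + η) = -2 * u - 2 * η - k * η by ring] at F3
    rw [show -2 * u + η + η = -(2 * u - 2 * η) by ring, add_sub_cancel_right,
      show -η - k * η + (-2 * u + η) = -2 * u - k * η by ring,
      show -η - k * η - (-2 * u + η) = 2 * u - 2 * η - k * η by ring, th_zero_neg,
      show -2 * u = -(2 * u) by ring, heven h, ← neg_mul] at F4
    rw [show 2 * u - k * η + η + -η = 2 * u - k * η by ring,
      show 2 * u - k * η + η - -η = 2 * u + 2 * η - k * η by ring] at F1
    rw [show -2 * u - k * η + η + -η = -2 * u - k * η by ring,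
      show -2 * u - k * η + η - -η = -2 * u + 2 * η - k * η by ring] at F2
    linear_combination E 0 a - E a 0 - (I * Jconst η τ a b c) * (E b c + E c b)
      + (th τ 0 (2 * u - 2 * η) * (f : ℂ → ℂ) (u + η + η)) * F1
      + (th τ 0 (2 * u + 2 * η) * (f : ℂ → ℂ) (u - η - η)) * F2
      - (th τ 0 (2 * u - 2 * η) * (f : ℂ → ℂ) u) * F3
      - (th τ 0 (2 * u + 2 * η) * (f : ℂ → ℂ) u) * F4
  · simp only [map_sub, map_add, map_mul, map_smul, FreeAlgebra.lift_ι_apply]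
    refine LinearMap.ext fun f => V_ext fun x => ?_
    filter_upwards [gen x] with u ⟨hu, hu1, hu2⟩
    simp only [LinearMap.sub_apply, LinearMap.add_apply, LinearMap.smul_apply,
      Module.End.mul_apply, Submodule.coe_add, Submodule.coe_smul, Submodule.coe_sub,
      Pi.add_apply, Pi.sub_apply, Pi.smul_apply, smul_eq_mul]
    have E := fun p q => seriesOp_seriesOp_apply hτ hη k p q f u
    apply mul_left_cancel₀ (mul_ne_zero (mul_ne_zero (mul_ne_zero (pow_ne_zero 2 h2η) hu) hu1) hu2)
    obtain ⟨ψ₁, F1⟩ := quad2_factor (η := η) hτ h (2 * u - k * η + η)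
    obtain ⟨ψ₂, F2⟩ := quad2_factor (η := η) hτ h (-2 * u - k * η + η)
    obtain ⟨ψ₃, F3⟩ := quad2_factor (η := η) hτ h (-η - k * η)
    have F1 := F1 (-η)
    have F2 := F2 (-η)
    have F4 := F3 (-2 * u + η)
    have F3 := F3 (2 * u + η)
    rw [neg_add_cancel, th_zero_zero] at F1 F2
    rw [show 2 * u + η + η = 2 * u + 2 * η by ring, add_sub_cancel_right,
      show -η - k * η + (2 * u + η) = 2 * u - k * η by ring,
      show -η - k * η - (2 * u + η) = -2 * u - 2 * η - k * η by ring] at F3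
    rw [show -2 * u + η + η = -(2 * u - 2 * η) by ring, add_sub_cancel_right,
      show -η - k * η + (-2 * u + η) = -2 * u - k * η by ring,
      show -η - k * η - (-2 * u + η) = 2 * u - 2 * η - k * η by ring, th_zero_neg,
      show -2 * u = -(2 * u) by ring, heven h, ← neg_mul] at F4
    rw [show 2 * u - k * η + η + -η = 2 * u - k * η by ring,
      show 2 * u - k * η + η - -η = 2 * u + 2 * η - k * η by ring] at F1
    rw [show -2 * u - k * η + η + -η = -2 * u - k * η by ring,
      show -2 * u - k * η + η - -η = -2 * u + 2 * η - k * η by ring] at F2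
    linear_combination E b c - E c b - I * (E 0 a + E a 0)
      + (th τ 0 (2 * u - 2 * η) * (f : ℂ → ℂ) (u + η + η)) * F1
      + (th τ 0 (2 * u + 2 * η) * (f : ℂ → ℂ) (u - η - η)) * F2
      - (th τ 0 (2 * u - 2 * η) * (f : ℂ → ℂ) u) * F3
      - (th τ 0 (2 * u + 2 * η) * (f : ℂ → ℂ) u) * F4

/-- The representation `π⁽ᵏ⁾`. -/
def seriesRep : Alg η τ →ₐ[ℂ] Module.End ℂ (V τ k) :=
  RingQuot.liftAlgHom ℂ ⟨FreeAlgebra.lift ℂ (seriesOp hτ hη k), seriesOp_rel hτ hη k⟩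

theorem seriesRep_S (α : Fin 4) : seriesRep hτ hη k (S η τ α) = seriesOp hτ hη k α := by
  simp [seriesRep, S]

theorem isSeriesA_seriesRep : IsSeriesA η τ k (seriesRep hτ hη k) := by
  intro α f u
  rw [seriesRep_S]
  exact seriesOp_spec hτ hη k α f u

theorem IsSeriesA.eq_seriesRep {η τ : ℂ} (hτ : 0 < τ.im) (hη : IsGen η τ) (k : ℕ) {ρ : Alg η τ →ₐ[ℂ] Module.End ℂ (V τ k)}
    (h : IsSeriesA η τ k ρ) : ρ = seriesRep hτ hη k := by
  refine RingQuot.ringQuot_ext' ℂ _ _ (FreeAlgebra.hom_ext (funext fun α => ?_))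
  show ρ (S η τ α) = seriesRep hτ hη k (S η τ α)
  rw [seriesRep_S]
  refine LinearMap.ext fun f => V_ext fun x => ?_
  filter_upwards [th_zero_two_mul_ne hτ x] with u hu
  apply mul_left_cancel₀ (mul_ne_zero (hη.th_zero_two_ne hτ) hu)
  rw [h α f u, seriesOp_spec]

end

/-! ### Interpolation in `𝒱⁽ᵏ⁾` -/

/-- The elementary even theta function with zeros at `± y`. -/
def dd (τ x y : ℂ) : ℂ := th τ 0 (x + y) * th τ 0 (x - y)

theorem dd_neg (τ x y : ℂ) : dd τ (-x) y = dd τ x y := by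
  rw [dd, dd, show -x + y = -(x - y) by ring, show -x - y = -(x + y) by ring, th_zero_neg,
    th_zero_neg]
  ring

theorem dd_neg_right (τ x y : ℂ) : dd τ x (-y) = dd τ x y := by
  rw [dd, dd, sub_neg_eq_add, ← sub_eq_add_neg, mul_comm]

theorem dd_self (τ x : ℂ) : dd τ x x = 0 := by rw [dd, sub_self, th_zero_zero, mul_zero]

theorem dd_add_one (τ x y : ℂ) : dd τ (x + 1) y = dd τ x y := by
  rw [dd, dd, show x + 1 + y = x + y + 1 by ring, show x + 1 - y = x - y + 1 by ring, th_add_one,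
    th_add_one]
  linear_combination (th τ 0 (x + y) * th τ 0 (x - y)) * sgn1_mul_self 0

theorem dd_add_tau (τ x y : ℂ) :
    dd τ (x + τ) y = exp (-2 * Real.pi * I * (2 * x + τ)) * dd τ x y := by
  rw [dd, dd, show x + τ + y = x + y + τ by ring, show x + τ - y = x - y + τ by ring, th_add_tau,
    th_add_tau]
  have : exp (-2 * Real.pi * I * (2 * x + τ)) = exp (-(Real.pi * I * (τ + 2 * (x + y)))) *
      exp (-(Real.pi * I * (τ + 2 * (x - y)))) := by
    rw [← Complex.exp_add]; congr 1; ring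
  rw [this]
  linear_combination (exp (-(Real.pi * I * (τ + 2 * (x + y)))) *
      exp (-(Real.pi * I * (τ + 2 * (x - y)))) * th τ 0 (x + y) * th τ 0 (x - y)) * sgnTau_mul_self 0

theorem differentiable_dd {τ : ℂ} (hτ : 0 < τ.im) (y : ℂ) : Differentiable ℂ fun x => dd τ x y :=
  ((differentiable_th hτ 0).comp (differentiable_id.add_const y)).mul
    ((differentiable_th hτ 0).comp (differentiable_id.sub_const y))

theorem V_isQP {τ : ℂ} {k : ℕ} (f : V τ k) : IsQP τ (2 * k) f := by
  obtain ⟨f, hf, h1, he, h2⟩ := f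
  refine ⟨hf, 1, exp (-2 * Real.pi * I * k * τ), by simp, Complex.exp_ne_zero _, by simpa using h1,
    fun z => ?_⟩
  show f (z + τ) = _ * f z
  rw [h2, ← Complex.exp_add]
  congr 2; push_cast; ring

section
variable {ι : Type*} [Fintype ι] [DecidableEq ι]

/-- The Lagrange interpolation functions. -/
def lagr (τ : ℂ) (u : ι → ℂ) (j : ι) (y : ℂ) : ℂ :=
  ∏ i ∈ Finset.univ.erase j, dd τ y (u i) / dd τ (u j) (u i)

variable {τ : ℂ} (hτ : 0 < τ.im) {k : ℕ} {u : ι → ℂ}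

include hτ in
theorem lagr_mem (hc : Fintype.card ι = k + 1) (j : ι) : lagr τ u j ∈ V τ k := by
  have hcard : (Finset.univ.erase j).card = k := by
    rw [Finset.card_erase_of_mem (Finset.mem_univ j), Finset.card_univ, hc]; rfl
  refine ⟨?_, fun x => ?_, fun x => ?_, fun x => ?_⟩
  · unfold lagr
    exact Differentiable.fun_finsetProd fun i _ => (differentiable_dd hτ (u i)).div_const _
  · exact Finset.prod_congr rfl fun i _ => by rw [dd_add_one]
  · exact Finset.prod_congr rfl fun i _ => by rw [dd_neg]
  · simp only [lagr, dd_add_tau, mul_div_assoc]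
    rw [Finset.prod_mul_distrib, Finset.prod_const, hcard, ← Complex.exp_nat_mul]
    congr 2; ring

theorem lagr_ne {i j : ι} (h : i ≠ j) : lagr τ u j (u i) = 0 :=
  Finset.prod_eq_zero (Finset.mem_erase.2 ⟨h, Finset.mem_univ i⟩) (by rw [dd_self, zero_div])

theorem lagr_self (h1 : ∀ i j, i ≠ j → th τ 0 (u i - u j) ≠ 0)
    (h2 : ∀ i j, th τ 0 (u i + u j) ≠ 0) (j : ι) : lagr τ u j (u j) = 1 :=
  Finset.prod_eq_one fun i hi => div_self (mul_ne_zero (h2 j i)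
    (h1 j i (Finset.ne_of_mem_erase hi).symm))

-- An even f also vanishes at the points -u i. One reflected point is left out, so that 2k + 1
-- incongruent zeros remain, one more than the degree 2k allows.
include hτ in
theorem V_eq_zero_of_vanish (hc : Fintype.card ι = k + 1)
    (h1 : ∀ i j, i ≠ j → th τ 0 (u i - u j) ≠ 0)
    (h2 : ∀ i j, th τ 0 (u i + u j) ≠ 0) (f : V τ k) (hf : ∀ i, (f : ℂ → ℂ) (u i) = 0) :
    f = 0 := by
  have hk : 0 < Fintype.card ι := by omega
  obtain ⟨i₀⟩ := Fintype.card_pos_iff.1 hk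
  set w : ι ⊕ {i // i ≠ i₀} → ℂ := Sum.elim u (fun i => -u i) with hw
  have hwz : ∀ a b, a ≠ b → w a - w b ∉ lat τ := by
    intro a b hab hm
    have h0 := th_zero_eq_zero_of_mem hm
    rcases a with a | a <;> rcases b with b | b <;> simp only [hw, Sum.elim_inl, Sum.elim_inr] at h0
    · exact h1 a b (by rintro rfl; exact hab rfl) h0
    · rw [sub_neg_eq_add] at h0; exact h2 _ _ h0
    · rw [show -u a - u b = -(u a + u b) by ring, th_zero_neg, neg_eq_zero] at h0
      exact h2 _ _ h0
    · rw [show -u a - -u b = u b - u a by ring] at h0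
      exact h1 b a (by intro e; exact hab (by rw [Subtype.ext e])) h0
  have hinj : Function.Injective w := by
    intro a b hab
    by_contra hne
    exact hwz a b hne (by rw [hab, sub_self]; exact zero_mem _)
  have hcard : (Finset.univ.image w).card = 2 * k + 1 := by
    rw [Finset.card_image_of_injective _ hinj, Finset.card_univ, Fintype.card_sum,
      Fintype.card_subtype_compl, Fintype.card_subtype_eq, hc]
    omega
  have := IsQP.eq_zero hτ (Finset.univ.image w) (by
      intro a ha b hb hab
      obtain ⟨i, -, rfl⟩ := Finset.mem_image.1 ha
      obtain ⟨j, -, rfl⟩ := Finset.mem_image.1 hb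
      exact hwz i j (by rintro rfl; exact hab rfl)) (f := f) (by
      rw [hcard]; have := V_isQP f; push_cast; simpa using this) (by
      intro a ha
      obtain ⟨i, -, rfl⟩ := Finset.mem_image.1 ha
      rcases i with i | i
      · exact hf i
      · show (f : ℂ → ℂ) (-u i) = 0
        rw [f.2.2.2.1]; exact hf i)
  ext z
  exact this z

/-- The trace of an operator on `𝒱⁽ᵏ⁾` by interpolation. -/
theorem trace_eq_sum_lagr (hc : Fintype.card ι = k + 1)
    (h1 : ∀ i j, i ≠ j → th τ 0 (u i - u j) ≠ 0)
    (h2 : ∀ i j, th τ 0 (u i + u j) ≠ 0) (T : Module.End ℂ (V τ k)) :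
    LinearMap.trace ℂ (V τ k) T = ∑ j, (T ⟨lagr τ u j, lagr_mem hτ hc j⟩ : ℂ → ℂ) (u j) := by
  have hsum : ∀ (c : ι → ℂ) (i : ι),
      ((∑ j, c j • (⟨lagr τ u j, lagr_mem hτ hc j⟩ : V τ k) : V τ k) : ℂ → ℂ) (u i) = c i := by
    intro c i
    rw [Submodule.coe_sum, Finset.sum_apply, Finset.sum_eq_single i]
    · simp [lagr_self h1 h2]
    · intro j _ hj
      simp [lagr_ne hj.symm]
    · simp
  -- Evaluation at the nodes identifies `V τ k` with `ι → ℂ`, and the Lagrange functions with the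
  -- standard basis; the diagonal matrix entries are then values at the nodes.
  let e : V τ k ≃ₗ[ℂ] (ι → ℂ) :=
    { toFun := fun f i => (f : ℂ → ℂ) (u i)
      map_add' := fun f g => rfl
      map_smul' := fun c f => rfl
      invFun := fun c => ∑ j, c j • ⟨lagr τ u j, lagr_mem hτ hc j⟩
      left_inv := by
        intro f
        rw [← sub_eq_zero]
        refine V_eq_zero_of_vanish hτ hc h1 h2 _ fun i => ?_
        rw [Submodule.coe_sub, Pi.sub_apply, hsum, sub_self]
      right_inv := fun c => funext fun i => hsum c i }
  have hb : ∀ j, Module.Basis.ofEquivFun e j = ⟨lagr τ u j, lagr_mem hτ hc j⟩ := by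
    intro j
    rw [Module.Basis.coe_ofEquivFun]
    show ∑ i, (Pi.single j (1 : ℂ) : ι → ℂ) i • (⟨lagr τ u i, lagr_mem hτ hc i⟩ : V τ k) = _
    simp [Pi.single_apply]
  rw [LinearMap.trace_eq_matrix_trace ℂ (Module.Basis.ofEquivFun e), Matrix.trace]
  refine Finset.sum_congr rfl fun j _ => ?_
  rw [Matrix.diag_apply, LinearMap.toMatrix_apply, hb]
  simp [Module.Basis.ofEquivFun, e]

end

/-! ### Words in the generators as difference operators -/

/-- The coefficient of the shift by `m η` in the difference operator given by a word. -/
def coef (η τ t : ℂ) : List (Fin 4) → ℤ → ℂ → ℂ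
  | [], m, _ => if m = 0 then 1 else 0
  | α :: L, m, u => wt η τ t α u * coef η τ t L (m - 1) (u + η) +
      wt η τ t α (-u) * coef η τ t L (m + 1) (u - η)

theorem coef_nil (η τ t : ℂ) (m : ℤ) (u : ℂ) :
    coef η τ t [] m u = if m = 0 then 1 else 0 := rfl

theorem coef_cons (η τ t : ℂ) (α : Fin 4) (L : List (Fin 4)) (m : ℤ) (u : ℂ) :
    coef η τ t (α :: L) m u = wt η τ t α u * coef η τ t L (m - 1) (u + η) +
      wt η τ t α (-u) * coef η τ t L (m + 1) (u - η) := rfl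

theorem coef_eq_zero_of_lt (η τ t : ℂ) {L : List (Fin 4)} {m : ℤ} (h : (L.length : ℤ) < |m|)
    (u : ℂ) : coef η τ t L m u = 0 := by
  induction L generalizing m u with
  | nil =>
    rw [coef_nil, if_neg]
    rintro rfl; simp at h
  | cons α L ih =>
    rw [List.length_cons] at h
    push_cast at h
    rw [coef_cons, ih (by grind), ih (by grind), mul_zero, mul_zero, add_zero]

/-- Every letter changes the shift by ±1, so its parity is that of the length. -/
theorem coef_eq_zero_of_odd (η τ t : ℂ) {L : List (Fin 4)} {m : ℤ} (h : Odd (m + L.length))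
    (u : ℂ) : coef η τ t L m u = 0 := by
  induction L generalizing m u with
  | nil =>
    rw [coef_nil, if_neg]
    rintro rfl; simp at h
  | cons α L ih =>
    rw [List.length_cons] at h
    push_cast at h
    rw [coef_cons, ih (by grind), ih (by grind), mul_zero, mul_zero, add_zero]

theorem coef_neg (η τ t : ℂ) (L : List (Fin 4)) (m : ℤ) (u : ℂ) :
    coef η τ t L (-m) (-u) = coef η τ t L m u := by
  induction L generalizing m u with
  | nil => simp [coef_nil]
  | cons α L ih =>
    rw [coef_cons, coef_cons, neg_neg, show -m - 1 = -(m + 1) by ring,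
      show -m + 1 = -(m - 1) by ring, show -u + η = -(u - η) by ring,
      show -u - η = -(u + η) by ring, ih, ih, add_comm]

/-- The difference operator given by a word. -/
def wordOp (η τ t : ℂ) (L : List (Fin 4)) (f : ℂ → ℂ) (u : ℂ) : ℂ :=
  ∑ᶠ m : ℤ, coef η τ t L m u * f (u + m * η)

theorem coef_support_finite (η τ t : ℂ) (L : List (Fin 4)) (u : ℂ) (f : ℤ → ℂ) :
    (Function.support fun m => coef η τ t L m u * f m).Finite := by
  refine (Set.finite_Icc (-(L.length : ℤ)) L.length).subset fun m hm => ?_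
  by_contra h
  refine hm ?_
  rw [Set.mem_Icc, ← abs_le, not_le] at h
  simp only [coef_eq_zero_of_lt _ _ _ h, zero_mul]

theorem wordOp_nil (η τ t : ℂ) (f : ℂ → ℂ) (u : ℂ) : wordOp η τ t [] f u = f u := by
  rw [wordOp, finsum_eq_single _ (0 : ℤ)]
  · simp [coef_nil]
  · intro m hm; simp [coef_nil, hm]

theorem wordOp_cons (η τ t : ℂ) (α : Fin 4) (L : List (Fin 4)) (f : ℂ → ℂ) (u : ℂ) :
    wordOp η τ t (α :: L) f u = wt η τ t α u * wordOp η τ t L f (u + η) +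
      wt η τ t α (-u) * wordOp η τ t L f (u - η) := by
  have e1 : wordOp η τ t L f (u + η) =
      ∑ᶠ m : ℤ, coef η τ t L (m - 1) (u + η) * f (u + m * η) := by
    rw [wordOp, ← finsum_comp_equiv (Equiv.subRight (1 : ℤ))]
    refine finsum_congr fun m => ?_
    rw [Equiv.subRight_apply]
    congr 2
    push_cast; ring
  have e2 : wordOp η τ t L f (u - η) =
      ∑ᶠ m : ℤ, coef η τ t L (m + 1) (u - η) * f (u + m * η) := by
    rw [wordOp, ← finsum_comp_equiv (Equiv.addRight (1 : ℤ))]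
    refine finsum_congr fun m => ?_
    rw [Equiv.coe_addRight]
    congr 2
    push_cast; ring
  have f1 : (Function.support fun m : ℤ =>
      coef η τ t L (m - 1) (u + η) * f (u + m * η)).Finite := by
    have := (coef_support_finite η τ t L (u + η) (fun m => f (u + (m + 1 : ℤ) * η))).preimage
      (f := fun m : ℤ => m - 1) (sub_left_injective.injOn)
    refine this.subset fun m hm => ?_
    simpa using hm
  have f2 : (Function.support fun m : ℤ =>
      coef η τ t L (m + 1) (u - η) * f (u + m * η)).Finite := by
    have := (coef_support_finite η τ t L (u - η) (fun m => f (u + (m - 1 : ℤ) * η))).preimage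
      (f := fun m : ℤ => m + 1) ((add_left_injective _).injOn)
    refine this.subset fun m hm => ?_
    simpa using hm
  rw [e1, e2, mul_finsum, mul_finsum, ← finsum_add_distrib
    (f1.subset fun m hm h => hm (by simp only at h ⊢; rw [h, mul_zero]))
    (f2.subset fun m hm h => hm (by simp only at h ⊢; rw [h, mul_zero]))]
  refine finsum_congr fun m => ?_
  rw [coef_cons]; ring

theorem wordOp_eq_sum (η τ t : ℂ) (L : List (Fin 4)) (f : ℂ → ℂ) (u : ℂ) :
    wordOp η τ t L f u =
      ∑ m ∈ Finset.Icc (-(L.length : ℤ)) L.length, coef η τ t L m u * f (u + m * η) := by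
  refine finsum_eq_sum_of_support_subset _ fun m hm => ?_
  by_contra h
  refine hm ?_
  rw [Finset.coe_Icc, Set.mem_Icc, ← abs_le, not_le] at h
  simp only [coef_eq_zero_of_lt _ _ _ h, zero_mul]

/-- A word in the generators. -/
def word (η τ : ℂ) (L : List (Fin 4)) : Alg η τ := (L.map (S η τ)).prod

theorem word_nil (η τ : ℂ) : word η τ [] = 1 := rfl

theorem word_cons (η τ : ℂ) (α : Fin 4) (L : List (Fin 4)) :
    word η τ (α :: L) = S η τ α * word η τ L := by simp [word]

/-- The hypothesis keeps the denominators of the weights nonzero along the orbit u + ℤη, so that the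
division-free identities for the generators can be solved for the values. -/
theorem seriesRep_word_apply {η τ : ℂ} (hτ : 0 < τ.im) (hη : IsGen η τ) (k : ℕ)
    (L : List (Fin 4)) (f : V τ k) {u : ℂ} (hu : ∀ j : ℤ, th τ 0 (2 * u + 2 * j * η) ≠ 0) :
    (seriesRep hτ hη k (word η τ L) f : ℂ → ℂ) u = wordOp η τ ((k + 1) * η) L f u := by
  induction L generalizing u with
  | nil => simp [word_nil, wordOp_nil]
  | cons α L ih =>
    have h0 : th τ 0 (2 * u) ≠ 0 := by simpa using hu 0
    rw [word_cons, map_mul, Module.End.mul_apply, seriesRep_S, seriesOp_apply hτ hη k α _ h0,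
      ih (u := u + η), ih (u := u - η), wordOp_cons]
    · intro j
      have := hu (j - 1)
      push_cast at this
      rwa [show 2 * (u - η) + 2 * j * η = 2 * u + 2 * (j - 1) * η by ring]
    · intro j
      have := hu (j + 1)
      push_cast at this
      rwa [show 2 * (u + η) + 2 * j * η = 2 * u + 2 * (j + 1) * η by ring]

/-! ### Change of parameters -/

/-- The factors exp(Γ(u ± η) - Γ(u)) form a coboundary: along any path of steps ±η from u to u + mη
they multiply to a quantity depending only on the end points. All transformation rules of `coef`
below are instances, with different Γ. -/
theorem coef_gauge {η τ t t' a : ℂ} (σ : Fin 4 → Fin 4) (κ : Fin 4 → ℂ) (Γ : ℂ → ℂ)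
    (hp : ∀ α u, wt η τ t' (σ α) (u + a) = κ α * exp (Γ (u + η) - Γ u) * wt η τ t α u)
    (hq : ∀ α u, wt η τ t' (σ α) (-(u + a)) = κ α * exp (Γ (u - η) - Γ u) * wt η τ t α (-u))
    (L : List (Fin 4)) (m : ℤ) (u : ℂ) :
    coef η τ t' (L.map σ) m (u + a) =
      (L.map κ).prod * exp (Γ (u + m * η) - Γ u) * coef η τ t L m u := by
  induction L generalizing m u with
  | nil =>
    by_cases h : m = 0 <;> simp [coef_nil, h]
  | cons α L ih =>
    rw [List.map_cons, List.map_cons, List.prod_cons, coef_cons, coef_cons, hp, hq,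
      show u + a + η = u + η + a by ring, show u + a - η = u - η + a by ring, ih, ih]
    have e1 : exp (Γ (u + m * η) - Γ u) =
        exp (Γ (u + η) - Γ u) * exp (Γ (u + η + ((m - 1 : ℤ) : ℂ) * η) - Γ (u + η)) := by
      rw [← Complex.exp_add]; push_cast
      rw [show u + η + (m - 1) * η = u + m * η by ring]; congr 1; ring
    have e2 : exp (Γ (u + m * η) - Γ u) =
        exp (Γ (u - η) - Γ u) * exp (Γ (u - η + ((m + 1 : ℤ) : ℂ) * η) - Γ (u - η)) := by
      rw [← Complex.exp_add]; push_cast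
      rw [show u - η + (m + 1) * η = u + m * η by ring]; congr 1; ring
    rw [mul_add]
    congr 1
    · rw [e1]; ring
    · rw [e2]; ring

theorem coef_gauge_id {η τ t t' a : ℂ} (κ : Fin 4 → ℂ) (Γ : ℂ → ℂ)
    (hp : ∀ α u, wt η τ t' α (u + a) = κ α * exp (Γ (u + η) - Γ u) * wt η τ t α u)
    (hq : ∀ α u, wt η τ t' α (-(u + a)) = κ α * exp (Γ (u - η) - Γ u) * wt η τ t α (-u))
    (L : List (Fin 4)) (m : ℤ) (u : ℂ) :
    coef η τ t' L m (u + a) =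
      (L.map κ).prod * exp (Γ (u + m * η) - Γ u) * coef η τ t L m u := by
  simpa using coef_gauge id κ Γ hp hq L m u

theorem sgn1_zero : sgn1 0 = -1 := rfl
theorem sgnTau_zero : sgnTau 0 = -1 := rfl

theorem th_sub_one (τ : ℂ) (α : Fin 4) (z : ℂ) : th τ α (z - 1) = sgn1 α * th τ α z := by
  have := th_add_one τ α (z - 1)
  rw [sub_add_cancel] at this
  rw [this, ← mul_assoc, sgn1_mul_self, one_mul]

theorem th_sub_tau (τ : ℂ) (α : Fin 4) (z : ℂ) :
    th τ α (z - τ) = sgnTau α * exp (Real.pi * I * (2 * z - τ)) * th τ α z := by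
  have := th_add_tau τ α (z - τ)
  rw [sub_add_cancel] at this
  rw [this]
  have e : exp (Real.pi * I * (2 * z - τ)) * exp (-(Real.pi * I * (τ + 2 * (z - τ)))) = 1 := by
    rw [← Complex.exp_add, ← Complex.exp_zero]; congr 1; ring
  linear_combination (-th τ α (z - τ)) * sgnTau_mul_self α -
    (sgnTau α * sgnTau α * th τ α (z - τ)) * e

theorem coef_t_add_one (η τ t : ℂ) (L : List (Fin 4)) (m : ℤ) (u : ℂ) :
    coef η τ (t + 1) L m u = (L.map sgn1).prod * coef η τ t L m u := by
  have := coef_gauge_id (η := η) (τ := τ) (t := t) (t' := t + 1) (a := 0) sgn1 (fun _ => 0) ?_ ?_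
    L m u
  · simpa using this
  · intro α u
    rw [wt, wt, add_zero, show 2 * u - (t + 1) + η = 2 * u - t + η - 1 by ring, th_sub_one, sub_self,
      Complex.exp_zero]
    ring
  · intro α u
    rw [wt, wt, add_zero, show 2 * -u - (t + 1) + η = 2 * -u - t + η - 1 by ring, th_sub_one,
      sub_self, Complex.exp_zero]
    ring

theorem prod_map_mul_const (f : Fin 4 → ℂ) (c : ℂ) (L : List (Fin 4)) :
    (L.map fun α => f α * c).prod = (L.map f).prod * c ^ L.length := by
  induction L with
  | nil => simp
  | cons α L ih => simp [ih, pow_succ]; ring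

/-- The multiplier of θ(2u - t + η) is the exponential of a linear function of u. It becomes a
coboundary for a quadratic Γ, because (u + η)² - u² is linear in u. -/
theorem coef_t_add_tau {η : ℂ} (hη : η ≠ 0) (τ t : ℂ) (L : List (Fin 4)) (m : ℤ) (u : ℂ) :
    coef η τ (t + τ) L m u = (L.map sgnTau).prod * exp (-(Real.pi * I * (τ + 2 * t))) ^ L.length *
      exp (2 * Real.pi * I * (2 * u * m + m ^ 2 * η)) * coef η τ t L m u := by
  have := coef_gauge_id (η := η) (τ := τ) (t := t) (t' := t + τ) (a := 0)
    (fun α => sgnTau α * exp (-(Real.pi * I * (τ + 2 * t))))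
    (fun u => 2 * Real.pi * I / η * u ^ 2) ?_ ?_ L m u
  · rw [add_zero, prod_map_mul_const] at this
    rw [this]
    congr 3
    field_simp
    ring
  · intro α u
    rw [wt, wt, add_zero, show 2 * u - (t + τ) + η = 2 * u - t + η - τ by ring, th_sub_tau]
    have : exp (Real.pi * I * (2 * (2 * u - t + η) - τ)) = exp (-(Real.pi * I * (τ + 2 * t))) *
        exp (2 * Real.pi * I / η * (u + η) ^ 2 - 2 * Real.pi * I / η * u ^ 2) := by
      rw [← Complex.exp_add]; congr 1; field_simp; ring
    rw [this]; ring
  · intro α u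
    rw [wt, wt, add_zero, show 2 * -u - (t + τ) + η = 2 * -u - t + η - τ by ring, th_sub_tau]
    have : exp (Real.pi * I * (2 * (2 * -u - t + η) - τ)) = exp (-(Real.pi * I * (τ + 2 * t))) *
        exp (2 * Real.pi * I / η * (u - η) ^ 2 - 2 * Real.pi * I / η * u ^ 2) := by
      rw [← Complex.exp_add]; congr 1; field_simp; ring
    rw [this]; ring

/-- The characters of the half period shifts. -/
def char1 (L : List (Fin 4)) : ℂ := (L.map fun α => sgn1 α * -1).prod
/-- The characters of the half period shifts. -/
def charTau (L : List (Fin 4)) : ℂ := (L.map fun α => sgnTau α * -1).prod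

theorem coef_add_half (η τ t : ℂ) (L : List (Fin 4)) (m : ℤ) (u : ℂ) :
    coef η τ t L m (u + 1 / 2) = char1 L * coef η τ t L m u := by
  have := coef_gauge_id (η := η) (τ := τ) (t := t) (t' := t) (a := 1 / 2)
    (fun α => sgn1 α * -1) (fun _ => 0) ?_ ?_ L m u
  · simpa [char1] using this
  · intro α u
    rw [wt, wt, show 2 * (u + 1 / 2) - t + η = 2 * u - t + η + 1 by ring, th_add_one, sub_self,
      Complex.exp_zero, show 2 * (u + 1 / 2) = 2 * u + 1 by ring, th_add_one, sgn1_zero]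
    field_simp
  · intro α u
    rw [wt, wt, show 2 * -(u + 1 / 2) - t + η = 2 * -u - t + η - 1 by ring, th_sub_one, sub_self,
      Complex.exp_zero, show 2 * -(u + 1 / 2) = 2 * -u - 1 by ring, th_sub_one, sgn1_zero]
    field_simp

/-- Numerator and denominator of the weight both move by τ, so the u-dependence of their multipliers
cancels; what remains is constant in u and comes from a linear Γ. -/
theorem coef_add_half_tau {η : ℂ} (hη : η ≠ 0) (τ t : ℂ) (L : List (Fin 4)) (m : ℤ) (u : ℂ) :
    coef η τ t L m (u + τ / 2) =
      charTau L * exp (2 * Real.pi * I * (m * (t - η))) * coef η τ t L m u := by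
  have := coef_gauge_id (η := η) (τ := τ) (t := t) (t' := t) (a := τ / 2)
    (fun α => sgnTau α * -1) (fun u => 2 * Real.pi * I * (t - η) / η * u) ?_ ?_ L m u
  · rw [this, charTau]
    congr 3
    field_simp
    ring
  · intro α u
    rw [wt, wt, show 2 * (u + τ / 2) - t + η = 2 * u - t + η + τ by ring, th_add_tau,
      show 2 * (u + τ / 2) = 2 * u + τ by ring, th_add_tau, sgnTau_zero]
    have : exp (-(Real.pi * I * (τ + 2 * (2 * u - t + η)))) =
        exp (-(Real.pi * I * (τ + 2 * (2 * u)))) *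
        exp (2 * Real.pi * I * (t - η) / η * (u + η) - 2 * Real.pi * I * (t - η) / η * u) := by
      rw [← Complex.exp_add]; congr 1; field_simp; ring
    rw [this]
    have := Complex.exp_ne_zero (-(Real.pi * I * (τ + 2 * (2 * u))))
    field_simp
  · intro α u
    rw [wt, wt, show 2 * -(u + τ / 2) - t + η = 2 * -u - t + η - τ by ring, th_sub_tau,
      show 2 * -(u + τ / 2) = 2 * -u - τ by ring, th_sub_tau, sgnTau_zero]
    have : exp (Real.pi * I * (2 * (2 * -u - t + η) - τ)) =
        exp (Real.pi * I * (2 * (2 * -u) - τ)) *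
        exp (2 * Real.pi * I * (t - η) / η * (u - η) - 2 * Real.pi * I * (t - η) / η * u) := by
      rw [← Complex.exp_add]; congr 1; field_simp; ring
    rw [this]
    have := Complex.exp_ne_zero (Real.pi * I * (2 * (2 * -u) - τ))
    field_simp

/-- A word whose two characters are trivial. -/
def IsTriv (L : List (Fin 4)) : Prop := char1 L = 1 ∧ charTau L = 1

theorem char1_eq (L : List (Fin 4)) : char1 L = (L.map sgn1).prod * (-1) ^ L.length :=
  prod_map_mul_const _ _ _

theorem charTau_eq (L : List (Fin 4)) : charTau L = (L.map sgnTau).prod * (-1) ^ L.length :=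
  prod_map_mul_const _ _ _

theorem IsTriv.prod_sgn1 {L : List (Fin 4)} (h : IsTriv L) :
    (L.map sgn1).prod = (-1) ^ L.length := by
  have := h.1
  rw [char1_eq] at this
  have h2 : ((-1 : ℂ) ^ L.length) * (-1) ^ L.length = 1 := by
    rw [← mul_pow]; simp
  linear_combination (-1 : ℂ) ^ L.length * this - (L.map sgn1).prod * h2

theorem IsTriv.prod_sgnTau {L : List (Fin 4)} (h : IsTriv L) :
    (L.map sgnTau).prod = (-1) ^ L.length := by
  have := h.2
  rw [charTau_eq] at this
  have h2 : ((-1 : ℂ) ^ L.length) * (-1) ^ L.length = 1 := by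
    rw [← mul_pow]; simp
  linear_combination (-1 : ℂ) ^ L.length * this - (L.map sgnTau).prod * h2

/-! ### Compatibility of the coefficients with ι¹ and ι³ -/

/-- The permutations of the generators underlying `ι¹` and `ι³`. -/
def perm1 : Fin 4 → Fin 4 := ![1, 0, 3, 2]
/-- The permutations of the generators underlying `ι¹` and `ι³`. -/
def perm3 : Fin 4 → Fin 4 := ![3, 2, 1, 0]

/-- The scalars in the definition of `ι¹`. -/
def scal1 (η τ : ℂ) : Fin 4 → ℂ :=
  ![-(th τ 0 η / th τ 1 η), th τ 1 η / th τ 0 η, I * (th τ 2 η / th τ 3 η),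
    -I * (th τ 3 η / th τ 2 η)]

/-- The scalars in the definition of `ι³`. -/
def scal3 (η τ : ℂ) : Fin 4 → ℂ :=
  ![th τ 0 η / th τ 3 η, th τ 1 η / th τ 2 η, -(th τ 2 η / th τ 1 η), th τ 3 η / th τ 0 η]

theorem iota1Gen_eq (η τ : ℂ) (α : Fin 4) :
    iota1Gen η τ α = scal1 η τ α • S η τ (perm1 α) := by
  fin_cases α <;> rfl

theorem iota3Gen_eq (η τ : ℂ) (α : Fin 4) :
    iota3Gen η τ α = scal3 η τ α • S η τ (perm3 α) := by
  fin_cases α <;> rfl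

theorem iota1_S {η τ : ℂ} (h : ∀ α, th τ α η ≠ 0) (α : Fin 4) :
    iota1 η τ (S η τ α) = scal1 η τ α • S η τ (perm1 α) := by
  rw [iota1, dif_pos h, ← iota1Gen_eq]
  simp [S]

theorem iota3_S {η τ : ℂ} (h : ∀ α, th τ α η ≠ 0) (α : Fin 4) :
    iota3 η τ (S η τ α) = scal3 η τ α • S η τ (perm3 α) := by
  rw [iota3, dif_pos h, ← iota3Gen_eq]
  simp [S]

theorem algHom_word {η τ : ℂ} (φ : Alg η τ →ₐ[ℂ] Alg η τ) (c : Fin 4 → ℂ) (σ : Fin 4 → Fin 4)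
    (h : ∀ α, φ (S η τ α) = c α • S η τ (σ α)) (L : List (Fin 4)) :
    φ (word η τ L) = (L.map c).prod • word η τ (L.map σ) := by
  induction L with
  | nil => simp [word_nil]
  | cons α L ih =>
    rw [word_cons, map_mul, ih, h, List.map_cons, List.map_cons, List.prod_cons, word_cons,
      smul_mul_smul_comm]

theorem char1_map_perm1 (L : List (Fin 4)) : char1 (L.map perm1) = char1 L := by
  have e : ∀ α, sgn1 (perm1 α) = sgn1 α := by intro α; fin_cases α <;> rfl
  simp [char1, Function.comp_def, e]

theorem charTau_map_perm3 (L : List (Fin 4)) : charTau (L.map perm3) = charTau L := by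
  have e : ∀ α, sgnTau (perm3 α) = sgnTau α := by intro α; fin_cases α <;> rfl
  simp [charTau, Function.comp_def, e]

/-- `perm1` reverses `sgnTau` on every letter; the signs compensate only for even length. -/
theorem charTau_map_perm1 {L : List (Fin 4)} (h : Even L.length) :
    charTau (L.map perm1) = charTau L := by
  have e : ∀ α, sgnTau (perm1 α) * -1 = sgnTau α * -1 * -1 := by
    intro α; fin_cases α <;> simp [sgnTau, perm1]
  have e2 := prod_map_mul_const (fun α => sgnTau α * -1) (-1) L
  rw [h.neg_one_pow, mul_one] at e2
  simp only [charTau, List.map_map, Function.comp_def, e]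
  exact e2

theorem char1_map_perm3 {L : List (Fin 4)} (h : Even L.length) :
    char1 (L.map perm3) = char1 L := by
  have e : ∀ α, sgn1 (perm3 α) * -1 = sgn1 α * -1 * -1 := by
    intro α; fin_cases α <;> simp [sgn1, perm3]
  have e2 := prod_map_mul_const (fun α => sgn1 α * -1) (-1) L
  rw [h.neg_one_pow, mul_one] at e2
  simp only [char1, List.map_map, Function.comp_def, e]
  exact e2

theorem isTriv_map_perm1 {L : List (Fin 4)} (h : Even L.length) :
    IsTriv (L.map perm1) ↔ IsTriv L := by
  rw [IsTriv, IsTriv, char1_map_perm1, charTau_map_perm1 h]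

theorem isTriv_map_perm3 {L : List (Fin 4)} (h : Even L.length) :
    IsTriv (L.map perm3) ↔ IsTriv L := by
  rw [IsTriv, IsTriv, charTau_map_perm3, char1_map_perm3 h]

/-- The half-period shift permutes the theta functions as `perm1` does, and the scalars of ι¹
convert the prefactor of the permuted generator into that of the original one. -/
theorem th_perm1_sub_half {η τ : ℂ} (h : ∀ α, th τ α η ≠ 0) (α : Fin 4) (z : ℂ) :
    scal1 η τ α * (sqrtEps (perm1 α) * th τ (perm1 α) η * th τ (perm1 α) (z - 1 / 2)) =
      sgn1 α * (sqrtEps α * th τ α η * th τ α z) := by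
  have h0 := h 0
  have h1 := h 1
  have h2 := h 2
  have h3 := h 3
  have e0 := th_zero_add_half τ (z - 1 / 2)
  have e1 := th_one_add_half τ (z - 1 / 2)
  have e2 := th_two_add_half τ (z - 1 / 2)
  have e3 := th_three_add_half τ (z - 1 / 2)
  rw [sub_add_cancel] at e0 e1 e2 e3
  generalize z - 1 / 2 = w at *
  fin_cases α <;> simp only [scal1, perm1, sqrtEps, sgn1, Fin.zero_eta, Fin.mk_one,
    Fin.reduceFinMk, Matrix.cons_val, e0, e1, e2, e3, if_true, Fin.reduceEq, if_false] <;>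
    field_simp
  linear_combination (-th τ 2 w) * I_sq

theorem th_perm3_sub_half_tau {η τ : ℂ} (h : ∀ α, th τ α η ≠ 0) (α : Fin 4) (z : ℂ) :
    scal3 η τ α * (sqrtEps (perm3 α) * th τ (perm3 α) η * th τ (perm3 α) (z - τ / 2)) =
      I * sgnTau α * exp (Real.pi * I * (z - τ / 4)) * (sqrtEps α * th τ α η * th τ α z) := by
  have h0 := h 0
  have h1 := h 1
  have h2 := h 2
  have h3 := h 3
  have e0 := th_zero_add_half_tau τ (z - τ / 2)
  have e1 := th_one_add_half_tau τ (z - τ / 2)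
  have e2 := th_two_add_half_tau τ (z - τ / 2)
  have e3 := th_three_add_half_tau τ (z - τ / 2)
  rw [sub_add_cancel] at e0 e1 e2 e3
  have hm : exp (Real.pi * I * (z - τ / 4)) * halfMul τ (z - τ / 2) = 1 := by
    rw [halfMul, ← Complex.exp_add, ← Complex.exp_zero]; congr 1; ring
  generalize z - τ / 2 = w at *
  generalize exp (Real.pi * I * (z - τ / 4)) = E at *
  fin_cases α <;> simp only [scal3, perm3, sqrtEps, sgnTau, Fin.zero_eta, Fin.mk_one,
    Fin.reduceFinMk, Matrix.cons_val, e0, e1, e2, e3, if_true, Fin.reduceEq, if_false] <;>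
    field_simp
  · linear_combination (th τ 3 w * E * halfMul τ w) * I_sq - th τ 3 w * hm
  · linear_combination (-th τ 2 w) * hm
  · linear_combination (-th τ 1 w * E * halfMul τ w) * I_sq + th τ 1 w * hm
  · linear_combination (th τ 0 w * E * halfMul τ w) * I_sq - th τ 0 w * hm

theorem scal1_ne {η τ : ℂ} (h : ∀ α, th τ α η ≠ 0) (α : Fin 4) : scal1 η τ α ≠ 0 := by
  have h0 := h 0
  have h1 := h 1
  have h2 := h 2
  have h3 := h 3
  fin_cases α <;> simp [scal1, h0, h1, h2, h3]

theorem scal3_ne {η τ : ℂ} (h : ∀ α, th τ α η ≠ 0) (α : Fin 4) : scal3 η τ α ≠ 0 := by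
  have h0 := h 0
  have h1 := h 1
  have h2 := h 2
  have h3 := h 3
  fin_cases α <;> simp [scal3, h0, h1, h2, h3]

theorem coef_perm1 {η τ : ℂ} (h : ∀ α, th τ α η ≠ 0) (t : ℂ) (L : List (Fin 4)) (m : ℤ) (u : ℂ) :
    (L.map (scal1 η τ)).prod * coef η τ (t + 1 / 2) (L.map perm1) m u =
      (L.map sgn1).prod * coef η τ t L m u := by
  have key : ∀ α u, wt η τ (t + 1 / 2) (perm1 α) u = sgn1 α * (scal1 η τ α)⁻¹ * wt η τ t α u := by
    intro α u
    have := th_perm1_sub_half h α (2 * u - t + η)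
    rw [wt, wt, show 2 * u - (t + 1 / 2) + η = 2 * u - t + η - 1 / 2 by ring,
      ← mul_div_assoc]
    congr 1
    have h1 := scal1_ne h α
    generalize 2 * u - t + η - 1 / 2 = w at *
    field_simp
    linear_combination this
  have := coef_gauge (η := η) (τ := τ) (t := t) (t' := t + 1 / 2) (a := 0) perm1
    (fun α => sgn1 α * (scal1 η τ α)⁻¹) (fun _ => 0)
    (fun α u => by simpa using key α u) (fun α u => by simpa using key α (-u)) L m u
  rw [add_zero, sub_self, Complex.exp_zero, mul_one, List.prod_map_mul] at this
  rw [this]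
  have h2 : (L.map (scal1 η τ)).prod * (L.map fun α => (scal1 η τ α)⁻¹).prod = 1 := by
    rw [← List.prod_map_mul]
    simp [mul_inv_cancel₀ (scal1_ne h _)]
  linear_combination ((L.map sgn1).prod * coef η τ t L m u) * h2

/-- The shift by τ/2 again leaves an exponential of a linear function of u, and the gauge function
is half of the one used for t ↦ t + τ. -/
theorem coef_perm3 {η τ : ℂ} (hη : η ≠ 0) (h : ∀ α, th τ α η ≠ 0) (t : ℂ) (L : List (Fin 4))
    (m : ℤ) (u : ℂ) :
    (L.map (scal3 η τ)).prod * coef η τ (t + τ / 2) (L.map perm3) m u =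
      (L.map sgnTau).prod * (I * exp (-(Real.pi * I * (t + τ / 4)))) ^ L.length *
        exp (Real.pi * I * (2 * u * m + m ^ 2 * η)) * coef η τ t L m u := by
  have key : ∀ α u, wt η τ (t + τ / 2) (perm3 α) u =
      sgnTau α * (scal3 η τ α)⁻¹ * (I * exp (-(Real.pi * I * (t + τ / 4)))) *
        exp (Real.pi * I * (2 * u + η)) * wt η τ t α u := by
    intro α u
    have := th_perm3_sub_half_tau h α (2 * u - t + η)
    rw [wt, wt, show 2 * u - (t + τ / 2) + η = 2 * u - t + η - τ / 2 by ring,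
      ← mul_div_assoc]
    congr 1
    have h1 := scal3_ne h α
    have e : exp (Real.pi * I * (2 * u - t + η - τ / 4)) =
        exp (-(Real.pi * I * (t + τ / 4))) * exp (Real.pi * I * (2 * u + η)) := by
      rw [← Complex.exp_add]; congr 1; ring
    rw [e] at this
    generalize 2 * u - t + η - τ / 2 = w at *
    generalize exp (-(Real.pi * I * (t + τ / 4))) = E at *
    generalize exp (Real.pi * I * (2 * u + η)) = E' at *
    field_simp
    linear_combination this
  have := coef_gauge (η := η) (τ := τ) (t := t) (t' := t + τ / 2) (a := 0) perm3
    (fun α => sgnTau α * (scal3 η τ α)⁻¹ * (I * exp (-(Real.pi * I * (t + τ / 4)))))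
    (fun u => Real.pi * I * u ^ 2 / η)
    (fun α u => by
      rw [add_zero, key]
      congr 3
      field_simp
      ring)
    (fun α u => by
      rw [add_zero, key]
      congr 3
      field_simp
      ring) L m u
  rw [add_zero, prod_map_mul_const, List.prod_map_mul] at this
  rw [this]
  have h2 : (L.map (scal3 η τ)).prod * (L.map fun α => (scal3 η τ α)⁻¹).prod = 1 := by
    rw [← List.prod_map_mul]
    simp [mul_inv_cancel₀ (scal3_ne h _)]
  have e : Real.pi * I * (u + m * η) ^ 2 / η - Real.pi * I * u ^ 2 / η =
      Real.pi * I * (2 * u * m + m ^ 2 * η) := by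
    field_simp
    ring
  rw [e]
  linear_combination ((L.map sgnTau).prod * (I * exp (-(Real.pi * I * (t + τ / 4)))) ^ L.length *
        exp (Real.pi * I * (2 * u * m + m ^ 2 * η)) * coef η τ t L m u) * h2

/-! ### Analyticity of the coefficients -/

theorem analyticAt_th_comp {τ : ℂ} (hτ : 0 < τ.im) (α : Fin 4) {f : ℂ → ℂ} {z : ℂ}
    (hf : AnalyticAt ℂ f z) : AnalyticAt ℂ (fun z => th τ α (f z)) z :=
  ((differentiable_th hτ α).analyticAt (f z)).comp hf

theorem analyticAt_wt {η τ : ℂ} (hτ : 0 < τ.im) (hη : IsGen η τ) (α : Fin 4) {t u : ℂ → ℂ} {z : ℂ}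
    (ht : AnalyticAt ℂ t z) (hu : AnalyticAt ℂ u z) (h : th τ 0 (2 * u z) ≠ 0) :
    AnalyticAt ℂ (fun z => wt η τ (t z) α (u z)) z := by
  unfold wt
  refine AnalyticAt.div ?_ ?_ (mul_ne_zero (hη.th_zero_two_ne hτ) h)
  · exact analyticAt_const.mul (analyticAt_th_comp hτ α
      (((analyticAt_const.mul hu).sub ht).add analyticAt_const))
  · exact analyticAt_const.mul (analyticAt_th_comp hτ 0 (analyticAt_const.mul hu))

theorem meromorphicAt_wt {η τ : ℂ} (hτ : 0 < τ.im) (α : Fin 4) {t u : ℂ → ℂ} {z : ℂ}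
    (ht : AnalyticAt ℂ t z) (hu : AnalyticAt ℂ u z) :
    MeromorphicAt (fun z => wt η τ (t z) α (u z)) z := by
  unfold wt
  refine MeromorphicAt.fun_div (AnalyticAt.meromorphicAt ?_) (AnalyticAt.meromorphicAt ?_)
  · exact analyticAt_const.mul (analyticAt_th_comp hτ α
      (((analyticAt_const.mul hu).sub ht).add analyticAt_const))
  · exact analyticAt_const.mul (analyticAt_th_comp hτ 0 (analyticAt_const.mul hu))

theorem analyticAt_coef {η τ : ℂ} (hτ : 0 < τ.im) (hη : IsGen η τ) (L : List (Fin 4)) (m : ℤ)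
    {t u : ℂ → ℂ} {z : ℂ} (ht : AnalyticAt ℂ t z) (hu : AnalyticAt ℂ u z)
    (h : ∀ j : ℤ, |j| < L.length → th τ 0 (2 * u z + 2 * j * η) ≠ 0) :
    AnalyticAt ℂ (fun z => coef η τ (t z) L m (u z)) z := by
  induction L generalizing m u with
  | nil => exact analyticAt_const
  | cons α L ih =>
    have h0 : th τ 0 (2 * u z) ≠ 0 := by simpa using h 0 (by simp)
    have h0' : th τ 0 (2 * -u z) ≠ 0 := by rw [mul_neg, th_zero_neg]; simpa using h0
    rw [List.length_cons] at h
    push_cast at h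
    refine ((analyticAt_wt hτ hη α ht hu h0).mul (ih _ (hu.add analyticAt_const) fun j hj => ?_)).add
      ((analyticAt_wt hτ hη α ht hu.neg h0').mul (ih _ (hu.sub analyticAt_const) fun j hj => ?_))
    · have := h (j + 1) (by grind)
      push_cast at this
      rwa [← show 2 * (u z + η) + 2 * j * η = 2 * u z + 2 * (j + 1) * η by ring] at this
    · have := h (j - 1) (by grind)
      push_cast at this
      rwa [← show 2 * (u z - η) + 2 * j * η = 2 * u z + 2 * (j - 1) * η by ring] at this

theorem meromorphicAt_coef {η τ : ℂ} (hτ : 0 < τ.im) (L : List (Fin 4)) (m : ℤ)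
    {t u : ℂ → ℂ} {z : ℂ} (ht : AnalyticAt ℂ t z) (hu : AnalyticAt ℂ u z) :
    MeromorphicAt (fun z => coef η τ (t z) L m (u z)) z := by
  induction L generalizing m u with
  | nil => exact MeromorphicAt.const _ _
  | cons α L ih =>
    exact ((meromorphicAt_wt hτ α ht hu).mul (ih _ (hu.add analyticAt_const))).add
      ((meromorphicAt_wt hτ α ht hu.neg).mul (ih _ (hu.sub analyticAt_const)))

/-! ### Regularity of the coefficient of the identity -/

theorem analyticAt_dslope {f : ℂ → ℂ} {x : ℂ} (hf : AnalyticAt ℂ f x) :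
    AnalyticAt ℂ (dslope f x) x := by
  obtain ⟨p, hp⟩ := hf
  exact ⟨_, hp.has_fpower_series_dslope_fslope⟩

theorem IsRem.div_of_tendsto_zero {f g : ℂ → ℂ} {x : ℂ} (hf : IsRem f x)
    (h0 : Tendsto f (𝓝[≠] x) (𝓝 0)) (hg : AnalyticAt ℂ g x) (hgx : g x = 0)
    (hg' : deriv g x ≠ 0) : IsRem (fun z => f z / g z) x := by
  obtain ⟨F, hF, e⟩ := hf
  have hFx : F x = 0 := tendsto_nhds_unique
    (hF.continuousAt.tendsto.mono_left nhdsWithin_le_nhds) (h0.congr' e)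
  refine ⟨fun z => dslope F x z / dslope g x z,
    (analyticAt_dslope hF).div (analyticAt_dslope hg) (by rwa [dslope_same]), ?_⟩
  filter_upwards [e, self_mem_nhdsWithin] with z hz hne
  have hne' : z - x ≠ 0 := sub_ne_zero.2 hne
  rw [hz, dslope_of_ne _ hne, dslope_of_ne _ hne, slope_def_field, slope_def_field, hFx, hgx,
    sub_zero, sub_zero, div_div_div_cancel_right₀ hne']

theorem IsRem.tendsto_zero_of_odd {f : ℂ → ℂ} (hf : IsRem f 0) (hodd : ∀ u, f (-u) = -f u) :
    Tendsto f (𝓝[≠] 0) (𝓝 0) := by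
  obtain ⟨c, hc⟩ := hf.exists_tendsto
  have h1 : Tendsto (fun u : ℂ => -u) (𝓝[≠] 0) (𝓝[≠] 0) := by
    refine tendsto_nhdsWithin_iff.2 ⟨?_, ?_⟩
    · have : Tendsto (fun u : ℂ => -u) (𝓝 0) (𝓝 (-0)) := continuous_neg.tendsto 0
      rw [neg_zero] at this
      exact this.mono_left nhdsWithin_le_nhds
    · filter_upwards [self_mem_nhdsWithin] with u hu
      simpa using hu
  have h2 := (hc.comp h1).congr (f₂ := fun u => -f u) (fun u => hodd u)
  have : c = -c := tendsto_nhds_unique h2 hc.neg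
  rwa [self_eq_neg.1 this] at hc

variable {η τ : ℂ}

theorem hasDerivAt_th_two_mul (hτ : 0 < τ.im) (x : ℂ) :
    HasDerivAt (fun u => th τ 0 (2 * u)) (deriv (th τ 0) (2 * x) * (2 * 1)) x :=
  (differentiable_th hτ 0 (2 * x)).hasDerivAt.comp x ((hasDerivAt_id x).const_mul 2)

theorem wordOp_even (t : ℂ) (L : List (Fin 4)) {f : ℂ → ℂ} (hf : ∀ u, f (-u) = f u) (u : ℂ) :
    wordOp η τ t L f (-u) = wordOp η τ t L f u := by
  induction L generalizing u with
  | nil => rw [wordOp_nil, wordOp_nil, hf]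
  | cons α L ih =>
    rw [wordOp_cons, wordOp_cons, neg_neg, show -u + η = -(u - η) by ring,
      show -u - η = -(u + η) by ring, ih, ih, add_comm]

/-- On the orbit ℤη a generator can create a pole only at u = 0, since 2jη is not in the lattice for
j ≠ 0. At 0 the numerator is odd, because f is even, and so cancels the simple zero of θ₁(2u).
Nothing is required of f away from the orbit, so f may be prescribed separately near its points. -/
theorem wordOp_isRem (hτ : 0 < τ.im) (hη : IsGen η τ) (t : ℂ) (L : List (Fin 4)) {f : ℂ → ℂ}
    (hf : ∀ u, f (-u) = f u) (hr : ∀ j : ℤ, IsRem f (j * η)) (j : ℤ) :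
    IsRem (wordOp η τ t L f) (j * η) := by
  induction L generalizing j with
  | nil =>
    rw [show wordOp η τ t [] f = f from funext fun u => wordOp_nil _ _ _ _ _]
    exact hr j
  | cons α L ih =>
    have e := wordOp_even (η := η) (τ := τ) t L hf
    set G := wordOp η τ t L f
    have hG1 : IsRem (fun u => G (u + η)) (j * η) := by
      refine IsRem.comp_add_const ?_
      have := ih (j + 1)
      push_cast at this
      rwa [add_mul, one_mul] at this
    have hG2 : IsRem (fun u => G (u - η)) (j * η) := by
      simp only [sub_eq_add_neg]
      refine IsRem.comp_add_const ?_
      have := ih (j - 1)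
      push_cast at this
      rwa [sub_mul, one_mul] at this
    have hfun : wordOp η τ t (α :: L) f = fun u => wt η τ t α u * G (u + η) +
        wt η τ t α (-u) * G (u - η) := funext fun u => wordOp_cons _ _ _ _ _ _ _
    rw [hfun]
    by_cases hj : j = 0
    · subst hj
      rw [Int.cast_zero, zero_mul] at *
      set N : ℂ → ℂ := fun u => th τ α (2 * u - t + η) * G (u + η) -
        th τ α (2 * -u - t + η) * G (u - η) with hN
      have hNr : IsRem N 0 := by
        refine IsRem.sub (IsRem.mul (AnalyticAt.isRem ?_) hG1) (IsRem.mul (AnalyticAt.isRem ?_) hG2)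
        · exact analyticAt_th_comp hτ α (by fun_prop)
        · exact analyticAt_th_comp hτ α (by fun_prop)
      have hNo : ∀ u, N (-u) = -N u := by
        intro u
        simp only [hN, neg_neg]
        rw [show -u + η = -(u - η) by ring, show -u - η = -(u + η) by ring, e, e]
        ring
      have hd := hasDerivAt_th_two_mul hτ 0
      have := IsRem.div_of_tendsto_zero hNr (hNr.tendsto_zero_of_odd hNo)
        (g := fun u => th τ 0 (2 * u)) (analyticAt_th_comp hτ 0 (by fun_prop))
        (by simp [th_zero_zero])
        (by
          rw [hd.deriv, mul_zero]
          simpa using deriv_th_zero_ne_of_mem hτ (zero_mem (lat τ)))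
      refine (this.const_mul (sqrtEps α * th τ α η / th τ 0 (2 * η))).congr
        (Eventually.of_forall fun u => ?_)
      simp only [hN, wt]
      rw [show 2 * -u = -(2 * u) by ring, th_zero_neg]
      simp only [div_eq_mul_inv, mul_inv, inv_neg]
      ring
    · have h0 : th τ 0 (2 * (j * η)) ≠ 0 := by
        have := hη.th_zero_int_ne hτ (n := 2 * j) (by omega)
        push_cast at this
        rwa [mul_assoc] at this
      have h0' : th τ 0 (2 * -(j * η)) ≠ 0 := by rwa [mul_neg, th_zero_neg, neg_ne_zero]
      exact ((analyticAt_wt hτ hη α (t := fun _ => t) (u := fun u => u) analyticAt_const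
        analyticAt_id h0).isRem.mul hG1).add ((analyticAt_wt hτ hη α (t := fun _ => t)
        (u := fun u => -u) analyticAt_const analyticAt_id.neg h0').isRem.mul hG2)

/-- A test function supported near `± j η`. -/
def testFn (η : ℂ) (j : ℤ) (φ : ℂ → ℂ) (u : ℂ) : ℂ :=
  if ‖u - j * η‖ < ‖η‖ / 2 then φ (u - j * η)
  else if ‖u + j * η‖ < ‖η‖ / 2 then φ (-u - j * η) else 0

/-- Distinct points of ℤη are at distance at least |η|, so discs of radius |η|/2 around them are
disjoint and test functions can be patched together from local pieces. -/
theorem norm_sub_lt_iff {i j : ℤ} {u : ℂ} (h : ‖u - i * η‖ < ‖η‖ / 2) :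
    ‖u - j * η‖ < ‖η‖ / 2 ↔ i = j := by
  refine ⟨fun h' => ?_, fun e => e ▸ h⟩
  by_contra hne
  have h1 : ‖η‖ ≤ ‖((i - j : ℤ) : ℂ) * η‖ := by
    rw [norm_mul]
    have : (1 : ℝ) ≤ ‖((i - j : ℤ) : ℂ)‖ := by
      rw [Complex.norm_intCast]
      exact_mod_cast Int.one_le_abs (sub_ne_zero.2 hne)
    nlinarith [norm_nonneg η]
  have h2 : ‖((i - j : ℤ) : ℂ) * η‖ ≤ ‖u - j * η‖ + ‖u - i * η‖ := by
    rw [show ((i - j : ℤ) : ℂ) * η = (u - j * η) - (u - i * η) by push_cast; ring]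
    exact norm_sub_le _ _
  linarith

theorem testFn_eq {i : ℤ} (j : ℤ) (φ : ℂ → ℂ) {u : ℂ} (h : ‖u - i * η‖ < ‖η‖ / 2) :
    testFn η j φ u = if i = j then φ (u - j * η) else if i = -j then φ (-u - j * η) else 0 := by
  rw [testFn]
  have h1 := norm_sub_lt_iff (j := j) h
  have h2 := norm_sub_lt_iff (j := -j) h
  push_cast at h2
  rw [neg_mul, sub_neg_eq_add] at h2
  simp only [h1, h2]

theorem testFn_even (j : ℤ) (φ : ℂ → ℂ) (hφ : j = 0 → ∀ u, φ (-u) = φ u) (u : ℂ) :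
    testFn η j φ (-u) = testFn η j φ u := by
  have h3 : ‖-u - j * η‖ = ‖u + j * η‖ := by rw [← norm_neg]; congr 1; ring
  have h4 : ‖-u + j * η‖ = ‖u - j * η‖ := by rw [← norm_neg]; congr 1; ring
  rw [testFn, testFn, h3, h4, neg_neg]
  by_cases h1 : ‖u - j * η‖ < ‖η‖ / 2 <;> by_cases h2 : ‖u + j * η‖ < ‖η‖ / 2 <;>
    simp only [h1, h2, if_true, if_false]
  have h5 := (norm_sub_lt_iff (j := -j) h1).1 (by
    push_cast; rwa [neg_mul, sub_neg_eq_add])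
  have h6 : j = 0 := by omega
  rw [show -u - j * η = -(u + j * η) by ring, hφ h6, h6]
  simp

theorem eventually_norm_sub_lt (hη : η ≠ 0) (x : ℂ) : ∀ᶠ u in 𝓝 x, ‖u - x‖ < ‖η‖ / 2 := by
  have := Metric.ball_mem_nhds x (half_pos (norm_pos_iff.2 hη))
  filter_upwards [this] with u hu
  rwa [Metric.mem_ball, dist_eq_norm] at hu

theorem testFn_isRem (hη : η ≠ 0) (j : ℤ) {φ : ℂ → ℂ} (hφ : ∀ x, AnalyticAt ℂ φ x) (i : ℤ) :
    IsRem (testFn η j φ) (i * η) := by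
  refine IsRem.congr (f := fun u => if i = j then φ (u - j * η) else
    if i = -j then φ (-u - j * η) else 0) ?_
    (((eventually_norm_sub_lt hη (i * η)).mono fun u hu => testFn_eq j φ hu).filter_mono
      nhdsWithin_le_nhds)
  split_ifs
  · exact ((hφ _).comp (g := φ) (f := fun u => u - j * η) (by fun_prop)).isRem
  · exact ((hφ _).comp (g := φ) (f := fun u => -u - j * η) (by fun_prop)).isRem
  · exact IsRem.const _ _

/-- Applied to a function living near ±jη only, the operator isolates two coefficients: from jη only
the shifts by 0 and by -2jη reach the support. -/
theorem coef_isRem_pair (hτ : 0 < τ.im) (hη : IsGen η τ) (hη0 : η ≠ 0) (t : ℂ) (L : List (Fin 4))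
    {j : ℤ} (hj : j ≠ 0) {φ : ℂ → ℂ} (hφ : ∀ x, AnalyticAt ℂ φ x) :
    IsRem (fun u => coef η τ t L 0 u * φ (u - j * η) + coef η τ t L (-2 * j) u * φ (j * η - u))
      (j * η) := by
  refine (wordOp_isRem hτ hη t L (testFn_even j φ (fun h => absurd h hj))
    (testFn_isRem hη0 j hφ) j).congr ?_
  refine ((eventually_norm_sub_lt hη0 (j * η)).mono fun u hu => ?_).filter_mono nhdsWithin_le_nhds
  have hm : ∀ m : ℤ, testFn η j φ (u + m * η) = if j + m = j then φ (u + m * η - j * η) else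
      if j + m = -j then φ (-(u + m * η) - j * η) else 0 := fun m => by
    refine testFn_eq j φ ?_
    rwa [show u + m * η - ((j + m : ℤ) : ℂ) * η = u - j * η by push_cast; ring]
  rw [wordOp, finsum_eq_sum_of_support_subset (s := {0, -2 * j})]
  · rw [Finset.sum_pair (by omega), hm, hm, if_pos (by omega), if_neg (by omega),
      if_pos (by omega)]
    push_cast
    ring_nf
  · intro m hm'
    by_contra h
    simp only [Finset.coe_insert, Finset.coe_singleton, Set.mem_insert_iff,
      Set.mem_singleton_iff, not_or] at h
    refine hm' ?_
    simp only [hm]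
    rw [if_neg (by omega), if_neg (by omega), mul_zero]

/-- With a test function equal to 1 near 0 and to 0 near the other points of ℤη, only the
coefficient of the identity survives. -/
theorem coef_zero_isRem_zero (hτ : 0 < τ.im) (hη : IsGen η τ) (hη0 : η ≠ 0) (t : ℂ)
    (L : List (Fin 4)) : IsRem (coef η τ t L 0) 0 := by
  have := wordOp_isRem hτ hη t L (testFn_even 0 (fun _ => 1) (fun _ _ => rfl))
    (testFn_isRem hη0 0 (fun _ => analyticAt_const)) 0
  rw [Int.cast_zero, zero_mul] at this
  refine this.congr ?_
  refine ((eventually_norm_sub_lt hη0 0).mono fun u hu => ?_).filter_mono nhdsWithin_le_nhds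
  have hm : ∀ m : ℤ, testFn η 0 (fun _ => 1) (u + m * η) = if m = 0 then 1 else 0 := fun m => by
    rw [testFn_eq (i := m) 0 _ (by rwa [add_sub_cancel_right, ← sub_zero u])]
    by_cases h : m = 0 <;> simp [h]
  rw [wordOp, finsum_eq_single _ (0 : ℤ)]
  · rw [hm]; simp
  · intro m h; rw [hm, if_neg h, mul_zero]

/-- Simple poles. -/
theorem coef_zero_isRem_mul (hτ : 0 < τ.im) (hη : IsGen η τ) (hη0 : η ≠ 0) (t : ℂ)
    (L : List (Fin 4)) {j : ℤ} (hj : j ≠ 0) :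
    IsRem (fun u => (u - j * η) * coef η τ t L 0 u) (j * η) := by
  -- φ = 1 controls the sum of the coefficients for the shifts 0 and -2j; φ = u controls their
  -- difference multiplied by u - jη. Half of the second plus u - jη times the first eliminates the
  -- coefficient for -2j.
  have h1 := coef_isRem_pair hτ hη hη0 t L hj (φ := fun _ => 1) (fun _ => analyticAt_const)
  have h2 := coef_isRem_pair hτ hη hη0 t L hj (φ := fun u => u) (fun _ => analyticAt_id)
  have h3 : IsRem (fun u => u - j * η) (j * η) :=
    (AnalyticAt.isRem (by fun_prop))
  refine ((h2.add (h3.mul h1)).const_mul (1 / 2)).congr (Eventually.of_forall fun u => ?_)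
  simp only
  ring

/-! ### Partial fractions -/

/-- The logarithmic derivative of the odd theta function. -/
def zf (τ x : ℂ) : ℂ := deriv (th τ 0) x / th τ 0 x

theorem zf_neg (τ x : ℂ) : zf τ (-x) = -zf τ x := by
  have h : deriv (th τ 0) (-x) = deriv (th τ 0) x := by
    have h1 := deriv_comp_neg (th τ 0) x
    rw [show (fun x => th τ 0 (-x)) = fun x => -th τ 0 x from funext (th_zero_neg τ)] at h1
    have h2 : deriv (fun x => -th τ 0 x) x = -deriv (th τ 0) x := deriv.fun_neg
    rw [h2] at h1
    exact neg_injective h1.symm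
  rw [zf, zf, h, th_zero_neg, div_neg]

theorem zf_add_one (τ x : ℂ) : zf τ (x + 1) = zf τ x := by
  have h1 := deriv_comp_add_const (th τ 0) 1 x
  rw [show (fun x => th τ 0 (x + 1)) = fun x => -th τ 0 x from
    funext fun x => by rw [th_add_one, sgn1_zero]; ring] at h1
  have h2 : deriv (fun x => -th τ 0 x) x = -deriv (th τ 0) x := deriv.fun_neg
  rw [h2] at h1
  rw [zf, zf, ← h1, th_add_one, sgn1_zero, neg_one_mul, neg_div_neg_eq]

theorem zf_add_tau {τ : ℂ} (hτ : 0 < τ.im) {x : ℂ} (hx : th τ 0 x ≠ 0) :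
    zf τ (x + τ) = zf τ x - 2 * Real.pi * I := by
  have h1 := deriv_comp_add_const (th τ 0) τ x
  rw [show (fun x => th τ 0 (x + τ)) = fun x => -(exp (-(Real.pi * I * (τ + 2 * x))) * th τ 0 x) from
    funext fun x => by rw [th_add_tau, sgnTau_zero]; ring] at h1
  have hd : HasDerivAt (fun x => exp (-(Real.pi * I * (τ + 2 * x))))
      (exp (-(Real.pi * I * (τ + 2 * x))) * (-(Real.pi * I * (2 * 1)))) x :=
    ((((hasDerivAt_id x).const_mul 2).const_add τ).const_mul (Real.pi * I)).neg.cexp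
  have h2 := (hd.mul (differentiable_th hτ 0 x).hasDerivAt).neg.deriv
  have h3 : deriv (fun x => -(exp (-(Real.pi * I * (τ + 2 * x))) * th τ 0 x)) x = _ := h2
  rw [h3] at h1
  have := Complex.exp_ne_zero (-(Real.pi * I * (τ + 2 * x)))
  rw [zf, zf, ← h1, th_add_tau, sgnTau_zero]
  field_simp
  ring

theorem analyticAt_zf {τ : ℂ} (hτ : 0 < τ.im) {f : ℂ → ℂ} {z : ℂ} (hf : AnalyticAt ℂ f z)
    (h : th τ 0 (f z) ≠ 0) : AnalyticAt ℂ (fun z => zf τ (f z)) z :=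
  (((differentiable_th hτ 0).analyticAt (f z)).deriv.comp hf).div (analyticAt_th_comp hτ 0 hf) h

theorem meromorphicAt_zf {τ : ℂ} (hτ : 0 < τ.im) {f : ℂ → ℂ} {z : ℂ} (hf : AnalyticAt ℂ f z) :
    MeromorphicAt (fun z => zf τ (f z)) z :=
  (((differentiable_th hτ 0).analyticAt (f z)).deriv.comp hf).meromorphicAt.fun_div
    (analyticAt_th_comp hτ 0 hf).meromorphicAt

theorem zf_sub_inv_isRem {τ : ℂ} (hτ : 0 < τ.im) : IsRem (fun x => zf τ x - 1 / x) 0 := by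
  have hb := analyticAt_dslope ((differentiable_th hτ 0).analyticAt 0)
  have hb0 : dslope (th τ 0) 0 0 ≠ 0 := by
    rw [dslope_same]; exact deriv_th_zero_ne_of_mem hτ (zero_mem _)
  set b := dslope (th τ 0) 0 with hbdef
  have hth : ∀ z, th τ 0 z = z * b z := by
    intro z
    have := sub_smul_dslope (th τ 0) 0 z
    rw [sub_zero, th_zero_zero, sub_zero, smul_eq_mul] at this
    exact this.symm
  refine ⟨fun z => deriv b z / b z, hb.deriv.div hb hb0, ?_⟩
  have h1 : ∀ᶠ z in 𝓝[≠] 0, b z ≠ 0 :=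
    (hb.continuousAt.eventually_ne hb0).filter_mono nhdsWithin_le_nhds
  have h2 : ∀ᶠ z in 𝓝[≠] 0, AnalyticAt ℂ b z :=
    hb.eventually_analyticAt.filter_mono nhdsWithin_le_nhds
  filter_upwards [h1, h2, self_mem_nhdsWithin] with z hz hz2 hz0
  have hz0' : z ≠ 0 := hz0
  have hd : deriv (th τ 0) z = b z + z * deriv b z := by
    rw [show th τ 0 = fun z => z * b z from funext hth]
    have := ((hasDerivAt_id' z).fun_mul hz2.differentiableAt.hasDerivAt).deriv
    simpa using this
  rw [zf, hd, hth]
  field_simp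
  ring

theorem IsRem.comp_affine {f : ℂ → ℂ} {x c d : ℂ} (hc : c ≠ 0) (hf : IsRem f (c * x + d)) :
    IsRem (fun z => f (c * z + d)) x := by
  obtain ⟨g, hg, e⟩ := hf
  refine ⟨fun z => g (c * z + d), hg.comp (f := fun z => c * z + d) (by fun_prop), ?_⟩
  have h1 : Tendsto (fun z : ℂ => c * z + d) (𝓝[≠] x) (𝓝[≠] (c * x + d)) := by
    refine tendsto_nhdsWithin_iff.2 ⟨?_, ?_⟩
    · have : Continuous fun z : ℂ => c * z + d := by fun_prop
      exact (this.tendsto x).mono_left nhdsWithin_le_nhds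
    · filter_upwards [self_mem_nhdsWithin] with z hz h
      exact hz (mul_left_cancel₀ hc (add_right_cancel h))
  exact h1.eventually e

theorem tendsto_add_const_nhdsNE (x c : ℂ) :
    Tendsto (fun z : ℂ => z + c) (𝓝[≠] x) (𝓝[≠] (x + c)) := by
  refine tendsto_nhdsWithin_iff.2 ⟨?_, ?_⟩
  · have : Continuous fun z : ℂ => z + c := by fun_prop
    exact (this.tendsto x).mono_left nhdsWithin_le_nhds
  · filter_upwards [self_mem_nhdsWithin] with z hz h
    exact hz (add_right_cancel h)

theorem isRem_add_iff {f : ℂ → ℂ} {c : ℂ} (h : ∀ x, ∀ᶠ u in 𝓝[≠] x, f (u + c) = f u) (x : ℂ) :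
    IsRem f (x + c) ↔ IsRem f x := by
  refine ⟨fun hf => hf.comp_add_const.congr ((h x).mono fun u hu => hu.symm), fun hf => ?_⟩
  have h1 : IsRem (fun z => f (z + -c)) (x + c) := by
    refine IsRem.comp_add_const ?_
    rwa [add_neg_cancel_right]
  refine h1.congr ?_
  have h2 := tendsto_add_const_nhdsNE (x + c) (-c)
  rw [add_neg_cancel_right] at h2
  filter_upwards [h2.eventually (h x)] with u hu
  rw [← hu, neg_add_cancel_right]

/-! ### Elliptic functions with poles at ±jη and their primitives for the shift by η -/

variable {η τ : ℂ}

/-- The elementary elliptic functions with poles at `± j η`. -/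
def psi (η τ : ℂ) (j : ℕ) (u : ℂ) : ℂ :=
  if j = 0 then 1 else zf τ (2 * u - 2 * j * η) - zf τ (2 * u + 2 * j * η)

/-- Primitives of the `psi j` with respect to the shift by `η`. -/
def hfn (η τ : ℂ) (j : ℕ) (u : ℂ) : ℂ :=
  if j = 0 then u / η - 1 / 2 else -∑ i ∈ Finset.Ico (-(j : ℤ)) j, zf τ (2 * u + 2 * i * η)

theorem sum_Ico_int_sub (f : ℤ → ℂ) (j : ℕ) :
    ∑ i ∈ Finset.Ico (-(j : ℤ)) j, (f (i + 1) - f i) = f j - f (-j) := by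
  induction j with
  | zero => simp
  | succ j ih =>
    have e : Finset.Ico (-((j + 1 : ℕ) : ℤ)) ((j + 1 : ℕ) : ℤ) =
        insert (-((j : ℤ) + 1)) (insert (j : ℤ) (Finset.Ico (-(j : ℤ)) j)) := by
      ext x; simp only [Finset.mem_Ico, Finset.mem_insert]; push_cast; omega
    rw [e, Finset.sum_insert (by simp), Finset.sum_insert (by simp), ih]
    push_cast
    rw [show -((j : ℤ) + 1) + 1 = -j by ring]
    ring

/-- The shift by η raises the summation index by one, so the difference telescopes to the two end
terms. -/
theorem hfn_add_eta (hη : η ≠ 0) (j : ℕ) (u : ℂ) :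
    hfn η τ j (u + η) - hfn η τ j u = psi η τ j u := by
  by_cases hj : j = 0
  · simp only [hfn, psi, hj, if_true]; field_simp; ring
  · simp only [hfn, psi, hj, if_false]
    have := sum_Ico_int_sub (fun i => zf τ (2 * u + 2 * i * η)) j
    push_cast at this
    rw [show 2 * u + 2 * -(j : ℂ) * η = 2 * u - 2 * j * η by ring, Finset.sum_sub_distrib] at this
    have e : ∀ i : ℤ, zf τ (2 * (u + η) + 2 * i * η) = zf τ (2 * u + 2 * (i + 1) * η) := by
      intro i; congr 1; ring
    simp only [e]
    linear_combination -this

/-- The range -j ≤ i < j is symmetric under i ↦ -1 - i, and for j = 0 the constant 1/2 is chosen to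
the same effect: `hfn` is odd about η/2. -/
theorem hfn_reflect (hη : η ≠ 0) (j : ℕ) (u : ℂ) : hfn η τ j (η - u) = -hfn η τ j u := by
  by_cases hj : j = 0
  · simp only [hfn, hj, if_true]; field_simp; ring
  · simp only [hfn, hj, if_false, neg_neg]
    rw [← Finset.sum_neg_distrib]
    refine Finset.sum_nbij' (fun i => -1 - i) (fun i => -1 - i) ?_ ?_ ?_ ?_ ?_
    · intro i hi; rw [Finset.mem_Ico] at hi ⊢; omega
    · intro i hi; rw [Finset.mem_Ico] at hi ⊢; omega
    · intro i _; ring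
    · intro i _; ring
    · intro i _
      rw [← zf_neg]; congr 1; push_cast; ring

theorem hfn_eta_half (hη : η ≠ 0) (j : ℕ) : hfn η τ j (η / 2) = 0 := by
  have := hfn_reflect (τ := τ) hη j (η / 2)
  rw [show η - η / 2 = η / 2 by ring] at this
  exact self_eq_neg.1 this

theorem hfn_add_half {j : ℕ} (hj : j ≠ 0) (u : ℂ) : hfn η τ j (u + 1 / 2) = hfn η τ j u := by
  simp only [hfn, hj, if_false]
  congr 1
  refine Finset.sum_congr rfl fun i _ => ?_
  rw [show 2 * (u + 1 / 2) + 2 * i * η = 2 * u + 2 * i * η + 1 by ring, zf_add_one]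

/-- The coefficients of words of length `n` are regular at such points. -/
def Reg (η τ : ℂ) (n : ℕ) (u : ℂ) : Prop := ∀ i : ℤ, |i| ≤ n → th τ 0 (2 * u + 2 * i * η) ≠ 0

/-- Each of the 2j logarithmic derivatives loses 2πi. This increment is the source of g₃. -/
theorem hfn_add_half_tau (hτ : 0 < τ.im) {n j : ℕ} (hj : j ≠ 0) (hjn : j ≤ n) {u : ℂ}
    (hu : Reg η τ n u) :
    hfn η τ j (u + τ / 2) = hfn η τ j u + 4 * Real.pi * I * j := by
  simp only [hfn, hj, if_false]
  have : ∀ i ∈ Finset.Ico (-(j : ℤ)) j, zf τ (2 * (u + τ / 2) + 2 * i * η) =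
      zf τ (2 * u + 2 * i * η) - 2 * Real.pi * I := by
    intro i hi
    rw [Finset.mem_Ico] at hi
    rw [show 2 * (u + τ / 2) + 2 * i * η = 2 * u + 2 * i * η + τ by ring,
      zf_add_tau hτ (hu i (by rw [abs_le]; omega))]
  rw [Finset.sum_congr rfl this, Finset.sum_sub_distrib, Finset.sum_const, Int.card_Ico]
  have : ((j : ℤ) - -(j : ℤ)).toNat = 2 * j := by omega
  rw [this, nsmul_eq_mul]
  push_cast
  ring

theorem eventually_reg (hτ : 0 < τ.im) (n : ℕ) (x : ℂ) : ∀ᶠ u in 𝓝[≠] x, Reg η τ n u := by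
  have : ∀ᶠ u in 𝓝[≠] x, ∀ i ∈ Finset.Icc (-(n : ℤ)) n, th τ 0 (2 * u + 2 * i * η) ≠ 0 :=
    (Finset.eventually_all _).2 fun i _ => th_zero_affine_ne hτ two_ne_zero _ x
  filter_upwards [this] with u hu i hi
  exact hu i (by rw [Finset.mem_Icc, ← abs_le]; exact hi)

theorem psi_neg (j : ℕ) (u : ℂ) : psi η τ j (-u) = psi η τ j u := by
  by_cases hj : j = 0
  · simp only [psi, hj, if_true]
  · simp only [psi, hj, if_false]
    rw [show 2 * -u - 2 * j * η = -(2 * u + 2 * j * η) by ring,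
      show 2 * -u + 2 * j * η = -(2 * u - 2 * j * η) by ring, zf_neg, zf_neg]
    ring

theorem psi_add_half (j : ℕ) (u : ℂ) : psi η τ j (u + 1 / 2) = psi η τ j u := by
  by_cases hj : j = 0
  · simp only [psi, hj, if_true]
  · simp only [psi, hj, if_false]
    rw [show 2 * (u + 1 / 2) - 2 * j * η = 2 * u - 2 * j * η + 1 by ring,
      show 2 * (u + 1 / 2) + 2 * j * η = 2 * u + 2 * j * η + 1 by ring, zf_add_one, zf_add_one]

theorem Reg.sub_ne {n j : ℕ} (hjn : j ≤ n) {u : ℂ} (hu : Reg η τ n u) :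
    th τ 0 (2 * u - 2 * j * η) ≠ 0 := by
  have := hu (-j) (by rw [abs_neg, Nat.abs_cast]; exact_mod_cast hjn)
  push_cast at this
  rwa [show 2 * u + 2 * -(j : ℂ) * η = 2 * u - 2 * j * η by ring] at this

theorem Reg.add_ne {n j : ℕ} (hjn : j ≤ n) {u : ℂ} (hu : Reg η τ n u) :
    th τ 0 (2 * u + 2 * j * η) ≠ 0 := by
  simpa using hu j (by rw [Nat.abs_cast]; exact_mod_cast hjn)

theorem psi_add_half_tau (hτ : 0 < τ.im) {n j : ℕ} (hjn : j ≤ n) {u : ℂ}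
    (hu : Reg η τ n u) : psi η τ j (u + τ / 2) = psi η τ j u := by
  by_cases hj : j = 0
  · simp only [psi, hj, if_true]
  · simp only [psi, hj, if_false]
    rw [show 2 * (u + τ / 2) - 2 * j * η = 2 * u - 2 * j * η + τ by ring,
      show 2 * (u + τ / 2) + 2 * j * η = 2 * u + 2 * j * η + τ by ring,
      zf_add_tau hτ (hu.sub_ne hjn), zf_add_tau hτ (hu.add_ne hjn)]
    ring

theorem analyticAt_psi (hτ : 0 < τ.im) {j : ℕ} {x : ℂ} (h1 : th τ 0 (2 * x - 2 * j * η) ≠ 0)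
    (h2 : th τ 0 (2 * x + 2 * j * η) ≠ 0) : AnalyticAt ℂ (psi η τ j) x := by
  by_cases hj : j = 0
  · rw [show psi η τ j = fun _ => 1 from funext fun u => by simp only [psi, hj, if_true]]
    exact analyticAt_const
  · rw [show psi η τ j = fun u => zf τ (2 * u - 2 * j * η) - zf τ (2 * u + 2 * j * η) from
      funext fun u => by simp only [psi, hj, if_false]]
    exact (analyticAt_zf hτ (f := fun u => 2 * u - 2 * j * η) (by fun_prop) h1).sub
      (analyticAt_zf hτ (f := fun u => 2 * u + 2 * j * η) (by fun_prop) h2)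

theorem IsGen.th_zero_two_mul_ne (hη : IsGen η τ) (hτ : 0 < τ.im) {n : ℤ} (hn : n ≠ 0) :
    th τ 0 (2 * n * η) ≠ 0 := by
  have := hη.th_zero_int_ne hτ (n := 2 * n) (by omega)
  push_cast at this
  exact this

/-- The principal part of `psi j` at `j η`. -/
theorem psi_isRem (hτ : 0 < τ.im) (hη : IsGen η τ) {j : ℕ} (hj : j ≠ 0) :
    IsRem (fun u => psi η τ j u - 1 / (2 * (u - j * η))) (j * η) := by
  have h1 : IsRem (fun u => zf τ (2 * u + -(2 * j * η)) - 1 / (2 * u + -(2 * j * η))) (j * η) := by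
    refine IsRem.comp_affine (f := fun x => zf τ x - 1 / x) two_ne_zero ?_
    rw [show 2 * (j * η) + -(2 * j * η) = 0 by ring]
    exact zf_sub_inv_isRem hτ
  have h2 : IsRem (fun u => zf τ (2 * u + 2 * j * η)) (j * η) := by
    refine (analyticAt_zf hτ (by fun_prop) ?_).isRem
    have := hη.th_zero_two_mul_ne hτ (n := 2 * j) (by omega)
    push_cast at this
    rwa [show 2 * (j * η) + 2 * j * η = 2 * (2 * j) * η by ring]
  refine (h1.sub h2).congr (Eventually.of_forall fun u => ?_)
  simp only [psi, hj, if_false]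
  rw [show 2 * u + -(2 * j * η) = 2 * u - 2 * j * η by ring,
    show 2 * (u - j * η) = 2 * u - 2 * j * η by ring]
  ring

theorem IsRem.sub_div {f : ℂ → ℂ} {x : ℂ} (hf : IsRem (fun u => (u - x) * f u) x) {ρ : ℂ}
    (h : Tendsto (fun u => (u - x) * f u) (𝓝[≠] x) (𝓝 ρ)) :
    IsRem (fun u => f u - ρ / (u - x)) x := by
  have h1 : IsRem (fun u => (u - x) * f u - ρ) x := hf.sub (IsRem.const ρ x)
  have h2 : Tendsto (fun u => (u - x) * f u - ρ) (𝓝[≠] x) (𝓝 0) := by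
    simpa using h.sub_const ρ
  refine (h1.div_of_tendsto_zero h2 (g := fun u => u - x) (by fun_prop) (sub_self x) (by
    rw [((hasDerivAt_id' x).sub_const x).deriv]; exact one_ne_zero)).congr ?_
  filter_upwards [self_mem_nhdsWithin] with u hu
  have : u - x ≠ 0 := sub_ne_zero.2 hu
  field_simp

/-- Partial fraction expansion of the coefficient of the identity. -/
theorem exists_pfd (hτ : 0 < τ.im) (hη : IsGen η τ) (hη0 : η ≠ 0) (t : ℂ) {L : List (Fin 4)}
    (hL : IsTriv L) : ∃ a : ℕ → ℂ, ∀ u, Reg η τ L.length u →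
      coef η τ t L 0 u = ∑ j ∈ Finset.range (L.length + 1), a j * psi η τ j u := by
  set n := L.length with hn
  have hρ : ∀ j : ℕ, ∃ ρ, j ≠ 0 →
      Tendsto (fun u => (u - j * η) * coef η τ t L 0 u) (𝓝[≠] (j * η)) (𝓝 ρ) := by
    intro j
    by_cases hj : j = 0
    · exact ⟨0, fun h => absurd hj h⟩
    · obtain ⟨ρ, h⟩ := (coef_zero_isRem_mul hτ hη hη0 t L (j := j)
        (by exact_mod_cast hj)).exists_tendsto
      exact ⟨ρ, fun _ => by simpa using h⟩
  choose ρ hρ using hρ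
  -- Here ρ j is the residue at jη for j ≥ 1, and the factor 2 compensates the principal part 1 /
  -- (2(u - jη)) of `psi j`. It remains to see that E is constant: its singularities are removable
  -- and it has the periods 1/2 and τ/2 where regular.
  set E : ℂ → ℂ := fun u => coef η τ t L 0 u -
    ∑ j ∈ Finset.range n, 2 * ρ (j + 1) * psi η τ (j + 1) u with hE
  have hEeven : ∀ u, E (-u) = E u := by
    intro u
    simp only [hE, psi_neg]
    rw [← coef_neg, neg_neg, neg_zero]
  have hE1 : ∀ u, E (u + 1 / 2) = E u := by
    intro u
    simp only [hE, psi_add_half, coef_add_half, hL.1, one_mul]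
  have hE2 : ∀ u, Reg η τ n u → E (u + τ / 2) = E u := by
    intro u hu
    simp only [hE]
    rw [coef_add_half_tau hη0, hL.2, Int.cast_zero, zero_mul, mul_zero, Complex.exp_zero, one_mul,
      one_mul]
    congr 1
    refine Finset.sum_congr rfl fun j hj => ?_
    rw [psi_add_half_tau hτ (by rw [Finset.mem_range] at hj; omega) hu]
  have hEreg : ∀ x, Reg η τ n x → AnalyticAt ℂ E x := by
    intro x hx
    refine (analyticAt_coef hτ hη L 0 (t := fun _ => t) analyticAt_const analyticAt_id
      fun j hj => hx j hj.le).sub (Finset.analyticAt_fun_sum _ fun j hj => ?_)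
    rw [Finset.mem_range] at hj
    exact analyticAt_const.mul (analyticAt_psi hτ (hx.sub_ne (by omega)) (hx.add_ne (by omega)))
  have hE0 : IsRem E 0 := by
    refine (coef_zero_isRem_zero hτ hη hη0 t L).sub (AnalyticAt.isRem
      (Finset.analyticAt_fun_sum _ fun j hj => analyticAt_const.mul ?_))
    have := hη.th_zero_two_mul_ne hτ (n := j + 1) (by omega)
    push_cast at this
    refine analyticAt_psi hτ ?_ ?_
    · push_cast
      rwa [mul_zero, zero_sub, th_zero_neg, neg_ne_zero]
    · push_cast
      rwa [mul_zero, zero_add]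
  have hEpos : ∀ i : ℕ, i ≠ 0 → i ≤ n → IsRem E (i * η) := by
    intro i hi hin
    obtain ⟨i, rfl⟩ := Nat.exists_eq_succ_of_ne_zero hi
    have h1 := (coef_zero_isRem_mul hτ hη hη0 t L (j := (i.succ : ℕ))
      (by exact_mod_cast hi))
    rw [Int.cast_natCast] at h1
    have h2 := h1.sub_div (hρ _ hi)
    have h3 := (psi_isRem hτ hη hi).const_mul (2 * ρ i.succ)
    have h4 : IsRem (fun u => ∑ j ∈ (Finset.range n).erase i,
        2 * ρ (j + 1) * psi η τ (j + 1) u) (i.succ * η) := by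
      refine AnalyticAt.isRem (Finset.analyticAt_fun_sum _ fun j hj => analyticAt_const.mul ?_)
      rw [Finset.mem_erase] at hj
      refine analyticAt_psi hτ ?_ ?_
      · have := hη.th_zero_two_mul_ne hτ (n := (i : ℤ) - j) (by omega)
        push_cast at this ⊢
        rwa [show 2 * ((i + 1) * η) - 2 * (j + 1) * η = 2 * ((i : ℂ) - j) * η by ring]
      · have := hη.th_zero_two_mul_ne hτ (n := (i : ℤ) + j + 2) (by omega)
        push_cast at this ⊢
        rwa [show 2 * ((i + 1) * η) + 2 * (j + 1) * η = 2 * ((i : ℂ) + j + 2) * η by ring]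
    refine ((h2.sub h3).sub h4).congr (Eventually.of_forall fun u => ?_)
    simp only [hE]
    rw [← Finset.add_sum_erase _ _ (Finset.mem_range.2 (by omega : i < n))]
    simp only [Nat.succ_eq_add_one]
    rw [show (1 : ℂ) / (2 * (u - (i + 1 : ℕ) * η)) = 1 / 2 * (1 / (u - (i + 1 : ℕ) * η)) by
      rw [one_div_mul_one_div]]
    ring
  have hEall : ∀ x, IsRem E x := by
    intro x
    by_cases hx : Reg η τ n x
    · exact (hEreg x hx).isRem
    · simp only [Reg, not_forall, not_not] at hx
      -- Some 2x + 2iη lies in the lattice, so x is congruent to -iη modulo half periods;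
      -- periodicity and evenness of E reduce the claim to the points 0, η, …, nη.
      obtain ⟨i, hi, h0⟩ := hx
      have hw := (th_zero_eq_zero_iff hτ).1 h0
      have hper : IsRem E ((-2 * i * η + (2 * x + 2 * i * η)) / 2) ↔ IsRem E (-2 * i * η / 2) := by
        refine lat_induction (p := fun z => IsRem E (z / 2)) (fun z => ?_) (fun z => ?_) hw _
        · rw [add_div]
          exact isRem_add_iff (fun x => Eventually.of_forall hE1) _
        · rw [add_div]
          exact isRem_add_iff (fun x => (eventually_reg hτ n x).mono hE2) _
      rw [show (-2 * i * η + (2 * x + 2 * i * η)) / 2 = x by ring] at hper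
      rw [hper, show -2 * (i : ℂ) * η / 2 = -(i * η) by ring]
      have hneg : ∀ y, IsRem E y → IsRem E (-y) := by
        intro y hy
        have : IsRem (fun z => E (-z)) (-y) := IsRem.comp_neg (by rwa [neg_neg])
        simpa only [hEeven] using this
      have hnat : ∀ i : ℕ, i ≤ n → IsRem E (i * η) := by
        intro i hin
        by_cases hi0 : i = 0
        · simpa [hi0] using hE0
        · exact hEpos i hi0 hin
      obtain ⟨k, rfl | rfl⟩ := i.eq_nat_or_neg
      · exact hneg _ (by simpa using hnat k (by simpa using hi))
      · have := hnat k (by simpa using hi)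
        push_cast
        rwa [neg_mul, neg_neg]
  obtain ⟨F, hF, hFE, hFc⟩ := exists_entire_of_isRem hEall
  have hshift : ∀ c : ℂ, (∀ x, ∀ᶠ u in 𝓝[≠] x, E (u + c) = E u) → ∀ z, F (z + c) = F z := by
    intro c hc z
    refine eq_of_eventuallyEq_nhdsNE (f := fun z => F (z + c))
      (hF.continuous.comp (by fun_prop)).continuousAt hF.continuous.continuousAt ?_
    filter_upwards [hFE z, (tendsto_add_const_nhdsNE z c).eventually (hFE (z + c)), hc z] with
      w h1 h2 h3
    rw [← h2, h3, h1]
  have hF1 := hshift (1 / 2) fun x => Eventually.of_forall hE1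
  have hF2 := hshift (τ / 2) fun x => (eventually_reg hτ n x).mono hE2
  obtain ⟨c, hc⟩ := eq_const_of_norm_periodic hτ hF
    (fun z => by rw [show z + 1 = z + 1 / 2 + 1 / 2 by ring, hF1, hF1])
    (fun z => by rw [show z + τ = z + τ / 2 + τ / 2 by ring, hF2, hF2])
  refine ⟨fun j => if j = 0 then c else 2 * ρ j, fun u hu => ?_⟩
  have e1 := hFc u (hEreg u hu).continuousAt
  rw [hc] at e1
  rw [Finset.sum_range_succ']
  have e2 : psi η τ 0 u = 1 := if_pos rfl
  simp only [Nat.add_eq_zero_iff, one_ne_zero, and_false, if_false, if_true, e2]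
  simp only [hE] at e1
  linear_combination -e1

theorem exists_reg (hτ : 0 < τ.im) (n : ℕ) : ∃ u, Reg η τ n u :=
  (eventually_reg hτ n 0).exists

/-- For 1 ≤ i ≤ n only `psi i` has a pole at iη, so the residue there determines its coefficient;
what is left is the constant `psi 0`. -/
theorem psi_linearIndependent (hτ : 0 < τ.im) (hη : IsGen η τ) {n : ℕ} {a : ℕ → ℂ}
    (h : ∀ u, Reg η τ n u → ∑ j ∈ Finset.range (n + 1), a j * psi η τ j u = 0) :
    ∀ j ≤ n, a j = 0 := by
  have hpos : ∀ j, j ≠ 0 → j ≤ n → a j = 0 := by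
    intro i hi hin
    have hx : Tendsto (fun u : ℂ => u - i * η) (𝓝[≠] (i * η)) (𝓝 0) := by
      have : Continuous fun u : ℂ => u - i * η := by fun_prop
      have h2 := this.tendsto (i * η)
      rw [sub_self] at h2
      exact h2.mono_left nhdsWithin_le_nhds
    have h0 : ∀ f : ℂ → ℂ, IsRem f (i * η) →
        Tendsto (fun u => (u - i * η) * f u) (𝓝[≠] (i * η)) (𝓝 0) := by
      intro f hf
      obtain ⟨c, hc⟩ := hf.exists_tendsto
      simpa using hx.mul hc
    have h1 := h0 _ ((psi_isRem hτ hη hi).const_mul (a i))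
    have h2 := h0 _ (AnalyticAt.isRem (f := fun u => ∑ j ∈ (Finset.range (n + 1)).erase i,
      a j * psi η τ j u) (Finset.analyticAt_fun_sum _ fun j hj => analyticAt_const.mul (by
        rw [Finset.mem_erase] at hj
        refine analyticAt_psi hτ ?_ ?_
        · have := hη.th_zero_two_mul_ne hτ (n := (i : ℤ) - j) (by omega)
          push_cast at this
          rwa [show 2 * (i * η) - 2 * j * η = 2 * ((i : ℂ) - j) * η by ring]
        · have := hη.th_zero_two_mul_ne hτ (n := (i : ℤ) + j) (by omega)
          push_cast at this
          rwa [show 2 * (i * η) + 2 * j * η = 2 * ((i : ℂ) + j) * η by ring])))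
    have h3 := h1.add h2
    have h4 : Tendsto (fun _ : ℂ => -(a i / 2)) (𝓝[≠] (i * η)) (𝓝 (0 + 0)) := by
      refine h3.congr' ?_
      filter_upwards [eventually_reg hτ n (i * η), self_mem_nhdsWithin] with u hu hne
      have hne' : u - i * η ≠ 0 := sub_ne_zero.2 hne
      have := h u hu
      rw [← Finset.add_sum_erase _ _ (Finset.mem_range.2 (by omega : i < n + 1))] at this
      rw [eq_neg_of_add_eq_zero_right this]
      field_simp
      ring
    have h5 := tendsto_nhds_unique h4 tendsto_const_nhds
    have h6 : a i / 2 = 0 := by linear_combination h5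
    simpa using h6
  intro j hj
  by_cases hj0 : j = 0
  · subst hj0
    obtain ⟨u, hu⟩ := exists_reg (η := η) hτ n
    have := h u hu
    rw [Finset.sum_range_succ', Finset.sum_eq_zero, zero_add] at this
    · simpa [psi] using this
    · intro i hi
      rw [hpos (i + 1) (by omega) (by rw [Finset.mem_range] at hi; omega), zero_mul]
  · exact hpos j hj0 hj

/-- The coefficients of a partial fraction expansion are finite combinations of values. -/
theorem exists_pfdFunctional (hτ : 0 < τ.im) (hη : IsGen η τ) (n j : ℕ) (hj : j ≤ n) :
    ∃ l : ℂ →₀ ℂ, (∀ u ∈ l.support, Reg η τ n u) ∧ ∀ (a : ℕ → ℂ) (f : ℂ → ℂ),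
      (∀ u, Reg η τ n u → f u = ∑ j ∈ Finset.range (n + 1), a j * psi η τ j u) →
      a j = ∑ u ∈ l.support, l u * f u := by
  set r : ℂ → (Fin (n + 1) → ℂ) := fun u i => psi η τ i u with hr
  -- By linear independence no nonzero functional kills all vectors (ψ₀(u), …, ψₙ(u)), so they span.
  -- The j-th unit vector as a finite combination of them expresses a j through values of f, from
  -- which it inherits analyticity and quasi-periodicity in a parameter.
  have htop : Submodule.span ℂ (r '' {u | Reg η τ n u}) = ⊤ := by
    by_contra hne
    obtain ⟨φ, hφ0, hφ⟩ := Submodule.exists_le_ker_of_lt_top _ (lt_top_iff_ne_top.2 hne)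
    refine hφ0 (LinearMap.pi_ext' fun i => LinearMap.ext_ring ?_)
    set b : ℕ → ℂ := fun j => if h : j < n + 1 then φ (Pi.single ⟨j, h⟩ 1) else 0 with hb
    have hφr : ∀ x, φ x = ∑ i : Fin (n + 1), φ (Pi.single i 1) * x i := by
      intro x
      conv_lhs => rw [← Finset.univ_sum_single x]
      rw [map_sum]
      refine Finset.sum_congr rfl fun i _ => ?_
      rw [show Pi.single i (x i) = x i • (Pi.single i (1 : ℂ) : Fin (n + 1) → ℂ) by
        rw [← Pi.single_smul, smul_eq_mul, mul_one], map_smul, smul_eq_mul, mul_comm]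
    have := psi_linearIndependent (η := η) hτ hη (n := n) (a := b) (fun u hu => by
      rw [Finset.sum_range]
      have h0 : φ (r u) = 0 := hφ (Submodule.subset_span ⟨u, hu, rfl⟩)
      rw [hφr] at h0
      rw [← h0]
      refine Finset.sum_congr rfl fun i _ => ?_
      rw [hb]
      simp only [hr]
      rw [dif_pos i.2]) i (by omega)
    simp only [hb] at this
    rw [dif_pos i.2] at this
    simpa using this
  have hmem : (Pi.single ⟨j, by omega⟩ 1 : Fin (n + 1) → ℂ) ∈
      Submodule.span ℂ (r '' {u | Reg η τ n u}) := by rw [htop]; trivial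
  obtain ⟨l, hl, e⟩ := (Finsupp.mem_span_image_iff_linearCombination ℂ).1 hmem
  refine ⟨l, fun u hu => hl hu, fun a f hf => ?_⟩
  have e2 : ∀ i : Fin (n + 1), ∑ u ∈ l.support, l u * psi η τ i u =
      (Pi.single ⟨j, by omega⟩ 1 : Fin (n + 1) → ℂ) i := by
    intro i
    rw [← e, Finsupp.linearCombination_apply, Finsupp.sum, Finset.sum_apply]
    rfl
  have e3 : ∀ u ∈ l.support, l u * f u = ∑ i : Fin (n + 1), a i * (l u * psi η τ i u) := by
    intro u hu
    rw [hf u (hl hu), Finset.sum_range, Finset.mul_sum]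
    exact Finset.sum_congr rfl fun i _ => by ring
  rw [Finset.sum_congr rfl e3, Finset.sum_comm]
  simp only [← Finset.mul_sum, e2]
  rw [Finset.sum_eq_single ⟨j, by omega⟩]
  · simp
  · intro i _ hi; simp [hi]
  · simp

/-! ### The trace formula -/

/-- `θ₁(s η)`, with the value at `s = 0` replaced by `1`. -/
def gz (η τ : ℂ) (s : ℤ) : ℂ := if s = 0 then 1 else th τ 0 (s * η)

theorem gz_ne {η τ : ℂ} (hτ : 0 < τ.im) (hη : IsGen η τ) (s : ℤ) : gz η τ s ≠ 0 := by
  by_cases h : s = 0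
  · simp [gz, h]
  · rw [gz, if_neg h]; exact hη.th_zero_int_ne hτ h

/-- A boundary term of the trace formula; `X` is the end of a string of interpolation points. -/
def bdTerm (η τ t : ℂ) (L : List (Fin 4)) (X : ℂ) (m i : ℕ) : ℂ :=
  coef η τ t L m (X - (i + 1) * η) * (th τ 0 (2 * X - 2 * (i + 1) * η) /
    (th τ 0 (m * η) * th τ 0 (2 * X + (m - 2 * (i + 1)) * η))) *
    ∏ l ∈ Finset.range m, (th τ 0 (t + (l - i) * η) * th τ 0 (2 * X + (l - i - 1) * η) /
      (gz η τ (l - i) * th τ 0 (2 * X - t + (l - i - 1) * η)))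

/-- The sum of the boundary terms at one end of the string of interpolation points. -/
def bdSum (η τ t : ℂ) (L : List (Fin 4)) (X : ℂ) : ℂ :=
  ∑ m ∈ Finset.Icc 1 L.length, ∑ i ∈ Finset.range m, bdTerm η τ t L X m i

theorem sum_Icc_symm (f : ℤ → ℂ) (n : ℕ) :
    ∑ m ∈ Finset.Icc (-(n : ℤ)) n, f m = f 0 + ∑ m ∈ Finset.Icc 1 n, (f m + f (-m)) := by
  induction n with
  | zero => simp
  | succ n ih =>
    have e : Finset.Icc (-((n + 1 : ℕ) : ℤ)) ((n + 1 : ℕ) : ℤ) =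
        insert (-((n : ℤ) + 1)) (insert ((n : ℤ) + 1) (Finset.Icc (-(n : ℤ)) n)) := by
      ext x; simp only [Finset.mem_Icc, Finset.mem_insert]; push_cast; omega
    rw [e, Finset.sum_insert (by simp; omega), Finset.sum_insert (by simp), ih,
      Finset.sum_Icc_succ_top (by omega)]
    push_cast
    ring

/-- Both sides are the product of F over the first K + m indices. This converts products along the
string into products of m factors. -/
theorem prod_range_swap (F : ℕ → ℂ) (K m : ℕ) :
    (∏ i ∈ Finset.range K, F (m + i)) * ∏ l ∈ Finset.range m, F l =
      (∏ i ∈ Finset.range K, F i) * ∏ l ∈ Finset.range m, F (K + l) := by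
  rw [← Finset.prod_range_add, mul_comm, ← Finset.prod_range_add, add_comm]

/-- The interpolation function of a string of points, evaluated at a shifted point. -/
def strLagr (η τ v : ℂ) (K j : ℕ) (y : ℂ) : ℂ :=
  ∏ i ∈ (Finset.range K).erase j, dd τ y (v + i * η) / dd τ (v + j * η) (v + i * η)

theorem lagr_string (η τ v : ℂ) (K : ℕ) (j : Fin K) (y : ℂ) :
    lagr τ (fun i : Fin K => v + (i : ℕ) * η) j y = strLagr η τ v K j y := by
  have : (Finset.range K).erase (j : ℕ) = (Finset.univ.erase j).map Fin.valEmbedding := by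
    rw [Finset.map_erase, Fin.map_valEmbedding_univ, Nat.Iio_eq_range]; rfl
  rw [lagr, strLagr, this, Finset.prod_map]
  rfl

/-- The points -(v + iη) form, in reverse order, the string starting at η - Kη - v, and `dd` is even
in both arguments. -/
theorem strLagr_reflect (η τ v : ℂ) {K j : ℕ} (hj : j < K) (y : ℂ) :
    strLagr η τ v K j (-y) = strLagr η τ (η - K * η - v) K (K - 1 - j) y := by
  rw [strLagr, strLagr]
  have key : ∀ i, i < K → η - K * η - v + ((K - 1 - i : ℕ) : ℂ) * η = -(v + i * η) := by
    intro i hi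
    have : ((K - 1 - i : ℕ) : ℂ) = K - 1 - i := by
      rw [Nat.cast_sub (by omega), Nat.cast_sub (by omega)]; simp
    rw [this]; ring
  refine Finset.prod_nbij' (fun i => K - 1 - i) (fun i => K - 1 - i) ?_ ?_ ?_ ?_ ?_
  · intro i hi; rw [Finset.mem_erase, Finset.mem_range] at hi ⊢; omega
  · intro i hi; rw [Finset.mem_erase, Finset.mem_range] at hi ⊢; omega
  · intro i hi; rw [Finset.mem_erase, Finset.mem_range] at hi; omega
  · intro i hi; rw [Finset.mem_erase, Finset.mem_range] at hi; omega
  · intro i hi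
    rw [Finset.mem_erase, Finset.mem_range] at hi
    rw [key i hi.2, key j hj, dd_neg, dd_neg, dd_neg_right, dd_neg_right]

section
variable {η τ : ℂ} (hτ : 0 < τ.im) (hη : IsGen η τ) (L : List (Fin 4))

/-- For j + m < K the shifted point is another node. -/
theorem strLagr_eq_zero (v : ℂ) {K j m : ℕ} (hm : m ≠ 0) (h : j + m < K) :
    strLagr η τ v K j (v + j * η + m * η) = 0 := by
  refine Finset.prod_eq_zero (i := j + m) ?_ ?_
  · rw [Finset.mem_erase, Finset.mem_range]; omega
  · push_cast
    rw [show v + j * η + m * η = v + (j + m) * η by ring, dd_self, zero_div]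

-- Each factor is a quotient of values of E and G whose indices differ by m, so by `prod_range_swap`
-- all but m factors cancel. After that K occurs only through Kη, and the formula makes sense for
-- every t. The convention that `gz` is 1 at index 0 allows the excluded node to be inserted into
-- the product and removed again.
include hτ hη in
theorem strLagr_eq_prod {v : ℂ} (hv : ∀ s : ℤ, th τ 0 (2 * v + s * η) ≠ 0) {K m i : ℕ}
    (hm : i < m) (hi : i < K) :
    strLagr η τ v K (K - 1 - i) (v + ((K - 1 - i : ℕ) : ℂ) * η + m * η) =
      th τ 0 (2 * (v + K * η) - 2 * (i + 1) * η) /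
        (th τ 0 (m * η) * th τ 0 (2 * (v + K * η) + (m - 2 * (i + 1)) * η)) *
      ∏ l ∈ Finset.range m, (th τ 0 (K * η + (l - i) * η) *
        th τ 0 (2 * (v + K * η) + (l - i - 1) * η) /
        (gz η τ (l - i) * th τ 0 (2 * (v + K * η) - K * η + (l - i - 1) * η))) := by
  obtain ⟨j, rfl⟩ : ∃ j, K = i + 1 + j := ⟨K - 1 - i, by omega⟩
  rw [show i + 1 + j - 1 - i = j by omega]
  set K := i + 1 + j with hK
  have hKc : (K : ℂ) = i + 1 + j := by rw [hK]; push_cast; ring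
  set E : ℕ → ℂ := fun s => th τ 0 (2 * v + (j + s : ℕ) * η) with hE
  set G : ℕ → ℂ := fun s => gz η τ ((s : ℤ) - i) with hG
  have hEne : ∀ s, E s ≠ 0 := fun s => by have := hv (j + s : ℕ); rwa [Int.cast_natCast] at this
  have hGne : ∀ s, G s ≠ 0 := fun s => gz_ne hτ hη _
  have hGth : ∀ s, s ≠ i → G s = th τ 0 (((s : ℂ) - i) * η) := by
    intro s hs
    simp only [hG]
    rw [gz, if_neg (by omega)]; push_cast; rfl
  have e1 : th τ 0 (2 * (v + K * η) - 2 * (i + 1) * η) = E j := by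
    simp only [hE]; rw [hKc]; congr 1; push_cast; ring
  have e2 : th τ 0 (m * η) = G (m + i) := by
    rw [hGth _ (by omega)]; congr 1; push_cast; ring
  have e3 : th τ 0 (2 * (v + K * η) + (m - 2 * (i + 1)) * η) = E (m + j) := by
    simp only [hE]; rw [hKc]; congr 1; push_cast; ring
  have e4 : ∀ l : ℕ, th τ 0 (K * η + (l - i) * η) = G (K + l) := by
    intro l
    rw [hGth _ (by omega)]; congr 1; push_cast; ring
  have e5 : ∀ l : ℕ, th τ 0 (2 * (v + K * η) + (l - i - 1) * η) = E (K + l) := by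
    intro l
    simp only [hE]; rw [hKc]; congr 1; push_cast; rw [hKc]; ring
  have e6 : ∀ l : ℕ, th τ 0 (2 * (v + K * η) - K * η + (l - i - 1) * η) = E l := by
    intro l
    simp only [hE]; rw [hKc]; congr 1; push_cast; ring
  have e7 : ∀ l : ℕ, gz η τ ((l : ℤ) - i) = G l := fun l => rfl
  simp only [e4, e5, e6, e7]
  rw [e1, e2, e3]
  set f : ℕ → ℂ := fun a => E (m + a) * G (m + (K - 1 - a)) / (E a * G (K - 1 - a)) with hf
  have hfac : ∀ a ∈ (Finset.range K).erase j,
      dd τ (v + j * η + m * η) (v + a * η) / dd τ (v + j * η) (v + a * η) = f a := by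
    intro a ha
    rw [Finset.mem_erase, Finset.mem_range] at ha
    have hc : ((K - 1 - a : ℕ) : ℂ) = i + j - a := by
      rw [Nat.cast_sub (by omega), Nat.cast_sub (by omega), hKc]; push_cast; ring
    simp only [hf, dd, hE]
    rw [hGth _ (by omega), hGth _ (by omega)]
    push_cast
    rw [hc]
    ring_nf
  rw [strLagr, Finset.prod_congr rfl hfac]
  have hj : j ∈ Finset.range K := Finset.mem_range.2 (by omega)
  have hmul := Finset.mul_prod_erase (Finset.range K) f hj
  have hfj : f j = E (m + j) * G (m + i) / E j := by
    have h0 : G i = 1 := by simp only [hG]; rw [sub_self, gz, if_pos rfl]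
    simp only [hf]
    rw [show K - 1 - j = i by omega, h0, mul_one]
  have hprod : ∏ a ∈ Finset.range K, f a =
      ∏ l ∈ Finset.range m, G (K + l) * E (K + l) / (G l * E l) := by
    have h1 := prod_range_swap E K m
    have h2 := prod_range_swap G K m
    have r1 := Finset.prod_range_reflect (fun a => G (m + a)) K
    have r2 := Finset.prod_range_reflect G K
    simp only [hf, Finset.prod_div_distrib, Finset.prod_mul_distrib, r1, r2]
    have p := fun (s : Finset ℕ) => Finset.prod_ne_zero_iff.2 (fun a (_ : a ∈ s) => hEne a)
    have q := fun (s : Finset ℕ) => Finset.prod_ne_zero_iff.2 (fun a (_ : a ∈ s) => hGne a)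
    rw [div_eq_div_iff (mul_ne_zero (p _) (q _)) (mul_ne_zero (q _) (p _))]
    linear_combination (∏ i ∈ Finset.range K, G (m + i)) * (∏ l ∈ Finset.range m, G l) * h1 +
      (∏ i ∈ Finset.range K, E i) * (∏ l ∈ Finset.range m, E (K + l)) * h2
  rw [← hprod, ← hmul, hfj]
  have a1 := hEne j
  have a2 := hEne (m + j)
  have a3 := hGne (m + i)
  field_simp

-- Reversing the index lets i count from the upper end; the shift by m leaves the string only for i
-- < m. If K ≤ i < m there is no such node, but the boundary term then contains θ₁(0), so the range
-- i < m serves for every K.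
include hτ hη in
theorem sum_upper {v : ℂ} (hv : ∀ s : ℤ, th τ 0 (2 * v + s * η) ≠ 0) (K : ℕ) {m : ℕ}
    (hm : m ≠ 0) :
    ∑ j ∈ Finset.range K, coef η τ (K * η) L m (v + j * η) *
        strLagr η τ v K j (v + j * η + m * η) =
      ∑ i ∈ Finset.range m, bdTerm η τ (K * η) L (v + K * η) m i := by
  rw [← Finset.sum_range_reflect]
  rw [← Finset.sum_subset (s₁ := Finset.range (min K m)) (s₂ := Finset.range K),
    ← Finset.sum_subset (s₁ := Finset.range (min K m)) (s₂ := Finset.range m)]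
  · refine Finset.sum_congr rfl fun i hi => ?_
    rw [Finset.mem_range, lt_min_iff] at hi
    rw [strLagr_eq_prod hτ hη hv hi.2 hi.1, bdTerm, ← mul_assoc]
    congr 3
    rw [Nat.cast_sub (by omega), Nat.cast_sub (by omega)]
    push_cast; ring
  · intro i hi; rw [Finset.mem_range] at hi ⊢; omega
  · intro i hi hi2
    rw [Finset.mem_range] at hi hi2
    rw [bdTerm, Finset.prod_eq_zero (i := i - K) (Finset.mem_range.2 (by omega)), mul_zero]
    rw [Nat.cast_sub (by omega), show (K : ℂ) * η + ((i : ℂ) - K - i) * η = 0 by ring, th_zero_zero,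
      zero_mul, zero_div]
  · intro i hi; rw [Finset.mem_range] at hi ⊢; omega
  · intro i hi hi2
    rw [Finset.mem_range] at hi hi2
    rw [strLagr_eq_zero _ hm (by omega), mul_zero]

/-- At each node the word is applied to the Lagrange function of that node. The shift 0 gives the
bulk; positive shifts leave the string at its upper end; negative shifts are positive shifts for the
reflected string, whose upper end is η - v. -/
theorem trace_word (k : ℕ) {v : ℂ} (hv : ∀ s : ℤ, th τ 0 (2 * v + s * η) ≠ 0) :
    LinearMap.trace ℂ (V τ k) (seriesRep hτ hη k (word η τ L)) =
      ∑ j ∈ Finset.range (k + 1), coef η τ ((k + 1) * η) L 0 (v + j * η) +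
        bdSum η τ ((k + 1) * η) L (v + (k + 1) * η) + bdSum η τ ((k + 1) * η) L (η - v) := by
  have hint : ∀ s : ℤ, s ≠ 0 → th τ 0 (s * η) ≠ 0 := fun s hs => hη.th_zero_int_ne hτ hs
  have h1 : ∀ i j : Fin (k + 1), i ≠ j →
      th τ 0 ((v + (i : ℕ) * η) - (v + (j : ℕ) * η)) ≠ 0 := by
    intro i j hij
    have := hint ((i : ℕ) - (j : ℕ) : ℤ) (by
      have : (i : ℕ) ≠ j := fun h => hij (Fin.ext h)
      omega)
    push_cast at this
    rwa [show (v + (i : ℕ) * η) - (v + (j : ℕ) * η) = ((i : ℕ) - (j : ℕ) : ℂ) * η by ring]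
  have h2 : ∀ i j : Fin (k + 1), th τ 0 ((v + (i : ℕ) * η) + (v + (j : ℕ) * η)) ≠ 0 := by
    intro i j
    have := hv ((i : ℕ) + (j : ℕ) : ℤ)
    push_cast at this
    rwa [show (v + (i : ℕ) * η) + (v + (j : ℕ) * η) = 2 * v + ((i : ℕ) + (j : ℕ) : ℂ) * η by ring]
  rw [trace_eq_sum_lagr hτ (k := k) (u := fun i : Fin (k + 1) => v + (i : ℕ) * η)
    (Fintype.card_fin _) h1 h2]
  set t : ℂ := (k + 1) * η with ht
  set n := L.length with hn
  have hterm : ∀ j : Fin (k + 1), (seriesRep hτ hη k (word η τ L)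
      ⟨lagr τ (fun i : Fin (k + 1) => v + (i : ℕ) * η) j,
        lagr_mem hτ (Fintype.card_fin _) j⟩ : ℂ → ℂ) (v + (j : ℕ) * η) =
      coef η τ t L 0 (v + (j : ℕ) * η) + ∑ m ∈ Finset.Icc 1 n,
        (coef η τ t L m (v + (j : ℕ) * η) *
          strLagr η τ v (k + 1) j (v + (j : ℕ) * η + m * η) +
        coef η τ t L m (-(v + (j : ℕ) * η)) *
          strLagr η τ v (k + 1) j (-(-(v + (j : ℕ) * η) + m * η))) := by
    intro j
    rw [seriesRep_word_apply hτ hη k L _ (fun s => by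
      have := hv (2 * (j : ℕ) + 2 * s)
      push_cast at this
      rwa [show 2 * (v + (j : ℕ) * η) + 2 * s * η = 2 * v + (2 * (j : ℕ) + 2 * s) * η by ring]),
      wordOp_eq_sum, sum_Icc_symm]
    congr 1
    · show _ * lagr τ _ j _ = _
      rw [Int.cast_zero, zero_mul, add_zero, lagr_self h1 h2, mul_one]
    · refine Finset.sum_congr rfl fun m _ => ?_
      congr 1
      · show _ * lagr τ _ j _ = _
        rw [lagr_string, Int.cast_natCast]
      · show _ * lagr τ _ j _ = _
        rw [lagr_string, ← coef_neg η τ t L m, neg_neg]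
        congr 2
        push_cast; ring
  rw [Finset.sum_congr rfl fun j _ => hterm j, Finset.sum_add_distrib, add_assoc]
  congr 1
  · exact (Finset.sum_range fun j => coef η τ t L 0 (v + (j : ℕ) * η)).symm
  · rw [Finset.sum_comm, bdSum, bdSum, ← Finset.sum_add_distrib]
    refine Finset.sum_congr rfl fun m hm => ?_
    rw [Finset.mem_Icc] at hm
    rw [Finset.sum_add_distrib]
    have hK : ((k + 1 : ℕ) : ℂ) * η = t := by rw [ht]; push_cast; ring
    congr 1
    · have := sum_upper hτ hη L hv (k + 1) (m := m) (by omega)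
      rw [hK, Finset.sum_range] at this
      exact this
    · have hv' : ∀ s : ℤ, th τ 0 (2 * (η - t - v) + s * η) ≠ 0 := by
        intro s
        have := hv (2 * k - s)
        push_cast at this
        rwa [← neg_ne_zero, ← th_zero_neg, show -(2 * (η - t - v) + s * η) = 2 * v + (2 * k - s) * η
          by rw [ht]; ring]
      have := sum_upper hτ hη L hv' (k + 1) (m := m) (by omega)
      rw [hK, show η - t - v + t = η - v by ring, ← Finset.sum_range_reflect,
        Finset.sum_range] at this
      rw [← this]
      refine Finset.sum_congr rfl fun j _ => ?_
      rw [strLagr_reflect η τ v j.2, hK]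
      have hc : ((k + 1 - 1 - (j : ℕ) : ℕ) : ℂ) = k - (j : ℕ) := by
        rw [Nat.cast_sub (by omega)]; simp
      rw [hc, show η - t - v + (k - (j : ℕ)) * η = -(v + (j : ℕ) * η) by rw [ht]; ring]

end

variable {η τ : ℂ}

/-! ### Transformation of the boundary terms -/

theorem bdSum_t_add_one {L : List (Fin 4)} (hL : IsTriv L) (t X : ℂ) :
    bdSum η τ (t + 1) L X = (-1) ^ L.length * bdSum η τ t L X := by
  rw [bdSum, bdSum, Finset.mul_sum]
  refine Finset.sum_congr rfl fun m _ => ?_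
  rw [Finset.mul_sum]
  refine Finset.sum_congr rfl fun i _ => ?_
  rw [bdTerm, bdTerm, coef_t_add_one, hL.prod_sgn1, ← mul_assoc, ← mul_assoc]
  congr 1
  refine Finset.prod_congr rfl fun l _ => ?_
  rw [show t + 1 + ((l : ℂ) - i) * η = t + (l - i) * η + 1 by ring,
    show 2 * X - (t + 1) + ((l : ℂ) - i - 1) * η = 2 * X - t + (l - i - 1) * η - 1 by ring,
    th_add_one, th_sub_one, sgn1_zero]
  rw [mul_left_comm (gz η τ (l - i)), mul_assoc (-1 : ℂ), mul_div_mul_left _ _ (by norm_num)]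

theorem sum_range_linear (m : ℕ) (a b : ℂ) :
    ∑ l ∈ Finset.range m, (a + b * l) = m * a + b * (m * (m - 1) / 2) := by
  induction m with
  | zero => simp
  | succ m ih => rw [Finset.sum_range_succ, ih]; push_cast; ring

theorem prod_range_exp (m : ℕ) (a b : ℂ) (f : ℕ → ℂ) :
    ∏ l ∈ Finset.range m, (exp (a + b * l) * f l) =
      exp (m * a + b * (m * (m - 1) / 2)) * ∏ l ∈ Finset.range m, f l := by
  rw [Finset.prod_mul_distrib, ← Complex.exp_sum, sum_range_linear]

/-- The exponents of the m multipliers in the product form an arithmetic progression, and their sum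
cancels the quadratic exponent from `coef_t_add_tau`. -/
theorem bdSum_t_add_tau (hη0 : η ≠ 0) {L : List (Fin 4)} (hL : IsTriv L) (t X : ℂ) :
    bdSum η τ (t + τ) L X =
      (-exp (-(Real.pi * I * (τ + 2 * t)))) ^ L.length * bdSum η τ t L X := by
  rw [bdSum, bdSum, Finset.mul_sum]
  refine Finset.sum_congr rfl fun m _ => ?_
  rw [Finset.mul_sum]
  refine Finset.sum_congr rfl fun i _ => ?_
  have key : ∏ l ∈ Finset.range m, (th τ 0 (t + τ + (l - i) * η) *
      th τ 0 (2 * X + (l - i - 1) * η) /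
      (gz η τ (l - i) * th τ 0 (2 * X - (t + τ) + (l - i - 1) * η))) =
      exp (m * (2 * Real.pi * I * ((2 * i + 1) * η - 2 * X)) +
        -4 * Real.pi * I * η * (m * (m - 1) / 2)) *
      ∏ l ∈ Finset.range m, (th τ 0 (t + (l - i) * η) * th τ 0 (2 * X + (l - i - 1) * η) /
      (gz η τ (l - i) * th τ 0 (2 * X - t + (l - i - 1) * η))) := by
    rw [← prod_range_exp]
    refine Finset.prod_congr rfl fun l _ => ?_
    rw [show t + τ + ((l : ℂ) - i) * η = t + (l - i) * η + τ by ring,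
      show 2 * X - (t + τ) + ((l : ℂ) - i - 1) * η = 2 * X - t + (l - i - 1) * η - τ by ring,
      th_add_tau, th_sub_tau, sgnTau_zero]
    have e : exp (-(Real.pi * I * (τ + 2 * (t + (l - i) * η)))) =
        exp (Real.pi * I * (2 * (2 * X - t + (l - i - 1) * η) - τ)) *
        exp (2 * Real.pi * I * ((2 * i + 1) * η - 2 * X) + -4 * Real.pi * I * η * l) := by
      rw [← Complex.exp_add]; congr 1; ring
    rw [e]
    have h := Complex.exp_ne_zero (Real.pi * I * (2 * (2 * X - t + (l - i - 1) * η) - τ))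
    generalize exp (Real.pi * I * (2 * (2 * X - t + (l - i - 1) * η) - τ)) = E at *
    rw [← mul_div_mul_left _ (gz η τ (l - i) * th τ 0 (2 * X - t + (l - i - 1) * η))
      (mul_ne_zero (neg_ne_zero.2 one_ne_zero) h), ← mul_div_assoc]
    congr 1 <;> ring
  rw [bdTerm, bdTerm, coef_t_add_tau hη0, hL.prod_sgnTau, key, neg_pow (exp _)]
  have e : exp (2 * Real.pi * I * (2 * (X - (i + 1) * η) * (m : ℤ) + (m : ℤ) ^ 2 * η)) *
      exp (m * (2 * Real.pi * I * ((2 * i + 1) * η - 2 * X)) +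
        -4 * Real.pi * I * η * (m * (m - 1) / 2)) = 1 := by
    rw [← Complex.exp_add, ← Complex.exp_zero]; congr 1; push_cast; ring
  generalize exp (2 * Real.pi * I * (2 * (X - (i + 1) * η) * (m : ℤ) + (m : ℤ) ^ 2 * η)) = E1 at *
  generalize exp (m * (2 * Real.pi * I * ((2 * i + 1) * η - 2 * X)) +
        -4 * Real.pi * I * η * (m * (m - 1) / 2)) = E2 at *
  generalize (∏ l ∈ Finset.range m, (th τ 0 (t + (l - i) * η) * th τ 0 (2 * X + (l - i - 1) * η) /
      (gz η τ (l - i) * th τ 0 (2 * X - t + (l - i - 1) * η)))) = P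
  generalize (th τ 0 (2 * X - 2 * (i + 1) * η) /
    (th τ 0 (m * η) * th τ 0 (2 * X + (m - 2 * (i + 1)) * η))) = Q
  linear_combination ((-1) ^ L.length * exp (-(Real.pi * I * (τ + 2 * t))) ^ L.length *
    coef η τ t L m (X - (i + 1) * η) * P * Q) * e

theorem bdSum_X_add_half {L : List (Fin 4)} (hL : IsTriv L) (t X : ℂ) :
    bdSum η τ t L (X + 1 / 2) = bdSum η τ t L X := by
  refine Finset.sum_congr rfl fun m _ => Finset.sum_congr rfl fun i _ => ?_
  rw [bdTerm, bdTerm, show X + 1 / 2 - (i + 1) * η = X - (i + 1) * η + 1 / 2 by ring,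
    coef_add_half, hL.1, one_mul,
    show 2 * (X + 1 / 2) - 2 * (i + 1) * η = 2 * X - 2 * (i + 1) * η + 1 by ring,
    show 2 * (X + 1 / 2) + (m - 2 * (i + 1)) * η = 2 * X + (m - 2 * (i + 1)) * η + 1 by ring,
    th_add_one, th_add_one, sgn1_zero, mul_left_comm (th τ 0 (m * η)),
    mul_div_mul_left _ _ (neg_ne_zero.2 one_ne_zero)]
  congr 1
  refine Finset.prod_congr rfl fun l _ => ?_
  rw [show 2 * (X + 1 / 2) + (l - i - 1) * η = 2 * X + (l - i - 1) * η + 1 by ring,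
    show 2 * (X + 1 / 2) - t + (l - i - 1) * η = 2 * X - t + (l - i - 1) * η + 1 by ring,
    th_add_one, th_add_one, sgn1_zero, mul_left_comm (gz η τ (l - i)),
    mul_left_comm (th τ 0 (t + (l - i) * η)), mul_div_mul_left _ _ (neg_ne_zero.2 one_ne_zero)]

/-- The multipliers of the coefficient, of the single quotient and of the product over l multiply to
1. -/
theorem bdSum_X_add_half_tau (hη0 : η ≠ 0) {L : List (Fin 4)} (hL : IsTriv L) (t X : ℂ) :
    bdSum η τ t L (X + τ / 2) = bdSum η τ t L X := by
  refine Finset.sum_congr rfl fun m _ => Finset.sum_congr rfl fun i _ => ?_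
  have key : ∏ l ∈ Finset.range m, (th τ 0 (t + (l - i) * η) *
      th τ 0 (2 * (X + τ / 2) + (l - i - 1) * η) /
      (gz η τ (l - i) * th τ 0 (2 * (X + τ / 2) - t + (l - i - 1) * η))) =
      exp (m * (-2 * Real.pi * I * t) + 0 * (m * (m - 1) / 2)) *
      ∏ l ∈ Finset.range m, (th τ 0 (t + (l - i) * η) * th τ 0 (2 * X + (l - i - 1) * η) /
      (gz η τ (l - i) * th τ 0 (2 * X - t + (l - i - 1) * η))) := by
    rw [← prod_range_exp]
    refine Finset.prod_congr rfl fun l _ => ?_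
    rw [show 2 * (X + τ / 2) + (l - i - 1) * η = 2 * X + (l - i - 1) * η + τ by ring,
      show 2 * (X + τ / 2) - t + (l - i - 1) * η = 2 * X - t + (l - i - 1) * η + τ by ring,
      th_add_tau, th_add_tau, sgnTau_zero]
    have e : exp (-(Real.pi * I * (τ + 2 * (2 * X + (l - i - 1) * η)))) =
        exp (-(Real.pi * I * (τ + 2 * (2 * X - t + (l - i - 1) * η)))) *
        exp (-2 * Real.pi * I * t + 0 * l) := by
      rw [← Complex.exp_add]; congr 1; ring
    rw [e]
    have h := Complex.exp_ne_zero (-(Real.pi * I * (τ + 2 * (2 * X - t + (l - i - 1) * η))))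
    generalize exp (-(Real.pi * I * (τ + 2 * (2 * X - t + (l - i - 1) * η)))) = E at *
    rw [← mul_div_mul_left _ (gz η τ (l - i) * th τ 0 (2 * X - t + (l - i - 1) * η))
      (mul_ne_zero (neg_ne_zero.2 one_ne_zero) h), ← mul_div_assoc]
    congr 1 <;> ring
  have k2 : th τ 0 (2 * (X + τ / 2) - 2 * (i + 1) * η) /
      (th τ 0 (m * η) * th τ 0 (2 * (X + τ / 2) + (m - 2 * (i + 1)) * η)) =
      exp (2 * Real.pi * I * (m * η)) * (th τ 0 (2 * X - 2 * (i + 1) * η) /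
      (th τ 0 (m * η) * th τ 0 (2 * X + (m - 2 * (i + 1)) * η))) := by
    rw [show 2 * (X + τ / 2) - 2 * (i + 1) * η = 2 * X - 2 * (i + 1) * η + τ by ring,
      show 2 * (X + τ / 2) + (m - 2 * (i + 1)) * η = 2 * X + (m - 2 * (i + 1)) * η + τ by ring,
      th_add_tau, th_add_tau, sgnTau_zero]
    have e : exp (-(Real.pi * I * (τ + 2 * (2 * X - 2 * (i + 1) * η)))) =
        exp (-(Real.pi * I * (τ + 2 * (2 * X + (m - 2 * (i + 1)) * η)))) *
        exp (2 * Real.pi * I * (m * η)) := by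
      rw [← Complex.exp_add]; congr 1; ring
    rw [e]
    have h := Complex.exp_ne_zero (-(Real.pi * I * (τ + 2 * (2 * X + (m - 2 * (i + 1)) * η))))
    generalize exp (-(Real.pi * I * (τ + 2 * (2 * X + (m - 2 * (i + 1)) * η)))) = E at *
    rw [← mul_div_mul_left _ (th τ 0 (m * η) * th τ 0 (2 * X + (m - 2 * (i + 1)) * η))
      (mul_ne_zero (neg_ne_zero.2 one_ne_zero) h), ← mul_div_assoc]
    congr 1 <;> ring
  rw [bdTerm, bdTerm, show X + τ / 2 - (i + 1) * η = X - (i + 1) * η + τ / 2 by ring,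
    coef_add_half_tau hη0, hL.2, one_mul, key, k2]
  have e : exp (2 * Real.pi * I * ((m : ℤ) * (t - η))) * exp (2 * Real.pi * I * (m * η)) *
      exp (m * (-2 * Real.pi * I * t) + 0 * (m * (m - 1) / 2)) = 1 := by
    rw [← Complex.exp_add, ← Complex.exp_add, ← Complex.exp_zero]; congr 1; push_cast; ring
  generalize exp (2 * Real.pi * I * ((m : ℤ) * (t - η))) = E1 at *
  generalize exp (2 * Real.pi * I * (m * η)) = E2 at *
  generalize exp (m * (-2 * Real.pi * I * t) + 0 * (m * (m - 1) / 2)) = E3 at *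
  generalize (∏ l ∈ Finset.range m, (th τ 0 (t + (l - i) * η) * th τ 0 (2 * X + (l - i - 1) * η) /
      (gz η τ (l - i) * th τ 0 (2 * X - t + (l - i - 1) * η)))) = P
  generalize (th τ 0 (2 * X - 2 * (i + 1) * η) /
    (th τ 0 (m * η) * th τ 0 (2 * X + (m - 2 * (i + 1)) * η))) = Q
  linear_combination (coef η τ t L m (X - (i + 1) * η) * P * Q) * e

/-- The boundary terms for the distinguished string. -/
theorem bdSum_center {t : ℂ} (h : ∀ s : ℤ, th τ 0 (t + s * η) ≠ 0) (L : List (Fin 4)) :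
    bdSum η τ t L (t + η / 2) = ∑ m ∈ Finset.Icc 1 L.length, ∑ i ∈ Finset.range m,
      coef η τ t L m (t + η / 2 - (i + 1) * η) * (th τ 0 (2 * (t + η / 2) - 2 * (i + 1) * η) /
      (th τ 0 (m * η) * th τ 0 (2 * (t + η / 2) + (m - 2 * (i + 1)) * η))) *
      ∏ l ∈ Finset.range m, (th τ 0 (2 * (t + η / 2) + (l - i - 1) * η) / gz η τ (l - i)) := by
  refine Finset.sum_congr rfl fun m _ => Finset.sum_congr rfl fun i _ => ?_
  rw [bdTerm]
  congr 1
  refine Finset.prod_congr rfl fun l _ => ?_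
  have := h (l - i)
  push_cast at this
  rw [show 2 * (t + η / 2) - t + (l - i - 1) * η = t + (l - i) * η by ring]
  rw [mul_comm (gz η τ (l - i)), mul_div_mul_left _ _ this]

/-- At X = t + η/2 numerators and denominators contain the same t-dependent theta values; replacing
t by t + 1/2 changes each quotient only by a sign. The total sign (-1)^m is harmless, since for even
length the coefficients with odd m vanish. -/
theorem bdSum_perm1 (hθ : ∀ α, th τ α η ≠ 0) {L : List (Fin 4)} (hL : IsTriv L)
    (hn : Even L.length) {t : ℂ} (h : ∀ s : ℤ, th τ 0 (t + s * η) ≠ 0)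
    (h' : ∀ s : ℤ, th τ 0 (t + 1 / 2 + s * η) ≠ 0) :
    (L.map (scal1 η τ)).prod * bdSum η τ (t + 1 / 2) (L.map perm1) (t + 1 / 2 + η / 2) =
      bdSum η τ t L (t + η / 2) := by
  have hL' := (isTriv_map_perm1 hn).2 hL
  rw [show t + 1 / 2 + η / 2 = t + η / 2 + 1 / 2 by ring, bdSum_X_add_half hL', bdSum_center h,
    bdSum, Finset.mul_sum, List.length_map]
  refine Finset.sum_congr rfl fun m hm => ?_
  rw [Finset.mul_sum]
  refine Finset.sum_congr rfl fun i _ => ?_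
  rw [bdTerm, mul_assoc, ← mul_assoc, coef_perm1 hθ, hL.prod_sgn1, hn.neg_one_pow, one_mul]
  by_cases hmn : Even m
  · have : ∀ l ∈ Finset.range m, th τ 0 (t + 1 / 2 + (l - i) * η) *
        th τ 0 (2 * (t + η / 2) + (l - i - 1) * η) /
        (gz η τ (l - i) * th τ 0 (2 * (t + η / 2) - (t + 1 / 2) + (l - i - 1) * η)) =
        -1 * (th τ 0 (2 * (t + η / 2) + (l - i - 1) * η) / gz η τ (l - i)) := by
      intro l _
      have := h' (l - i)
      push_cast at this
      rw [show 2 * (t + η / 2) - (t + 1 / 2) + (l - i - 1) * η = t + 1 / 2 + (l - i) * η - 1 by ring,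
        th_sub_one, sgn1_zero]
      generalize th τ 0 (t + 1 / 2 + (l - i) * η) = A at *
      rw [show gz η τ (l - i) * (-1 * A) = (-A) * gz η τ (l - i) by ring,
        show A * th τ 0 (2 * (t + η / 2) + (l - i - 1) * η) =
          (-A) * (-1 * th τ 0 (2 * (t + η / 2) + (l - i - 1) * η)) by ring,
        mul_div_mul_left _ _ (neg_ne_zero.2 this), mul_div_assoc]
    rw [Finset.prod_congr rfl this, Finset.prod_mul_distrib, Finset.prod_const, Finset.card_range,
      hmn.neg_one_pow, one_mul]
    ring
  · rw [coef_eq_zero_of_odd]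
    · simp
    · rw [Nat.not_even_iff_odd] at hmn
      exact (by exact_mod_cast hmn.add_even hn)

/-- As for `bdSum_perm1`, but the theta values now differ by a shift by τ, and the resulting
exponentials cancel the gauge factor in `coef_perm3`. -/
theorem bdSum_perm3 (hη0 : η ≠ 0) (hθ : ∀ α, th τ α η ≠ 0) {L : List (Fin 4)} (hL : IsTriv L)
    (hn : Even L.length) {t : ℂ} (h : ∀ s : ℤ, th τ 0 (t + s * η) ≠ 0)
    (h' : ∀ s : ℤ, th τ 0 (t + τ / 2 + s * η) ≠ 0) :
    (L.map (scal3 η τ)).prod * bdSum η τ (t + τ / 2) (L.map perm3) (t + τ / 2 + η / 2) =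
      (I * exp (-(Real.pi * I * (t + τ / 4)))) ^ L.length * bdSum η τ t L (t + η / 2) := by
  have hL' := (isTriv_map_perm3 hn).2 hL
  rw [show t + τ / 2 + η / 2 = t + η / 2 + τ / 2 by ring, bdSum_X_add_half_tau hη0 hL',
    bdSum_center h, bdSum, Finset.mul_sum, List.length_map, Finset.mul_sum]
  refine Finset.sum_congr rfl fun m hm => ?_
  rw [Finset.mul_sum, Finset.mul_sum]
  refine Finset.sum_congr rfl fun i _ => ?_
  rw [bdTerm, mul_assoc, ← mul_assoc (L.map (scal3 η τ)).prod, coef_perm3 hη0 hθ, hL.prod_sgnTau,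
    hn.neg_one_pow, one_mul]
  by_cases hmn : Even m
  · have : ∀ l ∈ Finset.range m, th τ 0 (t + τ / 2 + (l - i) * η) *
        th τ 0 (2 * (t + η / 2) + (l - i - 1) * η) /
        (gz η τ (l - i) * th τ 0 (2 * (t + η / 2) - (t + τ / 2) + (l - i - 1) * η)) =
        exp (-(2 * Real.pi * I * (t - i * η)) + -(2 * Real.pi * I * η) * l) *
        (-1 * (th τ 0 (2 * (t + η / 2) + (l - i - 1) * η) / gz η τ (l - i))) := by
      intro l _
      have := h' (l - i)
      push_cast at this
      rw [show 2 * (t + η / 2) - (t + τ / 2) + (l - i - 1) * η = t + τ / 2 + (l - i) * η - τ by ring,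
        th_sub_tau, sgnTau_zero]
      have e : exp (-(2 * Real.pi * I * (t - i * η)) + -(2 * Real.pi * I * η) * l) *
          exp (Real.pi * I * (2 * (t + τ / 2 + (l - i) * η) - τ)) = 1 := by
        rw [← Complex.exp_add, ← Complex.exp_zero]; congr 1; ring
      have e0 := Complex.exp_ne_zero (Real.pi * I * (2 * (t + τ / 2 + (l - i) * η) - τ))
      generalize exp (Real.pi * I * (2 * (t + τ / 2 + (l - i) * η) - τ)) = E at *
      rw [eq_div_of_mul_eq e0 e]
      generalize th τ 0 (t + τ / 2 + (l - i) * η) = A at *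
      generalize th τ 0 (2 * (t + η / 2) + (l - i - 1) * η) = B
      rw [show gz η τ (l - i) * (-1 * E * A) = (-A) * (E * gz η τ (l - i)) by ring,
        show A * B = (-A) * (-1 * B) by ring,
        mul_div_mul_left _ _ (neg_ne_zero.2 this), div_mul_eq_mul_div, one_mul, mul_div_assoc,
        ← div_div, mul_div_assoc, div_right_comm]
    rw [Finset.prod_congr rfl this, prod_range_exp, Finset.prod_mul_distrib, Finset.prod_const,
      Finset.card_range, hmn.neg_one_pow, one_mul]
    have e : exp (Real.pi * I * (2 * (t + η / 2 - (i + 1) * η) * (m : ℤ) + (m : ℤ) ^ 2 * η)) *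
        exp (m * -(2 * Real.pi * I * (t - i * η)) + -(2 * Real.pi * I * η) * (m * (m - 1) / 2)) =
        1 := by
      rw [← Complex.exp_add]
      exact (congrArg exp (show _ = (0 : ℂ) by push_cast; ring)).trans Complex.exp_zero
    generalize exp (Real.pi * I * (2 * (t + η / 2 - (i + 1) * η) * (m : ℤ) + (m : ℤ) ^ 2 * η)) = E1
      at *
    generalize exp (m * -(2 * Real.pi * I * (t - i * η)) +
      -(2 * Real.pi * I * η) * (m * (m - 1) / 2)) = E2 at *
    generalize (∏ l ∈ Finset.range m, (th τ 0 (2 * (t + η / 2) + (l - i - 1) * η) /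
      gz η τ (l - i))) = P
    generalize (th τ 0 (2 * (t + η / 2) - 2 * (i + 1) * η) /
      (th τ 0 (m * η) * th τ 0 (2 * (t + η / 2) + (m - 2 * (i + 1)) * η))) = Q
    linear_combination ((I * exp (-(Real.pi * I * (t + τ / 4)))) ^ L.length *
      coef η τ t L m (t + η / 2 - (i + 1) * η) * P * Q) * e
  · rw [coef_eq_zero_of_odd]
    · simp
    · rw [Nat.not_even_iff_odd] at hmn
      exact (by exact_mod_cast hmn.add_even hn)

/-! ### Meromorphic functions up to discrete sets -/

theorem eventually_codiscrete_iff {p : ℂ → Prop} :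
    (∀ᶠ z in codiscrete ℂ, p z) ↔ ∀ x, ∀ᶠ z in 𝓝[≠] x, p z := by
  rw [Filter.Eventually, mem_codiscrete]
  refine forall_congr' fun x => ?_
  rw [disjoint_principal_right, compl_compl]
  rfl

theorem eventually_codiscrete_add {p : ℂ → Prop} (h : ∀ᶠ z in codiscrete ℂ, p z) (c : ℂ) :
    ∀ᶠ z in codiscrete ℂ, p (z + c) := by
  rw [eventually_codiscrete_iff] at h ⊢
  exact fun x => (tendsto_add_const_nhdsNE x c).eventually (h (x + c))

theorem exists_of_eventually_codiscrete {p : ℂ → Prop} (h : ∀ᶠ z in codiscrete ℂ, p z) :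
    ∃ z, p z :=
  (eventually_codiscrete_iff.1 h 0).exists

/-- The identity theorem for meromorphic functions. -/
theorem eq_zero_or_ne_zero_of_meromorphic {f : ℂ → ℂ} (hf : Meromorphic f) :
    (∀ᶠ z in codiscrete ℂ, f z = 0) ∨ ∀ᶠ z in codiscrete ℂ, f z ≠ 0 := by
  by_cases h : ∃ u, meromorphicOrderAt f u ≠ ⊤
  · right
    rw [eventually_codiscrete_iff]
    exact fun x => (meromorphicOrderAt_ne_top_iff_eventually_ne_zero (hf x)).1
      (hf.exists_meromorphicOrderAt_ne_top_iff_forall.1 h x)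
  · left
    push Not at h
    rw [eventually_codiscrete_iff]
    exact fun x => meromorphicOrderAt_eq_top_iff.1 (h x)

theorem eq_zero_of_frequently {f : ℂ → ℂ} (hf : Meromorphic f) {x : ℂ}
    (h : ∃ᶠ z in 𝓝[≠] x, f z = 0) : ∀ᶠ z in codiscrete ℂ, f z = 0 :=
  (eq_zero_or_ne_zero_of_meromorphic hf).resolve_right fun h' =>
    h (eventually_codiscrete_iff.1 h' x)

/-- The increments add up because e is itself c-periodic. Used with e = g₃ for the shift by τ and
with e = 0 for honest periods. -/
theorem eventually_int_shift {f e : ℂ → ℂ} {c : ℂ}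
    (h : ∀ᶠ z in codiscrete ℂ, f (z + c) = f z + e z)
    (he : ∀ᶠ z in codiscrete ℂ, e (z + c) = e z) (n : ℤ) :
    ∀ᶠ z in codiscrete ℂ, f (z + n * c) = f z + n * e z ∧ e (z + n * c) = e z := by
  induction n using Int.induction_on with
  | zero => exact Eventually.of_forall fun z => by simp
  | succ n ih =>
    filter_upwards [ih, eventually_codiscrete_add h ((n : ℤ) * c),
      eventually_codiscrete_add he ((n : ℤ) * c)] with z h1 h2 h3
    have e1 : z + ((n + 1 : ℤ) : ℂ) * c = z + (n : ℤ) * c + c := by push_cast; ring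
    rw [e1, h2, h3, h1.1, h1.2]
    refine ⟨?_, rfl⟩
    push_cast; ring
  | pred n ih =>
    filter_upwards [ih, eventually_codiscrete_add h (((-n - 1 : ℤ) : ℂ) * c),
      eventually_codiscrete_add he (((-n - 1 : ℤ) : ℂ) * c)] with z h1 h2 h3
    have e1 : z + ((-n - 1 : ℤ) : ℂ) * c + c = z + ((-n : ℤ) : ℂ) * c := by push_cast; ring
    rw [e1, h1.1] at h2
    rw [e1, h1.2] at h3
    refine ⟨?_, h3.symm⟩
    rw [← h3] at h2
    push_cast at h2 ⊢
    linear_combination -h2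

/-! ### Recurrence of the multiples of `η` modulo the lattice -/

/-- Compactness: the multiples of η, reduced modulo the lattice, have a convergent subsequence. The
difference of two of its late terms is a multiple of η close to the lattice, and the two indices can
be taken as far apart as desired. -/
theorem exists_return {τ : ℂ} (hτ : 0 < τ.im) (η : ℂ) (N : ℕ) {ε : ℝ} (hε : 0 < ε) :
    ∃ k : ℕ, N ≤ k ∧ ∃ m l : ℤ, ‖(k : ℂ) * η - m - l * τ‖ < ε := by
  choose w hw hwm using fun k : ℕ => exists_lat_add_mem hτ ((k : ℂ) * η)
  have hK : IsCompact ((fun p : ℝ × ℝ => (p.1 : ℂ) + p.2 * τ) ''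
      (Set.Icc (0 : ℝ) 1 ×ˢ Set.Icc (0 : ℝ) 1)) :=
    (isCompact_Icc.prod isCompact_Icc).image (by fun_prop)
  obtain ⟨a, -, φ, hφ, ha⟩ := hK.tendsto_subseq hwm
  obtain ⟨M, hM⟩ := Metric.cauchySeq_iff.1 ha.cauchySeq ε hε
  have hle : φ M + N ≤ φ (M + N) := by
    clear hM
    induction N with
    | zero => simp
    | succ N ih =>
      have := hφ (show M + N < M + (N + 1) by omega)
      omega
  have h1 := hM (M + N) (by omega) M le_rfl
  rw [dist_eq_norm] at h1
  obtain ⟨m, l, e⟩ := sub_mem (hw (φ M)) (hw (φ (M + N)))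
  refine ⟨φ (M + N) - φ M, by omega, m, l, ?_⟩
  refine lt_of_eq_of_lt (congrArg _ ?_) h1
  rw [Nat.cast_sub (by omega)]
  simp only [Function.comp_apply]
  linear_combination e

theorem exists_return_seq {τ : ℂ} (hτ : 0 < τ.im) (η : ℂ) :
    ∃ (k : ℕ → ℕ) (m l : ℕ → ℤ), (∀ j, j + 1 ≤ k j) ∧
      Tendsto (fun j => (k j : ℂ) * η - m j - l j * τ) atTop (𝓝 0) := by
  choose k hk m l h using fun j : ℕ => exists_return hτ η (j + 1)
    (ε := 1 / ((j : ℝ) + 1)) (by positivity)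
  refine ⟨k, m, l, hk, ?_⟩
  exact squeeze_zero_norm (fun j => (h j).le) tendsto_one_div_add_atTop_nhds_zero_nat

/-! ### Uniqueness of the decomposition -/

/-- At x = kη - m - lτ the hypothesis becomes g₁ + l g₃ - k g₂ = 0, and taking imaginary parts of x
eliminates l: P(x) + k Q(x) = 0, where P and Q do not involve k. By recurrence x is a limit of
points of the same kind with k → ∞, so Q(x) = 0 and then P(x) = 0. Such points accumulate, which
allows the identity theorem to be applied to Q. It cannot be applied to P, which contains Im x and
is not meromorphic. -/
theorem eq_zero_of_tendsto_zero {η τ : ℂ} (hτ : 0 < τ.im) (hη : IsGen η τ) (hη0 : η ≠ 0)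
    {g₁ g₂ : ℂ → ℂ} (m1 : Meromorphic g₁) (p1 : (fun t => g₁ (t + 1)) =ᶠ[codiscrete ℂ] g₁)
    (h2 : IsElliptic τ g₂) (h3 : IsElliptic τ (fun t => g₁ (t + τ) - g₁ t))
    (hz : ∀ k : ℕ, 1 ≤ k →
      Tendsto (fun t => g₁ t - t / η * g₂ t) (𝓝[≠] (k * η)) (𝓝 0)) :
    (∀ᶠ t in codiscrete ℂ, g₁ t = 0) ∧ ∀ᶠ t in codiscrete ℂ, g₂ t = 0 := by
  obtain ⟨m2, p2, p2'⟩ := h2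
  obtain ⟨m3, p3, p3'⟩ := h3
  set g₃ : ℂ → ℂ := fun t => g₁ (t + τ) - g₁ t with hg3
  have hτ0 : (τ.im : ℂ) ≠ 0 := by exact_mod_cast hτ.ne'
  have shift : ∀ m l : ℤ, ∀ᶠ z in codiscrete ℂ,
      g₁ (z + (m + l * τ)) = g₁ z + l * g₃ z ∧ g₂ (z + (m + l * τ)) = g₂ z := by
    intro m l
    have a1 := eventually_int_shift (f := g₁) (e := fun _ => 0) (c := 1)
      (p1.mono fun z hz => by rw [add_zero]; exact hz) (Eventually.of_forall fun _ => rfl) m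
    have a2 := eventually_int_shift (f := g₁) (e := g₃) (c := τ)
      (Eventually.of_forall fun z => by rw [hg3]; ring) p3' l
    have a3 := eventually_int_shift (f := g₂) (e := fun _ => 0) (c := 1)
      (p2.mono fun z hz => by rw [add_zero]; exact hz) (Eventually.of_forall fun _ => rfl) m
    have a4 := eventually_int_shift (f := g₂) (e := fun _ => 0) (c := τ)
      (p2'.mono fun z hz => by rw [add_zero]; exact hz) (Eventually.of_forall fun _ => rfl) l
    filter_upwards [eventually_codiscrete_add a1 (l * τ), a2, eventually_codiscrete_add a3 (l * τ),
      a4] with z b1 b2 b3 b4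
    rw [show z + (m + l * τ) = z + l * τ + m * 1 by ring, b1.1, b2.1, b3.1, b4.1]
    constructor <;> ring
  set Good : ℂ → Prop := fun x => AnalyticAt ℂ g₁ x ∧ AnalyticAt ℂ g₂ x ∧ AnalyticAt ℂ g₃ x
    with hGood
  have hgood : ∀ x, ∀ᶠ z in 𝓝[≠] x, Good z := fun x => by
    filter_upwards [(m1 x).eventually_analyticAt, (m2 x).eventually_analyticAt,
      (m3 x).eventually_analyticAt] with z a b c
    exact ⟨a, b, c⟩
  have hgood' : ∀ x, Good x → ∀ᶠ z in 𝓝 x, Good z := fun x hx => by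
    filter_upwards [hx.1.eventually_analyticAt, hx.2.1.eventually_analyticAt,
      hx.2.2.eventually_analyticAt] with z a b c
    exact ⟨a, b, c⟩
  set Γ : ℂ → Prop := fun x => ∃ (k : ℕ) (m l : ℤ), 1 ≤ k ∧ x = k * η - m - l * τ with hΓ
  have hΓadd : ∀ x y, Γ x → Γ y → Γ (x + y) := by
    rintro x y ⟨k, m, l, hk, rfl⟩ ⟨k', m', l', hk', rfl⟩
    exact ⟨k + k', m + m', l + l', by omega, by push_cast; ring⟩
  set P : ℂ → ℂ := fun x => g₁ x - (x.im : ℂ) / τ.im * g₃ x with hP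
  set Q : ℂ → ℂ := fun x => (η.im : ℂ) / τ.im * g₃ x - g₂ x with hQ
  have rel : ∀ (k : ℕ) (m l : ℤ), 1 ≤ k → Good (k * η - m - l * τ) →
      P (k * η - m - l * τ) + k * Q (k * η - m - l * τ) = 0 := by
    intro k m l hk hx
    set x : ℂ := k * η - m - l * τ with hxdef
    have e0 : x + (m + l * τ) = k * η := by rw [hxdef]; ring
    have t1 : Tendsto (fun z => g₁ (z + (m + l * τ)) - (z + (m + l * τ)) / η *
        g₂ (z + (m + l * τ))) (𝓝[≠] x) (𝓝 0) := by
      have := tendsto_add_const_nhdsNE x (m + l * τ)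
      rw [e0] at this
      exact (hz k hk).comp this
    have t2 : Tendsto (fun z => g₁ z + l * g₃ z - (z + (m + l * τ)) / η * g₂ z) (𝓝[≠] x)
        (𝓝 (g₁ x + l * g₃ x - (x + (m + l * τ)) / η * g₂ x)) := by
      refine Tendsto.mono_left ?_ nhdsWithin_le_nhds
      have c1 := hx.1.continuousAt
      have c2 := hx.2.1.continuousAt
      have c3 := hx.2.2.continuousAt
      have : ContinuousAt (fun z => g₁ z + l * g₃ z - (z + (m + l * τ)) / η * g₂ z) x := by
        fun_prop
      exact this
    have t3 := t1.congr' ((eventually_codiscrete_iff.1 (shift m l) x).mono fun z hz => by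
      rw [hz.1, hz.2])
    have t4 := tendsto_nhds_unique t2 t3
    rw [e0, mul_div_cancel_right₀ _ hη0] at t4
    have him : (x.im : ℂ) = k * η.im - l * τ.im := by
      have : x.im = k * η.im - l * τ.im := by rw [hxdef]; simp
      rw [this]; push_cast; ring
    simp only [hP, hQ]
    rw [him]
    field_simp
    linear_combination (τ.im : ℂ) * t4
  obtain ⟨k, m, l, hk, hlim⟩ := exists_return_seq hτ η
  set δ : ℕ → ℂ := fun j => (k j : ℂ) * η - m j - l j * τ with hδ
  have hδΓ : ∀ j, Γ (δ j) := fun j => ⟨k j, m j, l j, by have := hk j; omega, rfl⟩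
  have hδ0 : ∀ j, δ j ≠ 0 := by
    intro j h
    refine hη (k j) (by have := hk j; omega) ⟨m j, l j, ?_⟩
    simp only [hδ] at h
    push_cast
    linear_combination h
  have hseq : ∀ x, Tendsto (fun j => x + δ j) atTop (𝓝[≠] x) := by
    intro x
    refine tendsto_nhdsWithin_iff.2 ⟨by simpa using hlim.const_add x, Eventually.of_forall
      fun j h => hδ0 j (by simpa using h)⟩
  have hPQ : ∀ x, Γ x → Good x → P x = 0 ∧ Q x = 0 := by
    intro x hx hxg
    obtain ⟨k', m', l', hk', hxe⟩ := id hx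
    have cP : ContinuousAt P x := by
      have c1 := hxg.1.continuousAt
      have c3 := hxg.2.2.continuousAt
      have c4 : Continuous fun z : ℂ => (z.im : ℂ) / (τ.im : ℂ) :=
        (Complex.continuous_ofReal.comp Complex.continuous_im).div_const _
      exact c1.sub (c4.continuousAt.mul c3)
    have cQ : ContinuousAt Q x := by
      have c2 := hxg.2.1.continuousAt
      have c3 := hxg.2.2.continuousAt
      simp only [hQ]
      fun_prop
    have hle := (hseq x).mono_right nhdsWithin_le_nhds
    have tP := cP.tendsto.comp hle
    have tQ := cQ.tendsto.comp hle
    have hk2 : Tendsto (fun j => ((k' + k j : ℕ) : ℂ)⁻¹) atTop (𝓝 0) := by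
      have : Tendsto (fun j => ((k' + k j : ℕ) : ℝ)⁻¹) atTop (𝓝 0) :=
        tendsto_inv_atTop_zero.comp (tendsto_natCast_atTop_atTop.comp
          (tendsto_atTop_mono (fun j => show j ≤ k' + k j by have := hk j; omega) tendsto_id))
      have h := (Complex.continuous_ofReal.tendsto 0).comp this
      rw [Complex.ofReal_zero] at h
      refine h.congr fun j => ?_
      simp
    -- Along x + δ j one has Q = -P / (k' + k j), and P converges while the denominators tend to
    -- infinity.
    have t1 : Tendsto (Q ∘ fun j => x + δ j) atTop (𝓝 0) := by
      have := (hk2.mul tP).neg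
      rw [zero_mul, neg_zero] at this
      refine this.congr' ?_
      filter_upwards [hle.eventually (hgood' x hxg)] with j hj
      have e : x + δ j = (k' + k j : ℕ) * η - (m' + m j : ℤ) - (l' + l j : ℤ) * τ := by
        rw [hxe]; simp only [hδ]; push_cast; ring
      have hr := rel (k' + k j) (m' + m j) (l' + l j) (by omega) (by rwa [← e])
      rw [← e] at hr
      have hne : ((k' + k j : ℕ) : ℂ) ≠ 0 := by
        exact_mod_cast (by omega : k' + k j ≠ 0)
      simp only [Function.comp_apply]
      field_simp
      linear_combination -hr
    have hQ0 := tendsto_nhds_unique tQ t1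
    have hr := rel k' m' l' hk' (by rwa [← hxe])
    rw [← hxe, hQ0, mul_zero, add_zero] at hr
    exact ⟨hr, hQ0⟩
  obtain ⟨j₀, hj₀⟩ := ((hseq 0).eventually (hgood 0)).exists
  rw [zero_add] at hj₀
  set x₀ := δ j₀ with hx0
  have freq : ∀ x, Γ x → ∀ {p : ℂ → Prop}, (∀ y, Γ y → Good y → p y) →
      ∃ᶠ z in 𝓝[≠] x, p z := by
    intro x hx p hp
    refine (hseq x).frequently (Eventually.frequently ?_)
    filter_upwards [(hseq x).eventually (hgood x)] with j hj
    exact hp _ (hΓadd _ _ hx (hδΓ j)) hj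
  have hQz : ∀ᶠ z in codiscrete ℂ, Q z = 0 := by
    refine eq_zero_of_frequently ?_ (freq x₀ (hδΓ j₀) fun y hy hyg => (hPQ y hy hyg).2)
    exact fun x => ((MeromorphicAt.const _ x).mul (m3 x)).sub (m2 x)
  rcases eq_zero_or_ne_zero_of_meromorphic m3 with h0 | h0
  · have hg1 : ∀ᶠ z in codiscrete ℂ, g₁ z = 0 := by
      refine eq_zero_of_frequently m1 (freq x₀ (hδΓ j₀) fun y hy hyg => ?_)
      have e3 : g₃ y = 0 := eq_of_eventuallyEq_nhdsNE (g := fun _ => 0) hyg.2.2.continuousAt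
        continuousAt_const (eventually_codiscrete_iff.1 h0 y)
      have := (hPQ y hy hyg).1
      simp only [hP] at this
      rwa [e3, mul_zero, sub_zero] at this
    refine ⟨hg1, ?_⟩
    filter_upwards [hQz, h0] with z a b
    simp only [hQ] at a
    rw [b, mul_zero, zero_sub, neg_eq_zero] at a
    exact a
  -- If g₃ is not zero, q = g₁/g₃ equals Im x / Im τ at the good points of Γ where g₃ ≠ 0. Its
  -- derivative at each of them is the limit of Im (δ j) / (Im τ · δ j), which does not depend on
  -- the point, so q' is constant and q is affine. The period 1 of g₁ and g₃ forces slope 0; then g₁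
  -- is a constant multiple of g₃, hence τ-periodic, and g₃ = 0 after all.
  · exfalso
    obtain ⟨j₁, hj₁, hj₁'⟩ := (((hseq x₀).eventually (hgood x₀)).and
      ((hseq x₀).eventually (eventually_codiscrete_iff.1 h0 x₀))).exists
    set x₁ := x₀ + δ j₁ with hx1
    have hx1Γ : Γ x₁ := hΓadd _ _ (hδΓ j₀) (hδΓ j₁)
    set q : ℂ → ℂ := fun z => g₁ z / g₃ z with hq
    have hqan : ∀ x, Good x → g₃ x ≠ 0 → AnalyticAt ℂ q x := fun x hx h => hx.1.div hx.2.2 h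
    have hqv : ∀ x, Γ x → Good x → g₃ x ≠ 0 → q x = (x.im : ℂ) / τ.im := by
      intro x hx hxg h
      have := (hPQ x hx hxg).1
      simp only [hP] at this
      simp only [hq]
      rw [div_eq_iff h]
      linear_combination this
    have near : ∀ x, Good x → g₃ x ≠ 0 → ∀ᶠ z in 𝓝 x, Good z ∧ g₃ z ≠ 0 := fun x hx h =>
      (hgood' x hx).and (hx.2.2.continuousAt.eventually_ne h)
    have hslope : ∀ x, Γ x → Good x → g₃ x ≠ 0 →
        Tendsto (fun j => ((δ j).im : ℂ) / τ.im / δ j) atTop (𝓝 (deriv q x)) := by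
      intro x hx hxg h
      have hd := (hqan x hxg h).differentiableAt.hasDerivAt
      have := (hasDerivAt_iff_tendsto_slope.1 hd).comp (hseq x)
      refine this.congr' ?_
      filter_upwards [((hseq x).mono_right nhdsWithin_le_nhds).eventually (near x hxg h)] with j hj
      rw [Function.comp_apply, slope_def_field, hqv x hx hxg h,
        hqv _ (hΓadd _ _ hx (hδΓ j)) hj.1 hj.2, add_sub_cancel_left, Complex.add_im]
      congr 1
      push_cast; ring
    set c := deriv q x₁ with hc
    have hderiv : ∀ᶠ z in 𝓝 x₁, deriv q z - c = 0 := by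
      have han : AnalyticAt ℂ (fun z => deriv q z - c) x₁ :=
        (hqan x₁ hj₁ hj₁').deriv.sub analyticAt_const
      refine han.eventually_eq_zero_or_eventually_ne_zero.resolve_right fun hne => ?_
      obtain ⟨j, a, b⟩ := (((hseq x₁).eventually hne).and
        (((hseq x₁).mono_right nhdsWithin_le_nhds).eventually (near x₁ hj₁ hj₁'))).exists
      refine a (sub_eq_zero.2 (tendsto_nhds_unique (hslope _ (hΓadd _ _ hx1Γ (hδΓ j)) b.1 b.2)
        (hslope _ hx1Γ hj₁ hj₁')))
    obtain ⟨r, hr, hball⟩ := Metric.eventually_nhds_iff_ball.1 (hderiv.and (near x₁ hj₁ hj₁'))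
    have hEq : Set.EqOn q (fun z => c * (z - x₁) + q x₁) (Metric.ball x₁ r) := by
      refine Metric.isOpen_ball.eqOn_of_deriv_eq (convex_ball _ _).isPreconnected
        (fun z hz => (hqan z (hball z hz).2.1 (hball z hz).2.2).differentiableAt.differentiableWithinAt)
        (by fun_prop) (fun z hz => ?_) (Metric.mem_ball_self hr) (by simp)
      rw [sub_eq_zero.1 (hball z hz).1]
      have : HasDerivAt (fun z => c * (z - x₁) + q x₁) (c * 1) z :=
        (((hasDerivAt_id' z).sub_const x₁).const_mul c).add_const _
      rw [this.deriv, mul_one]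
    have hlin : ∀ᶠ z in codiscrete ℂ, g₁ z - (c * (z - x₁) + q x₁) * g₃ z = 0 := by
      refine eq_zero_of_frequently (x := x₁) (fun x => (m1 x).sub
        ((AnalyticAt.meromorphicAt (by fun_prop)).mul (m3 x))) (Eventually.frequently ?_)
      filter_upwards [mem_nhdsWithin_of_mem_nhds (Metric.ball_mem_nhds x₁ hr)] with z hz
      have h5 := hEq hz
      simp only at h5
      rw [← h5]
      simp only [hq]
      rw [div_mul_cancel₀ _ (hball z hz).2.2, sub_self]
    have hc0 : c = 0 := by
      obtain ⟨z, a1, a2, a3, a4, a5⟩ := exists_of_eventually_codiscrete (hlin.and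
        ((eventually_codiscrete_add hlin 1).and (p1.and (p3.and h0))))
      simp only at a3 a4
      rw [a3, a4] at a2
      have : c * g₃ z = 0 := by linear_combination a1 - a2
      exact (mul_eq_zero.1 this).resolve_right a5
    rw [hc0] at hlin
    obtain ⟨z, a1, a2, a3, a4⟩ := exists_of_eventually_codiscrete (hlin.and
        ((eventually_codiscrete_add hlin τ).and (p3'.and h0)))
    simp only at a3
    rw [a3] at a2
    refine a4 ?_
    have : g₃ z = g₁ (z + τ) - g₁ z := rfl
    linear_combination this + a2 - a1

/-! ### Generic points -/

/-- No translate of `z` by a multiple of `η` is a lattice point. -/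
def Off (η τ z : ℂ) : Prop := ∀ s : ℤ, th τ 0 (z + s * η) ≠ 0

section
variable {η τ : ℂ}

theorem Off.neg {z : ℂ} (h : Off η τ z) : Off η τ (-z) := by
  intro s
  have := h (-s)
  push_cast at this
  rwa [show -z + s * η = -(z + -s * η) by ring, th_zero_neg, neg_ne_zero]

theorem Off.add_int {z : ℂ} (h : Off η τ z) (k : ℤ) : Off η τ (z + k * η) := by
  intro s
  have := h (k + s)
  push_cast at this
  rwa [show z + k * η + s * η = z + (k + s) * η by ring]

theorem countable_not_off (hτ : 0 < τ.im) {a : ℂ} (ha : a ≠ 0) (b : ℂ) :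
    {z | ¬ Off η τ (a * z + b)}.Countable := by
  refine (Set.countable_range fun p : ℤ × ℤ × ℤ =>
    ((p.1 : ℂ) + p.2.1 * τ - p.2.2 * η - b) / a).mono fun z hz => ?_
  simp only [Set.mem_ofPred_eq, Off, not_forall, not_not] at hz
  obtain ⟨s, hs⟩ := hz
  obtain ⟨m, l, e⟩ := (th_zero_eq_zero_iff hτ).1 hs
  refine ⟨(m, l, s), ?_⟩
  simp only
  rw [← e]
  field_simp
  ring

theorem frequently_of_countable {p : ℂ → Prop} (h : {z | ¬ p z}.Countable) (x : ℂ) :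
    ∃ᶠ z in 𝓝[≠] x, p z := by
  have hd := (h.union (Set.countable_singleton x)).dense_compl ℂ
  have := mem_closure_iff_frequently.1 (hd x)
  rw [frequently_nhdsWithin_iff]
  refine this.mono fun z hz => ?_
  simp only [Set.mem_compl_iff, Set.mem_union, Set.mem_ofPred_eq, Set.mem_singleton_iff, not_or,
    not_not] at hz
  exact hz

/-- The points excluded by `Off` are countable but need not be discrete. Their complement still
accumulates, so the identity theorem for meromorphic functions removes the excess. -/
theorem eventuallyEq_codiscrete_of_countable {f g : ℂ → ℂ} (hf : Meromorphic f) (hg : Meromorphic g)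
    {p : ℂ → Prop} (hp : {z | ¬ p z}.Countable) (h : ∀ z, p z → f z = g z) :
    f =ᶠ[codiscrete ℂ] g := by
  have := eq_zero_of_frequently (f := fun z => f z - g z) (fun x => (hf x).sub (hg x))
    (x := 0) ((frequently_of_countable hp 0).mono fun z hz => sub_eq_zero.2 (h z hz))
  exact this.mono fun z hz => sub_eq_zero.1 hz

theorem eq_of_frequently_of_continuousAt {f g : ℂ → ℂ} {x : ℂ} (hf : ContinuousAt f x)
    (hg : ContinuousAt g x) (h : ∃ᶠ z in 𝓝[≠] x, f z = g z) : f x = g x := by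
  by_contra hne
  have : ∀ᶠ z in 𝓝 x, f z - g z ≠ 0 := (hf.sub hg).eventually_ne (sub_ne_zero.2 hne)
  refine h ?_
  filter_upwards [this.filter_mono nhdsWithin_le_nhds] with z hz h'
  exact hz (sub_eq_zero.2 h')

theorem countable_not_and {p q : ℂ → Prop} (hp : {z | ¬ p z}.Countable)
    (hq : {z | ¬ q z}.Countable) : {z | ¬ (p z ∧ q z)}.Countable :=
  (hp.union hq).mono fun z hz => by
    simp only [Set.mem_ofPred_eq, Set.mem_union] at hz ⊢
    tauto

theorem th_zero_pow_ne (hτ : 0 < τ.im) (n : ℕ) : ∀ᶠ t in codiscrete ℂ, th τ 0 t ^ n ≠ 0 := by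
  rw [eventually_codiscrete_iff]
  intro x
  filter_upwards [th_zero_affine_ne hτ one_ne_zero 0 x] with z hz
  rw [one_mul, add_zero] at hz
  exact pow_ne_zero _ hz

theorem meromorphic_th_pow (hτ : 0 < τ.im) (n : ℕ) : Meromorphic fun t => th τ 0 t ^ n :=
  fun x => ((differentiable_th hτ 0).pow n |>.analyticAt x).meromorphicAt

/-! ### The coefficients of the partial fraction expansion -/

/-- A functional which computes a coefficient of a partial fraction expansion. -/
def pfdFun (η τ : ℂ) (n j : ℕ) : ℂ →₀ ℂ :=
  Classical.epsilon fun l : ℂ →₀ ℂ =>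
    (∀ u ∈ l.support, Reg η τ n u) ∧ ∀ (a : ℕ → ℂ) (f : ℂ → ℂ),
      (∀ u, Reg η τ n u → f u = ∑ j ∈ Finset.range (n + 1), a j * psi η τ j u) →
      a j = ∑ u ∈ l.support, l u * f u

theorem pfdFun_spec (hτ : 0 < τ.im) (hη : IsGen η τ) {n j : ℕ} (hj : j ≤ n) :
    (∀ u ∈ (pfdFun η τ n j).support, Reg η τ n u) ∧ ∀ (a : ℕ → ℂ) (f : ℂ → ℂ),
      (∀ u, Reg η τ n u → f u = ∑ j ∈ Finset.range (n + 1), a j * psi η τ j u) →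
      a j = ∑ u ∈ (pfdFun η τ n j).support, pfdFun η τ n j u * f u :=
  Classical.epsilon_spec (exists_pfdFunctional hτ hη n j hj)

/-- The coefficients of the partial fraction expansion of `coef η τ t L 0`. -/
def dec (η τ t : ℂ) (L : List (Fin 4)) (j : ℕ) : ℂ :=
  ∑ u ∈ (pfdFun η τ L.length j).support, pfdFun η τ L.length j u * coef η τ t L 0 u

theorem dec_spec (hτ : 0 < τ.im) (hη : IsGen η τ) (hη0 : η ≠ 0) (t : ℂ) {L : List (Fin 4)}
    (hL : IsTriv L) {u : ℂ} (hu : Reg η τ L.length u) :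
    coef η τ t L 0 u = ∑ j ∈ Finset.range (L.length + 1), dec η τ t L j * psi η τ j u := by
  obtain ⟨a, ha⟩ := exists_pfd hτ hη hη0 t hL
  rw [ha u hu]
  refine Finset.sum_congr rfl fun j hj => ?_
  rw [Finset.mem_range] at hj
  rw [(pfdFun_spec hτ hη (by omega : j ≤ L.length)).2 a _ ha, dec]

/-- A finite combination of values of the coefficient at fixed regular points u, and t enters the
weights only through numerators. -/
theorem differentiable_dec (hτ : 0 < τ.im) (hη : IsGen η τ) (L : List (Fin 4)) {j : ℕ}
    (hj : j ≤ L.length) : Differentiable ℂ fun t => dec η τ t L j := by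
  unfold dec
  refine Differentiable.fun_sum fun u hu => Differentiable.const_mul (fun t => ?_) _
  exact (analyticAt_coef hτ hη L 0 (t := fun t => t) (u := fun _ => u) analyticAt_id analyticAt_const
    fun i hi => (pfdFun_spec hτ hη hj).1 u hu i hi.le).differentiableAt

theorem dec_add_one {L : List (Fin 4)} (hL : IsTriv L) (t : ℂ) (j : ℕ) :
    dec η τ (t + 1) L j = (-1) ^ L.length * dec η τ t L j := by
  rw [dec, dec, Finset.mul_sum]
  refine Finset.sum_congr rfl fun u _ => ?_
  rw [coef_t_add_one, hL.prod_sgn1]; ring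

theorem dec_add_tau (hη0 : η ≠ 0) {L : List (Fin 4)} (hL : IsTriv L) (t : ℂ) (j : ℕ) :
    dec η τ (t + τ) L j = (-exp (-(Real.pi * I * (τ + 2 * t)))) ^ L.length * dec η τ t L j := by
  rw [dec, dec, Finset.mul_sum]
  refine Finset.sum_congr rfl fun u _ => ?_
  rw [coef_t_add_tau hη0, hL.prod_sgnTau, Int.cast_zero, mul_zero, zero_pow two_ne_zero, zero_mul,
    add_zero, mul_zero, Complex.exp_zero, neg_pow (exp _)]
  ring

theorem dec_of_odd {L : List (Fin 4)} (h : Odd L.length) (t : ℂ) (j : ℕ) :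
    dec η τ t L j = 0 := by
  refine Finset.sum_eq_zero fun u _ => ?_
  rw [coef_eq_zero_of_odd _ _ _ (by rw [zero_add]; exact_mod_cast h), mul_zero]

theorem dec_perm1 (hθ : ∀ α, th τ α η ≠ 0) {L : List (Fin 4)} (hL : IsTriv L)
    (hn : Even L.length) (t : ℂ) (j : ℕ) :
    (L.map (scal1 η τ)).prod * dec η τ (t + 1 / 2) (L.map perm1) j = dec η τ t L j := by
  rw [dec, dec, List.length_map, Finset.mul_sum]
  refine Finset.sum_congr rfl fun u _ => ?_
  rw [mul_left_comm, coef_perm1 hθ, hL.prod_sgn1, hn.neg_one_pow, one_mul]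

theorem dec_perm3 (hη0 : η ≠ 0) (hθ : ∀ α, th τ α η ≠ 0) {L : List (Fin 4)} (hL : IsTriv L)
    (hn : Even L.length) (t : ℂ) (j : ℕ) :
    (L.map (scal3 η τ)).prod * dec η τ (t + τ / 2) (L.map perm3) j =
      (I * exp (-(Real.pi * I * (t + τ / 4)))) ^ L.length * dec η τ t L j := by
  rw [dec, dec, List.length_map, Finset.mul_sum, Finset.mul_sum]
  refine Finset.sum_congr rfl fun u _ => ?_
  rw [mul_left_comm, coef_perm3 hη0 hθ, hL.prod_sgnTau, hn.neg_one_pow, one_mul, Int.cast_zero,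
    mul_zero, zero_pow two_ne_zero, zero_mul, add_zero, mul_zero, Complex.exp_zero]
  ring

/-! ### The interpolating function attached to a string -/

theorem analyticAt_hfn (hτ : 0 < τ.im) (j : ℕ) {f : ℂ → ℂ} {z : ℂ} (hf : AnalyticAt ℂ f z)
    (h : ∀ i : ℤ, th τ 0 (2 * f z + 2 * i * η) ≠ 0) :
    AnalyticAt ℂ (fun z => hfn η τ j (f z)) z := by
  by_cases hj : j = 0
  · simp only [hfn, hj, if_true]
    exact hf.div_const.sub analyticAt_const
  · simp only [hfn, hj, if_false]
    refine (Finset.analyticAt_fun_sum _ fun i _ => ?_).neg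
    exact analyticAt_zf hτ ((analyticAt_const.mul hf).add analyticAt_const) (h i)

theorem meromorphicAt_hfn (hτ : 0 < τ.im) (j : ℕ) {f : ℂ → ℂ} {z : ℂ} (hf : AnalyticAt ℂ f z) :
    MeromorphicAt (fun z => hfn η τ j (f z)) z := by
  by_cases hj : j = 0
  · simp only [hfn, hj, if_true]
    exact (hf.div_const.sub analyticAt_const).meromorphicAt
  · simp only [hfn, hj, if_false]
    refine (MeromorphicAt.fun_sum fun i _ => ?_).fun_neg
    exact meromorphicAt_zf hτ ((analyticAt_const.mul hf).add analyticAt_const)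

theorem hfn_add_one (j : ℕ) (u : ℂ) :
    hfn η τ j (u + 1) = hfn η τ j u + if j = 0 then 1 / η else 0 := by
  by_cases hj : j = 0
  · simp only [hfn, hj, if_true]; ring
  · rw [if_neg hj, show u + 1 = u + 1 / 2 + 1 / 2 by ring, hfn_add_half hj, hfn_add_half hj, add_zero]

theorem hfn_add_tau (hτ : 0 < τ.im) (j : ℕ) {u : ℂ} (hu : Off η τ (2 * u)) :
    hfn η τ j (u + τ) = hfn η τ j u + if j = 0 then τ / η else 8 * Real.pi * I * j := by
  by_cases hj : j = 0
  · simp only [hfn, hj, if_true]; ring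
  · have h1 : ∀ i : ℤ, th τ 0 (2 * u + 2 * i * η) ≠ 0 := fun i => by
      have := hu (2 * i); push_cast at this; exact this
    have h2 : Reg η τ j (u + τ / 2) := fun i _ => by
      rw [show 2 * (u + τ / 2) + 2 * i * η = 2 * u + 2 * i * η + τ by ring, th_add_tau]
      exact mul_ne_zero (mul_ne_zero (by simp [sgnTau]) (Complex.exp_ne_zero _)) (h1 i)
    rw [if_neg hj, show u + τ = u + τ / 2 + τ / 2 by ring, hfn_add_half_tau hτ hj le_rfl h2,
      hfn_add_half_tau hτ hj le_rfl fun i _ => h1 i]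
    ring

theorem analyticAt_bdTerm (hτ : 0 < τ.im) (hη : IsGen η τ) (L : List (Fin 4)) {m : ℕ} (hm : m ≠ 0)
    (i : ℕ) {t X : ℂ → ℂ} {z : ℂ} (ht : AnalyticAt ℂ t z) (hX : AnalyticAt ℂ X z)
    (h1 : ∀ s : ℤ, th τ 0 (2 * X z + 2 * s * η) ≠ 0)
    (h2 : th τ 0 (2 * X z + (m - 2 * (i + 1)) * η) ≠ 0) (h3 : Off η τ (2 * X z - t z)) :
    AnalyticAt ℂ (fun z => bdTerm η τ (t z) L (X z) m i) z := by
  unfold bdTerm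
  refine ((analyticAt_coef hτ hη L m ht (hX.sub analyticAt_const) fun j _ => ?_).mul
    (AnalyticAt.div ?_ ?_ ?_)).mul (Finset.analyticAt_fun_prod _ fun l _ => AnalyticAt.div ?_ ?_ ?_)
  · have := h1 (j - (i + 1))
    push_cast at this
    show th τ 0 (2 * (X z - (i + 1) * η) + 2 * j * η) ≠ 0
    rwa [show 2 * (X z - (i + 1) * η) + 2 * j * η = 2 * X z + 2 * (j - (i + 1)) * η by ring]
  · exact analyticAt_th_comp hτ 0 ((analyticAt_const.mul hX).sub analyticAt_const)
  · exact analyticAt_const.mul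
      (analyticAt_th_comp hτ 0 ((analyticAt_const.mul hX).add analyticAt_const))
  · refine mul_ne_zero ?_ h2
    have := hη.th_zero_int_ne hτ (n := m) (by omega)
    rwa [Int.cast_natCast] at this
  · exact (analyticAt_th_comp hτ 0 (ht.add analyticAt_const)).mul
      (analyticAt_th_comp hτ 0 ((analyticAt_const.mul hX).add analyticAt_const))
  · exact analyticAt_const.mul
      (analyticAt_th_comp hτ 0 (((analyticAt_const.mul hX).sub ht).add analyticAt_const))
  · refine mul_ne_zero (gz_ne hτ hη _) ?_
    have := h3 (l - i - 1)
    push_cast at this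
    exact this

theorem analyticAt_bdSum (hτ : 0 < τ.im) (hη : IsGen η τ) (L : List (Fin 4))
    {t X : ℂ → ℂ} {z : ℂ} (ht : AnalyticAt ℂ t z) (hX : AnalyticAt ℂ X z)
    (h1 : Off η τ (2 * X z)) (h3 : Off η τ (2 * X z - t z)) :
    AnalyticAt ℂ (fun z => bdSum η τ (t z) L (X z)) z := by
  unfold bdSum
  refine Finset.analyticAt_fun_sum _ fun m hm => Finset.analyticAt_fun_sum _ fun i _ => ?_
  rw [Finset.mem_Icc] at hm
  refine analyticAt_bdTerm hτ hη L (by omega) i ht hX (fun s => ?_) ?_ h3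
  · have := h1 (2 * s); push_cast at this; exact this
  · have := h1 (m - 2 * (i + 1)); push_cast at this; exact this

theorem meromorphicAt_bdSum (hτ : 0 < τ.im) (L : List (Fin 4))
    {t X : ℂ → ℂ} {z : ℂ} (ht : AnalyticAt ℂ t z) (hX : AnalyticAt ℂ X z) :
    MeromorphicAt (fun z => bdSum η τ (t z) L (X z)) z := by
  unfold bdSum bdTerm
  refine MeromorphicAt.fun_sum fun m _ => MeromorphicAt.fun_sum fun i _ => ?_
  refine ((meromorphicAt_coef hτ L m ht (hX.sub analyticAt_const)).fun_mul
    (MeromorphicAt.fun_div (AnalyticAt.meromorphicAt ?_) (AnalyticAt.meromorphicAt ?_))).fun_mul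
    (MeromorphicAt.fun_prod fun l _ =>
      MeromorphicAt.fun_div (AnalyticAt.meromorphicAt ?_) (AnalyticAt.meromorphicAt ?_))
  · exact analyticAt_th_comp hτ 0 ((analyticAt_const.mul hX).sub analyticAt_const)
  · exact analyticAt_const.mul
      (analyticAt_th_comp hτ 0 ((analyticAt_const.mul hX).add analyticAt_const))
  · exact (analyticAt_th_comp hτ 0 (ht.add analyticAt_const)).mul
      (analyticAt_th_comp hτ 0 ((analyticAt_const.mul hX).add analyticAt_const))
  · exact analyticAt_const.mul
      (analyticAt_th_comp hτ 0 (((analyticAt_const.mul hX).sub ht).add analyticAt_const))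

/-- The function of `t` which gives the trace of a word at `t = (k + 1) η`, computed with a string
of interpolation points that starts at `v`. -/
def strF (η τ : ℂ) (L : List (Fin 4)) (v t : ℂ) : ℂ :=
  ∑ j ∈ Finset.range (L.length + 1), dec η τ t L j * (hfn η τ j (v + t) - hfn η τ j v) +
    bdSum η τ t L (v + t) + bdSum η τ t L (η - v)

/-- Partial fractions at each node together with `hfn_add_eta` make the bulk sum telescope along the
string. -/
theorem trace_eq_strF (hτ : 0 < τ.im) (hη : IsGen η τ) (hη0 : η ≠ 0) {L : List (Fin 4)}
    (hL : IsTriv L) (k : ℕ) {v : ℂ} (hv : Off η τ (2 * v)) :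
    LinearMap.trace ℂ (V τ k) (seriesRep hτ hη k (word η τ L)) = strF η τ L v ((k + 1) * η) := by
  rw [trace_word hτ hη L k hv, strF]
  congr 2
  have : ∀ i ∈ Finset.range (k + 1), coef η τ ((k + 1) * η) L 0 (v + i * η) =
      ∑ j ∈ Finset.range (L.length + 1), dec η τ ((k + 1) * η) L j *
        (hfn η τ j (v + (i + 1 : ℕ) * η) - hfn η τ j (v + i * η)) := by
    intro i _
    rw [dec_spec hτ hη hη0 _ hL fun s _ => by
      have := hv (2 * i + 2 * s)
      push_cast at this
      rwa [show 2 * (v + i * η) + 2 * s * η = 2 * v + (2 * i + 2 * s) * η by ring]]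
    refine Finset.sum_congr rfl fun j _ => ?_
    rw [← hfn_add_eta hη0]
    push_cast
    rw [show v + (i + 1) * η = v + i * η + η by ring]
  rw [Finset.sum_congr rfl this, Finset.sum_comm]
  refine Finset.sum_congr rfl fun j _ => ?_
  rw [← Finset.mul_sum, Finset.sum_range_sub fun i : ℕ => hfn η τ j (v + i * η)]
  push_cast
  rw [zero_mul, add_zero]

theorem meromorphic_strF (hτ : 0 < τ.im) (hη : IsGen η τ) (L : List (Fin 4)) (v : ℂ) :
    Meromorphic (strF η τ L v) := by
  intro x
  unfold strF
  refine (MeromorphicAt.fun_add (MeromorphicAt.fun_sum fun j hj => ?_)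
    (meromorphicAt_bdSum hτ L analyticAt_id (by fun_prop))).fun_add
    (meromorphicAt_bdSum hτ L analyticAt_id analyticAt_const)
  rw [Finset.mem_range] at hj
  exact ((differentiable_dec hτ hη L (by omega)).analyticAt x).meromorphicAt.fun_mul
    ((meromorphicAt_hfn hτ j (by fun_prop)).fun_sub (MeromorphicAt.const _ _))

theorem analyticAt_strF (hτ : 0 < τ.im) (hη : IsGen η τ) (L : List (Fin 4)) {v x : ℂ}
    (h1 : Off η τ (2 * v)) (h2 : Off η τ (2 * v + x)) (h3 : Off η τ (2 * v + 2 * x)) :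
    AnalyticAt ℂ (strF η τ L v) x := by
  unfold strF
  refine ((Finset.analyticAt_fun_sum _ fun j hj => ?_).add
    (analyticAt_bdSum hτ hη L analyticAt_id (by fun_prop) ?_ ?_)).add
    (analyticAt_bdSum hτ hη L analyticAt_id analyticAt_const ?_ ?_)
  · rw [Finset.mem_range] at hj
    refine ((differentiable_dec hτ hη L (by omega)).analyticAt x).mul
      ((analyticAt_hfn hτ j (by fun_prop) fun i => ?_).sub analyticAt_const)
    have := h3 (2 * i)
    push_cast at this
    rwa [mul_add]
  · rwa [mul_add]
  · rwa [show 2 * (v + x) - id x = 2 * v + x by simp only [id]; ring]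
  · have := h1.neg.add_int 2
    push_cast at this
    rwa [show 2 * (η - v) = -(2 * v) + 2 * η by ring]
  · have := h2.neg.add_int 2
    push_cast at this
    rwa [show 2 * (η - v) - x = -(2 * v + x) + 2 * η by ring]

/-- Up to the multiplier of θ₁(t)^n the only defect, here and for the shift by τ, comes from the
increments of `hfn`; it does not involve v. -/
theorem strF_add_one {L : List (Fin 4)} (hL : IsTriv L) (v t : ℂ) :
    strF η τ L v (t + 1) = (-1) ^ L.length * (strF η τ L v t +
      ∑ j ∈ Finset.range (L.length + 1), dec η τ t L j * if j = 0 then 1 / η else 0) := by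
  rw [strF, strF, bdSum_t_add_one hL, bdSum_t_add_one hL,
    show v + (t + 1) = v + t + 1 / 2 + 1 / 2 by ring, bdSum_X_add_half hL, bdSum_X_add_half hL,
    show v + t + 1 / 2 + 1 / 2 = v + t + 1 by ring]
  have : ∀ j ∈ Finset.range (L.length + 1),
      dec η τ (t + 1) L j * (hfn η τ j (v + t + 1) - hfn η τ j v) =
      (-1) ^ L.length * (dec η τ t L j * (hfn η τ j (v + t) - hfn η τ j v)) +
      (-1) ^ L.length * (dec η τ t L j * if j = 0 then 1 / η else 0) := by
    intro j _
    rw [dec_add_one hL, hfn_add_one]; ring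
  rw [Finset.sum_congr rfl this, Finset.sum_add_distrib, ← Finset.mul_sum, ← Finset.mul_sum]
  ring

theorem strF_add_tau (hτ : 0 < τ.im) (hη0 : η ≠ 0) {L : List (Fin 4)} (hL : IsTriv L) {v t : ℂ}
    (h : Off η τ (2 * t + 2 * v)) :
    strF η τ L v (t + τ) = (-exp (-(Real.pi * I * (τ + 2 * t)))) ^ L.length * (strF η τ L v t +
      ∑ j ∈ Finset.range (L.length + 1),
        dec η τ t L j * if j = 0 then τ / η else 8 * Real.pi * I * j) := by
  rw [strF, strF, bdSum_t_add_tau hη0 hL, bdSum_t_add_tau hη0 hL,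
    show v + (t + τ) = v + t + τ / 2 + τ / 2 by ring, bdSum_X_add_half_tau hη0 hL,
    bdSum_X_add_half_tau hη0 hL, show v + t + τ / 2 + τ / 2 = v + t + τ by ring]
  have : ∀ j ∈ Finset.range (L.length + 1),
      dec η τ (t + τ) L j * (hfn η τ j (v + t + τ) - hfn η τ j v) =
      (-exp (-(Real.pi * I * (τ + 2 * t)))) ^ L.length *
        (dec η τ t L j * (hfn η τ j (v + t) - hfn η τ j v)) +
      (-exp (-(Real.pi * I * (τ + 2 * t)))) ^ L.length *
        (dec η τ t L j * if j = 0 then τ / η else 8 * Real.pi * I * j) := by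
    intro j _
    rw [dec_add_tau hη0 hL, hfn_add_tau hτ j (by rwa [mul_add, add_comm])]; ring
  rw [Finset.sum_congr rfl this, Finset.sum_add_distrib, ← Finset.mul_sum, ← Finset.mul_sum]
  ring

theorem th_zero_pow_add_one (t : ℂ) (n : ℕ) : th τ 0 (t + 1) ^ n = (-1) ^ n * th τ 0 t ^ n := by
  rw [th_add_one, sgn1_zero, mul_pow]

theorem th_zero_pow_add_tau (t : ℂ) (n : ℕ) :
    th τ 0 (t + τ) ^ n = (-exp (-(Real.pi * I * (τ + 2 * t)))) ^ n * th τ 0 t ^ n := by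
  rw [th_add_tau, sgnTau_zero, mul_pow, neg_one_mul]

/-- The function attached to a string does not depend on the string. -/
theorem strF_eventuallyEq (hτ : 0 < τ.im) (hη : IsGen η τ) (hη0 : η ≠ 0) {L : List (Fin 4)}
    (hL : IsTriv L) {v w : ℂ} (hv : Off η τ (2 * v)) (hw : Off η τ (2 * w)) :
    strF η τ L v =ᶠ[codiscrete ℂ] strF η τ L w := by
  set n := L.length with hn
  -- The defects of the two strings are equal, so D is elliptic. It vanishes at kη for k ≥ 1, where
  -- both strings compute the same trace; uniqueness with g₂ = 0 applies.
  set D : ℂ → ℂ := fun t => (strF η τ L v t - strF η τ L w t) / th τ 0 t ^ n with hD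
  have hmer : Meromorphic D := fun x => ((meromorphic_strF hτ hη L v x).sub
    (meromorphic_strF hτ hη L w x)).fun_div (meromorphic_th_pow hτ n x)
  have hshift : ∀ c, Meromorphic fun t => D (t + c) := fun c x => by
    exact MeromorphicAt.comp_analyticAt (f := D) (g := fun t => t + c) (hmer (x + c)) (by fun_prop)
  have p1 : (fun t => D (t + 1)) =ᶠ[codiscrete ℂ] D := Eventually.of_forall fun t => by
    simp only [hD]
    rw [strF_add_one hL, strF_add_one hL, th_zero_pow_add_one, ← mul_sub, add_sub_add_right_eq_sub,
      mul_div_mul_left _ _ (pow_ne_zero _ (by norm_num))]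
  have p2 : (fun t => D (t + τ)) =ᶠ[codiscrete ℂ] D := by
    refine eventuallyEq_codiscrete_of_countable (hshift τ) hmer
      (countable_not_and (countable_not_off (η := η) hτ two_ne_zero (2 * v))
        (countable_not_off (η := η) hτ two_ne_zero (2 * w))) fun t ht => ?_
    simp only [hD]
    rw [strF_add_tau hτ hη0 hL ht.1, strF_add_tau hτ hη0 hL ht.2, th_zero_pow_add_tau, ← mul_sub,
      add_sub_add_right_eq_sub,
      mul_div_mul_left _ _ (pow_ne_zero _ (neg_ne_zero.2 (Complex.exp_ne_zero _)))]
  have zero : ∀ᶠ t in codiscrete ℂ, D (t + τ) - D t = 0 := p2.mono fun t ht => sub_eq_zero.2 ht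
  have key := eq_zero_of_tendsto_zero hτ hη hη0 (g₁ := D) (g₂ := fun _ => 0) hmer p1
    ⟨fun x => MeromorphicAt.const _ x, EventuallyEq.rfl, EventuallyEq.rfl⟩
    ⟨fun x => (hshift τ x).sub (hmer x), by
      filter_upwards [zero, eventually_codiscrete_add zero 1] with t a b
      rw [a, b], by
      filter_upwards [zero, eventually_codiscrete_add zero τ] with t a b
      rw [a, b]⟩ (fun K hK => by
      obtain ⟨k, rfl⟩ : ∃ k, K = k + 1 := ⟨K - 1, by omega⟩
      have off : ∀ v, Off η τ (2 * v) → AnalyticAt ℂ (strF η τ L v) ((k + 1 : ℕ) * η) :=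
        fun v hv => analyticAt_strF hτ hη L hv (by have := hv.add_int (k + 1 : ℕ); exact_mod_cast this)
          (by
            have := hv.add_int (2 * (k + 1 : ℕ))
            push_cast at this ⊢
            rwa [← mul_assoc])
      have han : AnalyticAt ℂ D ((k + 1 : ℕ) * η) := ((off v hv).sub (off w hw)).div
        ((differentiable_th hτ 0).pow n |>.analyticAt _) (pow_ne_zero _ (by
          have := hη.th_zero_int_ne hτ (n := (k + 1 : ℕ)) (by omega)
          exact_mod_cast this))
      have h0 : D ((k + 1 : ℕ) * η) = 0 := by
        simp only [hD]
        push_cast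
        rw [← trace_eq_strF hτ hη hη0 hL k hv, ← trace_eq_strF hτ hη hη0 hL k hw, sub_self, zero_div]
      have := han.continuousAt.tendsto.mono_left (nhdsWithin_le_nhds (s := {((k + 1 : ℕ) * η)}ᶜ))
      rw [h0] at this
      refine this.congr fun t => ?_
      rw [mul_zero, sub_zero])
  filter_upwards [key.1, th_zero_pow_ne hτ n] with t a b
  simp only [hD] at a
  exact sub_eq_zero.1 ((div_eq_zero_iff.1 a).resolve_right b)

theorem exists_off (hτ : 0 < τ.im) : ∃ v, Off η τ (2 * v) := by
  obtain ⟨v, hv⟩ := (frequently_of_countable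
    (countable_not_off (η := η) hτ two_ne_zero 0) 0).exists
  exact ⟨v, by simpa using hv⟩

/-- For every t some string is regular at t. As all strings give the same meromorphic function, its
singularities are removable. -/
theorem exists_entire_strF (hτ : 0 < τ.im) (hη : IsGen η τ) (hη0 : η ≠ 0) {L : List (Fin 4)}
    (hL : IsTriv L) : ∃ F : ℂ → ℂ, Differentiable ℂ F ∧
      (∀ k : ℕ, F ((k + 1) * η) =
        LinearMap.trace ℂ (V τ k) (seriesRep hτ hη k (word η τ L))) ∧
      ∀ v t, Off η τ (2 * v) → Off η τ (2 * v + t) → Off η τ (2 * v + 2 * t) →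
        strF η τ L v t = F t := by
  obtain ⟨v₀, h0⟩ := exists_off (η := η) hτ
  have hrem : ∀ x, IsRem (strF η τ L v₀) x := by
    intro x
    obtain ⟨v, hv1, hv2, hv3⟩ := (frequently_of_countable (countable_not_and
      (countable_not_off (η := η) hτ two_ne_zero 0) (countable_not_and
      (countable_not_off (η := η) hτ two_ne_zero x)
      (countable_not_off (η := η) hτ two_ne_zero (2 * x)))) 0).exists
    rw [add_zero] at hv1
    exact (analyticAt_strF hτ hη L hv1 hv2 hv3).isRem.congr
      (eventually_codiscrete_iff.1 (strF_eventuallyEq hτ hη hη0 hL h0 hv1) x)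
  obtain ⟨F, hF, hFe, -⟩ := exists_entire_of_isRem hrem
  have key : ∀ v t, Off η τ (2 * v) → Off η τ (2 * v + t) → Off η τ (2 * v + 2 * t) →
      strF η τ L v t = F t := by
    intro v t h1 h2 h3
    refine eq_of_eventuallyEq_nhdsNE (analyticAt_strF hτ hη L h1 h2 h3).continuousAt
      hF.continuous.continuousAt ?_
    filter_upwards [eventually_codiscrete_iff.1 (strF_eventuallyEq hτ hη hη0 hL h0 h1) t, hFe t]
      with z a b
    rw [← a, b]
  refine ⟨F, hF, fun k => ?_, key⟩
  rw [trace_eq_strF hτ hη hη0 hL k h0]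
  refine (key _ _ h0 ?_ ?_).symm
  · have := h0.add_int (k + 1)
    push_cast at this
    exact this
  · have := h0.add_int (2 * (k + 1))
    push_cast at this
    rwa [← mul_assoc]

end

/-! ### Words with nontrivial characters -/

/-- By cyclicity tr(W T²) = tr(T W T) = c tr(W T²), and T² is a nonzero scalar. -/
theorem trace_eq_zero_of_twist {M : Type*} [AddCommGroup M] [Module ℂ M] {W T : Module.End ℂ M}
    {a c : ℂ} (h : T * W = c • (W * T)) (h2 : T * T = a • 1) (ha : a ≠ 0) (hc : c ≠ 1) :
    LinearMap.trace ℂ M W = 0 := by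
  have h1 : LinearMap.trace ℂ M (W * T * T) = c * LinearMap.trace ℂ M (W * T * T) := by
    conv_lhs => rw [LinearMap.trace_mul_comm, ← mul_assoc, h, smul_mul_assoc, map_smul, smul_eq_mul]
  rw [mul_assoc, h2, mul_smul_comm, mul_one, map_smul, smul_eq_mul] at h1
  have : a * (1 - c) * LinearMap.trace ℂ M W = 0 := by linear_combination h1
  exact (mul_eq_zero.1 this).resolve_left (mul_ne_zero ha (sub_ne_zero.2 hc.symm))

/-- The shift by `1 / 2` on `𝒱⁽ᵏ⁾`. -/
def shiftHalf (τ : ℂ) (k : ℕ) : Module.End ℂ (V τ k) where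
  toFun f := ⟨fun u => (f : ℂ → ℂ) (u + 1 / 2), by
    obtain ⟨f, hf, h1, h2, h3⟩ := f
    refine ⟨hf.comp (differentiable_id.add_const _), fun u => ?_, fun u => ?_, fun u => ?_⟩
    · show f _ = f _
      rw [← h1 (u + 1 / 2)]; ring_nf
    · show f _ = f _
      rw [← h2, ← h1]; ring_nf
    · show f _ = _ * f _
      rw [show u + τ + 1 / 2 = u + 1 / 2 + τ by ring, h3]
      congr 1
      exact exp_eq_of_sub (-k) (by push_cast; ring)⟩
  map_add' f g := rfl
  map_smul' c f := rfl

theorem shiftHalf_apply {τ : ℂ} {k : ℕ} (f : V τ k) (u : ℂ) :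
    (shiftHalf τ k f : ℂ → ℂ) u = (f : ℂ → ℂ) (u + 1 / 2) := rfl

/-- The shift by `τ / 2` on `𝒱⁽ᵏ⁾`. -/
def shiftHalfTau (τ : ℂ) (k : ℕ) : Module.End ℂ (V τ k) where
  toFun f := ⟨fun u => exp (2 * Real.pi * I * (k * u)) * (f : ℂ → ℂ) (u + τ / 2), by
    obtain ⟨f, hf, h1, h2, h3⟩ := f
    refine ⟨?_, fun u => ?_, fun u => ?_, fun u => ?_⟩
    · have : Differentiable ℂ fun u => exp (2 * Real.pi * I * (k * u)) := by fun_prop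
      exact this.mul (hf.comp (differentiable_id.add_const _))
    · show exp _ * f _ = exp _ * f _
      rw [show u + 1 + τ / 2 = u + τ / 2 + 1 by ring, h1]
      congr 1
      exact exp_eq_of_sub k (by push_cast; ring)
    · show exp _ * f _ = exp _ * f _
      have e : exp (2 * Real.pi * I * (k * -u)) = exp (2 * Real.pi * I * (k * u)) *
          exp (-2 * Real.pi * I * k * (2 * (u - τ / 2) + τ)) := by
        rw [← Complex.exp_add]; congr 1; ring
      rw [show u + τ / 2 = u - τ / 2 + τ by ring, h3, e, ← h2 (u - τ / 2),
        show -(u - τ / 2) = -u + τ / 2 by ring, mul_assoc]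
    · show exp _ * f _ = _ * (exp _ * f _)
      have e : exp (2 * Real.pi * I * (k * (u + τ))) *
          exp (-2 * Real.pi * I * k * (2 * (u + τ / 2) + τ)) =
          exp (-2 * Real.pi * I * k * (2 * u + τ)) * exp (2 * Real.pi * I * (k * u)) := by
        rw [← Complex.exp_add, ← Complex.exp_add]; congr 1; ring
      rw [show u + τ + τ / 2 = u + τ / 2 + τ by ring, h3, ← mul_assoc (exp _), e, mul_assoc]⟩
  map_add' f g := by ext u; exact mul_add _ _ _
  map_smul' c f := by ext u; exact mul_left_comm _ _ _

theorem shiftHalfTau_apply {τ : ℂ} {k : ℕ} (f : V τ k) (u : ℂ) :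
    (shiftHalfTau τ k f : ℂ → ℂ) u = exp (2 * Real.pi * I * (k * u)) * (f : ℂ → ℂ) (u + τ / 2) :=
  rfl

/-- A half-period shift commutes with the word up to `char1 L` or `charTau L`, and its square is a
nonzero scalar, so `trace_eq_zero_of_twist` applies to whichever character is nontrivial. -/
theorem trace_eq_zero_of_not_isTriv {η τ : ℂ} (hτ : 0 < τ.im) (hη : IsGen η τ) (hη0 : η ≠ 0)
    {L : List (Fin 4)} (hL : ¬ IsTriv L) (k : ℕ) :
    LinearMap.trace ℂ (V τ k) (seriesRep hτ hη k (word η τ L)) = 0 := by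
  have hfreq : ∀ (c x : ℂ), ∃ᶠ u in 𝓝[≠] x, Off η τ (2 * u) ∧ Off η τ (2 * u + c) := fun c x =>
    (frequently_of_countable (countable_not_and (countable_not_off (η := η) hτ two_ne_zero 0)
      (countable_not_off (η := η) hτ two_ne_zero c)) x).mono fun u hu => by simpa using hu
  have ext : ∀ {f g : V τ k} (c : ℂ), (∀ u, Off η τ (2 * u) → Off η τ (2 * u + c) →
      (f : ℂ → ℂ) u = (g : ℂ → ℂ) u) → f = g := fun {f g} c h => by
    ext u
    exact eq_of_frequently_of_continuousAt f.2.1.continuous.continuousAt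
      g.2.1.continuous.continuousAt ((hfreq c u).mono fun z hz => h z hz.1 hz.2)
  have off : ∀ {u : ℂ}, Off η τ u → ∀ j : ℤ, th τ 0 (u + 2 * j * η) ≠ 0 := fun h j => by
    have := h (2 * j); push_cast at this; exact this
  rw [IsTriv, not_and_or] at hL
  rcases hL with hL | hL
  · refine trace_eq_zero_of_twist (T := shiftHalf τ k) (a := 1) (c := char1 L) ?_ ?_ one_ne_zero hL
    · refine LinearMap.ext fun f => ext 1 fun u h1 h2 => ?_
      show (seriesRep hτ hη k (word η τ L) f : ℂ → ℂ) (u + 1 / 2) =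
        char1 L * (seriesRep hτ hη k (word η τ L) (shiftHalf τ k f) : ℂ → ℂ) u
      rw [seriesRep_word_apply hτ hη k L f fun j => by
          rw [show 2 * (u + 1 / 2) = 2 * u + 1 by ring]; exact off h2 j,
        seriesRep_word_apply hτ hη k L _ (off h1), wordOp_eq_sum, wordOp_eq_sum, Finset.mul_sum]
      refine Finset.sum_congr rfl fun m _ => ?_
      rw [coef_add_half, shiftHalf_apply, add_right_comm, mul_assoc]
    · refine LinearMap.ext fun f => ?_
      ext u
      show (f : ℂ → ℂ) (u + 1 / 2 + 1 / 2) = 1 * (f : ℂ → ℂ) u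
      rw [show u + 1 / 2 + 1 / 2 = u + 1 by ring, f.2.2.1, one_mul]
  · refine trace_eq_zero_of_twist (T := shiftHalfTau τ k) (a := exp (-(Real.pi * I * (k * τ))))
      (c := charTau L) ?_ ?_ (Complex.exp_ne_zero _) hL
    · refine LinearMap.ext fun f => ext τ fun u h1 h2 => ?_
      show exp _ * (seriesRep hτ hη k (word η τ L) f : ℂ → ℂ) (u + τ / 2) =
        charTau L * (seriesRep hτ hη k (word η τ L) (shiftHalfTau τ k f) : ℂ → ℂ) u
      rw [seriesRep_word_apply hτ hη k L f fun j => by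
          rw [show 2 * (u + τ / 2) = 2 * u + τ by ring]; exact off h2 j,
        seriesRep_word_apply hτ hη k L _ (off h1), wordOp_eq_sum, wordOp_eq_sum, Finset.mul_sum,
        Finset.mul_sum]
      refine Finset.sum_congr rfl fun m _ => ?_
      rw [coef_add_half_tau hη0, shiftHalfTau_apply, add_right_comm u (τ / 2)]
      have : exp (2 * Real.pi * I * (k * (u + m * η))) = exp (2 * Real.pi * I * (k * u)) *
          exp (2 * Real.pi * I * (m * ((k + 1) * η - η))) := by
        rw [← Complex.exp_add]; congr 1; ring
      rw [this]; ring
    · refine LinearMap.ext fun f => ?_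
      ext u
      show exp _ * (exp _ * (f : ℂ → ℂ) (u + τ / 2 + τ / 2)) = exp _ * (f : ℂ → ℂ) u
      rw [show u + τ / 2 + τ / 2 = u + τ by ring, f.2.2.2.2, ← mul_assoc, ← mul_assoc,
        ← Complex.exp_add, ← Complex.exp_add]
      congr 2; ring

/-! ### The distinguished string -/

section
variable {η τ : ℂ}

/-- The periodic part of `hfn`. -/
def hper (η τ : ℂ) (j : ℕ) (u : ℂ) : ℂ := if j = 0 then 0 else hfn η τ j u

/-- The periodic part of the trace function of a word, without its theta factor. -/
def perPart (η τ : ℂ) (L : List (Fin 4)) (t : ℂ) : ℂ :=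
  ∑ j ∈ Finset.range (L.length + 1), dec η τ t L j * hper η τ j (t + η / 2) +
    bdSum η τ t L (t + η / 2)

/-- The starting point η/2 violates `Off`, so the formula is reached as a limit of admissible
strings. No pole arises in this limit: for even length only even m occur, and the denominators which
do not involve t are then theta values at odd multiples of η. In the limit the lower boundary sum
vanishes, and `hfn` vanishes at η/2. -/
theorem strF_half_eta (hτ : 0 < τ.im) (hη : IsGen η τ) (hη0 : η ≠ 0) {L : List (Fin 4)}
    (hn : Even L.length) {F : ℂ → ℂ}
    (hF : ∀ v t, Off η τ (2 * v) → Off η τ (2 * v + t) → Off η τ (2 * v + 2 * t) →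
      strF η τ L v t = F t) {t : ℂ} (h1 : Off η τ t) (h2 : Off η τ (2 * t)) :
    F t = perPart η τ L t + t / η * dec η τ t L 0 := by
  have hodd : ∀ s : ℤ, th τ 0 (η + 2 * s * η) ≠ 0 := fun s => by
    have := hη.th_zero_int_ne hτ (n := 1 + 2 * s) (by omega)
    push_cast at this
    rwa [show η + 2 * s * η = (1 + 2 * s) * η by ring]
  have e2 : 2 * (η / 2) = η := by ring
  have hbd0 : ∀ m ∈ Finset.Icc 1 L.length, ∀ i ∈ Finset.range m,
      AnalyticAt ℂ (fun v => bdTerm η τ t L (η - v) m i) (η / 2) ∧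
        bdTerm η τ t L (η / 2) m i = 0 := by
    intro m hm i hi
    rw [Finset.mem_Icc] at hm
    by_cases hme : Even m
    · constructor
      · refine analyticAt_bdTerm hτ hη L (by omega) i analyticAt_const (by fun_prop) (fun s => ?_)
          ?_ ?_
        · rw [sub_half, e2]; exact hodd s
        · obtain ⟨r, rfl⟩ := hme
          have := hodd (r - (i + 1))
          push_cast at this ⊢
          rwa [sub_half, e2, show η + ((r : ℂ) + r - 2 * (i + 1)) * η = η + 2 * (r - (i + 1)) * η by
            ring]
        · have := h1.neg.add_int 1
          rw [sub_half, e2]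
          rwa [Int.cast_one, one_mul, neg_add_eq_sub] at this
      -- The factor l = i contains θ₁(2X - η), which is θ₁(0) at X = η/2.
      · rw [bdTerm, Finset.prod_eq_zero hi, mul_zero]
        rw [e2, show η + ((i : ℂ) - i - 1) * η = 0 by ring, th_zero_zero, mul_zero, zero_div]
    · have : ∀ X, bdTerm η τ t L X m i = 0 := fun X => by
        rw [bdTerm, coef_eq_zero_of_odd, zero_mul, zero_mul]
        rw [Nat.not_even_iff_odd] at hme
        exact_mod_cast hme.add_even hn
      simp only [this]
      exact ⟨analyticAt_const, trivial⟩
  have hbd : AnalyticAt ℂ (fun v => bdSum η τ t L (η - v)) (η / 2) := by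
    unfold bdSum
    exact Finset.analyticAt_fun_sum _ fun m hm => Finset.analyticAt_fun_sum _ fun i hi =>
      (hbd0 m hm i hi).1
  have hbdz : bdSum η τ t L (η - η / 2) = 0 := by
    rw [sub_half]
    exact Finset.sum_eq_zero fun m hm => Finset.sum_eq_zero fun i hi => (hbd0 m hm i hi).2
  have han : AnalyticAt ℂ (fun v => strF η τ L v t) (η / 2) := by
    unfold strF
    refine ((Finset.analyticAt_fun_sum _ fun j hj => analyticAt_const.mul
      ((analyticAt_hfn hτ j (by fun_prop) fun i => ?_).sub
        (analyticAt_hfn hτ j analyticAt_id fun i => ?_))).add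
      (analyticAt_bdSum hτ hη L analyticAt_const (by fun_prop) ?_ ?_)).add hbd
    · have := h2 (1 + 2 * i)
      push_cast at this
      rwa [show 2 * (η / 2 + t) + 2 * i * η = 2 * t + (1 + 2 * i) * η by ring]
    · rw [show 2 * id (η / 2) = η by simp only [id]; ring]
      exact hodd i
    · have := h2.add_int 1
      rw [Int.cast_one, one_mul] at this
      rwa [show 2 * (η / 2 + t) = 2 * t + η by ring]
    · have := h1.add_int 1
      rw [Int.cast_one, one_mul] at this
      rwa [show 2 * (η / 2 + t) - t = t + η by ring]
  have key : strF η τ L (η / 2) t = F t := by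
    refine eq_of_frequently_of_continuousAt (f := fun v => strF η τ L v t) (g := fun _ => F t)
      han.continuousAt continuousAt_const ?_
    refine (frequently_of_countable (countable_not_and
      (countable_not_off (η := η) hτ two_ne_zero 0) (countable_not_and
      (countable_not_off (η := η) hτ two_ne_zero t)
      (countable_not_off (η := η) hτ two_ne_zero (2 * t)))) _).mono fun v hv => ?_
    exact hF v t (by simpa using hv.1) hv.2.1 hv.2.2
  rw [← key, strF, hbdz, perPart, add_zero, add_comm (η / 2) t, add_right_comm]
  congr 1
  rw [Finset.sum_range_succ' _ L.length, Finset.sum_range_succ' _ L.length]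
  simp only [hfn_eta_half hη0, sub_zero, hper, if_true, Nat.add_eq_zero_iff, one_ne_zero, and_false,
    if_false, mul_zero, add_zero]
  congr 1
  rw [hfn, if_pos rfl]
  field_simp
  ring

/-- The canonical `g₁` of a word. -/
def gOne (η τ : ℂ) (L : List (Fin 4)) (t : ℂ) : ℂ := perPart η τ L t / th τ 0 t ^ L.length

/-- The canonical `g₂` of a word. -/
def gTwo (η τ : ℂ) (L : List (Fin 4)) (t : ℂ) : ℂ := -dec η τ t L 0 / th τ 0 t ^ L.length

/-- The canonical `g₃` of a word. -/
def gThree (η τ : ℂ) (L : List (Fin 4)) (t : ℂ) : ℂ :=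
  (∑ j ∈ Finset.range (L.length + 1), dec η τ t L j * (8 * Real.pi * I * j)) / th τ 0 t ^ L.length

theorem meromorphic_gOne (hτ : 0 < τ.im) (hη : IsGen η τ) (L : List (Fin 4)) :
    Meromorphic (gOne η τ L) := by
  intro x
  unfold gOne perPart
  refine (MeromorphicAt.fun_add (MeromorphicAt.fun_sum fun j hj => ?_)
    (meromorphicAt_bdSum hτ L analyticAt_id (by fun_prop))).fun_div (meromorphic_th_pow hτ _ x)
  rw [Finset.mem_range] at hj
  refine ((differentiable_dec hτ hη L (by omega)).analyticAt x).meromorphicAt.fun_mul ?_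
  by_cases h : j = 0
  · simp only [hper, h, if_true]; exact MeromorphicAt.const _ _
  · simp only [hper, h, if_false]; exact meromorphicAt_hfn hτ j (by fun_prop)

theorem meromorphic_gTwo (hτ : 0 < τ.im) (hη : IsGen η τ) (L : List (Fin 4)) :
    Meromorphic (gTwo η τ L) := fun x =>
  ((differentiable_dec hτ hη L (Nat.zero_le _)).analyticAt x).meromorphicAt.fun_neg.fun_div
    (meromorphic_th_pow hτ _ x)

theorem meromorphic_gThree (hτ : 0 < τ.im) (hη : IsGen η τ) (L : List (Fin 4)) :
    Meromorphic (gThree η τ L) := by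
  intro x
  refine (MeromorphicAt.fun_sum fun j hj => ?_).fun_div (meromorphic_th_pow hτ _ x)
  rw [Finset.mem_range] at hj
  exact ((differentiable_dec hτ hη L (by omega)).analyticAt x).meromorphicAt.fun_mul
    (MeromorphicAt.const _ _)

variable {L : List (Fin 4)} (hL : IsTriv L)

include hL in
theorem gOne_add_one (t : ℂ) : gOne η τ L (t + 1) = gOne η τ L t := by
  have hp : perPart η τ L (t + 1) = (-1) ^ L.length * perPart η τ L t := by
    rw [perPart, perPart, bdSum_t_add_one hL,
      show t + 1 + η / 2 = t + η / 2 + 1 / 2 + 1 / 2 by ring, bdSum_X_add_half hL,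
      bdSum_X_add_half hL, show t + η / 2 + 1 / 2 + 1 / 2 = t + η / 2 + 1 by ring, mul_add,
      Finset.mul_sum]
    congr 1
    refine Finset.sum_congr rfl fun j _ => ?_
    rw [dec_add_one hL, hper, hper, hfn_add_one]
    split_ifs <;> ring
  rw [gOne, gOne, hp, th_zero_pow_add_one, mul_div_mul_left _ _ (pow_ne_zero _ (by norm_num))]

include hL in
theorem gTwo_add_one (t : ℂ) : gTwo η τ L (t + 1) = gTwo η τ L t := by
  rw [gTwo, gTwo, dec_add_one hL, th_zero_pow_add_one, ← mul_neg,
    mul_div_mul_left _ _ (pow_ne_zero _ (by norm_num))]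

include hL in
theorem gThree_add_one (t : ℂ) : gThree η τ L (t + 1) = gThree η τ L t := by
  rw [gThree, gThree, th_zero_pow_add_one]
  simp only [dec_add_one hL, mul_assoc ((-1 : ℂ) ^ L.length)]
  rw [← Finset.mul_sum, mul_div_mul_left _ _ (pow_ne_zero _ (by norm_num))]

include hL in
theorem gTwo_add_tau (hη0 : η ≠ 0) (t : ℂ) : gTwo η τ L (t + τ) = gTwo η τ L t := by
  rw [gTwo, gTwo, dec_add_tau hη0 hL, th_zero_pow_add_tau, ← mul_neg,
    mul_div_mul_left _ _ (pow_ne_zero _ (neg_ne_zero.2 (Complex.exp_ne_zero _)))]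

include hL in
theorem gThree_add_tau (hη0 : η ≠ 0) (t : ℂ) : gThree η τ L (t + τ) = gThree η τ L t := by
  rw [gThree, gThree, th_zero_pow_add_tau]
  simp only [dec_add_tau hη0 hL,
    mul_assoc ((-exp (-(Real.pi * I * (τ + 2 * t)))) ^ L.length)]
  rw [← Finset.mul_sum, mul_div_mul_left _ _ (pow_ne_zero _ (neg_ne_zero.2 (Complex.exp_ne_zero _)))]

include hL in
theorem gOne_add_tau (hτ : 0 < τ.im) (hη0 : η ≠ 0) {t : ℂ} (h : Off η τ (2 * t)) :
    gOne η τ L (t + τ) = gOne η τ L t + gThree η τ L t := by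
  have hoff : Off η τ (2 * (t + η / 2)) := by
    have := h.add_int 1
    rw [Int.cast_one, one_mul] at this
    rwa [show 2 * (t + η / 2) = 2 * t + η by ring]
  have hp : perPart η τ L (t + τ) = (-exp (-(Real.pi * I * (τ + 2 * t)))) ^ L.length *
      (perPart η τ L t +
        ∑ j ∈ Finset.range (L.length + 1), dec η τ t L j * (8 * Real.pi * I * j)) := by
    rw [perPart, perPart, bdSum_t_add_tau hη0 hL,
      show t + τ + η / 2 = t + η / 2 + τ / 2 + τ / 2 by ring, bdSum_X_add_half_tau hη0 hL,
      bdSum_X_add_half_tau hη0 hL, show t + η / 2 + τ / 2 + τ / 2 = t + η / 2 + τ by ring,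
      add_right_comm (Finset.sum _ _), mul_add _ (Finset.sum _ _ + Finset.sum _ _),
      ← Finset.sum_add_distrib, Finset.mul_sum]
    congr 1
    refine Finset.sum_congr rfl fun j _ => ?_
    rw [dec_add_tau hη0 hL, hper, hper, hfn_add_tau hτ j hoff]
    by_cases hj : j = 0
    · simp [hj]
    · simp only [hj, if_false]; ring
  rw [gOne, gOne, gThree, hp, th_zero_pow_add_tau, mul_div_mul_left _ _
    (pow_ne_zero _ (neg_ne_zero.2 (Complex.exp_ne_zero _))), add_div]

include hL in
theorem perPart_perm1 (hθ : ∀ α, th τ α η ≠ 0) (hn : Even L.length) {t : ℂ} (h : Off η τ t)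
    (h' : Off η τ (t + 1 / 2)) :
    (L.map (scal1 η τ)).prod * perPart η τ (L.map perm1) (t + 1 / 2) = perPart η τ L t := by
  rw [perPart, perPart, mul_add, bdSum_perm1 hθ hL hn h h', List.length_map, Finset.mul_sum]
  congr 1
  refine Finset.sum_congr rfl fun j _ => ?_
  rw [← mul_assoc, dec_perm1 hθ hL hn, hper, hper, show t + 1 / 2 + η / 2 = t + η / 2 + 1 / 2 by ring]
  by_cases hj : j = 0
  · simp [hj]
  · simp only [hj, if_false]; rw [hfn_add_half hj]

-- The gain 4πij of `hfn j` under τ/2 is half of its gain under τ; this is where half of g₃ comes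
-- from.
include hL in
theorem perPart_perm3 (hτ : 0 < τ.im) (hη0 : η ≠ 0) (hθ : ∀ α, th τ α η ≠ 0) (hn : Even L.length)
    {t : ℂ} (h : Off η τ t) (h' : Off η τ (t + τ / 2)) (h2 : Off η τ (2 * t)) :
    (L.map (scal3 η τ)).prod * perPart η τ (L.map perm3) (t + τ / 2) =
      (I * exp (-(Real.pi * I * (t + τ / 4)))) ^ L.length * (perPart η τ L t +
        1 / 2 * ∑ j ∈ Finset.range (L.length + 1), dec η τ t L j * (8 * Real.pi * I * j)) := by
  rw [perPart, perPart, mul_add, bdSum_perm3 hη0 hθ hL hn h h', List.length_map, Finset.mul_sum,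
    add_right_comm (Finset.sum _ _), mul_add _ (Finset.sum _ _ + _ * Finset.sum _ _),
    Finset.mul_sum _ _ ((1 : ℂ) / 2), ← Finset.sum_add_distrib, Finset.mul_sum]
  congr 1
  refine Finset.sum_congr rfl fun j _ => ?_
  rw [← mul_assoc, dec_perm3 hη0 hθ hL hn, hper, hper,
    show t + τ / 2 + η / 2 = t + η / 2 + τ / 2 by ring]
  by_cases hj : j = 0
  · simp [hj]
  · simp only [hj, if_false]
    rw [hfn_add_half_tau hτ (n := j) hj le_rfl fun i _ => by
      have := h2 (1 + 2 * i)
      push_cast at this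
      rwa [show 2 * (t + η / 2) + 2 * i * η = 2 * t + (1 + 2 * i) * η by ring]]
    ring

end

/-! ### Homogeneous elements -/

theorem degreePart_eq_span_word (η τ : ℂ) (n : ℕ) :
    degreePart η τ n = Submodule.span ℂ {A | ∃ L : List (Fin 4), L.length = n ∧ A = word η τ L} := by
  induction n with
  | zero =>
    rw [degreePart, pow_zero, Submodule.one_eq_span]
    congr 1
    ext A
    simp only [Set.mem_singleton_iff, Set.mem_ofPred_eq, List.length_eq_zero_iff]
    constructor
    · rintro rfl; exact ⟨[], rfl, rfl⟩
    · rintro ⟨L, rfl, rfl⟩; rfl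
  | succ n ih =>
    rw [degreePart] at ih ⊢
    rw [pow_succ', ih, Submodule.span_mul_span]
    congr 1
    ext A
    simp only [Set.mem_mul, Set.mem_range, Set.mem_ofPred_eq]
    constructor
    · rintro ⟨_, ⟨α, rfl⟩, _, ⟨L, rfl, rfl⟩, rfl⟩
      exact ⟨α :: L, rfl, (word_cons η τ α L).symm⟩
    · rintro ⟨L, hL, rfl⟩
      match L, hL with
      | α :: L, hL => exact ⟨_, ⟨α, rfl⟩, _, ⟨L, by simpa using hL, rfl⟩, (word_cons η τ α L).symm⟩

theorem word_mem_degreePart (η τ : ℂ) (L : List (Fin 4)) : word η τ L ∈ degreePart η τ L.length := by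
  rw [degreePart_eq_span_word]
  exact Submodule.subset_span ⟨L, rfl, rfl⟩

theorem degreePart_induction {η τ : ℂ} {n : ℕ} {p : Alg η τ → Prop}
    (word : ∀ L : List (Fin 4), L.length = n → p (word η τ L)) (zero : p 0)
    (add : ∀ A B, p A → p B → p (A + B)) (smul : ∀ (c : ℂ) A, p A → p (c • A))
    {A : Alg η τ} (hA : A ∈ degreePart η τ n) : p A := by
  rw [degreePart_eq_span_word] at hA
  induction hA using Submodule.span_induction with
  | mem x hx => obtain ⟨L, hL, rfl⟩ := hx; exact word L hL
  | zero => exact zero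
  | add x y _ _ hx hy => exact add x y hx hy
  | smul c x _ hx => exact smul c x hx

theorem map_mem_degreePart {η τ : ℂ} (φ : Alg η τ →ₐ[ℂ] Alg η τ) (c : Fin 4 → ℂ)
    (σ : Fin 4 → Fin 4) (h : ∀ α, φ (S η τ α) = c α • S η τ (σ α)) {n : ℕ} {A : Alg η τ}
    (hA : A ∈ degreePart η τ n) : φ A ∈ degreePart η τ n := by
  refine degreePart_induction (p := fun A => φ A ∈ degreePart η τ n) ?_ ?_ ?_ ?_ hA
  · rintro L rfl
    rw [algHom_word φ c σ h]
    have := word_mem_degreePart η τ (L.map σ)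
    rw [List.length_map] at this
    exact Submodule.smul_mem _ _ this
  · rw [map_zero]; exact zero_mem _
  · intro A B hA hB; rw [map_add]; exact add_mem hA hB
  · intro c A hA; rw [map_smul]; exact Submodule.smul_mem _ _ hA

/-- The relations are homogeneous of degree 2, so doubling the generators respects them; the
resulting endomorphism has eigenvalue 2^n in degree n and separates the homogeneous components. -/
theorem scale_rel (η τ : ℂ) ⦃x y : FreeAlgebra ℂ (Fin 4)⦄ (h : Rel η τ x y) :
    FreeAlgebra.lift ℂ (fun α => (2 : ℂ) • S η τ α) x =
      FreeAlgebra.lift ℂ (fun α => (2 : ℂ) • S η τ α) y := by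
  rcases h with ⟨a, b, c, h⟩ | ⟨a, b, c, h⟩
  · have := congrArg (fun A => (4 : ℂ) • A) (S_quad1 η τ h)
    simp only [map_sub, map_mul, map_smul, map_add, FreeAlgebra.lift_ι_apply, smul_mul_assoc,
      mul_smul_comm, smul_smul, smul_sub, smul_add] at this ⊢
    norm_num at this ⊢
    rw [this]
    congr 1 <;> congr 1 <;> ring
  · have := congrArg (fun A => (4 : ℂ) • A) (S_quad2 η τ h)
    simp only [map_sub, map_mul, map_smul, map_add, FreeAlgebra.lift_ι_apply, smul_mul_assoc,
      mul_smul_comm, smul_smul, smul_sub, smul_add] at this ⊢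
    norm_num at this ⊢
    rw [this]
    congr 1 <;> congr 1 <;> ring

/-- The endomorphism of the Sklyanin algebra which doubles the generators. -/
def scale (η τ : ℂ) : Alg η τ →ₐ[ℂ] Alg η τ :=
  RingQuot.liftAlgHom ℂ ⟨FreeAlgebra.lift ℂ (fun α => (2 : ℂ) • S η τ α), scale_rel η τ⟩

theorem scale_S (η τ : ℂ) (α : Fin 4) : scale η τ (S η τ α) = (2 : ℂ) • S η τ α := by
  simp [scale, S]

theorem scale_of_mem {η τ : ℂ} {n : ℕ} {A : Alg η τ} (hA : A ∈ degreePart η τ n) :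
    scale η τ A = (2 : ℂ) ^ n • A := by
  refine degreePart_induction (p := fun A => scale η τ A = (2 : ℂ) ^ n • A) ?_ ?_ ?_ ?_ hA
  · rintro L rfl
    rw [algHom_word (scale η τ) (fun _ => 2) id (scale_S η τ)]
    simp
  · simp
  · intro A B hA hB; rw [map_add, hA, hB, smul_add]
  · intro c A hA; rw [map_smul, hA, smul_comm]

theorem eq_zero_of_mem_of_mem {η τ : ℂ} {n m : ℕ} (hnm : n ≠ m) {A : Alg η τ}
    (hn : A ∈ degreePart η τ n) (hm : A ∈ degreePart η τ m) : A = 0 := by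
  have h := (scale_of_mem hn).symm.trans (scale_of_mem hm)
  have h1 : ((2 : ℂ) ^ n - 2 ^ m) • A + (2 : ℂ) ^ m • A = (2 : ℂ) ^ m • A := by
    rw [← add_smul, sub_add_cancel, h]
  refine (smul_eq_zero.1 (add_eq_right.1 h1)).resolve_left fun h => hnm ?_
  have h2 : (2 : ℂ) ^ n = 2 ^ m := sub_eq_zero.1 h
  exact Nat.pow_right_injective le_rfl (by exact_mod_cast h2)

/-! ### Forms -/

section
variable {η τ : ℂ}

theorem IsElliptic.add {f g : ℂ → ℂ} (hf : IsElliptic τ f) (hg : IsElliptic τ g) :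
    IsElliptic τ fun t => f t + g t :=
  ⟨fun x => (hf.1 x).fun_add (hg.1 x), hf.2.1.add hg.2.1, hf.2.2.add hg.2.2⟩

theorem IsElliptic.const_mul {f : ℂ → ℂ} (c : ℂ) (hf : IsElliptic τ f) :
    IsElliptic τ fun t => c * f t :=
  ⟨fun x => (MeromorphicAt.const c x).fun_mul (hf.1 x), hf.2.1.fun_comp (c * ·),
    hf.2.2.fun_comp (c * ·)⟩

theorem isElliptic_zero : IsElliptic τ fun _ => 0 :=
  ⟨fun x => MeromorphicAt.const _ x, EventuallyEq.rfl, EventuallyEq.rfl⟩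

theorem _root_.Meromorphic.comp_add {f : ℂ → ℂ} (hf : Meromorphic f) (c : ℂ) :
    Meromorphic fun t => f (t + c) := fun x =>
  MeromorphicAt.comp_analyticAt (f := f) (g := fun t => t + c) (hf (x + c)) (by fun_prop)

theorem IsElliptic.congr {f g : ℂ → ℂ} (hf : IsElliptic τ f) (hg : Meromorphic g)
    (h : g =ᶠ[codiscrete ℂ] f) : IsElliptic τ g :=
  ⟨hg, by
    filter_upwards [eventually_codiscrete_add h 1, hf.2.1, h] with t a b c
    rw [a, b, c], by
    filter_upwards [eventually_codiscrete_add h τ, hf.2.2, h] with t a b c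
    rw [a, b, c]⟩

variable {n : ℕ} {F G f₁ f₂ g₁ g₂ g₀ : ℂ → ℂ}

theorem IsEvenForm.add (hF : IsEvenForm η τ n F f₁ f₂) (hG : IsEvenForm η τ n G g₁ g₂) :
    IsEvenForm η τ n (fun l => F l + G l) (fun t => f₁ t + g₁ t) fun t => f₂ t + g₂ t := by
  obtain ⟨a1, a2, a3, a4, a5⟩ := hF
  obtain ⟨b1, b2, b3, b4, b5⟩ := hG
  refine ⟨fun x => (a1 x).fun_add (b1 x), a2.add b2, a3.add b3, ?_, ?_⟩
  · have := a4.add b4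
    refine this.congr (fun x => ?_) (Eventually.of_forall fun t => by ring)
    exact ((a1.comp_add τ x).fun_add (b1.comp_add τ x)).fun_sub ((a1 x).fun_add (b1 x))
  · filter_upwards [a5, b5] with t h h'
    rw [h, h']; ring

theorem IsEvenForm.const_mul (c : ℂ) (hF : IsEvenForm η τ n F f₁ f₂) :
    IsEvenForm η τ n (fun l => c * F l) (fun t => c * f₁ t) fun t => c * f₂ t := by
  obtain ⟨a1, a2, a3, a4, a5⟩ := hF
  refine ⟨fun x => (MeromorphicAt.const c x).fun_mul (a1 x), a2.fun_comp (c * ·), a3.const_mul c,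
    ?_, ?_⟩
  · have := a4.const_mul c
    refine this.congr (fun x => ?_) (Eventually.of_forall fun t => by ring)
    exact ((MeromorphicAt.const c x).fun_mul (a1.comp_add τ x)).fun_sub
      ((MeromorphicAt.const c x).fun_mul (a1 x))
  · filter_upwards [a5] with t h
    rw [h]; ring

theorem isEvenForm_zero (η τ : ℂ) (n : ℕ) :
    IsEvenForm η τ n (fun _ => 0) (fun _ => 0) fun _ => 0 :=
  ⟨fun x => MeromorphicAt.const _ x, EventuallyEq.rfl, isElliptic_zero, by
    simpa using isElliptic_zero, Eventually.of_forall fun t => by simp⟩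

/-- Treating an odd form as an even form with g₂ = 0 lets one uniqueness statement serve both
parities. -/
theorem IsOddForm.isEvenForm (h : IsOddForm η τ n F g₀) :
    IsEvenForm η τ n F g₀ fun _ => 0 := by
  obtain ⟨⟨a1, a2, a3⟩, a4⟩ := h
  refine ⟨a1, a2, isElliptic_zero, isElliptic_zero.congr ?_ ?_, ?_⟩
  · exact fun x => (a1.comp_add τ x).fun_sub (a1 x)
  · filter_upwards [a3] with t h
    rw [h, sub_self]
  · filter_upwards [a4] with t h
    rw [h, mul_zero, sub_zero]

theorem IsOddForm.add {f₀ : ℂ → ℂ} (hF : IsOddForm η τ n F f₀) (hG : IsOddForm η τ n G g₀) :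
    IsOddForm η τ n (fun l => F l + G l) fun t => f₀ t + g₀ t := by
  refine ⟨hF.1.add hG.1, ?_⟩
  filter_upwards [hF.2, hG.2] with t h h'
  rw [h, h']; ring

theorem IsOddForm.const_mul (c : ℂ) (hF : IsOddForm η τ n F g₀) :
    IsOddForm η τ n (fun l => c * F l) fun t => c * g₀ t := by
  refine ⟨hF.1.const_mul c, ?_⟩
  filter_upwards [hF.2] with t h
  rw [h]; ring

theorem isOddForm_zero (η τ : ℂ) (n : ℕ) : IsOddForm η τ n (fun _ => 0) fun _ => 0 :=
  ⟨isElliptic_zero, Eventually.of_forall fun t => by simp⟩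

variable (hτ : 0 < τ.im) (hη : IsGen η τ)

/-- `F` interpolates the traces of `A`. -/
def Interp (A : Alg η τ) (F : ℂ → ℂ) : Prop :=
  Differentiable ℂ F ∧ ∀ k : ℕ, F (k + 1) = LinearMap.trace ℂ (V τ k) (seriesRep hτ hη k A)

variable {A B : Alg η τ} {hτ hη}

theorem Interp.add (hF : Interp hτ hη A F) (hG : Interp hτ hη B G) :
    Interp hτ hη (A + B) fun l => F l + G l :=
  ⟨hF.1.add hG.1, fun k => by
    show F _ + G _ = _
    rw [hF.2, hG.2, map_add, map_add]⟩

theorem Interp.smul (c : ℂ) (hF : Interp hτ hη A F) :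
    Interp hτ hη (c • A) fun l => c * F l :=
  ⟨hF.1.const_mul c, fun k => by
    show c * F _ = _
    rw [hF.2, map_smul, map_smul, smul_eq_mul]⟩

variable (hτ hη) in
theorem interp_zero : Interp hτ hη (0 : Alg η τ) fun _ => 0 :=
  ⟨differentiable_const 0, fun k => by rw [map_zero, map_zero]⟩

/-- Division by θ₁(t)^n, which does not vanish at kη for k ≥ 1, turns the vanishing of the traces
into the hypothesis of `eq_zero_of_tendsto_zero`. -/
theorem eq_zero_of_interp_zero (hη0 : η ≠ 0) (hF : Interp hτ hη (0 : Alg η τ) F)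
    (h : IsEvenForm η τ n F g₁ g₂) :
    (∀ l, F l = 0) ∧ (∀ᶠ t in codiscrete ℂ, g₁ t = 0) ∧ ∀ᶠ t in codiscrete ℂ, g₂ t = 0 := by
  obtain ⟨a1, a2, a3, a4, a5⟩ := h
  have hdiv : Differentiable ℂ fun t => F (t / η) :=
    hF.1.comp (differentiable_id.div_const _)
  have key := eq_zero_of_tendsto_zero hτ hη hη0 a1 a2 a3 a4 fun K hK => by
    obtain ⟨k, rfl⟩ : ∃ k, K = k + 1 := ⟨K - 1, by omega⟩
    have hθ : th τ 0 ((k + 1 : ℕ) * η) ^ n ≠ 0 := pow_ne_zero _ (by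
      have := hη.th_zero_int_ne hτ (n := (k + 1 : ℕ)) (by omega)
      exact_mod_cast this)
    have hc : ContinuousAt (fun t => F (t / η) / th τ 0 t ^ n) ((k + 1 : ℕ) * η) :=
      hdiv.continuous.continuousAt.div ((differentiable_th hτ 0).pow n).continuous.continuousAt hθ
    have h0 : F ((k + 1 : ℕ) * η / η) = 0 := by
      rw [mul_div_cancel_right₀ _ hη0]
      push_cast
      rw [hF.2, map_zero, map_zero]
    have ht := hc.tendsto.mono_left (nhdsWithin_le_nhds (s := {((k + 1 : ℕ) * η)}ᶜ))
    rw [h0, zero_div] at ht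
    refine ht.congr' ?_
    filter_upwards [eventually_codiscrete_iff.1 a5 _,
      eventually_codiscrete_iff.1 (th_zero_pow_ne hτ n) _] with t h1 h2
    rw [h1, mul_div_cancel_left₀ _ h2]
  refine ⟨fun l => ?_, key⟩
  have : F (l * η / η) = 0 := by
    refine eq_of_eventuallyEq_nhdsNE (f := fun t => F (t / η)) (g := fun _ => 0)
      hdiv.continuous.continuousAt continuousAt_const ?_
    filter_upwards [eventually_codiscrete_iff.1 a5 _, eventually_codiscrete_iff.1 key.1 _,
      eventually_codiscrete_iff.1 key.2 _] with t h1 h2 h3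
    rw [h1, h2, h3, mul_zero, sub_zero, mul_zero]
  rwa [mul_div_cancel_right₀ _ hη0] at this

theorem Interp.unique (hη0 : η ≠ 0) (hF : Interp hτ hη A F) (hF' : IsEvenForm η τ n F f₁ f₂)
    (hG : Interp hτ hη A G) (hG' : IsEvenForm η τ n G g₁ g₂) :
    F = G ∧ f₁ =ᶠ[codiscrete ℂ] g₁ ∧ f₂ =ᶠ[codiscrete ℂ] g₂ := by
  have h1 := hF.add (hG.smul (-1))
  have h0 : A + (-1 : ℂ) • A = 0 := by
    have : ((1 : ℂ) + -1) • A = A + (-1 : ℂ) • A := by rw [add_smul, one_smul]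
    rw [← this, add_neg_cancel, zero_smul]
  rw [h0] at h1
  obtain ⟨a, b, c⟩ := eq_zero_of_interp_zero hη0 h1 (hF'.add (hG'.const_mul (-1)))
  refine ⟨funext fun l => ?_, b.mono fun t ht => ?_, c.mono fun t ht => ?_⟩
  · linear_combination a l
  · linear_combination ht
  · linear_combination ht

/-! ### Words -/

theorem interp_word_of_not_isTriv (hη0 : η ≠ 0) {L : List (Fin 4)} (hL : ¬ IsTriv L) :
    Interp hτ hη (word η τ L) fun _ => 0 :=
  ⟨differentiable_const 0, fun k => (trace_eq_zero_of_not_isTriv hτ hη hη0 hL k).symm⟩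

-- For odd length every `dec` vanishes, so the shifts of `strF` have no defect and its quotient by
-- θ₁(t)^n is elliptic.
variable (hτ hη) in
theorem exists_interp_word_odd (hη0 : η ≠ 0) {L : List (Fin 4)} (hn : Odd L.length) :
    ∃ F g₀, Interp hτ hη (word η τ L) F ∧ IsOddForm η τ L.length F g₀ := by
  by_cases hL : IsTriv L
  · obtain ⟨F, hF, hk, hv⟩ := exists_entire_strF hτ hη hη0 hL
    obtain ⟨v, h0⟩ := exists_off (η := η) hτ
    have hmer : Meromorphic fun t => strF η τ L v t / th τ 0 t ^ L.length := fun x =>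
      (meromorphic_strF hτ hη L v x).fun_div (meromorphic_th_pow hτ _ x)
    refine ⟨fun l => F (l * η), fun t => strF η τ L v t / th τ 0 t ^ L.length,
      ⟨hF.comp (differentiable_id.mul_const η), hk⟩, ⟨hmer, Eventually.of_forall fun t => ?_, ?_⟩, ?_⟩
    · simp only [strF_add_one hL, dec_of_odd hn, zero_mul, Finset.sum_const_zero, add_zero,
        th_zero_pow_add_one]
      rw [mul_div_mul_left _ _ (pow_ne_zero _ (by norm_num))]
    · refine eventuallyEq_codiscrete_of_countable (hmer.comp_add τ) hmer
        (countable_not_off (η := η) hτ two_ne_zero (2 * v)) fun t ht => ?_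
      simp only [strF_add_tau hτ hη0 hL ht, dec_of_odd hn, zero_mul, Finset.sum_const_zero,
        add_zero, th_zero_pow_add_tau]
      rw [mul_div_mul_left _ _ (pow_ne_zero _ (neg_ne_zero.2 (Complex.exp_ne_zero _)))]
    · refine eventuallyEq_codiscrete_of_countable (fun x => ?_)
        (fun x => (meromorphic_th_pow hτ _ x).fun_mul (hmer x))
        (countable_not_and (countable_not_off (η := η) hτ one_ne_zero 0) (countable_not_and
        (countable_not_off (η := η) hτ one_ne_zero (2 * v))
        (countable_not_off (η := η) hτ two_ne_zero (2 * v)))) fun t ht => ?_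
      · have : Differentiable ℂ fun t => F (t / η * η) := hF.comp (by fun_prop)
        exact (this.analyticAt x).meromorphicAt
      · have h1 := ht.1 0
        rw [one_mul, add_zero, Int.cast_zero, zero_mul, add_zero] at h1
        have h2 := ht.2.1
        rw [one_mul, add_comm] at h2
        have h3 := ht.2.2
        rw [add_comm] at h3
        show F (t / η * η) = th τ 0 t ^ L.length * (strF η τ L v t / th τ 0 t ^ L.length)
        rw [div_mul_cancel₀ _ hη0, hv v t h0 h2 h3, mul_div_cancel₀ _ (pow_ne_zero _ h1)]
  · exact ⟨_, _, interp_word_of_not_isTriv hη0 hL, isOddForm_zero η τ _⟩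

variable (hτ hη) in
theorem exists_interp_word_even (hη0 : η ≠ 0) {L : List (Fin 4)} (hn : Even L.length)
    (hL : IsTriv L) : ∃ F, Interp hτ hη (word η τ L) F ∧
      IsEvenForm η τ L.length F (gOne η τ L) (gTwo η τ L) ∧
      ∀ t, Off η τ t → Off η τ (2 * t) →
        F (t / η) = perPart η τ L t + t / η * dec η τ t L 0 := by
  obtain ⟨F, hF, hk, hv⟩ := exists_entire_strF hτ hη hη0 hL
  have key : ∀ t, Off η τ t → Off η τ (2 * t) →
      F (t / η * η) = perPart η τ L t + t / η * dec η τ t L 0 := fun t h1 h2 => by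
    rw [div_mul_cancel₀ _ hη0]
    exact strF_half_eta hτ hη hη0 hn hv h1 h2
  have m1 := meromorphic_gOne hτ hη L
  have m2 := meromorphic_gTwo hτ hη L
  have m3 := meromorphic_gThree hτ hη L
  refine ⟨fun l => F (l * η), ⟨hF.comp (differentiable_id.mul_const η), hk⟩,
    ⟨m1, Eventually.of_forall fun t => gOne_add_one hL t,
    ⟨m2, Eventually.of_forall fun t => gTwo_add_one hL t,
      Eventually.of_forall fun t => gTwo_add_tau hL hη0 t⟩, ?_, ?_⟩, key⟩
  · refine IsElliptic.congr (f := gThree η τ L) ⟨m3, Eventually.of_forall fun t => gThree_add_one hL t,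
      Eventually.of_forall fun t => gThree_add_tau hL hη0 t⟩
      (fun x => (m1.comp_add τ x).fun_sub (m1 x)) ?_
    refine eventuallyEq_codiscrete_of_countable (fun x => (m1.comp_add τ x).fun_sub (m1 x)) m3
      (countable_not_off (η := η) hτ two_ne_zero 0) fun t ht => ?_
    rw [gOne_add_tau hL hτ hη0 (by simpa using ht), add_sub_cancel_left]
  · refine eventuallyEq_codiscrete_of_countable (fun x => ?_) (fun x => ?_)
      (countable_not_and (countable_not_off (η := η) hτ one_ne_zero 0)
        (countable_not_off (η := η) hτ two_ne_zero 0)) fun t ht => ?_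
    · have : Differentiable ℂ fun t => F (t / η * η) := hF.comp (by fun_prop)
      exact (this.analyticAt x).meromorphicAt
    · exact (meromorphic_th_pow hτ _ x).fun_mul ((m1 x).fun_sub
        ((AnalyticAt.meromorphicAt (f := fun t => t / η) (by fun_prop)).fun_mul (m2 x)))
    · have h1 : Off η τ t := by simpa using ht.1
      have h0 := h1 0
      rw [Int.cast_zero, zero_mul, add_zero] at h0
      show F (t / η * η) = _
      rw [key t h1 (by simpa using ht.2), gOne, gTwo]
      have := pow_ne_zero L.length h0
      field_simp
      ring

end

/-! ### Simultaneous trace functions for A, ι¹(A) and ι³(A), and the function `Tr` -/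

section
variable {η τ : ℂ} (hτ : 0 < τ.im) (hη : IsGen η τ)

/-- The relations between the traces of `A`, `ι¹(A)` and `ι³(A)`. -/
def IotaRel (η τ : ℂ) (n : ℕ) (g₁ g₂ F₁ F₃ : ℂ → ℂ) : Prop :=
  ((fun t => F₁ (t / η + 1 / (2 * η))) =ᶠ[codiscrete ℂ]
    fun t => th τ 0 t ^ n * (g₁ t - (t / η + 1 / (2 * η)) * g₂ t)) ∧
  ((fun t => F₃ (t / η + τ / (2 * η))) =ᶠ[codiscrete ℂ]
    fun t => th τ 0 t ^ n *
      ((g₁ t + 1 / 2 * (g₁ (t + τ) - g₁ t) - (t / η + τ / (2 * η)) * g₂ t) *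
        (-exp (-(Real.pi * I * (τ / 2 + 2 * t)))) ^ (n / 2)))

/-- There are trace functions for `A`, `ι¹(A)` and `ι³(A)`, with the expected relations. -/
def EvenData (n : ℕ) (A : Alg η τ) : Prop :=
  ∃ F g₁ g₂ F₁ a₁ a₂ F₃ b₁ b₂, Interp hτ hη A F ∧ IsEvenForm η τ n F g₁ g₂ ∧
    Interp hτ hη (iota1 η τ A) F₁ ∧ IsEvenForm η τ n F₁ a₁ a₂ ∧
    Interp hτ hη (iota3 η τ A) F₃ ∧ IsEvenForm η τ n F₃ b₁ b₂ ∧ IotaRel η τ n g₁ g₂ F₁ F₃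

variable {hτ hη} {n : ℕ} {A B : Alg η τ}

theorem EvenData.add (hA : EvenData hτ hη n A) (hB : EvenData hτ hη n B) :
    EvenData hτ hη n (A + B) := by
  obtain ⟨F, g₁, g₂, F₁, a₁, a₂, F₃, b₁, b₂, h1, h2, h3, h4, h5, h6, h7, h8⟩ := hA
  obtain ⟨F', g₁', g₂', F₁', a₁', a₂', F₃', b₁', b₂', h1', h2', h3', h4', h5', h6', h7', h8'⟩ := hB
  refine ⟨_, _, _, _, _, _, _, _, _, h1.add h1', h2.add h2', by rw [map_add]; exact h3.add h3',
    h4.add h4', by rw [map_add]; exact h5.add h5', h6.add h6', ?_, ?_⟩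
  · filter_upwards [h7, h7'] with t e e'
    rw [e, e']; ring
  · filter_upwards [h8, h8'] with t e e'
    rw [e, e']; ring

theorem EvenData.smul (c : ℂ) (hA : EvenData hτ hη n A) : EvenData hτ hη n (c • A) := by
  obtain ⟨F, g₁, g₂, F₁, a₁, a₂, F₃, b₁, b₂, h1, h2, h3, h4, h5, h6, h7, h8⟩ := hA
  refine ⟨_, _, _, _, _, _, _, _, _, h1.smul c, h2.const_mul c, by rw [map_smul]; exact h3.smul c,
    h4.const_mul c, by rw [map_smul]; exact h5.smul c, h6.const_mul c, ?_, ?_⟩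
  · filter_upwards [h7] with t e
    rw [e]; ring
  · filter_upwards [h8] with t e
    rw [e]; ring

theorem iotaRel_zero (η τ : ℂ) (n : ℕ) :
    IotaRel η τ n (fun _ => 0) (fun _ => 0) (fun _ => 0) fun _ => 0 :=
  ⟨Eventually.of_forall fun t => by simp, Eventually.of_forall fun t => by simp⟩

variable (hτ hη) in
theorem evenData_zero (n : ℕ) : EvenData hτ hη n 0 :=
  ⟨_, _, _, _, _, _, _, _, _, interp_zero hτ hη, isEvenForm_zero η τ n,
    by rw [map_zero]; exact interp_zero hτ hη, isEvenForm_zero η τ n,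
    by rw [map_zero]; exact interp_zero hτ hη, isEvenForm_zero η τ n, iotaRel_zero η τ n⟩

-- For a trivial word the distinguished string at t is compared with those of its images at t + 1/2
-- and t + τ/2. For a nontrivial word of even length the images are nontrivial too, and all traces
-- are zero.
variable (hτ hη) in
theorem evenData_word (hη0 : η ≠ 0) {L : List (Fin 4)} (hn : Even L.length) :
    EvenData hτ hη L.length (word η τ L) := by
  have hθ : ∀ α, th τ α η ≠ 0 := hη.th_ne hτ
  have e1 := algHom_word (iota1 η τ) (scal1 η τ) perm1 (iota1_S hθ) L
  have e3 := algHom_word (iota3 η τ) (scal3 η τ) perm3 (iota3_S hθ) L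
  have l1 : (L.map perm1).length = L.length := List.length_map _
  have l3 : (L.map perm3).length = L.length := List.length_map _
  have z : ∀ c : ℂ, (fun l : ℂ => c * (fun _ : ℂ => (0 : ℂ)) l) = fun _ => 0 :=
    fun c => funext fun _ => mul_zero c
  by_cases hL : IsTriv L
  · obtain ⟨F, h1, h2, -⟩ := exists_interp_word_even hτ hη hη0 hn hL
    obtain ⟨F₁, h3, h4, k1⟩ := exists_interp_word_even hτ hη hη0 (L := L.map perm1) (by rwa [l1])
      ((isTriv_map_perm1 hn).2 hL)
    obtain ⟨F₃, h5, h6, k3⟩ := exists_interp_word_even hτ hη hη0 (L := L.map perm3) (by rwa [l3])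
      ((isTriv_map_perm3 hn).2 hL)
    rw [l1] at h4
    rw [l3] at h6
    have m1 := meromorphic_gOne hτ hη L
    have m2 := meromorphic_gTwo hτ hη L
    have hF : ∀ {F : ℂ → ℂ} (c d : ℂ), Differentiable ℂ F → Meromorphic fun t => c * F (t / η + d) :=
      fun {F} c d h x => by
        have : Differentiable ℂ fun t => c * F (t / η + d) := (h.comp (by fun_prop)).const_mul c
        exact (this.analyticAt x).meromorphicAt
    have hlin : ∀ d : ℂ, Meromorphic fun t : ℂ => (t / η + d) * gTwo η τ L t := fun d x =>
      (AnalyticAt.meromorphicAt (f := fun t => t / η + d) (by fun_prop)).fun_mul (m2 x)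
    have hoff : ∀ {t : ℂ}, Off η τ t → th τ 0 t ^ L.length ≠ 0 := fun h => by
      have h0 := h 0
      rw [Int.cast_zero, zero_mul, add_zero] at h0
      exact pow_ne_zero _ h0
    have hcount : ∀ c : ℂ, {t | ¬ (Off η τ (1 * t + 0) ∧ Off η τ (2 * t + 0) ∧
        Off η τ (1 * t + c) ∧ Off η τ (2 * t + 2 * c))}.Countable := fun c =>
      countable_not_and (countable_not_off hτ one_ne_zero _) (countable_not_and
        (countable_not_off hτ two_ne_zero _) (countable_not_and
        (countable_not_off hτ one_ne_zero _) (countable_not_off hτ two_ne_zero _)))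
    refine ⟨_, _, _, _, _, _, _, _, _, h1, h2, by rw [e1]; exact h3.smul _, h4.const_mul _,
      by rw [e3]; exact h5.smul _, h6.const_mul _, ?_, ?_⟩
    · refine eventuallyEq_codiscrete_of_countable (hF _ _ h3.1) (fun x =>
        (meromorphic_th_pow hτ _ x).fun_mul ((m1 x).fun_sub (hlin _ x))) (hcount (1 / 2)) ?_
      rintro t ⟨o1, o2, o3, o4⟩
      simp only [one_mul, add_zero, ← mul_add] at o1 o2 o3 o4
      have hp := perPart_perm1 hL hθ hn o1 o3
      have hd := dec_perm1 hθ hL hn t 0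
      have hq := hoff o1
      have ht : t / η + 1 / (2 * η) = (t + 1 / 2) / η := by field_simp
      rw [ht, gOne, gTwo]
      show _ * F₁ _ = _
      rw [k1 _ o3 o4]
      have : th τ 0 t ^ L.length * (perPart η τ L t / th τ 0 t ^ L.length -
          (t + 1 / 2) / η * (-dec η τ t L 0 / th τ 0 t ^ L.length)) =
          perPart η τ L t + (t + 1 / 2) / η * dec η τ t L 0 := by
        field_simp
        ring
      rw [this]
      linear_combination hp + (t + 1 / 2) / η * hd
    · refine eventuallyEq_codiscrete_of_countable (hF _ _ h5.1) (fun x => ?_) (hcount (τ / 2)) ?_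
      · refine (meromorphic_th_pow hτ _ x).fun_mul ((((m1 x).fun_add
          ((MeromorphicAt.const _ x).fun_mul ((m1.comp_add τ x).fun_sub (m1 x)))).fun_sub
          (hlin _ x)).fun_mul (AnalyticAt.meromorphicAt ?_))
        have : Differentiable ℂ fun t : ℂ =>
          (-exp (-(Real.pi * I * (τ / 2 + 2 * t)))) ^ (L.length / 2) := by fun_prop
        exact this.analyticAt x
      · rintro t ⟨o1, o2, o3, o4⟩
        simp only [one_mul, add_zero, ← mul_add] at o1 o2 o3 o4
        have hp := perPart_perm3 hL hτ hη0 hθ hn o1 o3 o2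
        have hd := dec_perm3 hη0 hθ hL hn t 0
        have hq := hoff o1
        have ht : t / η + τ / (2 * η) = (t + τ / 2) / η := by field_simp
        -- The base on the left is the square of the base on the right, and n/2 is an exact division
        -- since n is even.
        have hE : (-exp (-(Real.pi * I * (τ / 2 + 2 * t)))) ^ (L.length / 2) =
            (I * exp (-(Real.pi * I * (t + τ / 4)))) ^ L.length := by
          obtain ⟨r, hr⟩ := hn
          have e : (I * exp (-(Real.pi * I * (t + τ / 4)))) ^ 2 =
              -exp (-(Real.pi * I * (τ / 2 + 2 * t))) := by
            rw [mul_pow, I_sq, ← Complex.exp_nat_mul, neg_one_mul]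
            congr 2; push_cast; ring
          rw [← e, ← pow_mul]
          congr 1
          omega
        rw [ht, gOne_add_tau hL hτ hη0 o2, add_sub_cancel_left, hE, gOne, gTwo, gThree]
        show _ * F₃ _ = _
        rw [k3 _ o3 o4]
        generalize (I * exp (-(Real.pi * I * (t + τ / 4)))) ^ L.length = E at *
        generalize (∑ j ∈ Finset.range (L.length + 1), dec η τ t L j * (8 * Real.pi * I * j)) = T
          at *
        have : th τ 0 t ^ L.length * ((perPart η τ L t / th τ 0 t ^ L.length +
            1 / 2 * (T / th τ 0 t ^ L.length) -
            (t + τ / 2) / η * (-dec η τ t L 0 / th τ 0 t ^ L.length)) * E) =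
            (perPart η τ L t + 1 / 2 * T + (t + τ / 2) / η * dec η τ t L 0) * E := by
          field_simp
          ring
        rw [this]
        linear_combination hp + (t + τ / 2) / η * hd
  · refine ⟨_, _, _, _, _, _, _, _, _, interp_word_of_not_isTriv hη0 hL, isEvenForm_zero η τ _, ?_,
      isEvenForm_zero η τ _, ?_, isEvenForm_zero η τ _, iotaRel_zero η τ _⟩
    · rw [e1, ← z]
      exact (interp_word_of_not_isTriv hη0 (mt (isTriv_map_perm1 hn).1 hL)).smul _
    · rw [e3, ← z]
      exact (interp_word_of_not_isTriv hη0 (mt (isTriv_map_perm3 hn).1 hL)).smul _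

variable (hτ hη) in
theorem evenData_of_mem (hη0 : η ≠ 0) (hn : Even n) (hA : A ∈ degreePart η τ n) :
    EvenData hτ hη n A := by
  refine degreePart_induction ?_ (evenData_zero hτ hη n) (fun A B => EvenData.add)
    (fun c A => EvenData.smul c) hA
  rintro L rfl
  exact evenData_word hτ hη hη0 hn

variable (hτ hη) in
theorem oddData_of_mem (hη0 : η ≠ 0) (hn : Odd n) (hA : A ∈ degreePart η τ n) :
    ∃ F g₀, Interp hτ hη A F ∧ IsOddForm η τ n F g₀ := by
  refine degreePart_induction (p := fun A => ∃ F g₀, Interp hτ hη A F ∧ IsOddForm η τ n F g₀)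
    ?_ ⟨_, _, interp_zero hτ hη, isOddForm_zero η τ n⟩ ?_ ?_ hA
  · rintro L rfl
    exact exists_interp_word_odd hτ hη hη0 hn
  · rintro A B ⟨F, f, h1, h2⟩ ⟨G, g, h3, h4⟩
    exact ⟨_, _, h1.add h3, h2.add h4⟩
  · rintro c A ⟨F, f, h1, h2⟩
    exact ⟨_, _, h1.smul c, h2.const_mul c⟩

-- The representation in `IsTr` is determined by its defining identity (`IsSeriesA.eq_seriesRep`),
-- so the quantifier over it disappears.
variable (hτ hη) in
theorem isTr_iff {F : ℂ → ℂ} : IsTr η τ A F ↔ Interp hτ hη A F ∧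
    ∀ n : ℕ, A ∈ degreePart η τ n →
      (Odd n → ∃ g₀, IsOddForm η τ n F g₀) ∧ (Even n → ∃ g₁ g₂, IsEvenForm η τ n F g₁ g₂) := by
  rw [IsTr, Interp, and_assoc]
  refine and_congr_right fun _ => and_congr_left fun _ => forall_congr' fun k => ⟨?_, fun h =>
    ⟨_, isSeriesA_seriesRep hτ hη k, h⟩⟩
  rintro ⟨ρ, h, e⟩
  rwa [IsSeriesA.eq_seriesRep hτ hη k h] at e

-- `IsTr` demands the functional form in every degree to which A belongs. Membership in two
-- different degrees forces A = 0, and then F = 0.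
variable (hτ hη) in
theorem isTr_of_interp {F : ℂ → ℂ} (hA : A ∈ degreePart η τ n) (hF : Interp hτ hη A F)
    (h : (Odd n → ∃ g₀, IsOddForm η τ n F g₀) ∧ (Even n → ∃ g₁ g₂, IsEvenForm η τ n F g₁ g₂))
    (hη0 : η ≠ 0) : IsTr η τ A F := by
  refine (isTr_iff hτ hη).2 ⟨hF, fun m hm => ?_⟩
  by_cases hnm : n = m
  · rwa [← hnm]
  · obtain ⟨g₁, g₂, hg⟩ : ∃ g₁ g₂, IsEvenForm η τ n F g₁ g₂ := by
      rcases Nat.even_or_odd n with hn | hn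
      · exact h.2 hn
      · obtain ⟨g₀, hg⟩ := h.1 hn
        exact ⟨_, _, hg.isEvenForm⟩
    obtain rfl := eq_zero_of_mem_of_mem hnm hA hm
    obtain rfl : F = fun _ => 0 := funext (eq_zero_of_interp_zero hη0 hF hg).1
    exact ⟨fun _ => ⟨_, isOddForm_zero η τ m⟩, fun _ => ⟨_, _, isEvenForm_zero η τ m⟩⟩

theorem IsTr.exists_form {F : ℂ → ℂ} (h : IsTr η τ A F) (hA : A ∈ degreePart η τ n) :
    ∃ g₁ g₂, IsEvenForm η τ n F g₁ g₂ := by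
  rcases Nat.even_or_odd n with hn | hn
  · exact (h.2.2 n hA).2 hn
  · obtain ⟨g₀, hg⟩ := (h.2.2 n hA).1 hn
    exact ⟨_, _, hg.isEvenForm⟩

variable (hτ hη) in
include hτ hη in
theorem existsUnique_isTr (hη0 : η ≠ 0) (hA : A ∈ degreePart η τ n) : ∃! F, IsTr η τ A F := by
  refine existsUnique_of_exists_of_unique ?_ fun F G hF hG => ?_
  · rcases Nat.even_or_odd n with hn | hn
    · obtain ⟨F, g₁, g₂, -, -, -, -, -, -, h1, h2, -⟩ := evenData_of_mem hτ hη hη0 hn hA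
      exact ⟨F, isTr_of_interp hτ hη hA h1 ⟨fun h => absurd hn (Nat.not_even_iff_odd.2 h),
        fun _ => ⟨_, _, h2⟩⟩ hη0⟩
    · obtain ⟨F, g₀, h1, h2⟩ := oddData_of_mem hτ hη hη0 hn hA
      exact ⟨F, isTr_of_interp hτ hη hA h1 ⟨fun _ => ⟨_, h2⟩,
        fun h => absurd h (Nat.not_even_iff_odd.2 hn)⟩ hη0⟩
  · obtain ⟨f₁, f₂, hf⟩ := hF.exists_form hA
    obtain ⟨g₁, g₂, hg⟩ := hG.exists_form hA
    exact (((isTr_iff hτ hη).1 hF).1.unique hη0 hf ((isTr_iff hτ hη).1 hG).1 hg).1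

variable (hτ hη) in
include hτ hη in
theorem isTr_Tr (hη0 : η ≠ 0) (hA : A ∈ degreePart η τ n) : IsTr η τ A (Tr η τ A) :=
  Classical.epsilon_spec (existsUnique_isTr hτ hη hη0 hA).exists

/-- Replaces `Tr`, which is defined by choice, by any concrete interpolating function of the right
form. -/
theorem Interp.eq_Tr (hη0 : η ≠ 0) (hA : A ∈ degreePart η τ n) {F g₁ g₂ : ℂ → ℂ}
    (hF : Interp hτ hη A F) (hg : IsEvenForm η τ n F g₁ g₂) : Tr η τ A = F := by
  have h := isTr_Tr hτ hη hη0 hA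
  obtain ⟨f₁, f₂, hf⟩ := h.exists_form hA
  exact (((isTr_iff hτ hη).1 h).1.unique hη0 hf hF hg).1

end

end Sklyanin
end

/-! ### The main theorem -/

theorem mainTheorem8 (τ : ℂ) (hτ : 0 < τ.im) :
    ∃ B : Set ℂ, B.Countable ∧
      ∀ η : ℂ, η ∉ B → (¬ ∃ p q : ℚ, η = p + q * τ) →
        (∀ (n : ℕ) (A : Sklyanin.Alg η τ), A ∈ Sklyanin.degreePart η τ n →
          ∃! F : ℂ → ℂ, Sklyanin.IsTr η τ A F) ∧
        ∀ (n : ℕ) (A : Sklyanin.Alg η τ), Even n → A ∈ Sklyanin.degreePart η τ n →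
          ∀ g₁ g₂ : ℂ → ℂ, Sklyanin.IsEvenForm η τ n (Sklyanin.Tr η τ A) g₁ g₂ →
            ((fun t : ℂ => (Sklyanin.th τ 0 t ^ n)⁻¹ *
                Sklyanin.Tr η τ (Sklyanin.iota1 η τ A) (t / η + 1 / (2 * η)))
              =ᶠ[codiscrete ℂ]
              fun t => g₁ t - (t / η + 1 / (2 * η)) * g₂ t) ∧
            ((fun t : ℂ => (Sklyanin.th τ 0 t ^ n)⁻¹ *
                Sklyanin.Tr η τ (Sklyanin.iota3 η τ A) (t / η + τ / (2 * η)))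
              =ᶠ[codiscrete ℂ]
              fun t => (g₁ t + 1 / 2 * (g₁ (t + τ) - g₁ t) - (t / η + τ / (2 * η)) * g₂ t) *
                (-exp (-(Real.pi * I * (τ / 2 + 2 * t)))) ^ (n / 2)) := by
  -- No further η has to be excluded: infinite order modulo the lattice suffices throughout.
  refine ⟨∅, Set.countable_empty, fun η _ hq => ?_⟩
  have hη : Sklyanin.IsGen η τ := Sklyanin.isGen_of_notMem hq
  have hη0 : η ≠ 0 := by
    rintro rfl
    exact hq ⟨0, 0, by simp⟩
  have hθ : ∀ α, Sklyanin.th τ α η ≠ 0 := hη.th_ne hτ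
  refine ⟨fun n A hA => Sklyanin.existsUnique_isTr hτ hη hη0 hA, fun n A hn hA g₁ g₂ hg => ?_⟩
  obtain ⟨F, f₁, f₂, F₁, a₁, a₂, F₃, b₁, b₂, h1, h2, h3, h4, h5, h6, h7, h8⟩ :=
    Sklyanin.evenData_of_mem hτ hη hη0 hn hA
  have hA1 : Sklyanin.iota1 η τ A ∈ Sklyanin.degreePart η τ n :=
    Sklyanin.map_mem_degreePart _ _ _ (Sklyanin.iota1_S hθ) hA
  have hA3 : Sklyanin.iota3 η τ A ∈ Sklyanin.degreePart η τ n :=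
    Sklyanin.map_mem_degreePart _ _ _ (Sklyanin.iota3_S hθ) hA
  rw [h1.eq_Tr hη0 hA h2] at hg
  rw [h3.eq_Tr hη0 hA1 h4, h5.eq_Tr hη0 hA3 h6]
  -- The given g₁ and g₂ agree with the constructed ones off a discrete set, so the relations carry
  -- over; for ι³ the agreement is needed at t + τ as well.
  obtain ⟨-, u1, u2⟩ := h1.unique hη0 h2 h1 hg
  constructor
  · filter_upwards [h7, u1, u2, Sklyanin.th_zero_pow_ne hτ n] with t e e1 e2 ht
    rw [e, e1, e2, inv_mul_cancel_left₀ ht]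
  · filter_upwards [h8, u1, u2, Sklyanin.eventually_codiscrete_add u1 τ,
      Sklyanin.th_zero_pow_ne hτ n] with t e e1 e2 e3 ht
    rw [e, e1, e2, e3, inv_mul_cancel_left₀ ht]
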